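/- **Setting.** Let $\varphi_0\in\mathscr S(\mathbb R^n)$ satisfy $\operatorname{supp}\widehat{\varphi_0}\subset\{1/2\le|\xi|\le 2\}$, $0\le\widehat{\varphi_0}\le 1$ and $\sum_{j\in\mathbb Z}\widehat{\varphi_j}(\xi)=1$ for $\xi\neq0$, where $\varphi_j(x)=2^{nj}\varphi_0(2^jx)$, and put $\Delta_jT=\mathscr F^{-1}(\widehat{\varphi_j}\,\widehat T)$ for $T\in\mathscr S'(\mathbb R^n)$. For $s\in\mathbb R$ and $1\le p,q\le\infty$ let $$\|T\|_{\dot B^s_{p,q}}=\big\|\{2^{sj}\|\Delta_jT\|_{L^p}\}_{j\in\mathbb Z}\big\|_{\ell^q(\mathbb Z)},\qquad \|F\|_{\widetilde{L^\infty}(I;\dot B^s_{p,q})}=\big\|\{2^{sj}\|\Delta_jF\|_{L^\infty(I;L^p)}\}_{j\in\mathbb Z}\big\|_{\ell^q(\mathbb Z)},$$ and let $\dot B^s_{p,q}(\mathbb R^n)$ be the space of tempered distributions modulo polynomials with finite norm; for $s<n/p$ (the only case needed) its elements are identified with their representatives $T=\sum_{j}\Delta_jT$ in $\mathscr S'$.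 Let $\widetilde C(I;\dot B^s_{p,q})=C(I;\dot B^s_{p,q})\cap\widetilde{L^\infty}(I;\dot B^s_{p,q})$. Consider, with $\mathbb P=I+\nabla\operatorname{div}(-\Delta)^{-1}$, the forced Navier–Stokes equations $$\partial_tu-\Delta u+\mathbb P\operatorname{div}(u\otimes u)=\mathbb Pf,\qquad \operatorname{div}u=0,\qquad u(0)=a\tag{NS}$$ on $(0,\infty)\times\mathbb R^n$. A global solution is understood in the weak sense: at each time $t\ge 0$, $u(t)$ is a real vector field such that $u(t)\otimes u(t)$ is integrable against Schwartz functions, $\operatorname{div}u(t)=0$, and the equation, integrated over $[0,t]$, holds when paired with every Schwartz field $\phi$ for which $\mathbb P\phi$ is a Schwartz field (the operator $\mathbb P$ being moved onto $\phi$). **Theorem.** Let $n,p,q$ satisfy one of 1. $n\ge3$, $n<p\le\infty$, $1\le q\le\infty$; 2. $n\ge3$, $p=n$, $2<q\le\infty$; 3. $n=2$, $1\le p\le\infty$, $q=1$. Then there are constants $\varepsilon_0,c_0>0$, depending only on $n,p,q$ (and the fixed $\varphi_0$), such that for every $0<\varepsilon\le\varepsilon_0$ there is a real external force $f_\varepsilon\in\widetilde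 C((0,\infty);\dot B^{n/p-3}_{p,q}(\mathbb R^n))$ with $$\|f_\varepsilon\|_{\widetilde{L^\infty}(0,\infty;\dot B^{n/p-3}_{p,q})}\le\varepsilon,\qquad \lim_{t\to\infty}\|f_\varepsilon(t)\|_{\dot B^{n/p-3}_{p,q}}=0,$$ for which (NS) with $a=0$ and $f=f_\varepsilon$ has a global solution $u_\varepsilon\in C([0,\infty);\dot B^{n/p-1}_{p,q}(\mathbb R^n))$ that is bounded in $\dot B^{n/p-1}_{p,q}$, belongs to $\widetilde C([0,T];\dot B^{n/p-1}_{p,q})$ for every $T>0$, belongs to $\widetilde C([0,\infty);\dot B^{n/p-1}_{p,q})$ if $n\ge3$ or $p>2$, and satisfies $$\limsup_{t\to\infty}\|u_\varepsilon(t)\|_{\dot B^{n/p-1}_{p,q}}\ge c_0,\qquad \liminf_{t\to\infty}\|u_\varepsilon(t)\|_{\dot B^{n/p-1}_{p,q}}=0.$$ In particular asymptotic stability fails: $u_\varepsilon(t)$ does not converge strongly to any element of $\dot B^{n/p-1}_{p,q}(\mathbb R^n)$ as $t\to\infty$. Uniform stability fails too: for every $C>0$ with $C\varepsilon<c_0$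 there is $t\ge0$ with $\|u_\varepsilon(t)\|_{\dot B^{n/p-1}_{p,q}}>C\|f_\varepsilon\|_{\widetilde{L^\infty}(0,\infty;\dot B^{n/p-3}_{p,q})}$. -/

import Mathlib

open MeasureTheory Filter Topology
open scoped SchwartzMap FourierTransform LineDeriv Laplacian ENNReal

noncomputable section

/-- Euclidean space `ℝⁿ`. -/
abbrev Rn (n : ℕ) : Type := EuclideanSpace ℝ (Fin n)

/-- Tempered distributions on `ℝⁿ` with values in `ℂⁿ`; the components of `T` are
`φ ↦ T φ i`. -/
abbrev VecDistribution (n : ℕ) : Type := 𝓢'(Rn n, EuclideanSpace ℂ (Fin n))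

/-- `φ₀` generates a homogeneous Littlewood–Paley decomposition: its Fourier transform takes
values in `[0, 1]`, is supported in `1/2 ≤ |ξ| ≤ 2`, and the transforms of
`φⱼ(x) = 2 ^ (n j) φ₀ (2 ^ j x)`, that is `ξ ↦ 𝓕 φ₀ (2 ^ (-j) ξ)`, add up to `1` for `ξ ≠ 0`. -/
structure IsLittlewoodPaley {n : ℕ} (φ₀ : 𝓢(Rn n, ℂ)) : Prop where
  support_subset : ∀ ξ : Rn n, 𝓕 φ₀ ξ ≠ 0 → 1 / 2 ≤ ‖ξ‖ ∧ ‖ξ‖ ≤ 2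
  im_eq_zero : ∀ ξ : Rn n, (𝓕 φ₀ ξ).im = 0
  re_mem : ∀ ξ : Rn n, 0 ≤ (𝓕 φ₀ ξ).re ∧ (𝓕 φ₀ ξ).re ≤ 1
  hasSum_one : ∀ ξ : Rn n, ξ ≠ 0 → HasSum (fun j : ℤ => 𝓕 φ₀ ((2 : ℝ) ^ (-j) • ξ)) 1

/-- The frequency-localized operator `Δⱼ T = 𝓕⁻¹ (𝓕 φⱼ · 𝓕 T)`. -/
def lpBlock {n : ℕ} (φ₀ : 𝓢(Rn n, ℂ)) (j : ℤ) (T : VecDistribution n) : VecDistribution n :=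
  TemperedDistribution.fourierMultiplierCLM (EuclideanSpace ℂ (Fin n))
    (fun ξ : Rn n => 𝓕 φ₀ ((2 : ℝ) ^ (-j) • ξ)) T

/-- The tempered distribution `T` is (integration against) the function `g`. -/
def Represents {n : ℕ} (T : VecDistribution n) (g : Rn n → EuclideanSpace ℂ (Fin n)) : Prop :=
  ∀ φ : 𝓢(Rn n, ℂ), Integrable (fun x => φ x • g x) ∧ T φ = ∫ x, φ x • g x

/-- The `Lᵖ` norm of a distribution: that of the (a.e. unique) function which represents it,
and `∞` if there is none. -/
def distLpNorm {n : ℕ} (p : ℝ≥0∞) (T : VecDistribution n) : ℝ≥0∞ :=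
  ⨅ (g : Rn n → EuclideanSpace ℂ (Fin n)) (_ : Represents T g), eLpNorm g p volume

/-- The norm of a sequence in `ℓ^q(ℤ)`. -/
def lqNorm (q : ℝ≥0∞) (c : ℤ → ℝ≥0∞) : ℝ≥0∞ := eLpNorm c q Measure.count

/-- The homogeneous Besov norm of `Ḃ^s_{p,q}(ℝⁿ)`; it does not see polynomials. -/
def besovNorm {n : ℕ} (φ₀ : 𝓢(Rn n, ℂ)) (s : ℝ) (p q : ℝ≥0∞) (T : VecDistribution n) : ℝ≥0∞ :=
  lqNorm q (fun j => ENNReal.ofReal ((2 : ℝ) ^ (s * (j : ℝ))) * distLpNorm p (lpBlock φ₀ j T))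

/-- Membership in `Ḃ^s_{p,q}(ℝⁿ)`. For `s < n / p` the series `∑ⱼ Δⱼ T` converges in `𝓢'`, and its
sum is a canonical representative of the class of `T` modulo polynomials; elements of the Besov
space are identified with these representatives. -/
def MemBesov {n : ℕ} (φ₀ : 𝓢(Rn n, ℂ)) (s : ℝ) (p q : ℝ≥0∞) (T : VecDistribution n) : Prop :=
  besovNorm φ₀ s p q T < ∞ ∧ HasSum (fun j : ℤ => lpBlock φ₀ j T) T

/-- The Chemin–Lerner norm of `L̃^∞(I; Ḃ^s_{p,q}(ℝⁿ))`. -/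
def cheminLernerNorm {n : ℕ} (φ₀ : 𝓢(Rn n, ℂ)) (I : Set ℝ) (s : ℝ) (p q : ℝ≥0∞)
    (F : ℝ → VecDistribution n) : ℝ≥0∞ :=
  lqNorm q (fun j => ENNReal.ofReal ((2 : ℝ) ^ (s * (j : ℝ))) *
    essSup (fun t => distLpNorm p (lpBlock φ₀ j (F t))) (volume.restrict I))

/-- `F ∈ C(I; Ḃ^s_{p,q}(ℝⁿ))`. -/
def ContinuousInBesov {n : ℕ} (φ₀ : 𝓢(Rn n, ℂ)) (I : Set ℝ) (s : ℝ) (p q : ℝ≥0∞)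
    (F : ℝ → VecDistribution n) : Prop :=
  ∀ t ∈ I, MemBesov φ₀ s p q (F t) ∧
    Tendsto (fun τ => besovNorm φ₀ s p q (F τ - F t)) (𝓝[I] t) (𝓝 0)

/-- `F ∈ C̃(I; Ḃ^s_{p,q}(ℝⁿ)) = C(I; Ḃ^s_{p,q}(ℝⁿ)) ∩ L̃^∞(I; Ḃ^s_{p,q}(ℝⁿ))`. -/
def MemTildeC {n : ℕ} (φ₀ : 𝓢(Rn n, ℂ)) (I : Set ℝ) (s : ℝ) (p q : ℝ≥0∞)
    (F : ℝ → VecDistribution n) : Prop :=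
  ContinuousInBesov φ₀ I s p q F ∧ cheminLernerNorm φ₀ I s p q F < ∞

/-- `T` is real: it takes real values on real-valued test functions. -/
def IsRealDistribution {n : ℕ} (T : VecDistribution n) : Prop :=
  ∀ φ : 𝓢(Rn n, ℂ), (∀ x, (φ x).im = 0) → ∀ i, (T φ i).im = 0

/-- The vector `w ∈ ℝⁿ` seen in `ℂⁿ`. -/
def complexify {n : ℕ} (w : Rn n) : EuclideanSpace ℂ (Fin n) :=
  WithLp.toLp 2 (fun i => ((w i : ℝ) : ℂ))

/-- The pairing `⟨T, φ⟩ = ∑ᵢ ⟨Tᵢ, φᵢ⟩` of a vector distribution with a vector test field. -/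
def pairing {n : ℕ} (T : VecDistribution n) (φ : Fin n → 𝓢(Rn n, ℂ)) : ℂ :=
  ∑ i, T (φ i) i

/-- The distribution `T` is divergence free. -/
def IsDivFree {n : ℕ} (T : VecDistribution n) : Prop :=
  ∀ χ : 𝓢(Rn n, ℂ), pairing T (fun i => ∂_{EuclideanSpace.single i (1 : ℝ)} χ) = 0

/-- `ψ = ℙ φ`, where `ℙ = I + ∇ div (-Δ)⁻¹` is the Helmholtz projection, the Fourier multiplier
with the matrix symbol `δᵢₖ - ξᵢ ξₖ / |ξ|²`. -/
def IsHelmholtzProj {n : ℕ} (φ ψ : Fin n → 𝓢(Rn n, ℂ)) : Prop :=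
  ∀ ξ : Rn n, ξ ≠ 0 → ∀ i,
    𝓕 (ψ i) ξ = 𝓕 (φ i) ξ - ∑ k, ((ξ i * ξ k / ‖ξ‖ ^ 2 : ℝ) : ℂ) * 𝓕 (φ k) ξ

/-- The pairing `⟨w ⊗ w, ∇ψ⟩ = ∑ᵢₖ ∫ wᵢ wₖ ∂ᵢψₖ dx = - ⟨div (w ⊗ w), ψ⟩`. -/
def convectionPairing {n : ℕ} (w : Rn n → Rn n) (ψ : Fin n → 𝓢(Rn n, ℂ)) : ℂ :=
  ∑ i, ∑ k, ∫ x, ((w x i * w x k : ℝ) : ℂ) * (∂_{EuclideanSpace.single i (1 : ℝ)} (ψ k)) x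

/-- `u` is a global (weak) solution of the forced Navier–Stokes equations
`∂ₜu - Δu + ℙ div (u ⊗ u) = ℙ f`, `div u = 0`, `u(0) = a`.
At each time `u t` is a real vector field `v t`, locally square integrable with at most polynomial
growth in the mean, so that `u ⊗ u` is a tempered distribution. The equation is integrated in time
and paired with Schwartz fields `φ`; as `ℙ` is symmetric, `⟨ℙ T, φ⟩ = ⟨T, ℙ φ⟩`, and `φ` runs over
the Schwartz fields for which `ψ = ℙ φ` is a Schwartz field (among them all solenoidal ones and all
those whose Fourier transform vanishes near the origin). -/
def IsNSSolution {n : ℕ} (a : VecDistribution n) (f u : ℝ → VecDistribution n) : Prop :=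
  u 0 = a ∧ (∀ t, 0 ≤ t → IsDivFree (u t)) ∧
  ∃ v : ℝ → Rn n → Rn n,
    (∀ t, 0 ≤ t → Represents (u t) (fun x => complexify (v t x))) ∧
    (∀ t, 0 ≤ t → ∀ (i k : Fin n) (χ : 𝓢(Rn n, ℂ)),
      Integrable (fun x => ((v t x i * v t x k : ℝ) : ℂ) * χ x)) ∧
    ∀ φ ψ : Fin n → 𝓢(Rn n, ℂ), IsHelmholtzProj φ ψ → ∀ t, 0 ≤ t →
      IntervalIntegrable (fun τ => pairing (u τ) (fun i => Δ (φ i))) volume 0 t ∧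
      IntervalIntegrable (fun τ => convectionPairing (v τ) ψ) volume 0 t ∧
      IntervalIntegrable (fun τ => pairing (f τ) ψ) volume 0 t ∧
      pairing (u t) φ = pairing a φ + ∫ τ in (0 : ℝ)..t,
        (pairing (u τ) (fun i => Δ (φ i)) + convectionPairing (v τ) ψ + pairing (f τ) ψ)

/-- The admissible indices. -/
def AdmissibleIndices (n : ℕ) (p q : ℝ≥0∞) : Prop :=
  (3 ≤ n ∧ (n : ℝ≥0∞) < p ∧ 1 ≤ q) ∨
  (3 ≤ n ∧ p = (n : ℝ≥0∞) ∧ 2 < q) ∨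
  (n = 2 ∧ 1 ≤ p ∧ q = 1)

/-- The number `n / p`, which is `0` for `p = ∞`. -/
def overExponent (n : ℕ) (p : ℝ≥0∞) : ℝ := (n : ℝ) * (p⁻¹).toReal

end

open MeasureTheory Filter Topology
open scoped SchwartzMap FourierTransform LineDeriv Laplacian ENNReal

noncomputable section

/-! ### Algebra and Fourier calculus of Schwartz functions. -/

section

variable {n : ℕ}

namespace SchwartzMap

/-! The nonlinearity turns a small fast oscillation into a slow flow that is not small. Let `u₁` be
a solenoidal field, small in the critical space, such that the Reynolds stress `u₁ ⊗ u₁` drives a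
Stokes flow `u₂` which is not small: `-Δu₂ + div (u₁ ⊗ u₁)` is nearly a gradient. The force that
holds `u₁ + u₂` at rest can still be small. Its linear part `-Δu₁` is small with `u₁`, the second
order part nearly cancels, and the construction has to make the mixed terms and `div (u₂ ⊗ u₂)`
small as well. For the flow `θ u₁ + θ² u₂` the force is `θ f₁ + θ² f₂ + θ³ f₃ + θ⁴ f₄` modulo
gradients (`IsForcedPair`).

Now let `θ` be a bump in time. The time derivative adds `θ' u₁ + 2 θ θ' u₂`, which is as small as
desired if the bump is slow. Such bumps are placed in consecutive windows, and the forces of the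
windows have summable sizes with a small sum. The total force is then small in the Chemin–Lerner
norm and tends to zero, while the velocity exceeds `c₀` inside every window and vanishes at its
ends. This reduces the theorem to the stationary statement `HasStaticPairs`; the reduction rests on
`isNSSolution_glue`, `exists_windows` and the estimates for `glue`.

Case `n/p < 1`, or `n/p = 1` and `q > 2` (`hasStaticPairs_of_overExponent_le_one`). A Stokes flow `U
≠ 0` is fixed. The field `u₁` is a sum of solenoidal waves with frequencies tending to infinity,
whose Reynolds stress has the stress driving `U` as its low frequency part, up to a scalar matrix.
Scalar matrices have gradients as divergences and belong to the pressure. A second family `W₂` of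
waves, with `u₂ = U + W₂`, is chosen so that the low frequency part of `u₂ ⊗ u₂` is a scalar matrix
too. Products at high frequency are negligible because stresses are measured with the negative
regularity `n/p - 2`; what remains at low frequency comes from the correctors and carries the factor
`lam⁻²`. If `n/p < 1`, the waves are small because `n/p - 1 < 0`. If `n/p = 1`, each wave is
replaced by `K` lacunary copies of amplitude `K^(-1/2)`; this keeps the Reynolds stress and gives
the norm `K^(1/q - 1/2)`. The divergence of a stress with frequencies near zero is harmless for `n ≥
3`. For `n = 2` the trace-free part of the stress must have mean zero, which follows from a symmetry
under the rotation by a right angle.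

Case `n = 2`, `p ≤ 2`, `q = 1` (`hasStaticPairs_plane`). High frequencies no longer make waves
small. Instead the Stokes flow is a cascade over `L` separated scales. In the plane a critically
rescaled stress keeps its mean, so the driving stress can be a telescoping sum, and waves are needed
only at the two extreme scales. With amplitude `a` for `u₁` and `a²` for each of the `L = a⁻²`
scales, the `ℓ¹` norm of `u₂` is of order one, while the four forces are of orders `a`, `a²`, `a³ L
= a` and `a⁴ L = a²`. Here symmetries make the means of the trace-free stresses vanish, and the
interaction of two scales of the cascade decays geometrically with their distance. -/

/-- Pointwise product of Schwartz functions. -/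
instance instMulRn : Mul 𝓢(Rn n, ℂ) := ⟨fun f g => pairing (ContinuousLinearMap.mul ℂ ℂ) f g⟩

@[simp] theorem mul_apply (f g : 𝓢(Rn n, ℂ)) (x : Rn n) : (f * g) x = f x * g x := rfl

instance instNonUnitalCommRingRn : NonUnitalCommRing 𝓢(Rn n, ℂ) :=
  { (inferInstance : AddCommGroup 𝓢(Rn n, ℂ)), instMulRn with
    left_distrib := fun f g h => by ext x; simp [mul_add]
    right_distrib := fun f g h => by ext x; simp [add_mul]
    zero_mul := fun f => by ext x; simp
    mul_zero := fun f => by ext x; simp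
    mul_assoc := fun f g h => by ext x; simp [mul_assoc]
    mul_comm := fun f g => by ext x; simp [mul_comm] }

instance : IsScalarTower ℂ 𝓢(Rn n, ℂ) 𝓢(Rn n, ℂ) := ⟨fun c f g => by ext x; simp [mul_assoc]⟩
instance : SMulCommClass ℂ 𝓢(Rn n, ℂ) 𝓢(Rn n, ℂ) := ⟨fun c f g => by ext x; simp [mul_left_comm]⟩

end SchwartzMap

open SchwartzMap

/-- The partial derivative in the `i`-th coordinate direction. -/
def pd (i : Fin n) (f : 𝓢(Rn n, ℂ)) : 𝓢(Rn n, ℂ) := ∂_{EuclideanSpace.single i (1 : ℝ)} f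

theorem pd_add (i : Fin n) (f g : 𝓢(Rn n, ℂ)) : pd i (f + g) = pd i f + pd i g :=
  LineDeriv.lineDerivOp_add _ f g
theorem pd_neg (i : Fin n) (f : 𝓢(Rn n, ℂ)) : pd i (-f) = -pd i f :=
  LineDeriv.lineDerivOp_neg _ f
theorem pd_sub (i : Fin n) (f g : 𝓢(Rn n, ℂ)) : pd i (f - g) = pd i f - pd i g :=
  by rw [sub_eq_add_neg, pd_add, pd_neg, sub_eq_add_neg]
theorem pd_smul (i : Fin n) (c : ℂ) (f : 𝓢(Rn n, ℂ)) : pd i (c • f) = c • pd i f :=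
  LineDeriv.lineDerivOp_smul _ c f
theorem pd_zero (i : Fin n) : pd i (0 : 𝓢(Rn n, ℂ)) = 0 := LineDeriv.lineDerivOp_zero _
theorem pd_sum {ι : Type*} (i : Fin n) (s : Finset ι) (f : ι → 𝓢(Rn n, ℂ)) :
    pd i (∑ a ∈ s, f a) = ∑ a ∈ s, pd i (f a) := LineDeriv.lineDerivOp_sum _ f s

theorem laplacian_eq_sum_pd (f : 𝓢(Rn n, ℂ)) : Δ f = ∑ i, pd i (pd i f) := by
  rw [SchwartzMap.laplacian_eq_sum (EuclideanSpace.basisFun (Fin n) ℝ)]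
  simp [pd]

/-! ### Fourier transform -/

/-- Identities between derivatives, dilations and frequency blocks are checked below on their
symbols, pointwise in `ξ`. -/
theorem fourier_ext {f g : 𝓢(Rn n, ℂ)} (h : ∀ ξ, 𝓕 f ξ = 𝓕 g ξ) : f = g := by
  have : 𝓕 f = 𝓕 g := SchwartzMap.ext h
  have h' := congrArg (fun F : 𝓢(Rn n, ℂ) => 𝓕⁻ F) this
  simpa using h'

theorem fourier_pd (i : Fin n) (f : 𝓢(Rn n, ℂ)) (ξ : Rn n) :
    𝓕 (pd i f) ξ = 2 * Real.pi * Complex.I * (ξ i : ℝ) * 𝓕 f ξ := by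
  have hg : Function.HasTemperateGrowth
      (fun x : Rn n => inner ℝ x (EuclideanSpace.single i (1 : ℝ))) := by fun_prop
  rw [pd, fourier_lineDerivOp_eq, _root_.smul_apply, smulLeftCLM_apply_apply hg]
  simp [EuclideanSpace.inner_single_right]
  ring

theorem pd_comm (i j : Fin n) (f : 𝓢(Rn n, ℂ)) : pd i (pd j f) = pd j (pd i f) := by
  apply fourier_ext; intro ξ
  simp only [fourier_pd]; ring

theorem fourier_laplacian (f : 𝓢(Rn n, ℂ)) (ξ : Rn n) :
    𝓕 (Δ f) ξ = -(4 * Real.pi ^ 2 * (‖ξ‖ ^ 2 : ℝ)) * 𝓕 f ξ := by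
  rw [laplacian_eq_sum_pd, FourierTransform.fourier_sum, _root_.sum_apply]
  simp only [fourier_pd]
  rw [EuclideanSpace.norm_sq_eq]
  push_cast
  rw [Finset.mul_sum, ← Finset.sum_neg_distrib, Finset.sum_mul]
  refine Finset.sum_congr rfl fun i _ => ?_
  simp only [Real.norm_eq_abs]
  rw [← Complex.ofReal_pow |ξ i|, sq_abs]
  push_cast
  linear_combination (4 * Real.pi^2 * (ξ i : ℂ)^2 * 𝓕 f ξ) * Complex.I_sq

theorem pd_laplacian (i : Fin n) (f : 𝓢(Rn n, ℂ)) : pd i (Δ f) = Δ (pd i f) := by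
  apply fourier_ext; intro ξ
  simp only [fourier_pd, fourier_laplacian]; ring

/-- The Fourier transform of `f` vanishes outside the ball of radius `R`. -/
def BandLimited (R : ℝ) (f : 𝓢(Rn n, ℂ)) : Prop := ∀ ξ, R < ‖ξ‖ → 𝓕 f ξ = 0

/-- The Fourier transform of `f` vanishes in the open ball of radius `R`. -/
def HighPass (R : ℝ) (f : 𝓢(Rn n, ℂ)) : Prop := ∀ ξ, ‖ξ‖ < R → 𝓕 f ξ = 0

theorem fourier_mul (f g : 𝓢(Rn n, ℂ)) (ξ : Rn n) :
    𝓕 (f * g) ξ = ∫ η, 𝓕 f η * 𝓕 g (ξ - η) := by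
  have h1 : 𝓕⁻ (SchwartzMap.convolution (ContinuousLinearMap.mul ℂ ℂ) (𝓕 f) (𝓕 g)) = f * g := by
    -- The convolution theorem is applied to `𝓕`; the inverse transform is `𝓕` followed by the
    -- reflection `x ↦ -x`, which commutes with pointwise products.
    have hc : ∀ F : 𝓢(Rn n, ℂ), 𝓕⁻ F =
        compCLMOfContinuousLinearEquiv ℂ (LinearIsometryEquiv.neg ℝ (E := Rn n)) (𝓕 F) :=
      fun F => fourierInv_apply_eq F
    rw [hc, fourier_convolution]
    ext x
    have hf := congrArg (fun F : 𝓢(Rn n, ℂ) => F x) (hc (𝓕 f))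
    have hg := congrArg (fun F : 𝓢(Rn n, ℂ) => F x) (hc (𝓕 g))
    simp only [FourierTransform.fourierInv_fourier_eq] at hf hg
    rw [mul_apply, hf, hg]
    simp [compCLMOfContinuousLinearEquiv_apply]
  rw [← h1, FourierTransform.fourier_fourierInv_eq, convolution_apply, convolution_def]
  simp

theorem BandLimited.mono {R R' : ℝ} {f : 𝓢(Rn n, ℂ)} (h : BandLimited R f) (hR : R ≤ R') :
    BandLimited R' f := fun ξ hξ => h ξ (hR.trans_lt hξ)

/-- In the convolution of the transforms `ξ` is split into `η` and `ξ - η`; if `‖ξ‖ > R + S`, one of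
the two lies outside its ball. -/
theorem BandLimited.mul {R S : ℝ} {f g : 𝓢(Rn n, ℂ)} (hf : BandLimited R f)
    (hg : BandLimited S g) : BandLimited (R + S) (f * g) := by
  intro ξ hξ
  rw [fourier_mul]
  apply integral_eq_zero_of_ae
  refine Eventually.of_forall fun η => ?_
  rcases lt_or_ge R ‖η‖ with h | h
  · simp [hf η h]
  · have : S < ‖ξ - η‖ := by
      have := norm_sub_norm_le ξ η
      linarith
    simp [hg _ this]

theorem BandLimited.add {R : ℝ} {f g : 𝓢(Rn n, ℂ)} (hf : BandLimited R f)
    (hg : BandLimited R g) : BandLimited R (f + g) := fun ξ h => by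
  simp [FourierTransform.fourier_add, hf ξ h, hg ξ h]

theorem BandLimited.smul {R : ℝ} {f : 𝓢(Rn n, ℂ)} (c : ℂ) (hf : BandLimited R f) :
    BandLimited R (c • f) := fun ξ h => by
  simp [FourierTransform.fourier_smul, hf ξ h]

theorem BandLimited.sub {R : ℝ} {f g : 𝓢(Rn n, ℂ)} (hf : BandLimited R f)
    (hg : BandLimited R g) : BandLimited R (f - g) := by
  have := hf.add (hg.smul (-1))
  rwa [neg_one_smul, ← sub_eq_add_neg] at this

theorem bandLimited_zero {R : ℝ} : BandLimited R (0 : 𝓢(Rn n, ℂ)) := fun ξ _ => by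
  simp [FourierTransform.fourier_zero]

theorem BandLimited.sum {ι : Type*} {R : ℝ} {s : Finset ι} {f : ι → 𝓢(Rn n, ℂ)}
    (h : ∀ a ∈ s, BandLimited R (f a)) : BandLimited R (∑ a ∈ s, f a) := fun ξ hξ => by
  rw [FourierTransform.fourier_sum, _root_.sum_apply]
  exact Finset.sum_eq_zero fun a ha => h a ha ξ hξ

theorem BandLimited.pd {R : ℝ} {f : 𝓢(Rn n, ℂ)} (i : Fin n) (hf : BandLimited R f) :
    BandLimited R (pd i f) := fun ξ h => by simp [fourier_pd, hf ξ h]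

theorem HighPass.mono {R R' : ℝ} {f : 𝓢(Rn n, ℂ)} (h : HighPass R f) (hR : R' ≤ R) :
    HighPass R' f := fun ξ hξ => h ξ (hξ.trans_le hR)

theorem HighPass.add {R : ℝ} {f g : 𝓢(Rn n, ℂ)} (hf : HighPass R f)
    (hg : HighPass R g) : HighPass R (f + g) := fun ξ h => by
  simp [FourierTransform.fourier_add, hf ξ h, hg ξ h]

theorem HighPass.smul {R : ℝ} {f : 𝓢(Rn n, ℂ)} (c : ℂ) (hf : HighPass R f) :
    HighPass R (c • f) := fun ξ h => by
  simp [FourierTransform.fourier_smul, hf ξ h]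

theorem HighPass.sub {R : ℝ} {f g : 𝓢(Rn n, ℂ)} (hf : HighPass R f)
    (hg : HighPass R g) : HighPass R (f - g) := by
  have := hf.add (hg.smul (-1))
  rwa [neg_one_smul, ← sub_eq_add_neg] at this

theorem highPass_zero {R : ℝ} : HighPass R (0 : 𝓢(Rn n, ℂ)) := fun ξ _ => by
  simp [FourierTransform.fourier_zero]

theorem HighPass.pd {R : ℝ} {f : 𝓢(Rn n, ℂ)} (i : Fin n) (hf : HighPass R f) :
    HighPass R (pd i f) := fun ξ h => by simp [fourier_pd, hf ξ h]

/-- A function with small spectrum times one with large spectrum has integral zero. -/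
theorem integral_mul_eq_zero_of_spectra {R S : ℝ} {f g : 𝓢(Rn n, ℂ)} (hf : BandLimited R f)
    (hg : HighPass S g) (h : R < S) : ∫ x, f x * g x = 0 := by
  -- The integral is the transform of the product at the origin, where the convolution pairs `η`
  -- with `-η`, two frequencies of equal size.
  have h0 : 𝓕 (f * g) 0 = ∫ x, f x * g x := by
    rw [fourier_coe, Real.fourier_eq']
    simp
  rw [← h0, fourier_mul]
  apply integral_eq_zero_of_ae
  refine Eventually.of_forall fun η => ?_
  rcases lt_or_ge R ‖η‖ with h' | h'
  · simp [hf η h']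
  · have : ‖(0 : Rn n) - η‖ < S := by simpa using h'.trans_lt h
    show _ * _ = (0 : ℂ)
    rw [hg _ this, mul_zero]

/-! ### Modulation, dilation, isometries -/

/-- Multiplication by the character `exp (2 π i ⟨ζ, x⟩)`. -/
def modulate (ζ : Rn n) (f : 𝓢(Rn n, ℂ)) : 𝓢(Rn n, ℂ) := 𝓕⁻ (compSubConstCLM ℂ ζ (𝓕 f))

theorem fourier_modulate (ζ : Rn n) (f : 𝓢(Rn n, ℂ)) (ξ : Rn n) :
    𝓕 (modulate ζ f) ξ = 𝓕 f (ξ - ζ) := by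
  simp [modulate]

theorem modulate_apply (ζ : Rn n) (f : 𝓢(Rn n, ℂ)) (x : Rn n) :
    modulate ζ f x = Complex.exp (2 * Real.pi * (inner ℝ ζ x : ℝ) * Complex.I) * f x := by
  have h1 : f x = 𝓕⁻ (𝓕 f) x := by simp
  rw [h1, modulate, fourierInv_coe, fourierInv_coe, Real.fourierInv_eq', Real.fourierInv_eq',
    ← integral_const_mul]
  rw [← integral_add_right_eq_self _ ζ]
  congr 1; ext v
  simp only [compSubConstCLM_apply, add_sub_cancel_right, smul_eq_mul, inner_add_left]
  rw [← mul_assoc, ← Complex.exp_add]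
  congr 2
  push_cast; ring

theorem modulate_zero (f : 𝓢(Rn n, ℂ)) : modulate 0 f = f := by
  apply fourier_ext; intro ξ; simp [fourier_modulate]

theorem modulate_mul_modulate (ζ η : Rn n) (f g : 𝓢(Rn n, ℂ)) :
    modulate ζ f * modulate η g = modulate (ζ + η) (f * g) := by
  ext x
  simp only [mul_apply, modulate_apply, inner_add_left]
  have : Complex.exp (2 * Real.pi * ((inner ℝ ζ x + inner ℝ η x : ℝ) : ℂ) * Complex.I) =
    Complex.exp (2 * Real.pi * (inner ℝ ζ x : ℝ) * Complex.I) *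
      Complex.exp (2 * Real.pi * (inner ℝ η x : ℝ) * Complex.I) := by
    rw [← Complex.exp_add]; congr 1; push_cast; ring
  rw [this]; ring

theorem modulate_mul (ζ : Rn n) (f g : 𝓢(Rn n, ℂ)) :
    modulate ζ f * g = modulate ζ (f * g) := by
  ext x; simp [modulate_apply, mul_assoc]

theorem modulate_add (ζ : Rn n) (f g : 𝓢(Rn n, ℂ)) :
    modulate ζ (f + g) = modulate ζ f + modulate ζ g := by
  ext x; simp [modulate_apply, mul_add]

theorem modulate_smul (ζ : Rn n) (c : ℂ) (f : 𝓢(Rn n, ℂ)) :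
    modulate ζ (c • f) = c • modulate ζ f := by
  ext x; simp [modulate_apply, mul_left_comm]

theorem norm_modulate (ζ : Rn n) (f : 𝓢(Rn n, ℂ)) (x : Rn n) : ‖modulate ζ f x‖ = ‖f x‖ := by
  rw [modulate_apply, norm_mul]
  have : (2 * Real.pi * (inner ℝ ζ x : ℝ) * Complex.I : ℂ) =
    ((2 * Real.pi * inner ℝ ζ x : ℝ) : ℂ) * Complex.I := by push_cast; ring
  rw [this, Complex.norm_exp_ofReal_mul_I, one_mul]

theorem BandLimited.highPass_modulate {R : ℝ} {f : 𝓢(Rn n, ℂ)} (hf : BandLimited R f)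
    (ζ : Rn n) : HighPass (‖ζ‖ - R) (modulate ζ f) := fun ξ hξ => by
  rw [fourier_modulate]
  apply hf
  have := norm_sub_norm_le ζ ξ
  rw [norm_sub_rev] at this
  linarith

theorem BandLimited.modulate {R : ℝ} {f : 𝓢(Rn n, ℂ)} (hf : BandLimited R f)
    (ζ : Rn n) : BandLimited (‖ζ‖ + R) (modulate ζ f) := fun ξ hξ => by
  rw [fourier_modulate]
  apply hf
  have := norm_sub_norm_le ξ ζ
  linarith

/-- Composition with a linear isometry. -/
def isoComp (A : Rn n ≃ₗᵢ[ℝ] Rn n) (f : 𝓢(Rn n, ℂ)) : 𝓢(Rn n, ℂ) :=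
  compCLMOfContinuousLinearEquiv ℂ A.toContinuousLinearEquiv f

@[simp] theorem isoComp_apply (A : Rn n ≃ₗᵢ[ℝ] Rn n) (f : 𝓢(Rn n, ℂ)) (x : Rn n) :
    isoComp A f x = f (A x) := rfl

theorem fourier_isoComp (A : Rn n ≃ₗᵢ[ℝ] Rn n) (f : 𝓢(Rn n, ℂ)) (ξ : Rn n) :
    𝓕 (isoComp A f) ξ = 𝓕 f (A ξ) := by
  rw [fourier_coe, fourier_coe]
  exact Real.fourier_comp_linearIsometry A f ξ

/-- The dilation `x ↦ f (2 ^ k x)`. -/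
def dil (k : ℤ) (f : 𝓢(Rn n, ℂ)) : 𝓢(Rn n, ℂ) :=
  compCLMOfContinuousLinearEquiv ℂ
    (ContinuousLinearEquiv.smulLeft (Units.mk0 ((2 : ℝ) ^ k) (by positivity)) :
      Rn n ≃L[ℝ] Rn n) f

@[simp] theorem dil_apply (k : ℤ) (f : 𝓢(Rn n, ℂ)) (x : Rn n) :
    dil k f x = f ((2 : ℝ) ^ k • x) := rfl

theorem fourier_dil (k : ℤ) (f : 𝓢(Rn n, ℂ)) (ξ : Rn n) :
    𝓕 (dil k f) ξ = (((2 : ℝ) ^ k)⁻¹ ^ n : ℝ) * 𝓕 f ((2 : ℝ) ^ (-k) • ξ) := by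
  rw [fourier_coe, fourier_coe, Real.fourier_eq', Real.fourier_eq']
  have h := Measure.integral_comp_smul_of_nonneg (μ := (volume : Measure (Rn n)))
    (fun v : Rn n => Complex.exp (↑(-2 * Real.pi * inner ℝ v ((2 : ℝ) ^ (-k) • ξ)) * Complex.I) •
      f v) ((2 : ℝ) ^ k) (hR := by positivity)
  rw [finrank_euclideanSpace_fin] at h
  rw [inv_pow, ← Complex.real_smul, ← h]
  congr 1; ext v
  rw [dil_apply, real_inner_smul_left, real_inner_smul_right, ← mul_assoc ((2 : ℝ) ^ k),
    zpow_neg, mul_inv_cancel₀ (by positivity), one_mul]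

end

/-! ### Minkowski's inequality, frequency blocks and Bernstein inequalities. -/

section

open SchwartzMap

/-- Minkowski's integral inequality with a weight. -/
theorem eLpNorm_lintegral_le {α β : Type*} [MeasurableSpace α] [MeasurableSpace β]
    {μ : Measure α} {ν : Measure β} [SFinite μ] [SFinite ν] {p : ℝ≥0∞} (hp : 1 ≤ p)
    {k : α → β → ℝ≥0∞} (hk : Measurable (Function.uncurry k)) {w : β → ℝ≥0∞} (hw : Measurable w)
    (hV : ∫⁻ y, w y ∂ν ≠ ∞) {M : ℝ≥0∞} (hM : ∀ y, eLpNorm (fun x => k x y) p μ ≤ M) :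
    eLpNorm (fun x => ∫⁻ y, w y * k x y ∂ν) p μ ≤ (∫⁻ y, w y ∂ν) * M := by
  set V := ∫⁻ y, w y ∂ν with hVdef
  set ν' := ν.withDensity w with hν'
  have hV' : ν' Set.univ = V := by rw [hν', withDensity_apply _ MeasurableSet.univ]; simp [hVdef]
  have : IsFiniteMeasure ν' := ⟨by rw [hV']; exact lt_top_iff_ne_top.2 hV⟩
  have hkx : ∀ x, Measurable (k x) := fun x => hk.comp measurable_prodMk_left
  have hky : ∀ y, Measurable (fun x => k x y) := fun y => hk.comp measurable_prodMk_right
  have hint : ∀ x, ∫⁻ y, w y * k x y ∂ν = ∫⁻ y, k x y ∂ν' := fun x => by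
    rw [hν', lintegral_withDensity_eq_lintegral_mul _ hw (hkx x)]; rfl
  simp only [hint]
  rcases eq_or_ne p ∞ with rfl | hpt
  · rw [eLpNorm_exponent_top]
    refine essSup_le_of_ae_le _ ?_
    -- For `p = ∞` the bound holds for each `y` and almost every `x`; Fubini's theorem for null sets
    -- exchanges the quantifiers.
    have h2 : ∀ᵐ x ∂μ, ∀ᵐ y ∂ν', k x y ≤ M := by
      rw [Measure.ae_ae_comm (p := fun x y => k x y ≤ M) (measurableSet_le hk measurable_const)]
      refine Eventually.of_forall fun y => ?_
      have := hM y
      rw [eLpNorm_exponent_top] at this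
      filter_upwards [ae_le_eLpNormEssSup (f := fun x => k x y) (μ := μ)] with x hx
      exact (by simpa using hx : k x y ≤ _).trans this
    filter_upwards [h2] with x hx
    simp only [enorm_eq_self]
    calc ∫⁻ y, k x y ∂ν' ≤ ∫⁻ _, M ∂ν' := lintegral_mono_ae hx
      _ = V * M := by rw [lintegral_const, hV', mul_comm]
  · have hp0 : p ≠ 0 := (zero_lt_one.trans_le hp).ne'
    have hpr : 1 ≤ p.toReal := by
      have := ENNReal.toReal_mono hpt hp; simpa using this
    have hpr0 : 0 < p.toReal := by linarith
    -- Jensen's inequality on the finite measure `ν'` of mass `V`. After integration in `x` and an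
    -- exchange of integrals the powers combine to `V ^ (p - 1) * V = V ^ p`.
    have key : ∀ x, (∫⁻ y, k x y ∂ν') ^ p.toReal ≤
        V ^ (p.toReal - 1) * ∫⁻ y, k x y ^ p.toReal ∂ν' := fun x => by
      have h := eLpNorm_le_eLpNorm_mul_rpow_measure_univ (f := k x) (μ := ν') hp
        (hkx x).aestronglyMeasurable
      rw [eLpNorm_one_eq_lintegral_enorm, eLpNorm_eq_lintegral_rpow_enorm_toReal hp0 hpt, hV'] at h
      simp only [enorm_eq_self] at h
      have h' := ENNReal.rpow_le_rpow h hpr0.le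
      rw [ENNReal.mul_rpow_of_nonneg _ _ hpr0.le, ← ENNReal.rpow_mul, ← ENNReal.rpow_mul] at h'
      rw [mul_comm]
      convert h' using 2
      · rw [one_div, inv_mul_cancel₀ hpr0.ne', ENNReal.rpow_one]
      · congr 1
        simp
        field_simp
    rw [eLpNorm_eq_lintegral_rpow_enorm_toReal hp0 hpt]
    simp only [enorm_eq_self]
    have hMp : ∀ y, ∫⁻ x, k x y ^ p.toReal ∂μ ≤ M ^ p.toReal := fun y => by
      have h := hM y
      rw [eLpNorm_eq_lintegral_rpow_enorm_toReal hp0 hpt] at h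
      simp only [enorm_eq_self] at h
      have h' := ENNReal.rpow_le_rpow h hpr0.le
      rwa [← ENNReal.rpow_mul, one_div, inv_mul_cancel₀ hpr0.ne', ENNReal.rpow_one] at h'
    have hVp : V ^ (p.toReal - 1) * V = V ^ p.toReal := by
      rcases eq_or_ne V 0 with h0 | h0
      · rw [h0, ENNReal.zero_rpow_of_pos hpr0, mul_zero]
      · nth_rw 2 [← ENNReal.rpow_one V]
        rw [← ENNReal.rpow_add _ _ h0 hV]; congr 1; ring
    calc (∫⁻ x, (∫⁻ y, k x y ∂ν') ^ p.toReal ∂μ) ^ (1 / p.toReal)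
        ≤ (∫⁻ x, V ^ (p.toReal - 1) * ∫⁻ y, k x y ^ p.toReal ∂ν' ∂μ) ^ (1 / p.toReal) := by
          gcongr with x; exact key x
      _ = (V ^ (p.toReal - 1) * ∫⁻ y, ∫⁻ x, k x y ^ p.toReal ∂μ ∂ν') ^ (1 / p.toReal) := by
          rw [lintegral_const_mul', lintegral_lintegral_swap]
          · exact (hk.pow_const _).aemeasurable
          · exact ENNReal.rpow_ne_top_of_nonneg (by linarith) hV
      _ ≤ (V ^ (p.toReal - 1) * ∫⁻ y, M ^ p.toReal ∂ν') ^ (1 / p.toReal) := by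
          gcongr with y; exact hMp y
      _ = V * M := by
          rw [lintegral_const, hV', mul_comm (M ^ p.toReal), ← mul_assoc, hVp,
            ENNReal.mul_rpow_of_nonneg _ _ (by positivity), ← ENNReal.rpow_mul, ← ENNReal.rpow_mul,
            mul_one_div_cancel hpr0.ne', ENNReal.rpow_one, ENNReal.rpow_one]

variable {n : ℕ}

theorem hasTemperateGrowth_symbol (ψ : 𝓢(Rn n, ℂ)) (j : ℤ) :
    Function.HasTemperateGrowth (fun ξ : Rn n => 𝓕 ψ ((2 : ℝ) ^ (-j) • ξ)) :=
  (dil (-j) (𝓕 ψ)).hasTemperateGrowth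

/-- The frequency localization with kernel `2 ^ (n j) ψ (2 ^ j x)`. -/
def kblock (ψ : 𝓢(Rn n, ℂ)) (j : ℤ) (g : 𝓢(Rn n, ℂ)) : 𝓢(Rn n, ℂ) :=
  SchwartzMap.fourierMultiplierCLM ℂ (fun ξ : Rn n => 𝓕 ψ ((2 : ℝ) ^ (-j) • ξ)) g

theorem fourier_kblock (ψ : 𝓢(Rn n, ℂ)) (j : ℤ) (g : 𝓢(Rn n, ℂ)) (ξ : Rn n) :
    𝓕 (kblock ψ j g) ξ = 𝓕 ψ ((2 : ℝ) ^ (-j) • ξ) * 𝓕 g ξ := by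
  rw [kblock, SchwartzMap.fourierMultiplierCLM_apply, FourierTransform.fourier_fourierInv_eq,
    smulLeftCLM_apply_apply (hasTemperateGrowth_symbol ψ j), smul_eq_mul]

theorem kblock_add (ψ : 𝓢(Rn n, ℂ)) (j : ℤ) (f g : 𝓢(Rn n, ℂ)) :
    kblock ψ j (f + g) = kblock ψ j f + kblock ψ j g := map_add _ _ _
theorem kblock_smul (ψ : 𝓢(Rn n, ℂ)) (j : ℤ) (c : ℂ) (g : 𝓢(Rn n, ℂ)) :
    kblock ψ j (c • g) = c • kblock ψ j g := map_smul _ _ _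
theorem kblock_zero (ψ : 𝓢(Rn n, ℂ)) (j : ℤ) : kblock ψ j 0 = 0 := map_zero _
theorem kblock_sum {ι : Type*} (ψ : 𝓢(Rn n, ℂ)) (j : ℤ) (s : Finset ι) (f : ι → 𝓢(Rn n, ℂ)) :
    kblock ψ j (∑ a ∈ s, f a) = ∑ a ∈ s, kblock ψ j (f a) := map_sum _ _ _

/-- The symbol of the derivative at `ξ` is `2 ^ j` times its value at `2 ^ (-j) ξ`. A derivative
thus passes to the kernel at the price `2 ^ j`; for this reason blocks are defined for kernels other
than `φ₀`. -/
theorem kblock_pd (ψ : 𝓢(Rn n, ℂ)) (j : ℤ) (i : Fin n) (g : 𝓢(Rn n, ℂ)) :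
    kblock ψ j (pd i g) = ((2 : ℝ) ^ j : ℂ) • kblock (pd i ψ) j g := by
  apply fourier_ext; intro ξ
  have h2 : ((2 : ℂ) ^ j) * (2 : ℂ) ^ (-j) = 1 := by
    rw [zpow_neg, mul_inv_cancel₀ (zpow_ne_zero _ two_ne_zero)]
  simp only [fourier_kblock, fourier_pd, FourierTransform.fourier_smul, _root_.smul_apply,
    smul_eq_mul, PiLp.smul_apply]
  push_cast
  linear_combination (-2 * Real.pi * Complex.I * ξ i * 𝓕 ψ ((2 : ℝ) ^ (-j) • ξ) * 𝓕 g ξ) * h2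

theorem dil_kblock (ψ : 𝓢(Rn n, ℂ)) (j k : ℤ) (g : 𝓢(Rn n, ℂ)) :
    dil k (kblock ψ j g) = kblock ψ (j + k) (dil k g) := by
  apply fourier_ext; intro ξ
  rw [fourier_dil, fourier_kblock, fourier_kblock, fourier_dil, smul_smul,
    ← zpow_add₀ (by norm_num)]
  rw [show -j + -k = -(j + k) by ring]
  ring

theorem dil_dil (j k : ℤ) (g : 𝓢(Rn n, ℂ)) : dil j (dil k g) = dil (j + k) g := by
  ext x
  simp only [dil_apply, smul_smul]
  rw [← zpow_add₀ (by norm_num), add_comm]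

theorem dil_zero (g : 𝓢(Rn n, ℂ)) : dil 0 g = g := by ext x; simp

theorem kblock_zero_apply (ψ g : 𝓢(Rn n, ℂ)) (x : Rn n) :
    kblock ψ 0 g x = ∫ y, g y * ψ (x - y) := by
  have h : kblock ψ 0 g = SchwartzMap.convolution (ContinuousLinearMap.mul ℂ ℂ) g ψ := by
    apply fourier_ext; intro ξ
    rw [fourier_kblock, fourier_convolution]
    simp [mul_comm]
  rw [h, convolution_apply, convolution_def]
  simp

/-- Convolution is commutative. The exchange decides which of the two factors is measured in `L¹` in
the estimates below. -/
theorem kblock_zero_comm (ψ g : 𝓢(Rn n, ℂ)) : kblock ψ 0 g = kblock g 0 ψ := by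
  apply fourier_ext; intro ξ
  simp [fourier_kblock, mul_comm]

theorem eLpNorm_comp_sub_right {E : Type*} [NormedAddCommGroup E] {f : Rn n → E}
    (hf : AEStronglyMeasurable f volume) (p : ℝ≥0∞) (v : Rn n) :
    eLpNorm (fun x => f (x - v)) p volume = eLpNorm f p volume :=
  eLpNorm_comp_measurePreserving (g := f) hf (measurePreserving_sub_right volume v)

/-- Young's inequality: the convolution averages translates of `ψ`, all of the same `Lᵖ` norm, with
the weight `|g|`. -/
theorem eLpNorm_kblock_zero_le {p : ℝ≥0∞} (hp : 1 ≤ p) (ψ g : 𝓢(Rn n, ℂ)) :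
    eLpNorm (kblock ψ 0 g) p volume ≤ eLpNorm g 1 volume * eLpNorm ψ p volume := by
  have h := eLpNorm_lintegral_le (μ := (volume : Measure (Rn n))) (ν := (volume : Measure (Rn n)))
    hp (k := fun x y => ‖ψ (x - y)‖ₑ) (w := fun y => ‖g y‖ₑ) (M := eLpNorm ψ p volume)
    (by
      have : Continuous (Function.uncurry fun x y : Rn n => ‖ψ (x - y)‖ₑ) := by
        have := ψ.continuous
        fun_prop
      exact this.measurable)
    (by have := g.continuous; exact (by fun_prop : Continuous fun y => ‖g y‖ₑ).measurable)
    g.integrable.hasFiniteIntegral.ne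
    (fun y => by
      rw [← eLpNorm_comp_sub_right ψ.continuous.aestronglyMeasurable p y]
      exact (eLpNorm_enorm _).le)
  rw [eLpNorm_one_eq_lintegral_enorm]
  refine le_trans (eLpNorm_mono_enorm fun x => ?_) h
  rw [kblock_zero_apply, enorm_eq_self]
  refine (enorm_integral_le_lintegral_enorm _).trans (lintegral_mono fun y => ?_)
  rw [enorm_mul]

theorem eLpNorm_dil (p : ℝ≥0∞) (k : ℤ) (g : 𝓢(Rn n, ℂ)) :
    eLpNorm (dil k g) p volume =
      ENNReal.ofReal ((2 : ℝ) ^ (-(overExponent n p) * (k : ℝ))) * eLpNorm g p volume := by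
  have h2 : (0 : ℝ) < 2 ^ k := by positivity
  have hmap := Measure.map_addHaar_smul (volume : Measure (Rn n)) h2.ne'
  have hc : ENNReal.ofReal |(((2 : ℝ) ^ k) ^ Module.finrank ℝ (Rn n))⁻¹| ≠ 0 := by
    rw [Ne, ENNReal.ofReal_eq_zero, not_le]; positivity
  have h := eLpNorm_map_measure (p := p) (μ := (volume : Measure (Rn n)))
    (f := fun x : Rn n => (2 : ℝ) ^ k • x) (g := g)
    g.continuous.aestronglyMeasurable (by fun_prop)
  rw [hmap, eLpNorm_smul_measure_of_ne_zero hc] at h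
  have h' : (⇑g ∘ fun x : Rn n => (2 : ℝ) ^ k • x) = dil k g := rfl
  rw [h'] at h
  rw [← h, smul_eq_mul]
  congr 1
  rw [finrank_euclideanSpace_fin, abs_of_nonneg (by positivity),
    ENNReal.ofReal_rpow_of_pos (by positivity), overExponent, one_div]
  congr 1
  rw [← Real.rpow_intCast, ← Real.rpow_natCast, ← Real.rpow_mul (by norm_num),
    ← Real.rpow_neg (by norm_num), ← Real.rpow_mul (by norm_num)]
  congr 1; ring

/-- Scaling reduces every estimate for block `j` to the plain convolution of block `0`. -/
theorem kblock_eq_dil (ψ : 𝓢(Rn n, ℂ)) (j : ℤ) (g : 𝓢(Rn n, ℂ)) :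
    kblock ψ j g = dil j (kblock ψ 0 (dil (-j) g)) := by
  rw [dil_kblock, dil_dil]; simp [dil_zero]

theorem ofReal_two_rpow_mul (a b : ℝ) :
    ENNReal.ofReal ((2 : ℝ) ^ a) * ENNReal.ofReal ((2 : ℝ) ^ b) =
      ENNReal.ofReal ((2 : ℝ) ^ (a + b)) := by
  rw [← ENNReal.ofReal_mul (by positivity), Real.rpow_add (by norm_num)]

theorem eLpNorm_kblock_le {p : ℝ≥0∞} (hp : 1 ≤ p) (ψ : 𝓢(Rn n, ℂ)) (j : ℤ) (g : 𝓢(Rn n, ℂ)) :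
    eLpNorm (kblock ψ j g) p volume ≤ eLpNorm ψ 1 volume * eLpNorm g p volume := by
  rw [kblock_eq_dil, eLpNorm_dil, kblock_zero_comm]
  calc _ ≤ ENNReal.ofReal ((2 : ℝ) ^ (-(overExponent n p) * (j : ℝ))) *
        (eLpNorm ψ 1 volume * eLpNorm (dil (-j) g) p volume) := by
        gcongr; exact eLpNorm_kblock_zero_le hp _ _
    _ = eLpNorm ψ 1 volume * ((ENNReal.ofReal ((2 : ℝ) ^ (-(overExponent n p) * (j : ℝ))) *
        ENNReal.ofReal ((2 : ℝ) ^ (-(overExponent n p) * ((-j : ℤ) : ℝ)))) *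
        eLpNorm g p volume) := by rw [eLpNorm_dil]; ring
    _ = _ := by rw [ofReal_two_rpow_mul]; simp

theorem overExponent_one : overExponent n 1 = n := by simp [overExponent]

/-- Bernstein's inequality. -/
theorem eLpNorm_kblock_le_bernstein {p : ℝ≥0∞} (hp : 1 ≤ p) (ψ : 𝓢(Rn n, ℂ)) (j : ℤ)
    (g : 𝓢(Rn n, ℂ)) :
    eLpNorm (kblock ψ j g) p volume ≤ ENNReal.ofReal ((2 : ℝ) ^ ((n - overExponent n p) * (j : ℝ))) *
      (eLpNorm ψ p volume * eLpNorm g 1 volume) := by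
  rw [kblock_eq_dil, eLpNorm_dil]
  calc _ ≤ ENNReal.ofReal ((2 : ℝ) ^ (-(overExponent n p) * (j : ℝ))) *
        (eLpNorm (dil (-j) g) 1 volume * eLpNorm ψ p volume) := by
        gcongr; exact eLpNorm_kblock_zero_le hp _ _
    _ = (ENNReal.ofReal ((2 : ℝ) ^ (-(overExponent n p) * (j : ℝ))) *
        ENNReal.ofReal ((2 : ℝ) ^ (-(overExponent n 1) * ((-j : ℤ) : ℝ)))) *
        (eLpNorm ψ p volume * eLpNorm g 1 volume) := by rw [eLpNorm_dil]; ring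
    _ = _ := by
      rw [ofReal_two_rpow_mul, overExponent_one]; congr 4; push_cast; ring

/-- The first moment `∫ ‖y‖ ‖g y‖ dy`. -/
def firstMoment (g : 𝓢(Rn n, ℂ)) : ℝ≥0∞ := ∫⁻ y, ‖y‖ₑ * ‖g y‖ₑ

theorem firstMoment_ne_top (g : 𝓢(Rn n, ℂ)) : firstMoment g ≠ ∞ := by
  have h := (g.integrable_pow_mul volume 1).hasFiniteIntegral.ne
  unfold firstMoment
  convert h using 3 with y
  simp [enorm_mul]

theorem firstMoment_dil (k : ℤ) (g : 𝓢(Rn n, ℂ)) :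
    firstMoment (dil k g) = ENNReal.ofReal ((2 : ℝ) ^ (-(n + 1) * (k : ℝ))) * firstMoment g := by
  have h2 : (0 : ℝ) < 2 ^ k := by positivity
  have hmap := Measure.map_addHaar_smul (volume : Measure (Rn n)) h2.ne'
  have hmeas : Measurable fun y : Rn n => ‖y‖ₑ * ‖g y‖ₑ := by
    have := g.continuous
    exact (by fun_prop : Measurable fun y : Rn n => ‖y‖ₑ).mul
      (by fun_prop : Continuous fun y => ‖g y‖ₑ).measurable
  have h := lintegral_map (μ := (volume : Measure (Rn n))) hmeas
    (g := fun x : Rn n => (2 : ℝ) ^ k • x) (by fun_prop)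
  rw [hmap, lintegral_smul_measure, finrank_euclideanSpace_fin] at h
  have h3 : ∫⁻ a : Rn n, ‖(2 : ℝ) ^ k • a‖ₑ * ‖g ((2 : ℝ) ^ k • a)‖ₑ =
      ENNReal.ofReal ((2 : ℝ) ^ k) * firstMoment (dil k g) := by
    rw [firstMoment, ← lintegral_const_mul' _ _ ENNReal.ofReal_ne_top]
    congr 1; ext a
    rw [enorm_smul, Real.enorm_eq_ofReal h2.le, dil_apply, mul_assoc]
  rw [h3] at h
  have h4 : firstMoment (dil k g) = ENNReal.ofReal ((2 : ℝ) ^ (-k)) *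
      (ENNReal.ofReal ((2 : ℝ) ^ k) * firstMoment (dil k g)) := by
    rw [← mul_assoc, ← ENNReal.ofReal_mul (by positivity), ← zpow_add₀ (by norm_num)]; simp
  rw [h4, ← h, smul_eq_mul, ← mul_assoc, ← ENNReal.ofReal_mul (by positivity), firstMoment]
  congr 2
  rw [abs_of_nonneg (by positivity), ← Real.rpow_intCast, ← Real.rpow_intCast,
    ← Real.rpow_natCast, ← Real.rpow_mul (by norm_num),
    ← Real.rpow_neg (by norm_num), ← Real.rpow_add (by norm_num)]
  congr 1; push_cast; ring

/-- The difference is the integral of the derivative along the segment from `x` to `x - y`;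
Minkowski's inequality averages translates of the derivative. -/
theorem eLpNorm_sub_translate_le {p : ℝ≥0∞} (hp : 1 ≤ p) (ψ : 𝓢(Rn n, ℂ)) (y : Rn n) :
    eLpNorm (fun x => ψ (x - y) - ψ x) p volume ≤
      ‖y‖ₑ * eLpNorm (fderivCLM ℂ (Rn n) ℂ ψ) p volume := by
  set D := fderivCLM ℂ (Rn n) ℂ ψ
  have hcont : Continuous (Function.uncurry fun (x : Rn n) (t : ℝ) => ‖D (x - t • y)‖ₑ) := by
    have := D.continuous
    fun_prop
  have h := eLpNorm_lintegral_le (μ := (volume : Measure (Rn n)))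
    (ν := (volume : Measure ℝ).restrict (Set.Ioc 0 1))
    hp (k := fun x t => ‖D (x - t • y)‖ₑ) (w := fun _ => ‖y‖ₑ) (M := eLpNorm D p volume)
    hcont.measurable measurable_const (by simp)
    (fun t => by
      rw [← eLpNorm_comp_sub_right D.continuous.aestronglyMeasurable p (t • y)]
      exact (eLpNorm_enorm _).le)
  rw [lintegral_const] at h
  simp only [Measure.restrict_apply MeasurableSet.univ, Set.univ_inter, Real.volume_Ioc, sub_zero,
    ENNReal.ofReal_one, mul_one] at h
  refine le_trans (eLpNorm_mono_enorm fun x => ?_) h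
  rw [enorm_eq_self]
  have hd : ∀ t ∈ Set.uIcc (0 : ℝ) 1,
      HasDerivAt (fun t : ℝ => ψ (x - t • y)) (-(D (x - t • y) y)) t := fun t _ => by
    have h1 : HasDerivAt (fun t : ℝ => x - t • y) (-y) t := by
      simpa using ((hasDerivAt_id t).smul_const y).const_sub x
    have h2 := (ψ.hasFDerivAt (x - t • y)).comp_hasDerivAt t h1
    have h3 : fderiv ℝ ψ (x - t • y) (-y) = -(D (x - t • y) y) := by
      simp [D, fderivCLM_apply]
    rw [h3] at h2
    exact h2
  have hi : IntervalIntegrable (fun t : ℝ => -(D (x - t • y) y)) volume 0 1 := by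
    have := D.continuous
    exact (by fun_prop : Continuous fun t : ℝ => -(D (x - t • y) y)).intervalIntegrable _ _
  have hf := intervalIntegral.integral_eq_sub_of_hasDerivAt hd hi
  simp only [one_smul, zero_smul, sub_zero] at hf
  rw [← hf, intervalIntegral.integral_of_le zero_le_one]
  refine (enorm_integral_le_lintegral_enorm _).trans (lintegral_mono fun t => ?_)
  rw [enorm_neg, mul_comm]
  exact ContinuousLinearMap.le_opENorm _ _

/-- As `g` has mean zero, `ψ (x - y)` may be replaced by `ψ (x - y) - ψ x`. Minkowski's inequality
is applied to the difference quotient in `y` with the weight `‖y‖ |g y|`. -/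
theorem eLpNorm_kblock_zero_le_moment {p : ℝ≥0∞} (hp : 1 ≤ p) (ψ g : 𝓢(Rn n, ℂ))
    (hg : ∫ x, g x = 0) :
    eLpNorm (kblock ψ 0 g) p volume ≤
      firstMoment g * eLpNorm (fderivCLM ℂ (Rn n) ℂ ψ) p volume := by
  have hψ := ψ.continuous
  have hgc := g.continuous
  have hnorm : Measurable fun y : Rn n => ‖y‖ₑ := by fun_prop
  have h := eLpNorm_lintegral_le (μ := (volume : Measure (Rn n))) (ν := (volume : Measure (Rn n)))
    hp (k := fun x y => ‖ψ (x - y) - ψ x‖ₑ / ‖y‖ₑ) (w := fun y => ‖y‖ₑ * ‖g y‖ₑ)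
    (M := eLpNorm (fderivCLM ℂ (Rn n) ℂ ψ) p volume)
    (by
      have : Continuous (Function.uncurry fun x y : Rn n => ‖ψ (x - y) - ψ x‖ₑ) := by fun_prop
      exact this.measurable.div (hnorm.comp measurable_snd))
    (hnorm.mul (by fun_prop : Continuous fun y => ‖g y‖ₑ).measurable)
    (firstMoment_ne_top g)
    (fun y => by
      -- At `y = 0` the quotient is `0 / 0`, which is `0` in `ℝ≥0∞`.
      rcases eq_or_ne y 0 with rfl | hy
      · simp
      have hy1 : ‖y‖ₑ ≠ 0 := by simpa using hy
      have hy2 : ‖y‖ₑ ≠ ∞ := enorm_ne_top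
      have h1 := eLpNorm_sub_translate_le hp ψ y
      have h2 : (fun x => ‖ψ (x - y) - ψ x‖ₑ / ‖y‖ₑ) =
          fun x => ‖(‖y‖⁻¹ : ℝ) • (ψ (x - y) - ψ x)‖ₑ := by
        ext x
        rw [enorm_smul, ENNReal.div_eq_inv_mul, enorm_inv (by simpa using hy), enorm_norm]
      have h3 : eLpNorm (fun x => (‖y‖⁻¹ : ℝ) • (ψ (x - y) - ψ x)) p volume =
          ‖(‖y‖⁻¹ : ℝ)‖ₑ * eLpNorm (fun x => ψ (x - y) - ψ x) p volume :=
        eLpNorm_const_smul (‖y‖⁻¹ : ℝ) _ p volume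
      rw [h2, eLpNorm_enorm, h3, enorm_inv (by simpa using hy), enorm_norm]
      calc _ ≤ ‖y‖ₑ⁻¹ * (‖y‖ₑ * eLpNorm (fderivCLM ℂ (Rn n) ℂ ψ) p volume) := by gcongr
        _ = _ := by rw [← mul_assoc, ENNReal.inv_mul_cancel hy1 hy2, one_mul])
  refine le_trans (eLpNorm_mono_enorm fun x => ?_) h
  have hx : kblock ψ 0 g x = ∫ y, g y * (ψ (x - y) - ψ x) := by
    rw [kblock_zero_apply]
    simp only [mul_sub]
    rw [integral_sub, integral_mul_const, hg]
    · simp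
    · refine g.integrable.mul_bdd (c := SchwartzMap.seminorm ℝ 0 0 ψ) ?_ ?_
      · exact (by fun_prop : Continuous fun y => ψ (x - y)).aestronglyMeasurable
      · exact Eventually.of_forall fun y => SchwartzMap.norm_le_seminorm ℝ ψ _
    · exact g.integrable.mul_const _
  rw [hx, enorm_eq_self]
  refine (enorm_integral_le_lintegral_enorm _).trans (lintegral_mono fun y => ?_)
  rcases eq_or_ne y 0 with rfl | hy
  · simp
  have hy1 : ‖y‖ₑ ≠ 0 := by simpa using hy
  simp only
  rw [enorm_mul, mul_comm ‖y‖ₑ, mul_assoc, ENNReal.mul_div_cancel hy1 enorm_ne_top]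

/-- Bernstein's inequality with a gain from a vanishing mean. -/
theorem eLpNorm_kblock_le_moment {p : ℝ≥0∞} (hp : 1 ≤ p) (ψ : 𝓢(Rn n, ℂ)) (j : ℤ)
    (g : 𝓢(Rn n, ℂ)) (hg : ∫ x, g x = 0) :
    eLpNorm (kblock ψ j g) p volume ≤
      ENNReal.ofReal ((2 : ℝ) ^ ((n - overExponent n p + 1) * (j : ℝ))) *
      (eLpNorm (fderivCLM ℂ (Rn n) ℂ ψ) p volume * firstMoment g) := by
  have hg' : ∫ x, dil (-j) g x = 0 := by
    simp only [dil_apply]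
    rw [Measure.integral_comp_smul, hg, smul_zero]
  rw [kblock_eq_dil, eLpNorm_dil]
  calc _ ≤ ENNReal.ofReal ((2 : ℝ) ^ (-(overExponent n p) * (j : ℝ))) *
        (firstMoment (dil (-j) g) * eLpNorm (fderivCLM ℂ (Rn n) ℂ ψ) p volume) := by
        gcongr; exact eLpNorm_kblock_zero_le_moment hp _ _ hg'
    _ = (ENNReal.ofReal ((2 : ℝ) ^ (-(overExponent n p) * (j : ℝ))) *
        ENNReal.ofReal ((2 : ℝ) ^ (-(n + 1 : ℝ) * ((-j : ℤ) : ℝ)))) *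
        (eLpNorm (fderivCLM ℂ (Rn n) ℂ ψ) p volume * firstMoment g) := by
        rw [firstMoment_dil]; ring
    _ = _ := by
      rw [ofReal_two_rpow_mul]; congr 4; push_cast; ring

end

section

open SchwartzMap

/-! ### The norm of `ℓ^q(ℤ)` -/

theorem lqNorm_top (c : ℤ → ℝ≥0∞) : lqNorm ∞ c = ⨆ j, c j := by
  rw [lqNorm, eLpNorm_exponent_top, eLpNormEssSup]
  simp

theorem lqNorm_eq {q : ℝ≥0∞} (hq : q ≠ 0) (hq' : q ≠ ∞) (c : ℤ → ℝ≥0∞) :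
    lqNorm q c = (∑' j, c j ^ q.toReal) ^ (1 / q.toReal) := by
  rw [lqNorm, eLpNorm_eq_lintegral_rpow_enorm_toReal hq hq']
  simp [lintegral_count]

theorem lqNorm_one (c : ℤ → ℝ≥0∞) : lqNorm 1 c = ∑' j, c j := by
  rw [lqNorm_eq one_ne_zero ENNReal.one_ne_top]; simp

theorem lqNorm_mono {q : ℝ≥0∞} {c d : ℤ → ℝ≥0∞} (h : ∀ j, c j ≤ d j) :
    lqNorm q c ≤ lqNorm q d := eLpNorm_mono_enorm (by simpa using h)

theorem lqNorm_zero (q : ℝ≥0∞) : lqNorm q (fun _ => 0) = 0 := by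
  rw [lqNorm]; exact eLpNorm_zero'

theorem lqNorm_add_le {q : ℝ≥0∞} (hq : 1 ≤ q) (c d : ℤ → ℝ≥0∞) :
    lqNorm q (fun j => c j + d j) ≤ lqNorm q c + lqNorm q d :=
  eLpNorm_add_le (measurable_of_countable c).aestronglyMeasurable
    (measurable_of_countable d).aestronglyMeasurable hq

theorem lqNorm_const_mul {q : ℝ≥0∞} (hq : 1 ≤ q) (a : ℝ≥0∞) (c : ℤ → ℝ≥0∞) :
    lqNorm q (fun j => a * c j) = a * lqNorm q c := by
  rcases eq_or_ne q ∞ with rfl | hq'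
  · simp [lqNorm_top, ENNReal.mul_iSup]
  have hq0 : q ≠ 0 := (zero_lt_one.trans_le hq).ne'
  have hr : 0 < q.toReal := ENNReal.toReal_pos hq0 hq'
  rw [lqNorm_eq hq0 hq', lqNorm_eq hq0 hq']
  simp_rw [ENNReal.mul_rpow_of_nonneg _ _ hr.le]
  rw [ENNReal.tsum_mul_left, ENNReal.mul_rpow_of_nonneg _ _ (by positivity), ← ENNReal.rpow_mul,
    mul_one_div_cancel hr.ne', ENNReal.rpow_one]

theorem le_lqNorm {q : ℝ≥0∞} (hq : 1 ≤ q) (c : ℤ → ℝ≥0∞) (j : ℤ) : c j ≤ lqNorm q c := by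
  rcases eq_or_ne q ∞ with rfl | hq'
  · rw [lqNorm_top]; exact le_iSup c j
  have hq0 : q ≠ 0 := (zero_lt_one.trans_le hq).ne'
  have hr : 0 < q.toReal := ENNReal.toReal_pos hq0 hq'
  rw [lqNorm_eq hq0 hq']
  have := ENNReal.rpow_le_rpow (ENNReal.le_tsum (f := fun j => c j ^ q.toReal) j)
    (z := 1 / q.toReal) (by positivity)
  rwa [← ENNReal.rpow_mul, mul_one_div_cancel hr.ne', ENNReal.rpow_one] at this

/-- With `S` the sum and `r = q.toReal`, each term satisfies `c j ^ r ≤ c j * S ^ (r - 1)`, and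
these bounds add up to `S ^ r`. -/
theorem lqNorm_le_tsum {q : ℝ≥0∞} (hq : 1 ≤ q) (c : ℤ → ℝ≥0∞) : lqNorm q c ≤ ∑' j, c j := by
  rcases eq_or_ne q ∞ with rfl | hq'
  · rw [lqNorm_top]; exact iSup_le fun j => ENNReal.le_tsum j
  have hq0 : q ≠ 0 := (zero_lt_one.trans_le hq).ne'
  have hr : 0 < q.toReal := ENNReal.toReal_pos hq0 hq'
  have hr1 : 1 ≤ q.toReal := by have := ENNReal.toReal_mono hq' hq; simpa using this
  rw [lqNorm_eq hq0 hq']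
  set S := ∑' j, c j
  have hj : ∀ j, c j ^ q.toReal ≤ c j * S ^ (q.toReal - 1) := fun j => by
    calc c j ^ q.toReal = c j ^ (1 + (q.toReal - 1)) := by congr 1; ring
      _ = c j * c j ^ (q.toReal - 1) := by
        rw [ENNReal.rpow_add_of_nonneg _ _ zero_le_one (by linarith), ENNReal.rpow_one]
      _ ≤ _ := by gcongr; exact ENNReal.le_tsum j
  calc (∑' j, c j ^ q.toReal) ^ (1 / q.toReal)
      ≤ (∑' j, c j * S ^ (q.toReal - 1)) ^ (1 / q.toReal) := by
        gcongr with j; exact hj j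
    _ = (S ^ (1 + (q.toReal - 1))) ^ (1 / q.toReal) := by
        rw [ENNReal.tsum_mul_right, ENNReal.rpow_add_of_nonneg _ _ zero_le_one (by linarith),
          ENNReal.rpow_one]
    _ = S := by
        rw [← ENNReal.rpow_mul, add_sub_cancel, mul_one_div_cancel hr.ne', ENNReal.rpow_one]

theorem lqNorm_sum_le {q : ℝ≥0∞} (hq : 1 ≤ q) {ι : Type*} (s : Finset ι) (a : ι → ℤ → ℝ≥0∞) :
    lqNorm q (fun j => ∑ m ∈ s, a m j) ≤ ∑ m ∈ s, lqNorm q (a m) := by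
  classical
  induction s using Finset.induction_on with
  | empty => simp [lqNorm_zero]
  | insert m s hm ih =>
    simp only [Finset.sum_insert hm]
    exact (lqNorm_add_le hq _ _).trans (by gcongr)

/-- The triangle inequality holds for partial sums in `m`; it passes to the limit on every finite
set of indices `j`, and these finite sets exhaust the norm. -/
theorem lqNorm_tsum_le {q : ℝ≥0∞} (hq : 1 ≤ q) (a : ℕ → ℤ → ℝ≥0∞) :
    lqNorm q (fun j => ∑' m, a m j) ≤ ∑' m, lqNorm q (a m) := by
  have hfin : ∀ N, lqNorm q (fun j => ∑ m ∈ Finset.range N, a m j) ≤ ∑' m, lqNorm q (a m) :=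
    fun N => (lqNorm_sum_le hq _ _).trans (ENNReal.sum_le_tsum _)
  rcases eq_or_ne q ∞ with rfl | hq'
  · rw [lqNorm_top]
    refine iSup_le fun j => ?_
    rw [ENNReal.tsum_eq_iSup_nat]
    exact iSup_le fun N => (le_lqNorm hq (fun j => ∑ m ∈ Finset.range N, a m j) j).trans (hfin N)
  have hq0 : q ≠ 0 := (zero_lt_one.trans_le hq).ne'
  have hr : 0 < q.toReal := ENNReal.toReal_pos hq0 hq'
  rw [lqNorm_eq hq0 hq', one_div, ENNReal.rpow_inv_le_iff hr, ENNReal.tsum_eq_iSup_sum]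
  refine iSup_le fun J => ?_
  have hlim : Tendsto (fun N => ∑ j ∈ J, (∑ m ∈ Finset.range N, a m j) ^ q.toReal) atTop
      (𝓝 (∑ j ∈ J, (∑' m, a m j) ^ q.toReal)) := by
    refine tendsto_finsetSum _ fun j _ => ?_
    exact (ENNReal.continuous_rpow_const.tendsto _).comp ENNReal.summable.hasSum.tendsto_sum_nat
  refine le_of_tendsto' hlim fun N => ?_
  have h := hfin N
  rw [lqNorm_eq hq0 hq', one_div, ENNReal.rpow_inv_le_iff hr] at h
  exact (ENNReal.sum_le_tsum _).trans h

/-- The factor `card ^ (1 / q)` is what competes with the amplitude `K ^ (-1 / 2)` of lacunary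
copies of waves. -/
theorem lqNorm_le_of_support {q : ℝ≥0∞} (hq : 1 ≤ q) {c : ℤ → ℝ≥0∞} {M : ℝ≥0∞} (J : Finset ℤ)
    (hM : ∀ j, c j ≤ M) (hJ : ∀ j, j ∉ J → c j = 0) :
    lqNorm q c ≤ M * (J.card : ℝ≥0∞) ^ (q⁻¹).toReal := by
  rcases eq_or_ne q ∞ with rfl | hq'
  · rw [lqNorm_top]; simpa using hM
  have hq0 : q ≠ 0 := (zero_lt_one.trans_le hq).ne'
  have hr : 0 < q.toReal := ENNReal.toReal_pos hq0 hq'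
  rw [lqNorm_eq hq0 hq', tsum_eq_sum (s := J) (fun j hj => by rw [hJ j hj]; simp [hr])]
  calc (∑ j ∈ J, c j ^ q.toReal) ^ (1 / q.toReal)
      ≤ (∑ j ∈ J, M ^ q.toReal) ^ (1 / q.toReal) := by
        gcongr with j; exact hM j
    _ = _ := by
        rw [Finset.sum_const, nsmul_eq_mul, ENNReal.mul_rpow_of_nonneg _ _ (by positivity),
          ← ENNReal.rpow_mul, mul_one_div_cancel hr.ne', ENNReal.rpow_one, mul_comm,
          ENNReal.toReal_inv, one_div]

/-! ### Distributions given by Schwartz fields -/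

variable {n : ℕ}

/-- The Schwartz function with values in `ℂⁿ` and components `F i`. -/
def vecSchwartz (F : Fin n → 𝓢(Rn n, ℂ)) : 𝓢(Rn n, EuclideanSpace ℂ (Fin n)) :=
  ∑ i, postcompCLM ((ContinuousLinearMap.id ℂ ℂ).smulRight
    (EuclideanSpace.single i (1 : ℂ))) (F i)

theorem vecSchwartz_apply (F : Fin n → 𝓢(Rn n, ℂ)) (x : Rn n) :
    vecSchwartz F x = WithLp.toLp 2 (fun i => F i x) := by
  ext k
  rw [vecSchwartz, _root_.sum_apply]
  simp [postcompCLM_apply, Pi.single_apply]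

/-- The distribution defined by a Schwartz field. -/
def toDist (F : Fin n → 𝓢(Rn n, ℂ)) : VecDistribution n := (vecSchwartz F : 𝓢'(_, _))

theorem toDist_apply (F : Fin n → 𝓢(Rn n, ℂ)) (φ : 𝓢(Rn n, ℂ)) :
    toDist F φ = ∫ x, φ x • vecSchwartz F x := rfl

theorem integrable_smul_vecSchwartz (F : Fin n → 𝓢(Rn n, ℂ)) (φ : 𝓢(Rn n, ℂ)) :
    Integrable (fun x => φ x • vecSchwartz F x) := by
  have := (pairing (ContinuousLinearMap.lsmul ℂ ℂ) φ (vecSchwartz F)).integrable (μ := volume)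
  simpa [pairing_apply_apply] using! this

theorem toDist_apply_apply (F : Fin n → 𝓢(Rn n, ℂ)) (φ : 𝓢(Rn n, ℂ)) (i : Fin n) :
    toDist F φ i = ∫ x, F i x * φ x := by
  rw [toDist_apply]
  have := (EuclideanSpace.proj (𝕜 := ℂ) i).integral_comp_comm (integrable_smul_vecSchwartz F φ)
  refine Eq.trans this.symm ?_
  congr 1; ext x
  simp [vecSchwartz_apply, mul_comm]

theorem represents_toDist (F : Fin n → 𝓢(Rn n, ℂ)) : Represents (toDist F) (vecSchwartz F) :=
  fun φ => ⟨integrable_smul_vecSchwartz F φ, toDist_apply F φ⟩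

theorem vecSchwartz_add (F G : Fin n → 𝓢(Rn n, ℂ)) :
    vecSchwartz (F + G) = vecSchwartz F + vecSchwartz G := by
  ext x i; simp [vecSchwartz_apply]

theorem vecSchwartz_smul (c : ℂ) (F : Fin n → 𝓢(Rn n, ℂ)) :
    vecSchwartz (c • F) = c • vecSchwartz F := by
  ext x i; simp [vecSchwartz_apply]

theorem toDist_add (F G : Fin n → 𝓢(Rn n, ℂ)) : toDist (F + G) = toDist F + toDist G := by
  rw [toDist, vecSchwartz_add]; exact map_add (toTemperedDistributionCLM _ _ _) _ _

theorem toDist_smul (c : ℂ) (F : Fin n → 𝓢(Rn n, ℂ)) : toDist (c • F) = c • toDist F := by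
  rw [toDist, vecSchwartz_smul]; exact map_smul (toTemperedDistributionCLM _ _ _) _ _

theorem toDist_sub (F G : Fin n → 𝓢(Rn n, ℂ)) : toDist (F - G) = toDist F - toDist G := by
  have := toDist_add F ((-1 : ℂ) • G)
  have h1 : (-1 : ℂ) • G = -G := by ext; simp
  have h2 : (-1 : ℂ) • toDist G = -toDist G := by ext; simp
  rwa [toDist_smul, h1, h2, ← sub_eq_add_neg, ← sub_eq_add_neg] at this

/-- By Parseval's formula both sides are the integral of `𝓕 f * 𝓕⁻ φ` times the symbol. Hence blocks
of distributions given by Schwartz fields are computed componentwise. -/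
theorem integral_mul_fourier_symbol (φ₀ : 𝓢(Rn n, ℂ)) (j : ℤ) (f φ : 𝓢(Rn n, ℂ)) :
    ∫ x, f x * 𝓕 (smulLeftCLM ℂ (fun ξ : Rn n => 𝓕 φ₀ ((2 : ℝ) ^ (-j) • ξ)) (𝓕⁻ φ)) x =
      ∫ x, kblock φ₀ j f x * φ x := by
  rw [← integral_fourier_mul_eq]
  have h : ∫ x, kblock φ₀ j f x * φ x = ∫ x, kblock φ₀ j f x * 𝓕 (𝓕⁻ φ) x := by simp
  rw [h, ← integral_fourier_mul_eq]
  congr 1; ext ξ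
  rw [fourier_kblock, smulLeftCLM_apply_apply (hasTemperateGrowth_symbol φ₀ j), smul_eq_mul]
  ring

theorem lpBlock_toDist (φ₀ : 𝓢(Rn n, ℂ)) (j : ℤ) (F : Fin n → 𝓢(Rn n, ℂ)) :
    lpBlock φ₀ j (toDist F) = toDist (fun i => kblock φ₀ j (F i)) := by
  ext φ i
  rw [lpBlock, TemperedDistribution.fourierMultiplierCLM_apply_apply, toDist_apply_apply,
    toDist_apply_apply, integral_mul_fourier_symbol]

theorem Represents.add {S T : VecDistribution n} {g h : Rn n → EuclideanSpace ℂ (Fin n)}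
    (hS : Represents S g) (hT : Represents T h) : Represents (S + T) (fun x => g x + h x) :=
  fun φ => by
    simp only [smul_add]
    refine ⟨(hS φ).1.add (hT φ).1, ?_⟩
    rw [integral_add (hS φ).1 (hT φ).1, ← (hS φ).2, ← (hT φ).2]; rfl

theorem Represents.smul {S : VecDistribution n} {g : Rn n → EuclideanSpace ℂ (Fin n)} (c : ℂ)
    (hS : Represents S g) : Represents (c • S) (fun x => c • g x) :=
  fun φ => by
    simp only [smul_comm _ c]
    refine ⟨(hS φ).1.smul c, ?_⟩
    rw [integral_smul, ← (hS φ).2]; rfl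

/-- Test functions equal to one on a ball give integrability there. -/
theorem Represents.locallyIntegrable {S : VecDistribution n}
    {g : Rn n → EuclideanSpace ℂ (Fin n)} (hS : Represents S g) :
    LocallyIntegrable g volume := by
  intro x
  obtain ⟨χ, hχ⟩ : ∃ χ : ContDiffBump x, True := ⟨⟨1, 2, by norm_num, by norm_num⟩, trivial⟩
  have hcs : HasCompactSupport (fun y => ((χ y : ℝ) : ℂ)) :=
    χ.hasCompactSupport.comp_left (g := fun r : ℝ => (r : ℂ)) (by simp)
  have hsm : ContDiff ℝ ((⊤ : ℕ∞) : WithTop ℕ∞) (fun y => ((χ y : ℝ) : ℂ)) :=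
    Complex.ofRealCLM.contDiff.comp χ.contDiff
  refine ⟨Metric.closedBall x χ.rIn, Metric.closedBall_mem_nhds x χ.rIn_pos, ?_⟩
  have h := ((hS (hcs.toSchwartzMap hsm)).1).integrableOn (s := Metric.closedBall x χ.rIn)
  refine h.congr_fun (fun y hy => ?_) measurableSet_closedBall
  simp [χ.one_of_mem_closedBall hy]

/-- The fundamental lemma of the calculus of variations; because of it the infimum in `distLpNorm`
runs over one class of functions up to null sets. -/
theorem Represents.ae_eq {S : VecDistribution n} {g h : Rn n → EuclideanSpace ℂ (Fin n)}
    (hg : Represents S g) (hh : Represents S h) : g =ᵐ[volume] h := by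
  refine ae_eq_of_integral_contDiff_smul_eq hg.locallyIntegrable hh.locallyIntegrable
    fun χ hsm hcs => ?_
  have hcs' : HasCompactSupport (fun y => ((χ y : ℝ) : ℂ)) :=
    hcs.comp_left (g := fun r : ℝ => (r : ℂ)) (by simp)
  have hsm' : ContDiff ℝ ((⊤ : ℕ∞) : WithTop ℕ∞) (fun y => ((χ y : ℝ) : ℂ)) := Complex.ofRealCLM.contDiff.comp hsm
  have h1 := (hg (hcs'.toSchwartzMap hsm')).2
  have h2 := (hh (hcs'.toSchwartzMap hsm')).2
  rw [h1] at h2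
  simpa using h2

theorem distLpNorm_eq {S : VecDistribution n} {g : Rn n → EuclideanSpace ℂ (Fin n)}
    (hg : Represents S g) (p : ℝ≥0∞) : distLpNorm p S = eLpNorm g p volume := by
  apply le_antisymm
  · exact iInf₂_le g hg
  · exact le_iInf₂ fun h hh => (eLpNorm_congr_ae (hg.ae_eq hh)).le

theorem distLpNorm_add_le {p : ℝ≥0∞} (hp : 1 ≤ p) (S T : VecDistribution n) :
    distLpNorm p (S + T) ≤ distLpNorm p S + distLpNorm p T := by
  by_cases hS : ∃ g, Represents S g
  · by_cases hT : ∃ g, Represents T g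
    · obtain ⟨g, hg⟩ := hS
      obtain ⟨h, hh⟩ := hT
      rw [distLpNorm_eq hg, distLpNorm_eq hh, distLpNorm_eq (hg.add hh)]
      exact eLpNorm_add_le hg.locallyIntegrable.aestronglyMeasurable
        hh.locallyIntegrable.aestronglyMeasurable hp
    · have : distLpNorm p T = ∞ := by
        simp only [distLpNorm, iInf_eq_top]
        exact fun g hg => absurd ⟨g, hg⟩ hT
      simp [this]
  · have : distLpNorm p S = ∞ := by
      simp only [distLpNorm, iInf_eq_top]
      exact fun g hg => absurd ⟨g, hg⟩ hS
    simp [this]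

theorem distLpNorm_smul_le (p : ℝ≥0∞) (c : ℂ) (S : VecDistribution n) :
    distLpNorm p (c • S) ≤ ‖c‖ₑ * distLpNorm p S := by
  by_cases hS : ∃ g, Represents S g
  · obtain ⟨g, hg⟩ := hS
    rw [distLpNorm_eq hg, distLpNorm_eq (hg.smul c)]
    exact (eLpNorm_const_smul c g p volume).le
  · have : distLpNorm p S = ∞ := by
      simp only [distLpNorm, iInf_eq_top]
      exact fun g hg => absurd ⟨g, hg⟩ hS
    rcases eq_or_ne c 0 with rfl | hc
    -- Here the right side is `0 * ∞ = 0`, so the zero distribution has to be seen to have norm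
    -- zero.
    · have h1 : ((0 : ℂ) • S : VecDistribution n) = 0 := by ext; simp
      have h0 : Represents (0 : VecDistribution n) (fun _ => 0) := fun φ => by simp
      rw [h1, distLpNorm_eq h0]; simp
    · rw [this, ENNReal.mul_top (by simpa using hc)]; exact le_top

theorem distLpNorm_toDist (p : ℝ≥0∞) (F : Fin n → 𝓢(Rn n, ℂ)) :
    distLpNorm p (toDist F) = eLpNorm (vecSchwartz F) p volume :=
  distLpNorm_eq (represents_toDist F) p

theorem distLpNorm_toDist_le {p : ℝ≥0∞} (hp : 1 ≤ p) (F : Fin n → 𝓢(Rn n, ℂ)) :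
    distLpNorm p (toDist F) ≤ ∑ i, eLpNorm (F i) p volume := by
  rw [distLpNorm_toDist]
  have h : eLpNorm (vecSchwartz F) p volume ≤
      eLpNorm (∑ i, fun x => (‖F i x‖ : ℝ)) p volume := by
    refine eLpNorm_mono_real fun x => ?_
    rw [vecSchwartz_apply, EuclideanSpace.norm_eq, Finset.sum_apply]
    refine Real.sqrt_le_iff.2 ⟨Finset.sum_nonneg fun i _ => norm_nonneg _, ?_⟩
    exact Finset.sum_sq_le_sq_sum_of_nonneg fun i _ => norm_nonneg _
  refine h.trans ((eLpNorm_sum_le (fun i _ => ?_) hp).trans ?_)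
  · exact (F i).continuous.norm.aestronglyMeasurable
  · exact Finset.sum_le_sum fun i _ => (eLpNorm_norm _).le

theorem le_distLpNorm_toDist (p : ℝ≥0∞) (F : Fin n → 𝓢(Rn n, ℂ)) (i : Fin n) :
    eLpNorm (F i) p volume ≤ distLpNorm p (toDist F) := by
  rw [distLpNorm_toDist]
  refine eLpNorm_mono fun x => ?_
  rw [vecSchwartz_apply]
  exact PiLp.norm_apply_le (WithLp.toLp 2 fun i => F i x : EuclideanSpace ℂ (Fin n)) i

/-! ### Besov norms -/

theorem lpBlock_add (φ₀ : 𝓢(Rn n, ℂ)) (j : ℤ) (S T : VecDistribution n) :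
    lpBlock φ₀ j (S + T) = lpBlock φ₀ j S + lpBlock φ₀ j T := map_add _ _ _

theorem lpBlock_smul (φ₀ : 𝓢(Rn n, ℂ)) (j : ℤ) (c : ℂ) (T : VecDistribution n) :
    lpBlock φ₀ j (c • T) = c • lpBlock φ₀ j T := map_smul _ _ _

theorem besovNorm_add_le {p q : ℝ≥0∞} (hp : 1 ≤ p) (hq : 1 ≤ q) (φ₀ : 𝓢(Rn n, ℂ)) (s : ℝ)
    (S T : VecDistribution n) :
    besovNorm φ₀ s p q (S + T) ≤ besovNorm φ₀ s p q S + besovNorm φ₀ s p q T := by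
  refine le_trans (lqNorm_mono fun j => ?_) (lqNorm_add_le hq _ _)
  rw [lpBlock_add, ← mul_add]
  gcongr
  exact distLpNorm_add_le hp _ _

theorem besovNorm_smul_le {p q : ℝ≥0∞} (hq : 1 ≤ q) (φ₀ : 𝓢(Rn n, ℂ)) (s : ℝ)
    (c : ℂ) (T : VecDistribution n) :
    besovNorm φ₀ s p q (c • T) ≤ ‖c‖ₑ * besovNorm φ₀ s p q T := by
  rw [besovNorm, besovNorm, ← lqNorm_const_mul hq]
  refine lqNorm_mono fun j => ?_
  rw [lpBlock_smul, mul_left_comm]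
  gcongr
  exact distLpNorm_smul_le _ _ _

theorem besovNorm_neg_le {p q : ℝ≥0∞} (hq : 1 ≤ q) (φ₀ : 𝓢(Rn n, ℂ)) (s : ℝ)
    (T : VecDistribution n) : besovNorm φ₀ s p q (-T) ≤ besovNorm φ₀ s p q T := by
  have := besovNorm_smul_le (p := p) hq φ₀ s (-1) T
  have h2 : (-1 : ℂ) • T = -T := by ext; simp
  rwa [h2, enorm_neg, enorm_one, one_mul] at this

theorem besovNorm_zero {p q : ℝ≥0∞} (hq : 1 ≤ q) (φ₀ : 𝓢(Rn n, ℂ)) (s : ℝ) :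
    besovNorm φ₀ s p q 0 = 0 := by
  have := besovNorm_smul_le (p := p) hq φ₀ s 0 0
  have h1 : ((0 : ℂ) • (0 : VecDistribution n)) = 0 := by ext; simp
  rw [h1, enorm_zero, zero_mul] at this
  exact le_antisymm this zero_le

theorem besovNorm_sum_le {p q : ℝ≥0∞} (hp : 1 ≤ p) (hq : 1 ≤ q) (φ₀ : 𝓢(Rn n, ℂ)) (s : ℝ)
    {ι : Type*} (A : Finset ι) (T : ι → VecDistribution n) :
    besovNorm φ₀ s p q (∑ a ∈ A, T a) ≤ ∑ a ∈ A, besovNorm φ₀ s p q (T a) := by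
  classical
  induction A using Finset.induction_on with
  | empty => simp [besovNorm_zero hq]
  | insert m A hm ih =>
    simp only [Finset.sum_insert hm]
    exact (besovNorm_add_le hp hq _ _ _ _).trans (by gcongr)

/-- The homogeneous Besov norm of a scalar Schwartz function. -/
def scalarBesov (φ₀ : 𝓢(Rn n, ℂ)) (s : ℝ) (p q : ℝ≥0∞) (g : 𝓢(Rn n, ℂ)) : ℝ≥0∞ :=
  lqNorm q (fun j => ENNReal.ofReal ((2 : ℝ) ^ (s * (j : ℝ))) *
    eLpNorm (kblock φ₀ j g) p volume)

theorem besovNorm_toDist_le {p q : ℝ≥0∞} (hp : 1 ≤ p) (hq : 1 ≤ q) (φ₀ : 𝓢(Rn n, ℂ)) (s : ℝ)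
    (F : Fin n → 𝓢(Rn n, ℂ)) :
    besovNorm φ₀ s p q (toDist F) ≤ ∑ i, scalarBesov φ₀ s p q (F i) := by
  refine le_trans (lqNorm_mono fun j => ?_) (lqNorm_sum_le hq _ _)
  rw [lpBlock_toDist, ← Finset.mul_sum]
  gcongr
  exact distLpNorm_toDist_le hp _

theorem scalarBesov_le_besovNorm {p q : ℝ≥0∞} (φ₀ : 𝓢(Rn n, ℂ)) (s : ℝ)
    (F : Fin n → 𝓢(Rn n, ℂ)) (i : Fin n) :
    scalarBesov φ₀ s p q (F i) ≤ besovNorm φ₀ s p q (toDist F) := by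
  refine lqNorm_mono fun j => ?_
  rw [lpBlock_toDist]
  gcongr
  exact le_distLpNorm_toDist p (fun i => kblock φ₀ j (F i)) i

theorem scalarBesov_add_le {p q : ℝ≥0∞} (hp : 1 ≤ p) (hq : 1 ≤ q) (φ₀ : 𝓢(Rn n, ℂ)) (s : ℝ)
    (f g : 𝓢(Rn n, ℂ)) :
    scalarBesov φ₀ s p q (f + g) ≤ scalarBesov φ₀ s p q f + scalarBesov φ₀ s p q g := by
  refine le_trans (lqNorm_mono fun j => ?_) (lqNorm_add_le hq _ _)
  rw [kblock_add, ← mul_add]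
  gcongr
  exact eLpNorm_add_le (kblock φ₀ j f).continuous.aestronglyMeasurable
    (kblock φ₀ j g).continuous.aestronglyMeasurable hp

theorem scalarBesov_smul {p q : ℝ≥0∞} (hq : 1 ≤ q) (φ₀ : 𝓢(Rn n, ℂ)) (s : ℝ)
    (c : ℂ) (g : 𝓢(Rn n, ℂ)) :
    scalarBesov φ₀ s p q (c • g) = ‖c‖ₑ * scalarBesov φ₀ s p q g := by
  rw [scalarBesov, scalarBesov, ← lqNorm_const_mul hq]
  congr 1; ext j
  rw [kblock_smul, mul_left_comm]
  congr 1
  exact eLpNorm_const_smul c (kblock φ₀ j g) p volume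

theorem scalarBesov_zero {p q : ℝ≥0∞} (hq : 1 ≤ q) (φ₀ : 𝓢(Rn n, ℂ)) (s : ℝ) :
    scalarBesov φ₀ s p q 0 = 0 := by
  have := scalarBesov_smul (p := p) hq φ₀ s 0 0
  simpa using this

theorem scalarBesov_sum_le {p q : ℝ≥0∞} (hp : 1 ≤ p) (hq : 1 ≤ q) (φ₀ : 𝓢(Rn n, ℂ)) (s : ℝ)
    {ι : Type*} (A : Finset ι) (f : ι → 𝓢(Rn n, ℂ)) :
    scalarBesov φ₀ s p q (∑ a ∈ A, f a) ≤ ∑ a ∈ A, scalarBesov φ₀ s p q (f a) := by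
  classical
  induction A using Finset.induction_on with
  | empty => simp [scalarBesov_zero hq]
  | insert m A hm ih =>
    simp only [Finset.sum_insert hm]
    exact (scalarBesov_add_le hp hq _ _ _ _).trans (by gcongr)

/-- The `ℓ¹` norm dominates all `ℓ^q` norms. -/
theorem scalarBesov_le_one {p q : ℝ≥0∞} (hq : 1 ≤ q) (φ₀ : 𝓢(Rn n, ℂ)) (s : ℝ)
    (g : 𝓢(Rn n, ℂ)) : scalarBesov φ₀ s p q g ≤ scalarBesov φ₀ s p 1 g := by
  rw [scalarBesov, scalarBesov, lqNorm_one]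
  exact lqNorm_le_tsum hq _

/-- Littlewood–Paley reconstruction of Schwartz fields. -/
theorem hasSum_lpBlock_toDist (hn : 0 < n) {φ₀ : 𝓢(Rn n, ℂ)} (hφ₀ : IsLittlewoodPaley φ₀)
    (F : Fin n → 𝓢(Rn n, ℂ)) : HasSum (fun j : ℤ => lpBlock φ₀ j (toDist F)) (toDist F) := by
  unfold HasSum
  rw [PointwiseConvergenceCLM.tendsto_iff_forall_tendsto]
  intro φ
  set K : 𝓢(Rn n, EuclideanSpace ℂ (Fin n)) :=
    SchwartzMap.pairing (ContinuousLinearMap.lsmul ℂ ℂ) (𝓕⁻ φ) (𝓕 (vecSchwartz F))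
  have hK : ∀ ξ, K ξ = (𝓕⁻ φ) ξ • 𝓕 (vecSchwartz F) ξ := fun ξ => by
    simp [K, pairing_apply_apply]
  set σ : ℤ → Rn n → ℂ := fun j ξ => 𝓕 φ₀ ((2 : ℝ) ^ (-j) • ξ)
  have hσn : ∀ j ξ, ‖σ j ξ‖ = (σ j ξ).re := fun j ξ => by
    have h1 := hφ₀.im_eq_zero ((2 : ℝ) ^ (-j) • ξ)
    have h2 := (hφ₀.re_mem ((2 : ℝ) ^ (-j) • ξ)).1
    rw [← Complex.abs_re_eq_norm.2 h1, abs_of_nonneg h2]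
  have h1 : toDist F φ = ∫ ξ, K ξ := by
    have : toDist F φ = toDist F (𝓕 (𝓕⁻ φ)) := by simp
    rw [this, toDist_apply, SchwartzMap.integral_fourier_smul_eq]
    simp only [hK]
  have h2 : ∀ j, lpBlock φ₀ j (toDist F) φ = ∫ ξ, σ j ξ • K ξ := fun j => by
    rw [lpBlock, TemperedDistribution.fourierMultiplierCLM_apply_apply, toDist_apply,
      SchwartzMap.integral_fourier_smul_eq]
    congr 1; ext1 ξ
    rw [smulLeftCLM_apply_apply (hasTemperateGrowth_symbol φ₀ j), hK, smul_smul, smul_eq_mul]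
  -- The symbols add up to one only away from the origin, which is a null set because `n > 0`.
  have hne : ∀ᵐ ξ : Rn n, ξ ≠ 0 := by
    have : Nonempty (Fin n) := ⟨⟨0, hn⟩⟩
    exact compl_mem_ae_iff.2 (measure_singleton (0 : Rn n))
  have hre : ∀ ξ : Rn n, ξ ≠ 0 → HasSum (fun j => (σ j ξ).re) 1 := fun ξ hξ => by
    have := Complex.hasSum_re (hφ₀.hasSum_one ξ hξ)
    rwa [Complex.one_re] at this
  -- Dominated convergence: the symbols are nonnegative with sum one, so the norms of the terms add
  -- up to the integrable function `‖K‖`.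
  have h3 : HasSum (fun j => ∫ ξ, σ j ξ • K ξ) (∫ ξ, K ξ) := by
    refine hasSum_integral_of_dominated_convergence (fun j ξ => (σ j ξ).re * ‖K ξ‖) ?_ ?_ ?_ ?_ ?_
    · intro j
      have : Continuous (σ j) := (dil (-j) (𝓕 φ₀)).continuous
      exact (this.smul K.continuous).aestronglyMeasurable
    · exact fun j => Eventually.of_forall fun ξ => by rw [norm_smul, hσn]
    · filter_upwards [hne] with ξ hξ
      exact (hre ξ hξ).summable.mul_right _
    · refine (K.integrable (μ := volume)).norm.congr ?_
      filter_upwards [hne] with ξ hξ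
      rw [tsum_mul_right, (hre ξ hξ).tsum_eq, one_mul]
    · filter_upwards [hne] with ξ hξ
      have := (hφ₀.hasSum_one ξ hξ).smul_const (K ξ)
      rwa [one_smul] at this
  rw [← h1] at h3
  refine Tendsto.congr (fun A => ?_) h3
  rw [_root_.sum_apply]
  exact Finset.sum_congr rfl fun j _ => (h2 j).symm

end

section

open SchwartzMap
variable {n : ℕ}

/-! ### Frequency localization and supports -/

theorem IsLittlewoodPaley.fourier_eq_zero_low {φ₀ : 𝓢(Rn n, ℂ)} (h : IsLittlewoodPaley φ₀) (j : ℤ)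
    {ξ : Rn n} (hξ : ‖ξ‖ < (2 : ℝ) ^ (j - 1)) : 𝓕 φ₀ ((2 : ℝ) ^ (-j) • ξ) = 0 := by
  by_contra hne
  have := (h.support_subset _ hne).1
  rw [norm_smul, Real.norm_of_nonneg (by positivity), zpow_neg] at this
  have h2 : (0 : ℝ) < 2 ^ j := by positivity
  rw [zpow_sub_one₀ (by norm_num)] at hξ
  rw [inv_mul_eq_div, le_div_iff₀ h2] at this
  linarith

theorem IsLittlewoodPaley.fourier_eq_zero_high {φ₀ : 𝓢(Rn n, ℂ)} (h : IsLittlewoodPaley φ₀) (j : ℤ)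
    {ξ : Rn n} (hξ : (2 : ℝ) ^ (j + 1) < ‖ξ‖) : 𝓕 φ₀ ((2 : ℝ) ^ (-j) • ξ) = 0 := by
  by_contra hne
  have := (h.support_subset _ hne).2
  rw [norm_smul, Real.norm_of_nonneg (by positivity), zpow_neg] at this
  have h2 : (0 : ℝ) < 2 ^ j := by positivity
  rw [zpow_add_one₀ (by norm_num)] at hξ
  rw [inv_mul_eq_div, div_le_iff₀ h2] at this
  linarith

/-- The kernel `ψ` has the spectral support of `φ₀`. -/
def SpectralSub (φ₀ ψ : 𝓢(Rn n, ℂ)) : Prop := ∀ ξ, 𝓕 φ₀ ξ = 0 → 𝓕 ψ ξ = 0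

theorem SpectralSub.refl (φ₀ : 𝓢(Rn n, ℂ)) : SpectralSub φ₀ φ₀ := fun _ h => h
theorem SpectralSub.pd {φ₀ ψ : 𝓢(Rn n, ℂ)} (h : SpectralSub φ₀ ψ) (i : Fin n) :
    SpectralSub φ₀ (pd i ψ) := fun ξ hξ => by rw [fourier_pd, h ξ hξ, mul_zero]
theorem SpectralSub.laplacian {φ₀ ψ : 𝓢(Rn n, ℂ)} (h : SpectralSub φ₀ ψ) :
    SpectralSub φ₀ (Δ ψ) := fun ξ hξ => by rw [fourier_laplacian, h ξ hξ, mul_zero]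

theorem kblock_eq_zero_of_bandLimited {φ₀ ψ g : 𝓢(Rn n, ℂ)} (h : IsLittlewoodPaley φ₀)
    (hψ : SpectralSub φ₀ ψ) {R : ℝ} (hg : BandLimited R g) {j : ℤ} (hj : R < (2 : ℝ) ^ (j - 1)) :
    kblock ψ j g = 0 := by
  apply fourier_ext; intro ξ
  rw [fourier_kblock, FourierTransform.fourier_zero, zero_apply]
  rcases lt_or_ge R ‖ξ‖ with h1 | h1
  · rw [hg ξ h1, mul_zero]
  · rw [hψ _ (h.fourier_eq_zero_low j (h1.trans_lt hj)), zero_mul]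

theorem kblock_eq_zero_of_highPass {φ₀ ψ g : 𝓢(Rn n, ℂ)} (h : IsLittlewoodPaley φ₀)
    (hψ : SpectralSub φ₀ ψ) {R : ℝ} (hg : HighPass R g) {j : ℤ} (hj : (2 : ℝ) ^ (j + 1) < R) :
    kblock ψ j g = 0 := by
  apply fourier_ext; intro ξ
  rw [fourier_kblock, FourierTransform.fourier_zero, zero_apply]
  rcases lt_or_ge ‖ξ‖ R with h1 | h1
  · rw [hg ξ h1, mul_zero]
  · rw [hψ _ (h.fourier_eq_zero_high j (hj.trans_le h1)), zero_mul]

/-! ### Geometric series over `ℤ` -/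

theorem tsum_nat_rpow_ne_top {s : ℝ} (hs : s < 0) :
    ∑' m : ℕ, ENNReal.ofReal ((2 : ℝ) ^ (s * (m : ℝ))) ≠ ∞ := by
  have h : ∀ m : ℕ, ENNReal.ofReal ((2 : ℝ) ^ (s * (m : ℝ))) = ENNReal.ofReal ((2 : ℝ) ^ s) ^ m :=
    fun m => by
      rw [← ENNReal.ofReal_pow (by positivity), Real.rpow_mul (by norm_num), Real.rpow_natCast]
  simp_rw [h]
  rw [ENNReal.tsum_geometric]
  apply ENNReal.inv_ne_top.2
  rw [Ne, tsub_eq_zero_iff_le, not_le, ENNReal.ofReal_lt_one]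
  exact Real.rpow_lt_one_of_one_lt_of_neg (by norm_num) hs

/-- The geometric series `∑_{m ≥ 0} 2 ^ (- |s| m)`. -/
def geomConst (s : ℝ) : ℝ≥0∞ := ∑' m : ℕ, ENNReal.ofReal ((2 : ℝ) ^ (-|s| * (m : ℝ)))

theorem geomConst_ne_top {s : ℝ} (hs : s ≠ 0) : geomConst s ≠ ∞ :=
  tsum_nat_rpow_ne_top (by simpa using hs)

/-- The sum starts at `j₀`, and its first term fixes the size. The constant depends on `|s|` only,
so the companion for `s > 0` follows by reflecting `ℤ`. -/
theorem tsum_int_ge {s : ℝ} (hs : s < 0) (j₀ : ℤ) (c : ℤ → ℝ≥0∞) (A : ℝ≥0∞)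
    (hc : ∀ j, c j ≤ ENNReal.ofReal ((2 : ℝ) ^ (s * (j : ℝ))) * A) (h0 : ∀ j, j < j₀ → c j = 0) :
    ∑' j, c j ≤ ENNReal.ofReal ((2 : ℝ) ^ (s * (j₀ : ℝ))) * geomConst s * A := by
  have hinj : Function.Injective (fun m : ℕ => j₀ + (m : ℤ)) := fun a b h => by simpa using h
  have hsupp : Function.support c ⊆ Set.range (fun m : ℕ => j₀ + (m : ℤ)) := fun j hj => by
    have : j₀ ≤ j := by
      by_contra hlt
      exact hj (h0 j (not_le.1 hlt))
    exact ⟨(j - j₀).toNat, by simp [this]⟩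
  rw [← hinj.tsum_eq hsupp]
  calc ∑' m : ℕ, c (j₀ + m)
      ≤ ∑' m : ℕ, ENNReal.ofReal ((2 : ℝ) ^ (s * (j₀ : ℝ))) *
        (ENNReal.ofReal ((2 : ℝ) ^ (-|s| * (m : ℝ))) * A) := by
        refine ENNReal.tsum_le_tsum fun m => (hc _).trans (le_of_eq ?_)
        rw [← mul_assoc, ofReal_two_rpow_mul, abs_of_neg hs]
        congr 3; push_cast; ring
    _ = _ := by rw [ENNReal.tsum_mul_left, ENNReal.tsum_mul_right, geomConst, mul_assoc]

theorem tsum_int_le {s : ℝ} (hs : 0 < s) (j₀ : ℤ) (c : ℤ → ℝ≥0∞) (A : ℝ≥0∞)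
    (hc : ∀ j, c j ≤ ENNReal.ofReal ((2 : ℝ) ^ (s * (j : ℝ))) * A) (h0 : ∀ j, j₀ < j → c j = 0) :
    ∑' j, c j ≤ ENNReal.ofReal ((2 : ℝ) ^ (s * (j₀ : ℝ))) * geomConst s * A := by
  have h := tsum_int_ge (neg_lt_zero.2 hs) (-j₀) (fun j => c (-j)) A
    (fun j => (hc (-j)).trans (le_of_eq (by congr 3; push_cast; ring)))
    (fun j hj => h0 _ (by linarith))
  rw [show ∑' j, c (-j) = ∑' j, c j from (Equiv.neg ℤ).tsum_eq c] at h
  refine h.trans (le_of_eq ?_)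
  rw [geomConst, geomConst, abs_neg]
  congr 4; push_cast; ring

/-! ### Besov norms of localized functions -/

/-- Generalization of `scalarBesov` with another kernel. -/
theorem scalarBesov_pd (φ₀ : 𝓢(Rn n, ℂ)) (s : ℝ) (p q : ℝ≥0∞) (i : Fin n) (g : 𝓢(Rn n, ℂ)) :
    scalarBesov φ₀ s p q (pd i g) = lqNorm q (fun j =>
      ENNReal.ofReal ((2 : ℝ) ^ ((s + 1) * (j : ℝ))) * eLpNorm (kblock (pd i φ₀) j g) p volume) := by
  rw [scalarBesov]
  congr 1; ext j
  rw [kblock_pd]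
  have : eLpNorm (⇑(((2 : ℝ) ^ j : ℂ) • kblock (pd i φ₀) j g)) p volume =
      ‖((2 : ℝ) ^ j : ℂ)‖ₑ * eLpNorm (kblock (pd i φ₀) j g) p volume :=
    eLpNorm_const_smul ((2 : ℝ) ^ j : ℂ) (kblock (pd i φ₀) j g) p volume
  rw [this, ← mul_assoc]
  congr 1
  have h2 : ‖((2 : ℝ) ^ j : ℂ)‖ₑ = ENNReal.ofReal ((2 : ℝ) ^ (j : ℝ)) := by
    rw [← ofReal_norm, norm_zpow, Complex.norm_real, Real.rpow_intCast]; simp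
  rw [h2, ofReal_two_rpow_mul]
  congr 2; ring

theorem two_zpow_lt_of_lt_log {R : ℝ} {j : ℤ} (hR : 0 < R) (hj : j < Int.log 2 R - 1) :
    (2 : ℝ) ^ (j + 1) < R := by
  have h1 : ((2 : ℕ) : ℝ) ^ Int.log 2 R ≤ R := Int.zpow_log_le_self (by norm_num) hR
  refine lt_of_lt_of_le ?_ h1
  exact zpow_lt_zpow_right₀ (by norm_num) (by linarith)

theorem lt_two_zpow_of_log_lt {R : ℝ} {j : ℤ} (hj : Int.log 2 R + 1 < j) :
    R < (2 : ℝ) ^ (j - 1) := by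
  have h1 : R < ((2 : ℕ) : ℝ) ^ (Int.log 2 R + 1) := Int.lt_zpow_succ_log_self (by norm_num) R
  refine h1.trans_le ?_
  exact zpow_le_zpow_right₀ (by norm_num) (by linarith)

/-- A spectrum in an annulus. -/
structure AnnularSpectrum (g : 𝓢(Rn n, ℂ)) : Prop where
  exists_highPass : ∃ r, 0 < r ∧ HighPass r g
  exists_bandLimited : ∃ R, BandLimited R g

theorem AnnularSpectrum.add {f g : 𝓢(Rn n, ℂ)} (hf : AnnularSpectrum f) (hg : AnnularSpectrum g) :
    AnnularSpectrum (f + g) := by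
  obtain ⟨⟨r, hr, h1⟩, R, h2⟩ := hf
  obtain ⟨⟨r', hr', h1'⟩, R', h2'⟩ := hg
  exact ⟨⟨min r r', lt_min hr hr', (h1.mono (min_le_left _ _)).add (h1'.mono (min_le_right _ _))⟩,
    ⟨max R R', (h2.mono (le_max_left _ _)).add (h2'.mono (le_max_right _ _))⟩⟩

theorem annularSpectrum_zero : AnnularSpectrum (0 : 𝓢(Rn n, ℂ)) :=
  ⟨⟨1, one_pos, highPass_zero⟩, ⟨1, bandLimited_zero⟩⟩

theorem AnnularSpectrum.smul {f : 𝓢(Rn n, ℂ)} (c : ℂ) (hf : AnnularSpectrum f) :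
    AnnularSpectrum (c • f) := by
  obtain ⟨⟨r, hr, h1⟩, R, h2⟩ := hf
  exact ⟨⟨r, hr, h1.smul c⟩, ⟨R, h2.smul c⟩⟩

theorem AnnularSpectrum.sub {f g : 𝓢(Rn n, ℂ)} (hf : AnnularSpectrum f) (hg : AnnularSpectrum g) :
    AnnularSpectrum (f - g) := by
  have := hf.add (hg.smul (-1))
  rwa [neg_one_smul, ← sub_eq_add_neg] at this

theorem AnnularSpectrum.pd {f : 𝓢(Rn n, ℂ)} (i : Fin n) (hf : AnnularSpectrum f) :
    AnnularSpectrum (pd i f) := by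
  obtain ⟨⟨r, hr, h1⟩, R, h2⟩ := hf
  exact ⟨⟨r, hr, h1.pd i⟩, ⟨R, h2.pd i⟩⟩

theorem AnnularSpectrum.sum {ι : Type*} (s : Finset ι) {f : ι → 𝓢(Rn n, ℂ)}
    (h : ∀ a ∈ s, AnnularSpectrum (f a)) : AnnularSpectrum (∑ a ∈ s, f a) := by
  classical
  induction s using Finset.induction_on with
  | empty => simpa using annularSpectrum_zero
  | insert m s hm ih =>
    rw [Finset.sum_insert hm]
    exact (h m (Finset.mem_insert_self _ _)).add
      (ih fun a ha => h a (Finset.mem_insert_of_mem ha))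

theorem AnnularSpectrum.laplacian {f : 𝓢(Rn n, ℂ)} (hf : AnnularSpectrum f) :
    AnnularSpectrum (Δ f) := by
  rw [laplacian_eq_sum_pd]
  exact AnnularSpectrum.sum _ fun i _ => (hf.pd i).pd i

theorem eLpNorm_schwartz_ne_top (g : 𝓢(Rn n, ℂ)) (p : ℝ≥0∞) : eLpNorm g p volume ≠ ∞ :=
  (g.memLp p volume).2.ne

/-- Only finitely many blocks meet the annulus, and each of them is a Schwartz function; there is no
restriction on `s`. -/
theorem AnnularSpectrum.scalarBesov_lt_top {φ₀ : 𝓢(Rn n, ℂ)} (h : IsLittlewoodPaley φ₀) (s : ℝ)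
    {p q : ℝ≥0∞} (hq : 1 ≤ q) {g : 𝓢(Rn n, ℂ)} (hg : AnnularSpectrum g) :
    scalarBesov φ₀ s p q g < ∞ := by
  obtain ⟨⟨r, hr, h1⟩, R, h2⟩ := hg
  refine (scalarBesov_le_one hq φ₀ s g).trans_lt ?_
  rw [scalarBesov, lqNorm_one, tsum_eq_sum (s := Finset.Icc (Int.log 2 r - 1) (Int.log 2 R + 1))]
  · refine ENNReal.sum_lt_top.2 fun j _ => ?_
    exact ENNReal.mul_lt_top ENNReal.ofReal_lt_top (eLpNorm_schwartz_ne_top _ p).lt_top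
  · intro j hj
    rw [Finset.mem_Icc, not_and_or, not_le, not_le] at hj
    have : kblock φ₀ j g = 0 := by
      rcases hj with hj | hj
      · exact kblock_eq_zero_of_highPass h (.refl _) h1 (two_zpow_lt_of_lt_log hr hj)
      · exact kblock_eq_zero_of_bandLimited h (.refl _) h2 (lt_two_zpow_of_log_lt hj)
    rw [this]; simp

/-- High frequency functions are small in spaces of negative regularity. -/
theorem HighPass.tsum_le {φ₀ ψ : 𝓢(Rn n, ℂ)} (h : IsLittlewoodPaley φ₀) (hψ : SpectralSub φ₀ ψ)
    {s : ℝ} (hs : s < 0) {p : ℝ≥0∞} (hp : 1 ≤ p) {R : ℝ} (hR : 0 < R) {g : 𝓢(Rn n, ℂ)}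
    (hg : HighPass R g) :
    ∑' j : ℤ, ENNReal.ofReal ((2 : ℝ) ^ (s * (j : ℝ))) * eLpNorm (kblock ψ j g) p volume ≤
      ENNReal.ofReal ((R / 4) ^ s) * (geomConst s * eLpNorm ψ 1 volume) *
        eLpNorm g p volume := by
  have := tsum_int_ge hs (Int.log 2 R - 1)
    (fun j : ℤ => ENNReal.ofReal ((2 : ℝ) ^ (s * (j : ℝ))) * eLpNorm (kblock ψ j g) p volume)
    (eLpNorm ψ 1 volume * eLpNorm g p volume)
    (fun j => by gcongr; exact eLpNorm_kblock_le hp ψ j g)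
    (fun j hj => by
      rw [kblock_eq_zero_of_highPass h hψ hg (two_zpow_lt_of_lt_log hR hj)]; simp)
  refine this.trans ?_
  rw [← mul_assoc, mul_assoc _ (geomConst s)]
  gcongr
  rw [mul_comm, Real.rpow_mul (by norm_num)]
  refine Real.rpow_le_rpow_of_nonpos (by positivity) ?_ hs.le
  -- This gives `R / 4 < 2 ^ (Int.log 2 R - 1)`, the scale of the first block that can be nonzero.
  have h1 : R < ((2 : ℕ) : ℝ) ^ (Int.log 2 R + 1) := Int.lt_zpow_succ_log_self (by norm_num) R
  rw [Real.rpow_intCast, show Int.log 2 R - 1 = (Int.log 2 R + 1) - 2 by ring,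
    zpow_sub₀ (by norm_num)]
  push_cast at h1
  norm_num
  linarith

/-- Low frequency estimate for derivatives. -/
theorem BandLimited.scalarBesov_pd_le {φ₀ : 𝓢(Rn n, ℂ)} (h : IsLittlewoodPaley φ₀)
    {s : ℝ} {p q : ℝ≥0∞} (hp : 1 ≤ p) (hq : 1 ≤ q) (hs : 0 < s + 1 + (n - overExponent n p)) {R : ℝ}
    (i : Fin n) {g : 𝓢(Rn n, ℂ)} (hg : BandLimited R g) :
    scalarBesov φ₀ s p q (_root_.pd i g) < ∞ := by
  refine (scalarBesov_le_one hq φ₀ s _).trans_lt ?_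
  rw [scalarBesov_pd, lqNorm_one]
  -- The derivative contributes `2 ^ j` and Bernstein's inequality from `L¹` to `Lᵖ` contributes `2
  -- ^ ((n - n/p) j)`; the series over low frequencies converges as the total exponent is positive.
  refine (tsum_int_le hs (Int.log 2 R + 1) _ (eLpNorm (_root_.pd i φ₀) p volume * eLpNorm g 1 volume)
    (fun j => ?_) (fun j hj => ?_)).trans_lt ?_
  · calc _ ≤ ENNReal.ofReal ((2 : ℝ) ^ ((s + 1) * (j : ℝ))) *
          (ENNReal.ofReal ((2 : ℝ) ^ ((n - overExponent n p) * (j : ℝ))) *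
            (eLpNorm (_root_.pd i φ₀) p volume * eLpNorm g 1 volume)) := by
          gcongr; exact eLpNorm_kblock_le_bernstein hp _ j g
      _ = _ := by
          rw [← mul_assoc, ofReal_two_rpow_mul]; congr 3; ring
  · rw [kblock_eq_zero_of_bandLimited h ((SpectralSub.refl _).pd i) hg (lt_two_zpow_of_log_lt hj)]
    simp
  · exact ENNReal.mul_lt_top (ENNReal.mul_lt_top ENNReal.ofReal_lt_top
      (geomConst_ne_top hs.ne').lt_top) (ENNReal.mul_lt_top (eLpNorm_schwartz_ne_top _ _).lt_top
      (eLpNorm_schwartz_ne_top _ _).lt_top)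

/-- Low frequency estimate for derivatives of functions of vanishing mean. -/
theorem exists_scalarBesov_pd_le_moment {φ₀ : 𝓢(Rn n, ℂ)} (h : IsLittlewoodPaley φ₀)
    {s : ℝ} {p : ℝ≥0∞} (hp : 1 ≤ p) (hs : 0 < s + 1 + (n - overExponent n p + 1))
    (R : ℝ) : ∃ C : ℝ≥0∞, C ≠ ∞ ∧ ∀ q : ℝ≥0∞, 1 ≤ q → ∀ (i : Fin n) (g : 𝓢(Rn n, ℂ)),
      BandLimited R g → ∫ x, g x = 0 → scalarBesov φ₀ s p q (pd i g) ≤ C * firstMoment g := by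
  -- The vanishing mean yields one more factor `2 ^ j` than Bernstein's inequality. The constant
  -- sees `g` only through the radius `R` of its band, which makes it uniform over rescaled fields.
  refine ⟨ENNReal.ofReal ((2 : ℝ) ^ ((s + 1 + (n - overExponent n p + 1)) *
    ((Int.log 2 R + 1 : ℤ) : ℝ))) * geomConst (s + 1 + (n - overExponent n p + 1)) *
      ∑ i, eLpNorm (fderivCLM ℂ (Rn n) ℂ (pd i φ₀)) p volume, ?_, ?_⟩
  · refine (ENNReal.mul_lt_top (ENNReal.mul_lt_top ENNReal.ofReal_lt_top
      (geomConst_ne_top hs.ne').lt_top) (ENNReal.sum_lt_top.2 fun i _ => ?_)).ne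
    exact ((fderivCLM ℂ (Rn n) ℂ (pd i φ₀)).memLp p volume).2
  · intro q hq i g hg h0
    refine (scalarBesov_le_one hq φ₀ s _).trans ?_
    rw [scalarBesov_pd, lqNorm_one]
    refine (tsum_int_le hs (Int.log 2 R + 1) _ (eLpNorm (fderivCLM ℂ (Rn n) ℂ (pd i φ₀)) p volume *
      firstMoment g) (fun j => ?_) (fun j hj => ?_)).trans ?_
    · calc _ ≤ ENNReal.ofReal ((2 : ℝ) ^ ((s + 1) * (j : ℝ))) *
            (ENNReal.ofReal ((2 : ℝ) ^ ((n - overExponent n p + 1) * (j : ℝ))) *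
              (eLpNorm (fderivCLM ℂ (Rn n) ℂ (pd i φ₀)) p volume * firstMoment g)) := by
            gcongr; exact eLpNorm_kblock_le_moment hp _ j g h0
        _ = _ := by
            rw [← mul_assoc, ofReal_two_rpow_mul]; congr 3; ring
    · rw [kblock_eq_zero_of_bandLimited h ((SpectralSub.refl _).pd i) hg
        (lt_two_zpow_of_log_lt hj)]
      simp
    · rw [← mul_assoc]
      gcongr
      exact Finset.single_le_sum (f := fun i => eLpNorm (fderivCLM ℂ (Rn n) ℂ (pd i φ₀)) p volume)
        (fun _ _ => zero_le) (Finset.mem_univ i)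

end

section

open SchwartzMap
variable {n : ℕ}

/-! ### Vector fields with Schwartz components -/

/-- Divergence of a field. -/
def fieldDiv (F : Fin n → 𝓢(Rn n, ℂ)) : 𝓢(Rn n, ℂ) := ∑ i, pd i (F i)

/-- Gradient of a function. -/
def grad (g : 𝓢(Rn n, ℂ)) : Fin n → 𝓢(Rn n, ℂ) := fun i => pd i g

/-- Componentwise Laplacian of a field. -/
def vecLaplacian (F : Fin n → 𝓢(Rn n, ℂ)) : Fin n → 𝓢(Rn n, ℂ) := fun i => Δ (F i)

/-- The divergence of the matrix field `Q`, `k ↦ ∑ᵢ ∂ᵢ Qᵢₖ`. -/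
def matrixDiv (Q : Fin n → Fin n → 𝓢(Rn n, ℂ)) : Fin n → 𝓢(Rn n, ℂ) :=
  fun k => ∑ i, pd i (Q i k)

/-- The matrix field `F ⊗ G`. -/
def tensor (F G : Fin n → 𝓢(Rn n, ℂ)) : Fin n → Fin n → 𝓢(Rn n, ℂ) := fun i k => F i * G k

/-- `g` takes real values. -/
def IsRealFun (g : 𝓢(Rn n, ℂ)) : Prop := ∀ x, (g x).im = 0

theorem IsRealFun.add {f g : 𝓢(Rn n, ℂ)} (hf : IsRealFun f) (hg : IsRealFun g) :
    IsRealFun (f + g) := fun x => by simp [hf x, hg x]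
theorem IsRealFun.sub {f g : 𝓢(Rn n, ℂ)} (hf : IsRealFun f) (hg : IsRealFun g) :
    IsRealFun (f - g) := fun x => by simp [hf x, hg x]
theorem IsRealFun.neg {f : 𝓢(Rn n, ℂ)} (hf : IsRealFun f) :
    IsRealFun (-f) := fun x => by simp [hf x]
theorem IsRealFun.mul {f g : 𝓢(Rn n, ℂ)} (hf : IsRealFun f) (hg : IsRealFun g) :
    IsRealFun (f * g) := fun x => by simp [hf x, hg x]
theorem IsRealFun.smul {f : 𝓢(Rn n, ℂ)} (c : ℝ) (hf : IsRealFun f) :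
    IsRealFun ((c : ℂ) • f) := fun x => by simp [hf x]
theorem isRealFun_zero : IsRealFun (0 : 𝓢(Rn n, ℂ)) := fun x => by simp
theorem IsRealFun.sum {ι : Type*} (s : Finset ι) {f : ι → 𝓢(Rn n, ℂ)}
    (h : ∀ a ∈ s, IsRealFun (f a)) : IsRealFun (∑ a ∈ s, f a) := fun x => by
  rw [_root_.sum_apply, Complex.im_sum]
  exact Finset.sum_eq_zero fun a ha => h a ha x
theorem IsRealFun.pd {f : 𝓢(Rn n, ℂ)} (i : Fin n) (hf : IsRealFun f) : IsRealFun (pd i f) := by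
  intro x
  have h1 : HasFDerivAt (fun y => (f y).im) (Complex.imCLM.comp (fderiv ℝ f x)) x :=
    Complex.imCLM.hasFDerivAt.comp x f.differentiableAt.hasFDerivAt
  have h2 : (fun y => (f y).im) = fun _ => (0 : ℝ) := funext hf
  rw [h2] at h1
  have h3 := h1.unique (hasFDerivAt_const 0 x)
  have h4 := congrArg (fun L : Rn n →L[ℝ] ℝ => L (EuclideanSpace.single i 1)) h3
  simpa [_root_.pd, SchwartzMap.lineDerivOp_apply_eq_fderiv] using h4
theorem IsRealFun.laplacian {f : 𝓢(Rn n, ℂ)} (hf : IsRealFun f) : IsRealFun (Δ f) := by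
  rw [laplacian_eq_sum_pd]
  exact IsRealFun.sum _ fun i _ => (hf.pd i).pd i

theorem IsRealFun.eq_re {f : 𝓢(Rn n, ℂ)} (hf : IsRealFun f) (x : Rn n) :
    f x = ((f x).re : ℂ) := Complex.ext rfl (by simp [hf x])

theorem isRealDistribution_toDist {F : Fin n → 𝓢(Rn n, ℂ)} (hF : ∀ i, IsRealFun (F i)) :
    IsRealDistribution (toDist F) := by
  intro φ hφ i
  rw [toDist_apply_apply]
  have : (fun x => F i x * φ x) = fun x => (((F i x).re * (φ x).re : ℝ) : ℂ) := by
    ext x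
    rw [(hF i).eq_re x, IsRealFun.eq_re hφ x]; simp
  rw [this, integral_complex_ofReal]
  simp

/-! ### Pairings -/

theorem pairing_toDist (F φ : Fin n → 𝓢(Rn n, ℂ)) :
    _root_.pairing (toDist F) φ = ∑ i, ∫ x, F i x * φ i x := by
  simp [_root_.pairing, toDist_apply_apply]

theorem pairing_add_left (S T : VecDistribution n) (φ : Fin n → 𝓢(Rn n, ℂ)) :
    _root_.pairing (S + T) φ = _root_.pairing S φ + _root_.pairing T φ := by
  simp [_root_.pairing, Finset.sum_add_distrib]

theorem pairing_smul_left (c : ℂ) (T : VecDistribution n) (φ : Fin n → 𝓢(Rn n, ℂ)) :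
    _root_.pairing (c • T) φ = c * _root_.pairing T φ := by
  simp [_root_.pairing, Finset.mul_sum]

theorem integrable_mul (f g : 𝓢(Rn n, ℂ)) : Integrable (fun x => f x * g x) := (f * g).integrable

theorem integral_mul_eq_fourier (f g : 𝓢(Rn n, ℂ)) :
    ∫ x, f x * g x = ∫ ξ, 𝓕 f (-ξ) * 𝓕 g ξ := by
  have h := integral_fourier_mul_eq (𝓕⁻ f) g
  rw [FourierTransform.fourier_fourierInv_eq] at h
  rw [h]
  rfl

theorem pairing_toDist_eq_fourier (F φ : Fin n → 𝓢(Rn n, ℂ)) :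
    _root_.pairing (toDist F) φ = ∫ ξ, ∑ i, 𝓕 (F i) (-ξ) * 𝓕 (φ i) ξ := by
  rw [pairing_toDist, integral_finsetSum]
  · exact Finset.sum_congr rfl fun i _ => integral_mul_eq_fourier _ _
  · intro i _
    have h : ∀ ξ, (𝓕⁻ (F i)) ξ = 𝓕 (F i) (-ξ) := fun ξ => rfl
    simpa only [h] using integrable_mul (𝓕⁻ (F i)) (𝓕 (φ i))

theorem fourier_fieldDiv_eq_zero {F : Fin n → 𝓢(Rn n, ℂ)} (hF : fieldDiv F = 0) (ξ : Rn n) :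
    ∑ i, (ξ i : ℂ) * 𝓕 (F i) ξ = 0 := by
  have h := congrArg (fun g : 𝓢(Rn n, ℂ) => 𝓕 g ξ) hF
  simp only [fieldDiv, FourierTransform.fourier_sum, FourierTransform.fourier_zero,
    _root_.zero_apply, _root_.sum_apply, fourier_pd, mul_assoc] at h
  rw [← Finset.mul_sum, ← Finset.mul_sum, ← Finset.mul_sum] at h
  simpa [Real.pi_ne_zero] using h

/-- Solenoidal fields do not see the Helmholtz projection. -/
theorem pairing_helmholtz {F φ ψ : Fin n → 𝓢(Rn n, ℂ)} (hF : fieldDiv F = 0)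
    (h : IsHelmholtzProj φ ψ) : _root_.pairing (toDist F) ψ = _root_.pairing (toDist F) φ := by
  -- In dimension zero the origin is not a null set, but there the pairings are empty sums.
  rcases n.eq_zero_or_pos with rfl | hn
  · simp [_root_.pairing]
  have : NeZero n := ⟨hn.ne'⟩
  have : Nontrivial (Rn n) := inferInstance
  rw [pairing_toDist_eq_fourier, pairing_toDist_eq_fourier]
  refine integral_congr_ae ?_
  filter_upwards [compl_mem_ae_iff.2 (measure_singleton (0 : Rn n))] with ξ hξ
  have h0 := fourier_fieldDiv_eq_zero hF (-ξ)
  -- The transforms of `ψ` and `φ` differ by a multiple of `ξ`, to which the transform of a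
  -- solenoidal field is orthogonal.
  have h1 : ∑ i, 𝓕 (F i) (-ξ) * 𝓕 (ψ i) ξ = ∑ i, 𝓕 (F i) (-ξ) * 𝓕 (φ i) ξ +
      (∑ i, (((-ξ) i : ℝ) : ℂ) * 𝓕 (F i) (-ξ)) *
        ∑ k, ((ξ k / ‖ξ‖ ^ 2 : ℝ) : ℂ) * 𝓕 (φ k) ξ := by
    rw [Finset.sum_mul, ← Finset.sum_add_distrib]
    refine Finset.sum_congr rfl fun i _ => ?_
    rw [h ξ hξ i, mul_sub, sub_eq_add_neg, Finset.mul_sum, Finset.mul_sum, ← Finset.sum_neg_distrib]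
    congr 1
    refine Finset.sum_congr rfl fun k _ => ?_
    push_cast [PiLp.neg_apply]
    ring
  rw [h1, h0, zero_mul, add_zero]

/-- The transform of a gradient is parallel to `ξ`, that of a projected field is orthogonal to it.
This removes every pressure term from the weak formulation. -/
theorem pairing_grad_eq_zero {φ ψ : Fin n → 𝓢(Rn n, ℂ)} (h : IsHelmholtzProj φ ψ)
    (g : 𝓢(Rn n, ℂ)) : _root_.pairing (toDist (grad g)) ψ = 0 := by
  rcases n.eq_zero_or_pos with rfl | hn
  · simp [_root_.pairing]
  have : NeZero n := ⟨hn.ne'⟩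
  have : Nontrivial (Rn n) := inferInstance
  rw [pairing_toDist_eq_fourier, ← integral_zero (Rn n) ℂ]
  refine integral_congr_ae ?_
  filter_upwards [compl_mem_ae_iff.2 (measure_singleton (0 : Rn n))] with ξ hξ
  have hne : ((‖ξ‖ ^ 2 : ℝ) : ℂ) ≠ 0 := by
    rw [Complex.ofReal_ne_zero]
    exact pow_ne_zero _ (norm_ne_zero_iff.2 hξ)
  have h1 : ∑ i, (ξ i : ℂ) * 𝓕 (ψ i) ξ = 0 := by
    simp_rw [h ξ hξ, mul_sub, Finset.sum_sub_distrib, Finset.mul_sum]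
    rw [Finset.sum_comm, sub_eq_zero]
    refine Finset.sum_congr rfl fun k _ => ?_
    have h2 : ∑ i, (ξ i : ℂ) * (((ξ i * ξ k / ‖ξ‖ ^ 2 : ℝ) : ℂ) * 𝓕 (φ k) ξ) =
        ((∑ i, ξ i ^ 2 : ℝ) : ℂ) / ((‖ξ‖ ^ 2 : ℝ) : ℂ) * ((ξ k : ℂ) * 𝓕 (φ k) ξ) := by
      rw [Complex.ofReal_sum, Finset.sum_div, Finset.sum_mul]
      refine Finset.sum_congr rfl fun i _ => ?_
      push_cast; ring
    rw [h2, ← EuclideanSpace.real_norm_sq_eq, div_self hne, one_mul]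
  calc ∑ i, 𝓕 (grad g i) (-ξ) * 𝓕 (ψ i) ξ
      = -(2 * Real.pi * Complex.I * 𝓕 g (-ξ)) * ∑ i, (ξ i : ℂ) * 𝓕 (ψ i) ξ := by
        rw [Finset.mul_sum]
        refine Finset.sum_congr rfl fun i _ => ?_
        rw [grad, fourier_pd]
        push_cast [PiLp.neg_apply]
        ring
    _ = 0 := by rw [h1, mul_zero]

theorem pairing_vecLaplacian (F φ : Fin n → 𝓢(Rn n, ℂ)) :
    _root_.pairing (toDist (vecLaplacian F)) φ = _root_.pairing (toDist F) (fun i => Δ (φ i)) := by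
  rw [pairing_toDist, pairing_toDist]
  exact Finset.sum_congr rfl fun i _ => (integral_mul_laplacian_right_eq_left (F i) (φ i)).symm

theorem fieldDiv_vecLaplacian {F : Fin n → 𝓢(Rn n, ℂ)} (hF : fieldDiv F = 0) :
    fieldDiv (vecLaplacian F) = 0 := by
  apply fourier_ext; intro ξ
  have h := fourier_fieldDiv_eq_zero hF ξ
  simp only [fieldDiv, vecLaplacian, FourierTransform.fourier_sum, FourierTransform.fourier_zero,
    _root_.zero_apply, _root_.sum_apply, fourier_pd, fourier_laplacian]
  calc _ = (2 * Real.pi * Complex.I * -(4 * Real.pi ^ 2 * (‖ξ‖ ^ 2 : ℝ))) *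
        ∑ i, (ξ i : ℂ) * 𝓕 (F i) ξ := by
        rw [Finset.mul_sum]; exact Finset.sum_congr rfl fun i _ => by ring
    _ = 0 := by rw [h, mul_zero]

theorem pairing_matrixDiv (Q : Fin n → Fin n → 𝓢(Rn n, ℂ)) (ψ : Fin n → 𝓢(Rn n, ℂ)) :
    _root_.pairing (toDist (matrixDiv Q)) ψ = -∑ i, ∑ k, ∫ x, Q i k x * pd i (ψ k) x := by
  rw [pairing_toDist, Finset.sum_comm, ← Finset.sum_neg_distrib]
  refine Finset.sum_congr rfl fun k _ => ?_
  rw [← Finset.sum_neg_distrib]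
  simp only [matrixDiv, _root_.sum_apply, Finset.sum_mul]
  rw [integral_finsetSum _ fun i _ => integrable_mul _ _]
  refine Finset.sum_congr rfl fun i _ => ?_
  have h := integral_mul_lineDerivOp_right_eq_neg_left (μ := volume) (Q i k) (ψ k)
    (EuclideanSpace.single i (1 : ℝ))
  exact (neg_eq_iff_eq_neg.2 h).symm

theorem isDivFree_toDist {F : Fin n → 𝓢(Rn n, ℂ)} (hF : fieldDiv F = 0) :
    IsDivFree (toDist F) := by
  intro χ
  rw [pairing_toDist]
  have h : ∀ i, ∫ x, F i x * (∂_{EuclideanSpace.single i (1 : ℝ)} χ) x =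
      -∫ x, pd i (F i) x * χ x := fun i => integral_mul_lineDerivOp_right_eq_neg_left _ _ _
  simp_rw [h]
  rw [Finset.sum_neg_distrib, ← integral_finsetSum _ fun i _ => integrable_mul _ _, neg_eq_zero,
    ← integral_zero (Rn n) ℂ]
  congr 1; ext x
  rw [← Finset.sum_mul, ← _root_.sum_apply]
  have : (∑ i, pd i (F i)) = 0 := hF
  simp [this]

/-- The real vector field with components the real parts of `F`. -/
def reField (F : Fin n → 𝓢(Rn n, ℂ)) (x : Rn n) : Rn n := WithLp.toLp 2 (fun i => (F i x).re)

theorem represents_reField {F : Fin n → 𝓢(Rn n, ℂ)} (hF : ∀ i, IsRealFun (F i)) :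
    Represents (toDist F) (fun x => complexify (reField F x)) := by
  have : (fun x => complexify (reField F x)) = vecSchwartz F := by
    ext x i
    rw [vecSchwartz_apply]
    simp [complexify, reField, ← (hF i).eq_re x]
  rw [this]; exact represents_toDist F

theorem reField_mul {F : Fin n → 𝓢(Rn n, ℂ)} (hF : ∀ i, IsRealFun (F i)) (i k : Fin n) (x : Rn n) :
    ((reField F x i * reField F x k : ℝ) : ℂ) = F i x * F k x := by
  rw [(hF i).eq_re x, (hF k).eq_re x]
  simp [reField]

theorem convectionPairing_reField {F : Fin n → 𝓢(Rn n, ℂ)} (hF : ∀ i, IsRealFun (F i))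
    (ψ : Fin n → 𝓢(Rn n, ℂ)) :
    convectionPairing (reField F) ψ = -_root_.pairing (toDist (matrixDiv (tensor F F))) ψ := by
  rw [pairing_matrixDiv, neg_neg, convectionPairing]
  simp_rw [reField_mul hF]
  rfl

end

section

open SchwartzMap
variable {n : ℕ}

/-! ### Space-time fields assembled from windows in time -/

theorem memBesov_toDist (hn : 0 < n) {φ₀ : 𝓢(Rn n, ℂ)} (hφ₀ : IsLittlewoodPaley φ₀) {s : ℝ}
    {p q : ℝ≥0∞} {F : Fin n → 𝓢(Rn n, ℂ)} (h : besovNorm φ₀ s p q (toDist F) < ∞) :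
    MemBesov φ₀ s p q (toDist F) := ⟨h, hasSum_lpBlock_toDist hn hφ₀ F⟩

theorem MemBesov.add {φ₀ : 𝓢(Rn n, ℂ)} {s : ℝ} {p q : ℝ≥0∞} (hp : 1 ≤ p) (hq : 1 ≤ q)
    {S T : VecDistribution n} (hS : MemBesov φ₀ s p q S) (hT : MemBesov φ₀ s p q T) :
    MemBesov φ₀ s p q (S + T) :=
  ⟨(besovNorm_add_le hp hq φ₀ s S T).trans_lt (ENNReal.add_lt_top.2 ⟨hS.1, hT.1⟩),
    by simpa only [lpBlock_add] using hS.2.add hT.2⟩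

theorem ContinuousInBesov.add {φ₀ : 𝓢(Rn n, ℂ)} {I : Set ℝ} {s : ℝ} {p q : ℝ≥0∞} (hp : 1 ≤ p)
    (hq : 1 ≤ q) {F G : ℝ → VecDistribution n} (hF : ContinuousInBesov φ₀ I s p q F)
    (hG : ContinuousInBesov φ₀ I s p q G) :
    ContinuousInBesov φ₀ I s p q (fun t => F t + G t) := fun t ht => by
  refine ⟨(hF t ht).1.add hp hq (hG t ht).1, ?_⟩
  have h := (hF t ht).2.add (hG t ht).2
  rw [add_zero] at h
  refine tendsto_of_tendsto_of_tendsto_of_le_of_le tendsto_const_nhds h (fun _ => zero_le) ?_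
  intro τ
  have : F τ + G τ - (F t + G t) = (F τ - F t) + (G τ - G t) := by abel
  simp only [this]
  exact besovNorm_add_le hp hq φ₀ s _ _

theorem cheminLernerNorm_add_le {φ₀ : 𝓢(Rn n, ℂ)} {I : Set ℝ} {s : ℝ} {p q : ℝ≥0∞} (hp : 1 ≤ p)
    (hq : 1 ≤ q) (F G : ℝ → VecDistribution n) :
    cheminLernerNorm φ₀ I s p q (fun t => F t + G t) ≤
      cheminLernerNorm φ₀ I s p q F + cheminLernerNorm φ₀ I s p q G := by
  refine le_trans (lqNorm_mono fun j => ?_) (lqNorm_add_le hq _ _)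
  rw [← mul_add]
  gcongr
  refine le_trans (essSup_mono_ae (Eventually.of_forall fun t => ?_)) (ENNReal.essSup_add_le _ _)
  change distLpNorm p (lpBlock φ₀ j (F t + G t)) ≤ _
  rw [lpBlock_add]
  exact distLpNorm_add_le hp _ _

/-- A sequence of consecutive time intervals `(T m, T (m + 1))` of length at least one. -/
structure IsWindowSeq (T : ℕ → ℝ) : Prop where
  zero : T 0 = 0
  step : ∀ m, T m + 1 ≤ T (m + 1)

theorem IsWindowSeq.strictMono {T : ℕ → ℝ} (hT : IsWindowSeq T) : StrictMono T :=
  strictMono_nat_of_lt_succ fun m => by linarith [hT.step m]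

theorem IsWindowSeq.natCast_le {T : ℕ → ℝ} (hT : IsWindowSeq T) (m : ℕ) : (m : ℝ) ≤ T m := by
  induction m with
  | zero => simp [hT.zero]
  | succ m ih => push_cast; linarith [hT.step m]

/-- The open windows are disjoint, so at most one contains `t`. At a common end point none does, and
then `N` serves as well as any other index. -/
theorem IsWindowSeq.exists_isolated {T : ℕ → ℝ} (hT : IsWindowSeq T) {N : ℕ} {t : ℝ}
    (ht : T N ≤ t) : ∃ m, N ≤ m ∧ ∀ m', m' ≠ m → ¬(T m' < t ∧ t < T (m' + 1)) := by
  by_cases h : ∃ m, T m < t ∧ t < T (m + 1)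
  · obtain ⟨m, hm⟩ := h
    refine ⟨m, Nat.lt_succ_iff.1 (hT.strictMono.lt_iff_lt.1 (ht.trans_lt hm.2)), ?_⟩
    intro m' hne hm'
    have h1 := hT.strictMono.lt_iff_lt.1 (hm.1.trans hm'.2)
    have h2 := hT.strictMono.lt_iff_lt.1 (hm'.1.trans hm.2)
    omega
  · exact ⟨N, le_rfl, fun m' _ hm' => h ⟨m', hm'⟩⟩

/-- The functions `c m` live in the windows given by `T`. -/
def LivesIn (T : ℕ → ℝ) (c : ℕ → ℝ → ℝ) : Prop := ∀ m t, ¬(T m < t ∧ t < T (m + 1)) → c m t = 0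

/-- The sum `∑ₘ c m t • A m` over the windows. -/
def glue (c : ℕ → ℝ → ℝ) (A : ℕ → Fin n → 𝓢(Rn n, ℂ)) (t : ℝ) : Fin n → 𝓢(Rn n, ℂ) :=
  ∑ᶠ m, (c m t : ℂ) • A m

section Glue

variable {T : ℕ → ℝ} {c : ℕ → ℝ → ℝ} {A : ℕ → Fin n → 𝓢(Rn n, ℂ)}

theorem glue_eq_single (A : ℕ → Fin n → 𝓢(Rn n, ℂ)) {t : ℝ} {m : ℕ}
    (h : ∀ m', m' ≠ m → c m' t = 0) : glue c A t = (c m t : ℂ) • A m :=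
  finsum_eq_single _ m fun m' hm' => by rw [h m' hm']; simp

/-- Windows have length at least one, so window `m` opens no earlier than time `m`. The sum is
therefore finite, locally uniformly in time, and it can be differentiated and estimated term by
term. -/
theorem glue_eq_sum (hT : IsWindowSeq T) (hc : LivesIn T c) (A : ℕ → Fin n → 𝓢(Rn n, ℂ)) {t : ℝ}
    {N : ℕ} (ht : t < N) : glue c A t = ∑ m ∈ Finset.range N, (c m t : ℂ) • A m := by
  refine finsum_eq_sum_of_support_subset _ fun m hm => ?_
  rw [Finset.coe_range, Set.mem_Iio]
  by_contra hle
  have h1 : c m t = 0 := hc m t fun h => by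
    have h2 := hT.natCast_le m
    have h3 : (N : ℝ) ≤ m := by exact_mod_cast not_lt.1 hle
    linarith [h.1]
  exact hm (by simp [h1])

theorem toDist_zero : toDist (0 : Fin n → 𝓢(Rn n, ℂ)) = 0 := by
  have := toDist_sub (0 : Fin n → 𝓢(Rn n, ℂ)) 0
  simpa using this

theorem toDist_sum {ι : Type*} (s : Finset ι) (F : ι → Fin n → 𝓢(Rn n, ℂ)) :
    toDist (∑ a ∈ s, F a) = ∑ a ∈ s, toDist (F a) := by
  classical
  induction s using Finset.induction_on with
  | empty => simp [toDist_zero]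
  | insert a s ha ih => rw [Finset.sum_insert ha, Finset.sum_insert ha, toDist_add, ih]

theorem continuousInBesov_glue (hn : 0 < n) {φ₀ : 𝓢(Rn n, ℂ)} (hφ₀ : IsLittlewoodPaley φ₀)
    {s : ℝ} {p q : ℝ≥0∞} (hp : 1 ≤ p) (hq : 1 ≤ q) (hT : IsWindowSeq T) (hc : LivesIn T c)
    (hcont : ∀ m, Continuous (c m)) (hA : ∀ m, besovNorm φ₀ s p q (toDist (A m)) < ∞) (I : Set ℝ) :
    ContinuousInBesov φ₀ I s p q (fun t => toDist (glue c A t)) := by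
  intro t _
  obtain ⟨N, hN⟩ := exists_nat_gt t
  constructor
  · apply memBesov_toDist hn hφ₀
    rw [glue_eq_sum hT hc A hN, toDist_sum]
    refine (besovNorm_sum_le hp hq φ₀ s _ _).trans_lt (ENNReal.sum_lt_top.2 fun m _ => ?_)
    rw [toDist_smul]
    exact (besovNorm_smul_le hq φ₀ s _ _).trans_lt (ENNReal.mul_lt_top (by simp) (hA m))
  · have h1 : Tendsto (fun τ => ∑ m ∈ Finset.range N, ‖((c m τ - c m t : ℝ) : ℂ)‖ₑ *
        besovNorm φ₀ s p q (toDist (A m))) (𝓝[I] t) (𝓝 0) := by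
      have h2 : ∀ m ∈ Finset.range N, Tendsto (fun τ => ‖((c m τ - c m t : ℝ) : ℂ)‖ₑ *
          besovNorm φ₀ s p q (toDist (A m))) (𝓝[I] t) (𝓝 0) := fun m _ => by
        have h3 : Tendsto (fun τ => ‖((c m τ - c m t : ℝ) : ℂ)‖ₑ) (𝓝[I] t) (𝓝 0) := by
          have h4 : Continuous fun τ => ‖((c m τ - c m t : ℝ) : ℂ)‖ₑ := by
            have := hcont m
            fun_prop
          have := (h4.tendsto t).mono_left (nhdsWithin_le_nhds (s := I))
          simpa using this
        have := ENNReal.Tendsto.mul_const h3 (Or.inr (hA m).ne)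
        simpa using this
      simpa using tendsto_finsetSum _ h2
    refine tendsto_of_tendsto_of_tendsto_of_le_of_le' tendsto_const_nhds h1
      (Eventually.of_forall fun _ => zero_le) ?_
    have h5 : ∀ᶠ τ in 𝓝[I] t, τ < (N : ℝ) := nhdsWithin_le_nhds (eventually_lt_nhds hN)
    filter_upwards [h5] with τ hτ
    rw [← toDist_sub, glue_eq_sum hT hc A hN, glue_eq_sum hT hc A hτ, ← Finset.sum_sub_distrib,
      toDist_sum]
    refine (besovNorm_sum_le hp hq φ₀ s _ _).trans (Finset.sum_le_sum fun m _ => ?_)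
    rw [← sub_smul, toDist_smul, ← Complex.ofReal_sub]
    exact besovNorm_smul_le hq φ₀ s _ _

/-- The index depends on the time alone and not on the coefficients or fields; thus the products and
sums of glued fields can all be computed with one index. -/
theorem exists_glue_eq_single (hT : IsWindowSeq T) {N : ℕ} {t : ℝ} (ht : T N ≤ t) :
    ∃ m, N ≤ m ∧ ∀ (c : ℕ → ℝ → ℝ) (A : ℕ → Fin n → 𝓢(Rn n, ℂ)), LivesIn T c →
      glue c A t = (c m t : ℂ) • A m := by
  obtain ⟨m, hm, h⟩ := hT.exists_isolated ht
  exact ⟨m, hm, fun c A hc => glue_eq_single A fun m' hm' => hc m' t (h m' hm')⟩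

theorem exists_glue_eq_single_of_nonneg (hT : IsWindowSeq T) {t : ℝ} (ht : 0 ≤ t) :
    ∃ m, ∀ (c : ℕ → ℝ → ℝ) (A : ℕ → Fin n → 𝓢(Rn n, ℂ)), LivesIn T c →
      glue c A t = (c m t : ℂ) • A m := by
  obtain ⟨m, -, h⟩ := exists_glue_eq_single (n := n) hT (N := 0) (hT.zero.trans_le ht)
  exact ⟨m, h⟩

/-- The supremum in time stands inside the `ℓ^q` norm, and different windows may dominate different
blocks. The supremum over windows is therefore bounded by their sum, which calls for summable sizes.
-/
theorem cheminLernerNorm_glue_le {φ₀ : 𝓢(Rn n, ℂ)} {s : ℝ} {p q : ℝ≥0∞} (hq : 1 ≤ q)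
    (hT : IsWindowSeq T) (hc : LivesIn T c) {I : Set ℝ} (hI : MeasurableSet I)
    (hI0 : ∀ t ∈ I, 0 ≤ t) {M : ℕ → ℝ≥0∞} (hM : ∀ m, ∀ t ∈ I, ‖(c m t : ℂ)‖ₑ ≤ M m) :
    cheminLernerNorm φ₀ I s p q (fun t => toDist (glue c A t)) ≤
      ∑' m, M m * besovNorm φ₀ s p q (toDist (A m)) := by
  have h1 : ∀ j : ℤ, essSup (fun t => distLpNorm p (lpBlock φ₀ j (toDist (glue c A t))))
      (volume.restrict I) ≤ ∑' m, M m * distLpNorm p (lpBlock φ₀ j (toDist (A m))) := by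
    intro j
    refine essSup_le_of_ae_le _ ?_
    filter_upwards [ae_restrict_mem hI] with t ht
    obtain ⟨m, hm⟩ := exists_glue_eq_single_of_nonneg (n := n) hT (hI0 t ht)
    rw [hm c A hc, toDist_smul, lpBlock_smul]
    refine (distLpNorm_smul_le p _ _).trans (le_trans ?_ (ENNReal.le_tsum m))
    gcongr
    exact hM m t ht
  calc _ ≤ lqNorm q (fun j => ∑' m, M m * (ENNReal.ofReal ((2 : ℝ) ^ (s * (j : ℝ))) *
        distLpNorm p (lpBlock φ₀ j (toDist (A m))))) := by
        refine lqNorm_mono fun j => ?_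
        simp_rw [mul_left_comm (M _)]
        rw [ENNReal.tsum_mul_left]
        gcongr
        exact h1 j
    _ ≤ _ := (lqNorm_tsum_le hq _).trans
        (ENNReal.tsum_le_tsum fun m => (lqNorm_const_mul hq _ _).le)

/-- If all windows carry the same field, infinitely many of them cost nothing. This puts the
velocity into the Chemin–Lerner space on the whole half line when `u₂` is close to a fixed field. -/
theorem cheminLernerNorm_glue_const_le {φ₀ : 𝓢(Rn n, ℂ)} {s : ℝ} {p q : ℝ≥0∞}
    (hT : IsWindowSeq T) (hc : LivesIn T c) {I : Set ℝ} (hI : MeasurableSet I)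
    (hI0 : ∀ t ∈ I, 0 ≤ t) (hM : ∀ m, ∀ t ∈ I, ‖(c m t : ℂ)‖ₑ ≤ 1) (V : Fin n → 𝓢(Rn n, ℂ)) :
    cheminLernerNorm φ₀ I s p q (fun t => toDist (glue c (fun _ => V) t)) ≤
      besovNorm φ₀ s p q (toDist V) := by
  refine lqNorm_mono fun j => ?_
  gcongr
  refine essSup_le_of_ae_le _ ?_
  filter_upwards [ae_restrict_mem hI] with t ht
  obtain ⟨m, hm⟩ := exists_glue_eq_single_of_nonneg (n := n) hT (hI0 t ht)
  rw [hm c _ hc, toDist_smul, lpBlock_smul]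
  refine (distLpNorm_smul_le p _ _).trans ?_
  calc _ ≤ 1 * distLpNorm p (lpBlock φ₀ j (toDist V)) := by gcongr; exact hM m t ht
    _ = _ := one_mul _

/-- At a fixed time a single window is active, so the bound is the largest contribution of the
windows from `N` on and no sum is needed. -/
theorem besovNorm_glue_le {φ₀ : 𝓢(Rn n, ℂ)} {s : ℝ} {p q : ℝ≥0∞} (hq : 1 ≤ q)
    (hT : IsWindowSeq T) (hc : LivesIn T c) {M : ℕ → ℝ≥0∞} (hM : ∀ m t, ‖(c m t : ℂ)‖ₑ ≤ M m)
    {K : ℝ≥0∞} {N : ℕ} (hK : ∀ m, N ≤ m → M m * besovNorm φ₀ s p q (toDist (A m)) ≤ K)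
    {t : ℝ} (ht : T N ≤ t) : besovNorm φ₀ s p q (toDist (glue c A t)) ≤ K := by
  obtain ⟨m, hNm, hm⟩ := exists_glue_eq_single (n := n) hT ht
  rw [hm c A hc, toDist_smul]
  refine (besovNorm_smul_le hq φ₀ s _ _).trans (le_trans ?_ (hK m hNm))
  gcongr
  exact hM m t

theorem tendsto_besovNorm_glue {φ₀ : 𝓢(Rn n, ℂ)} {s : ℝ} {p q : ℝ≥0∞} (hq : 1 ≤ q)
    (hT : IsWindowSeq T) (hc : LivesIn T c) {M : ℕ → ℝ≥0∞} (hM : ∀ m t, ‖(c m t : ℂ)‖ₑ ≤ M m)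
    {b : ℕ → ℝ≥0∞} (hb : Tendsto b atTop (𝓝 0))
    (hK : ∀ m, M m * besovNorm φ₀ s p q (toDist (A m)) ≤ b m) :
    Tendsto (fun t => besovNorm φ₀ s p q (toDist (glue c A t))) atTop (𝓝 0) := by
  rw [ENNReal.tendsto_nhds_zero] at hb ⊢
  intro ε hε
  obtain ⟨N, hN⟩ := eventually_atTop.1 (hb ε hε)
  filter_upwards [eventually_ge_atTop (T N)] with t ht
  exact besovNorm_glue_le hq hT hc hM (fun m hm => (hK m).trans (hN m hm)) ht

theorem pairing_glue (hT : IsWindowSeq T) (hc : LivesIn T c) (A : ℕ → Fin n → 𝓢(Rn n, ℂ))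
    (φ : Fin n → 𝓢(Rn n, ℂ)) {t : ℝ} {N : ℕ} (ht : t < N) :
    _root_.pairing (toDist (glue c A t)) φ =
      ∑ m ∈ Finset.range N, (c m t : ℂ) * _root_.pairing (toDist (A m)) φ := by
  rw [glue_eq_sum hT hc A ht, toDist_sum]
  simp only [toDist_smul]
  induction N with
  | zero => simp [_root_.pairing]
  | succ N ih => 
    clear ih
    generalize Finset.range (N + 1) = s
    classical
    induction s using Finset.induction_on with
    | empty => simp [_root_.pairing]
    | insert a s ha ih =>
      rw [Finset.sum_insert ha, Finset.sum_insert ha, pairing_add_left, pairing_smul_left, ih]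

theorem continuous_pairing_glue (hT : IsWindowSeq T) (hc : LivesIn T c)
    (hcont : ∀ m, Continuous (c m)) (A : ℕ → Fin n → 𝓢(Rn n, ℂ)) (φ : Fin n → 𝓢(Rn n, ℂ)) :
    Continuous (fun t => _root_.pairing (toDist (glue c A t)) φ) := by
  rw [continuous_iff_continuousAt]
  intro t
  obtain ⟨N, hN⟩ := exists_nat_gt t
  have h : ∀ᶠ τ in 𝓝 t, ∑ m ∈ Finset.range N, (c m τ : ℂ) * _root_.pairing (toDist (A m)) φ =
      _root_.pairing (toDist (glue c A τ)) φ := by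
    filter_upwards [eventually_lt_nhds hN] with τ hτ
    exact (pairing_glue hT hc A φ hτ).symm
  refine ContinuousAt.congr (Continuous.continuousAt ?_) h
  fun_prop

theorem hasDerivAt_pairing_glue (hT : IsWindowSeq T) (hc : LivesIn T c) {c' : ℕ → ℝ → ℝ}
    (hc' : LivesIn T c') (hd : ∀ m t, HasDerivAt (c m) (c' m t) t)
    (A : ℕ → Fin n → 𝓢(Rn n, ℂ)) (φ : Fin n → 𝓢(Rn n, ℂ)) (t : ℝ) :
    HasDerivAt (fun t => _root_.pairing (toDist (glue c A t)) φ)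
      (_root_.pairing (toDist (glue c' A t)) φ) t := by
  obtain ⟨N, hN⟩ := exists_nat_gt t
  have h : ∀ᶠ τ in 𝓝 t, _root_.pairing (toDist (glue c A τ)) φ =
      ∑ m ∈ Finset.range N, (c m τ : ℂ) * _root_.pairing (toDist (A m)) φ := by
    filter_upwards [eventually_lt_nhds hN] with τ hτ
    exact pairing_glue hT hc A φ hτ
  rw [pairing_glue hT hc' A φ hN]
  refine HasDerivAt.congr_of_eventuallyEq ?_ h
  exact HasDerivAt.fun_sum fun m _ => ((hd m t).ofReal_comp).mul_const _

end Glue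

end

section

open SchwartzMap
variable {n : ℕ}

/-! ### Reduction to a stationary problem -/

theorem toDist_neg (F : Fin n → 𝓢(Rn n, ℂ)) : toDist (-F) = -toDist F := by
  have := toDist_sub 0 F
  simpa [toDist_zero] using this

/-- The fields `u₁`, `u₂` are solenoidal, and the flow `θ u₁ + θ² u₂` with a constant `θ` is
driven, up to a pressure, by the force `θ f₁ + θ² f₂ + θ³ f₃ + θ⁴ f₄`. -/
structure IsForcedPair (u₁ u₂ f₁ f₂ f₃ f₄ : Fin n → 𝓢(Rn n, ℂ)) : Prop where
  real_u₁ : ∀ i, IsRealFun (u₁ i)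
  real_u₂ : ∀ i, IsRealFun (u₂ i)
  real_f₁ : ∀ i, IsRealFun (f₁ i)
  real_f₂ : ∀ i, IsRealFun (f₂ i)
  real_f₃ : ∀ i, IsRealFun (f₃ i)
  real_f₄ : ∀ i, IsRealFun (f₄ i)
  div_u₁ : fieldDiv u₁ = 0
  div_u₂ : fieldDiv u₂ = 0
  spectrum_u₁ : ∀ i, AnnularSpectrum (u₁ i)
  spectrum_u₂ : ∀ i, AnnularSpectrum (u₂ i)
  f₁_eq : f₁ = -vecLaplacian u₁
  f₂_eq : ∃ π, f₂ = -vecLaplacian u₂ + matrixDiv (tensor u₁ u₁) + grad π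
  f₃_eq : ∃ π, f₃ = matrixDiv (tensor u₁ u₂) + matrixDiv (tensor u₂ u₁) + grad π
  f₄_eq : ∃ π, f₄ = matrixDiv (tensor u₂ u₂) + grad π

theorem besovNorm_toDist_lt_top {φ₀ : 𝓢(Rn n, ℂ)} (h : IsLittlewoodPaley φ₀) (s : ℝ)
    {p q : ℝ≥0∞} (hp : 1 ≤ p) (hq : 1 ≤ q) {F : Fin n → 𝓢(Rn n, ℂ)}
    (hF : ∀ i, AnnularSpectrum (F i)) : besovNorm φ₀ s p q (toDist F) < ∞ :=
  (besovNorm_toDist_le hp hq φ₀ s F).trans_lt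
    (ENNReal.sum_lt_top.2 fun i _ => (hF i).scalarBesov_lt_top h s hq)

theorem matrixDiv_tensor_combination (a b : ℂ) (F G : Fin n → 𝓢(Rn n, ℂ)) :
    matrixDiv (tensor (a • F + b • G) (a • F + b • G)) = a ^ 2 • matrixDiv (tensor F F) +
      (a * b) • (matrixDiv (tensor F G) + matrixDiv (tensor G F)) +
      b ^ 2 • matrixDiv (tensor G G) := by
  funext k
  simp only [matrixDiv, tensor, Pi.add_apply, Pi.smul_apply, Finset.smul_sum, smul_add,
    ← Finset.sum_add_distrib, ← pd_smul, ← pd_add]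
  refine Finset.sum_congr rfl fun i _ => ?_
  congr 1
  simp only [add_mul, mul_add, smul_mul_assoc, mul_smul_comm]
  module

section Pairings

variable {u₁ u₂ f₁ f₂ f₃ f₄ φ ψ : Fin n → 𝓢(Rn n, ℂ)}

theorem pairing_neg_vecLaplacian {F : Fin n → 𝓢(Rn n, ℂ)} (hF : fieldDiv F = 0)
    (h : IsHelmholtzProj φ ψ) : _root_.pairing (toDist (-vecLaplacian F)) ψ =
      -_root_.pairing (toDist F) (fun i => Δ (φ i)) := by
  rw [← neg_one_smul ℂ, toDist_smul, pairing_smul_left,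
    pairing_helmholtz (fieldDiv_vecLaplacian hF) h, pairing_vecLaplacian, neg_one_mul]

theorem IsForcedPair.pairing_f₁ (hF : IsForcedPair u₁ u₂ f₁ f₂ f₃ f₄) (h : IsHelmholtzProj φ ψ) :
    _root_.pairing (toDist f₁) ψ = -_root_.pairing (toDist u₁) (fun i => Δ (φ i)) := by
  rw [hF.f₁_eq, pairing_neg_vecLaplacian hF.div_u₁ h]

theorem IsForcedPair.pairing_f₂ (hF : IsForcedPair u₁ u₂ f₁ f₂ f₃ f₄) (h : IsHelmholtzProj φ ψ) :
    _root_.pairing (toDist f₂) ψ = -_root_.pairing (toDist u₂) (fun i => Δ (φ i)) +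
      _root_.pairing (toDist (matrixDiv (tensor u₁ u₁))) ψ := by
  obtain ⟨π, hπ⟩ := hF.f₂_eq
  rw [hπ, toDist_add, toDist_add, pairing_add_left, pairing_add_left, pairing_grad_eq_zero h,
    pairing_neg_vecLaplacian hF.div_u₂ h, add_zero]

theorem IsForcedPair.pairing_f₃ (hF : IsForcedPair u₁ u₂ f₁ f₂ f₃ f₄) (h : IsHelmholtzProj φ ψ) :
    _root_.pairing (toDist f₃) ψ =
      _root_.pairing (toDist (matrixDiv (tensor u₁ u₂) + matrixDiv (tensor u₂ u₁))) ψ := by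
  obtain ⟨π, hπ⟩ := hF.f₃_eq
  rw [hπ, toDist_add, pairing_add_left, pairing_grad_eq_zero h, add_zero]

theorem IsForcedPair.pairing_f₄ (hF : IsForcedPair u₁ u₂ f₁ f₂ f₃ f₄) (h : IsHelmholtzProj φ ψ) :
    _root_.pairing (toDist f₄) ψ = _root_.pairing (toDist (matrixDiv (tensor u₂ u₂))) ψ := by
  obtain ⟨π, hπ⟩ := hF.f₄_eq
  rw [hπ, toDist_add, pairing_add_left, pairing_grad_eq_zero h, add_zero]

end Pairings

theorem integrable_mul_three (f g χ : 𝓢(Rn n, ℂ)) : Integrable (fun x => f x * g x * χ x) :=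
  (f * g * χ).integrable

theorem LivesIn.pow {T : ℕ → ℝ} {c : ℕ → ℝ → ℝ} (hc : LivesIn T c) {k : ℕ} (hk : k ≠ 0) :
    LivesIn T (fun m t => c m t ^ k) := fun m t h => by simp [hc m t h, hk]

theorem fieldDiv_combination (a b : ℂ) {F G : Fin n → 𝓢(Rn n, ℂ)} (hF : fieldDiv F = 0)
    (hG : fieldDiv G = 0) : fieldDiv (a • F + b • G) = 0 := by
  have h : fieldDiv (a • F + b • G) = a • fieldDiv F + b • fieldDiv G := by
    simp only [fieldDiv, Pi.add_apply, Pi.smul_apply, pd_add, pd_smul, Finset.sum_add_distrib,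
      Finset.smul_sum]
  rw [h, hF, hG]; simp

/-- At each time the flow is `θ u₁ + θ² u₂` for one window. The powers of `θ` in `-Δu` and `div (u ⊗
u)` match `f₁, …, f₄` modulo gradients. What is left of the force is the exact time derivative `θ'
u₁ + 2 θ θ' u₂`, and integrating it in time gives the weak equation. -/
theorem isNSSolution_glue {T : ℕ → ℝ} {θ θ' : ℕ → ℝ → ℝ} (hT : IsWindowSeq T)
    (hθ : LivesIn T θ) (hθ' : LivesIn T θ') (hd : ∀ m t, HasDerivAt (θ m) (θ' m t) t)
    (hcont : ∀ m, Continuous (θ' m)) {u₁ u₂ f₁ f₂ f₃ f₄ : ℕ → Fin n → 𝓢(Rn n, ℂ)}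
    (hF : ∀ m, IsForcedPair (u₁ m) (u₂ m) (f₁ m) (f₂ m) (f₃ m) (f₄ m)) :
    IsNSSolution 0
      (fun t => toDist (glue θ f₁ t + glue (fun m t => θ m t ^ 2) f₂ t +
        glue (fun m t => θ m t ^ 3) f₃ t + glue (fun m t => θ m t ^ 4) f₄ t +
        (glue θ' u₁ t + glue (fun m t => 2 * θ m t * θ' m t) u₂ t)))
      (fun t => toDist (glue θ u₁ t + glue (fun m t => θ m t ^ 2) u₂ t)) := by
  have hθc : ∀ m, Continuous (θ m) := fun m =>
    continuous_iff_continuousAt.2 fun t => (hd m t).continuousAt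
  have h2 : LivesIn T (fun m t => 2 * θ m t * θ' m t) := fun m t h => by simp [hθ m t h]
  have hW : ∀ t, 0 ≤ t → ∃ m, glue θ u₁ t + glue (fun m t => θ m t ^ 2) u₂ t =
      (θ m t : ℂ) • u₁ m + ((θ m t) ^ 2 : ℂ) • u₂ m ∧ 
      ∀ (c : ℕ → ℝ → ℝ) (A : ℕ → Fin n → 𝓢(Rn n, ℂ)), LivesIn T c →
      glue c A t = (c m t : ℂ) • A m := fun t ht => by
    obtain ⟨m, hm⟩ := exists_glue_eq_single_of_nonneg (n := n) hT ht
    refine ⟨m, ?_, hm⟩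
    rw [hm _ _ hθ, hm _ _ (hθ.pow two_ne_zero)]; push_cast; rfl
  have hreal : ∀ t, 0 ≤ t → ∀ i, IsRealFun
      ((glue θ u₁ t + glue (fun m t => θ m t ^ 2) u₂ t) i) := fun t ht i => by
    obtain ⟨m, hm, -⟩ := hW t ht
    rw [hm]
    have := (((hF m).real_u₂ i).smul (θ m t ^ 2))
    push_cast at this
    exact (((hF m).real_u₁ i).smul _).add this
  -- No window opens before time zero, so all coefficients vanish there; this is the zero initial
  -- datum.
  have h0 : ∀ m, θ m 0 = 0 := fun m => hθ m 0 fun h => by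
    have := hT.natCast_le m
    have h3 : (0 : ℝ) ≤ m := by positivity
    linarith [h.1]
  refine ⟨?_, fun t ht => ?_, fun t => reField (glue θ u₁ t + glue (fun m t => θ m t ^ 2) u₂ t),
    fun t ht => represents_reField (hreal t ht), fun t ht i k χ => ?_, fun φ ψ hφψ t ht => ?_⟩
  · obtain ⟨m, hm, -⟩ := hW 0 le_rfl
    simp only [hm, h0]
    simp [toDist_zero]
  · obtain ⟨m, hm, -⟩ := hW t ht
    simp only [hm]
    exact isDivFree_toDist (fieldDiv_combination _ _ (hF m).div_u₁ (hF m).div_u₂)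
  · simp only [reField_mul (hreal t ht)]
    exact integrable_mul_three _ _ _
  have cg : ∀ (c : ℕ → ℝ → ℝ) (A : ℕ → Fin n → 𝓢(Rn n, ℂ)) (φ : Fin n → 𝓢(Rn n, ℂ)),
      LivesIn T c → (∀ m, Continuous (c m)) →
      Continuous (fun t => _root_.pairing (toDist (glue c A t)) φ) :=
    fun c A φ hc hcc => continuous_pairing_glue hT hc hcc A φ
  have hc1 : Continuous fun τ => _root_.pairing
      (toDist (glue θ u₁ τ + glue (fun m t => θ m t ^ 2) u₂ τ)) (fun i => Δ (φ i)) := by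
    simp only [toDist_add, pairing_add_left]
    exact (cg _ _ _ hθ hθc).add (cg _ _ _ (hθ.pow two_ne_zero) fun m => (hθc m).pow 2)
  have hc2 : Continuous fun τ => -_root_.pairing (toDist
      (glue (fun m t => θ m t ^ 2) (fun m => matrixDiv (tensor (u₁ m) (u₁ m))) τ +
       glue (fun m t => θ m t ^ 3) (fun m => matrixDiv (tensor (u₁ m) (u₂ m)) +
        matrixDiv (tensor (u₂ m) (u₁ m))) τ +
       glue (fun m t => θ m t ^ 4) (fun m => matrixDiv (tensor (u₂ m) (u₂ m))) τ)) ψ := by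
    simp only [toDist_add, pairing_add_left]
    exact (((cg _ _ _ (hθ.pow two_ne_zero) fun m => (hθc m).pow 2).add
      (cg _ _ _ (hθ.pow three_ne_zero) fun m => (hθc m).pow 3)).add
      (cg _ _ _ (hθ.pow four_ne_zero) fun m => (hθc m).pow 4)).neg
  have hc3 : Continuous fun τ => _root_.pairing (toDist (glue θ f₁ τ +
        glue (fun m t => θ m t ^ 2) f₂ τ +
        glue (fun m t => θ m t ^ 3) f₃ τ + glue (fun m t => θ m t ^ 4) f₄ τ +
        (glue θ' u₁ τ + glue (fun m t => 2 * θ m t * θ' m t) u₂ τ))) ψ := by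
    simp only [toDist_add, pairing_add_left]
    exact ((((cg _ _ _ hθ hθc).add
      (cg _ _ _ (hθ.pow two_ne_zero) fun m => (hθc m).pow 2)).add
      (cg _ _ _ (hθ.pow three_ne_zero) fun m => (hθc m).pow 3)).add
      (cg _ _ _ (hθ.pow four_ne_zero) fun m => (hθc m).pow 4)).add ((cg _ _ _ hθ' hcont).add
      (cg _ _ _ h2 fun m => (continuous_const.mul (hθc m)).mul (hcont m)))
  have hconv : ∀ τ, 0 ≤ τ →
      convectionPairing (reField (glue θ u₁ τ + glue (fun m t => θ m t ^ 2) u₂ τ)) ψ =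
      -_root_.pairing (toDist
      (glue (fun m t => θ m t ^ 2) (fun m => matrixDiv (tensor (u₁ m) (u₁ m))) τ +
       glue (fun m t => θ m t ^ 3) (fun m => matrixDiv (tensor (u₁ m) (u₂ m)) +
        matrixDiv (tensor (u₂ m) (u₁ m))) τ +
       glue (fun m t => θ m t ^ 4) (fun m => matrixDiv (tensor (u₂ m) (u₂ m))) τ)) ψ := by
    intro τ hτ
    rw [convectionPairing_reField (hreal τ hτ)]
    obtain ⟨m, hm, hg⟩ := hW τ hτ
    rw [hm, matrixDiv_tensor_combination, hg _ _ (hθ.pow two_ne_zero),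
      hg _ _ (hθ.pow three_ne_zero), hg _ _ (hθ.pow four_ne_zero)]
    push_cast
    rw [← pow_mul, ← pow_succ']
  -- Diffusion and convection cancel against the first four terms of the force. Projecting the
  -- remaining terms changes nothing, as `u₁` and `u₂` are solenoidal.
  have hid : ∀ τ, 0 ≤ τ → _root_.pairing
      (toDist (glue θ u₁ τ + glue (fun m t => θ m t ^ 2) u₂ τ)) (fun i => Δ (φ i)) +
      convectionPairing (reField (glue θ u₁ τ + glue (fun m t => θ m t ^ 2) u₂ τ)) ψ +
      _root_.pairing (toDist (glue θ f₁ τ +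
        glue (fun m t => θ m t ^ 2) f₂ τ +
        glue (fun m t => θ m t ^ 3) f₃ τ + glue (fun m t => θ m t ^ 4) f₄ τ +
        (glue θ' u₁ τ + glue (fun m t => 2 * θ m t * θ' m t) u₂ τ))) ψ =
      _root_.pairing (toDist (glue θ' u₁ τ)) φ +
        _root_.pairing (toDist (glue (fun m t => 2 * θ m t * θ' m t) u₂ τ)) φ := by
    intro τ hτ
    rw [hconv τ hτ]
    obtain ⟨m, -, hg⟩ := hW τ hτ
    simp only [hg _ _ hθ, hg _ _ (hθ.pow two_ne_zero), hg _ _ (hθ.pow three_ne_zero),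
      hg _ _ (hθ.pow four_ne_zero), hg _ _ hθ', hg _ _ h2]
    simp only [toDist_add, toDist_smul, pairing_add_left, pairing_smul_left]
    rw [(hF m).pairing_f₁ hφψ, (hF m).pairing_f₂ hφψ, (hF m).pairing_f₃ hφψ,
      (hF m).pairing_f₄ hφψ, pairing_helmholtz (hF m).div_u₁ hφψ,
      pairing_helmholtz (hF m).div_u₂ hφψ]
    simp only [toDist_add, pairing_add_left]
    ring
  have hsub : ∀ τ ∈ Set.uIcc 0 t, 0 ≤ τ := fun τ hτ => by
    rw [Set.uIcc_of_le ht] at hτ; exact hτ.1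
  have hsub' : ∀ τ ∈ Set.uIoc 0 t, 0 ≤ τ := fun τ hτ => hsub τ (Set.uIoc_subset_uIcc hτ)
  refine ⟨hc1.intervalIntegrable _ _, ?_, hc3.intervalIntegrable _ _, ?_⟩
  · exact (hc2.intervalIntegrable 0 t).congr fun τ hτ => (hconv τ (hsub' τ hτ)).symm
  · rw [intervalIntegral.integral_congr fun τ hτ => hid τ (hsub τ hτ),
      intervalIntegral.integral_eq_sub_of_hasDerivAt
        (f := fun t => _root_.pairing (toDist (glue θ u₁ t)) φ +
          _root_.pairing (toDist (glue (fun m t => θ m t ^ 2) u₂ t)) φ)]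
    · obtain ⟨m, hm, hg⟩ := hW 0 le_rfl
      simp only [hg _ _ hθ, hg _ _ (hθ.pow two_ne_zero), h0]
      simp [toDist_zero, toDist_add, pairing_add_left]
      simp [_root_.pairing]
    · intro τ _
      refine (hasDerivAt_pairing_glue hT hθ hθ' hd u₁ φ τ).add
        (hasDerivAt_pairing_glue hT (hθ.pow two_ne_zero) h2 (fun m t => ?_) u₂ φ τ)
      have := (hd m t).fun_pow 2
      simpa using this
    · exact ((cg _ _ _ hθ' hcont).add (cg _ _ _ h2 fun m =>
        (continuous_const.mul (hθc m)).mul (hcont m))).intervalIntegrable _ _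

end

/-! ### Stationary pairs and slow profiles in time. -/

section

open SchwartzMap
variable {n : ℕ}

/-- There are stationary pairs of fields with arbitrarily small forces and bounded, but not small,
velocity. -/
def HasStaticPairs (n : ℕ) (p q : ℝ≥0∞) (φ₀ : 𝓢(Rn n, ℂ)) : Prop :=
  ∃ c₀ : ℝ, 0 < c₀ ∧ ∃ C₀ : ℝ≥0∞, C₀ ≠ ∞ ∧ ∃ V : Fin n → 𝓢(Rn n, ℂ),
    (∀ i, AnnularSpectrum (V i)) ∧ ∀ δ : ℝ, 0 < δ → ∃ u₁ u₂ f₁ f₂ f₃ f₄ : Fin n → 𝓢(Rn n, ℂ),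
      IsForcedPair u₁ u₂ f₁ f₂ f₃ f₄ ∧
      besovNorm φ₀ (overExponent n p - 3) p q (toDist f₁) ≤ ENNReal.ofReal δ ∧
      besovNorm φ₀ (overExponent n p - 3) p q (toDist f₂) ≤ ENNReal.ofReal δ ∧
      besovNorm φ₀ (overExponent n p - 3) p q (toDist f₃) ≤ ENNReal.ofReal δ ∧
      besovNorm φ₀ (overExponent n p - 3) p q (toDist f₄) ≤ ENNReal.ofReal δ ∧
      besovNorm φ₀ (overExponent n p - 1) p q (toDist u₁) ≤ ENNReal.ofReal δ ∧
      besovNorm φ₀ (overExponent n p - 1) p q (toDist u₂) ≤ C₀ ∧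
      ENNReal.ofReal c₀ ≤ besovNorm φ₀ (overExponent n p - 1) p q (toDist (u₁ + u₂)) ∧
      ((3 ≤ n ∨ 2 < p) →
        besovNorm φ₀ (overExponent n p - 1) p q (toDist (u₂ - V)) ≤ ENNReal.ofReal δ)

/-- Profiles in time, with slowly varying bumps in prescribed long windows. -/
theorem exists_windows (B : ℕ → ℝ) (hB : ∀ m, 0 < B m) :
    ∃ (T : ℕ → ℝ) (θ θ' : ℕ → ℝ → ℝ), IsWindowSeq T ∧ LivesIn T θ ∧ LivesIn T θ' ∧
      (∀ m t, HasDerivAt (θ m) (θ' m t) t) ∧ (∀ m, Continuous (θ' m)) ∧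
      (∀ m t, |θ m t| ≤ 1) ∧ (∀ m t, |θ' m t| ≤ B m) ∧ ∀ m, ∃ t, T m ≤ t ∧ θ m t = 1 := by
  -- The bump is centred at `1 / 2` with outer radius `1 / 4`, so after rescaling it and its
  -- derivative vanish near both ends of the window.
  let b : ContDiffBump (1 / 2 : ℝ) := ⟨1 / 8, 1 / 4, by norm_num, by norm_num⟩
  have hb : ContDiff ℝ 1 b := b.contDiff
  have hbc : Continuous (deriv b) := hb.continuous_deriv le_rfl
  obtain ⟨L, hL⟩ := b.hasCompactSupport.deriv.exists_bound_of_continuous hbc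
  have hL0 : 0 ≤ L := (norm_nonneg _).trans (hL 0)
  -- The window lengths: stretching by `τ m` divides the derivative bound `L` by `τ m`, and `L / τ m
  -- ≤ B m`; the summand `1` keeps the windows from shrinking.
  let τ : ℕ → ℝ := fun m => 1 + L / B m
  have hτ : ∀ m, 1 ≤ τ m := fun m => le_add_of_nonneg_right (div_nonneg hL0 (hB m).le)
  have hτ0 : ∀ m, 0 < τ m := fun m => one_pos.trans_le (hτ m)
  let T : ℕ → ℝ := fun m => ∑ k ∈ Finset.range m, τ k
  have hTs : ∀ m, T (m + 1) = T m + τ m := fun m => Finset.sum_range_succ _ _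
  have hout : ∀ m t, ¬(T m < t ∧ t < T (m + 1)) → 1 / 4 < dist ((t - T m) / τ m) (1 / 2) := by
    intro m t h
    rw [hTs] at h
    rw [Real.dist_eq, lt_abs]
    by_cases h1 : T m < t
    · left
      have h2 : T m + τ m ≤ t := not_lt.1 fun h2 => h ⟨h1, h2⟩
      have : 1 ≤ (t - T m) / τ m := by rw [le_div_iff₀ (hτ0 m)]; linarith
      linarith
    · right
      have : (t - T m) / τ m ≤ 0 := div_nonpos_of_nonpos_of_nonneg (by linarith) (hτ0 m).le
      linarith
  refine ⟨T, fun m t => b ((t - T m) / τ m), fun m t => deriv b ((t - T m) / τ m) / τ m,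
    ⟨by simp [T], fun m => by rw [hTs]; linarith [hτ m]⟩, fun m t h => ?_, fun m t h => ?_,
    fun m t => ?_, fun m => ?_, fun m t => ?_, fun m t => ?_, fun m => ⟨T m + τ m / 2, ?_, ?_⟩⟩
  · exact b.zero_of_le_dist (hout m t h).le
  · have : deriv b ((t - T m) / τ m) = 0 := by
      by_contra hne
      have h1 := support_deriv_subset (Function.mem_support.2 hne)
      rw [b.tsupport_eq, Metric.mem_closedBall] at h1
      exact absurd h1 (not_le.2 (hout m t h))
    simp [this]
  · have h1 : HasDerivAt (fun t => (t - T m) / τ m) (1 / τ m) t :=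
      ((hasDerivAt_id t).sub_const (T m)).div_const (τ m)
    have h2 := ((hb.differentiable one_ne_zero ((t - T m) / τ m)).hasDerivAt).comp t h1
    rw [mul_one_div] at h2
    exact h2
  · fun_prop
  · rw [abs_of_nonneg b.nonneg]; exact b.le_one
  · rw [abs_div, abs_of_pos (hτ0 m), div_le_iff₀ (hτ0 m)]
    refine (hL _).trans ?_
    have : B m * τ m = B m + L := by
      have := (hB m).ne'
      simp only [τ]; field_simp
    rw [this]
    linarith [hB m]
  · linarith [hτ0 m]
  · apply b.one_of_mem_closedBall
    have h1 : (T m + τ m / 2 - T m) / τ m = 1 / 2 := by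
      have := (hτ0 m).ne'
      field_simp; ring
    rw [h1]
    exact Metric.mem_closedBall_self (by norm_num)

theorem AdmissibleIndices.one_le_p {p q : ℝ≥0∞} (h : AdmissibleIndices n p q) : 1 ≤ p := by
  rcases h with ⟨h1, h2, -⟩ | ⟨h1, h2, -⟩ | ⟨-, h, -⟩
  · refine le_trans ?_ h2.le
    exact_mod_cast (by omega : 1 ≤ n)
  · rw [h2]
    exact_mod_cast (by omega : 1 ≤ n)
  · exact h

theorem AdmissibleIndices.one_le_q {p q : ℝ≥0∞} (h : AdmissibleIndices n p q) : 1 ≤ q := by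
  rcases h with ⟨-, -, h⟩ | ⟨-, -, h⟩ | ⟨-, -, h⟩
  · exact h
  · exact le_trans (by norm_num) h.le
  · exact h.ge

theorem AdmissibleIndices.pos {p q : ℝ≥0∞} (h : AdmissibleIndices n p q) : 0 < n := by
  rcases h with ⟨h, -⟩ | ⟨h, -⟩ | ⟨h, -⟩ <;> omega

theorem exists_small_pos {x : ℝ≥0∞} (hx : x ≠ ∞) {δ : ℝ} (hδ : 0 < δ) :
    ∃ B : ℝ, 0 < B ∧ ENNReal.ofReal (2 * B) * x ≤ ENNReal.ofReal δ := by
  -- The factor `2` is for the coefficient `2 θ θ'`; the summand `1` avoids a division by zero.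
  refine ⟨δ / (2 * (x.toReal + 1)), by positivity, ?_⟩
  rw [← ENNReal.ofReal_toReal hx, ← ENNReal.ofReal_mul (by positivity),
    ENNReal.toReal_ofReal (by positivity)]
  apply ENNReal.ofReal_le_ofReal
  have : 2 * (δ / (2 * (x.toReal + 1))) * x.toReal = δ * (x.toReal / (x.toReal + 1)) := by
    field_simp
  rw [this]
  have h1 : x.toReal / (x.toReal + 1) ≤ 1 := (div_le_one (by positivity)).2 (by linarith)
  nlinarith

end

section

open SchwartzMap
variable {n : ℕ}

/-! ### Fourier characterizations -/

theorem fourier_neg_of_isRealFun {g : 𝓢(Rn n, ℂ)} (hg : IsRealFun g) (ξ : Rn n) :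
    𝓕 g (-ξ) = starRingEnd ℂ (𝓕 g ξ) := by
  rw [fourier_coe, Real.fourier_eq', Real.fourier_eq', ← integral_conj]
  congr 1; ext v
  rw [smul_eq_mul, smul_eq_mul, map_mul, ← Complex.exp_conj, Complex.conj_eq_iff_im.2 (hg v),
    map_mul, Complex.conj_I, Complex.conj_ofReal, inner_neg_right]
  congr 2
  push_cast; ring

theorem isRealFun_of_fourier {g : 𝓢(Rn n, ℂ)} (hg : ∀ ξ, 𝓕 g (-ξ) = starRingEnd ℂ (𝓕 g ξ)) :
    IsRealFun g := by
  intro x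
  rw [← Complex.conj_eq_iff_im]
  have h1 : g x = 𝓕⁻ (𝓕 g) x := by simp
  rw [h1, fourierInv_coe, Real.fourierInv_eq', ← integral_conj, ← integral_neg_eq_self]
  congr 1; ext v
  rw [smul_eq_mul, smul_eq_mul, map_mul, ← Complex.exp_conj, hg, Complex.conj_conj,
    map_mul, Complex.conj_I, Complex.conj_ofReal, inner_neg_left]
  congr 2
  push_cast; ring

theorem fourier_fourierInv_apply (g : 𝓢(Rn n, ℂ)) (ξ : Rn n) : 𝓕 (𝓕⁻ g) ξ = g ξ := by
  simp

/-- A compactly supported radial cutoff. -/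
def radialCutoff (x : Rn n) : ℝ := Real.smoothTransition (2 - ‖x‖ ^ 2)

theorem contDiff_radialCutoff : ContDiff ℝ (⊤ : ℕ∞) (radialCutoff : Rn n → ℝ) := by
  unfold radialCutoff
  exact Real.smoothTransition.contDiff.comp (contDiff_const.sub (contDiff_norm_sq ℝ))

theorem radialCutoff_eq_one {x : Rn n} (hx : ‖x‖ ≤ 1) : radialCutoff x = 1 := by
  apply Real.smoothTransition.one_of_one_le
  nlinarith [norm_nonneg x]

theorem radialCutoff_eq_zero {x : Rn n} (hx : 2 ≤ ‖x‖) : radialCutoff x = 0 := by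
  apply Real.smoothTransition.zero_of_nonpos
  nlinarith

/-- A real radial function with Fourier transform `radialCutoff`. -/
theorem exists_radial_bandLimited (n : ℕ) : ∃ g : 𝓢(Rn n, ℂ),
    ∀ ξ, 𝓕 g ξ = (radialCutoff ξ : ℂ) := by
  have h1 : HasCompactSupport (fun ξ : Rn n => (radialCutoff ξ : ℂ)) := by
    refine HasCompactSupport.intro (isCompact_closedBall (0 : Rn n) 2) fun x hx => ?_
    rw [Metric.mem_closedBall, dist_zero_right, not_le] at hx
    rw [radialCutoff_eq_zero hx.le, Complex.ofReal_zero]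
  have h2 : ContDiff ℝ (⊤ : ℕ∞) (fun ξ : Rn n => (radialCutoff ξ : ℂ)) :=
    Complex.ofRealCLM.contDiff.comp contDiff_radialCutoff
  exact ⟨𝓕⁻ (h1.toSchwartzMap h2), fun ξ => by rw [fourier_fourierInv_apply]; rfl⟩

/-- The function `κ` solves `Δ² κ = r`; it is obtained by dividing by the symbol. -/
def IsBilaplacianInverse (r κ : 𝓢(Rn n, ℂ)) : Prop :=
  ∀ ξ, 𝓕 κ ξ = (((4 * Real.pi ^ 2 * ‖ξ‖ ^ 2) ^ 2)⁻¹ : ℝ) * 𝓕 r ξ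

/-- The inverse symbol is singular only at the origin, near which the transform of `r` vanishes; the
quotient is smooth with compact support. -/
theorem AnnularSpectrum.exists_isBilaplacianInverse {r : 𝓢(Rn n, ℂ)} (hr : AnnularSpectrum r) :
    ∃ κ, IsBilaplacianInverse r κ := by
  obtain ⟨⟨ρ, hρ, h1⟩, R, h2⟩ := hr
  have hc : HasCompactSupport
      (fun ξ : Rn n => (((4 * Real.pi ^ 2 * ‖ξ‖ ^ 2) ^ 2)⁻¹ : ℝ) * 𝓕 r ξ) := by
    refine HasCompactSupport.intro (isCompact_closedBall (0 : Rn n) R) fun x hx => ?_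
    rw [Metric.mem_closedBall, dist_zero_right, not_le] at hx
    rw [h2 x hx, mul_zero]
  have hs : ContDiff ℝ (⊤ : ℕ∞)
      (fun ξ : Rn n => ((((4 * Real.pi ^ 2 * ‖ξ‖ ^ 2) ^ 2)⁻¹ : ℝ) : ℂ) * 𝓕 r ξ) := by
    rw [contDiff_iff_contDiffAt]
    intro ξ
    rcases eq_or_ne ξ 0 with rfl | hξ
    · refine (contDiffAt_const (c := (0 : ℂ))).congr_of_eventuallyEq ?_
      filter_upwards [Metric.ball_mem_nhds (0 : Rn n) hρ] with ξ hξ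
      rw [h1 ξ (by simpa using hξ), mul_zero]
    · refine ContDiffAt.mul ?_ ((𝓕 r).smooth ⊤).contDiffAt
      refine Complex.ofRealCLM.contDiff.contDiffAt.comp ξ (ContDiffAt.inv ?_ ?_)
      · exact ((contDiff_const.mul (contDiff_norm_sq ℝ)).pow 2).contDiffAt
      · have : 0 < ‖ξ‖ := norm_pos_iff.2 hξ
        positivity
  refine ⟨𝓕⁻ (hc.toSchwartzMap hs), fun ξ => ?_⟩
  rw [fourier_fourierInv_apply]; rfl

/-- At `ξ = 0` the inverse symbol is `0⁻¹ = 0`, so the identity needs `𝓕 r 0 = 0` there. -/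
theorem IsBilaplacianInverse.laplacian_laplacian {r κ : 𝓢(Rn n, ℂ)}
    (h : IsBilaplacianInverse r κ) (hr : 𝓕 r 0 = 0) : Δ (Δ κ) = r := by
  apply fourier_ext; intro ξ
  rw [fourier_laplacian, fourier_laplacian, h]
  rcases eq_or_ne ξ 0 with rfl | hξ
  · simp [hr]
  · have h2 : 0 < ‖ξ‖ := norm_pos_iff.2 hξ
    have h1 : ((4 * Real.pi ^ 2 * ‖ξ‖ ^ 2 : ℝ) : ℂ) ≠ 0 := by
      rw [Complex.ofReal_ne_zero]; positivity
    have h3 : (4 * Real.pi ^ 2 * (‖ξ‖ ^ 2 : ℝ) : ℂ) = ((4 * Real.pi ^ 2 * ‖ξ‖ ^ 2 : ℝ) : ℂ) := by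
      push_cast; ring
    rw [h3, Complex.ofReal_inv, Complex.ofReal_pow]
    field_simp

theorem IsBilaplacianInverse.isRealFun {r κ : 𝓢(Rn n, ℂ)}
    (h : IsBilaplacianInverse r κ) (hr : IsRealFun r) : IsRealFun κ :=
  isRealFun_of_fourier fun ξ => by
    rw [h, h, norm_neg, fourier_neg_of_isRealFun hr, map_mul, Complex.conj_ofReal]

theorem IsBilaplacianInverse.annularSpectrum {r κ : 𝓢(Rn n, ℂ)}
    (h : IsBilaplacianInverse r κ) (hr : AnnularSpectrum r) : AnnularSpectrum κ := by
  obtain ⟨⟨ρ, hρ, h1⟩, R, h2⟩ := hr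
  exact ⟨⟨ρ, hρ, fun ξ hξ => by rw [h, h1 ξ hξ, mul_zero]⟩,
    ⟨R, fun ξ hξ => by rw [h, h2 ξ hξ, mul_zero]⟩⟩

/-- The inverse symbol is radial, so every symmetry of the stress is inherited by the stream
function. -/
theorem IsBilaplacianInverse.isoComp_eq {r κ : 𝓢(Rn n, ℂ)} (h : IsBilaplacianInverse r κ)
    (A : Rn n ≃ₗᵢ[ℝ] Rn n) {c : ℂ} (hr : isoComp A r = c • r) : isoComp A κ = c • κ := by
  apply fourier_ext; intro ξ
  have h1 := congrArg (fun f : 𝓢(Rn n, ℂ) => 𝓕 f ξ) hr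
  simp only [FourierTransform.fourier_smul, _root_.smul_apply, fourier_isoComp, smul_eq_mul] at h1
  rw [FourierTransform.fourier_smul, _root_.smul_apply, fourier_isoComp, h, h, h1, A.norm_map,
    smul_eq_mul]
  ring

theorem AnnularSpectrum.fourier_zero_eq {r : 𝓢(Rn n, ℂ)} (hr : AnnularSpectrum r) :
    𝓕 r 0 = 0 := by
  obtain ⟨⟨ρ, hρ, h1⟩, -⟩ := hr
  exact h1 0 (by simpa using hρ)

/-! ### A solution of the Stokes equations -/

/-- The matrix field whose only entry is `r`, at `(i₀, i₀)`. -/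
def diagEntry (i₀ : Fin n) (r : 𝓢(Rn n, ℂ)) : Fin n → Fin n → 𝓢(Rn n, ℂ) :=
  fun i k => if i = i₀ ∧ k = i₀ then r else 0

/-- The velocity of the Stokes flow driven by `- div (r e ⊗ e)`, where `r = Δ² κ`. -/
def stokesField (i₀ : Fin n) (κ : 𝓢(Rn n, ℂ)) : Fin n → 𝓢(Rn n, ℂ) :=
  fun i => (if i = i₀ then Δ (pd i₀ κ) else 0) - pd i (pd i₀ (pd i₀ κ))

theorem fieldDiv_stokesField (i₀ : Fin n) (κ : 𝓢(Rn n, ℂ)) : fieldDiv (stokesField i₀ κ) = 0 := by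
  have h1 : ∀ i, pd i (if i = i₀ then Δ (pd i₀ κ) else 0) =
      if i = i₀ then pd i (Δ (pd i₀ κ)) else 0 := fun i => by
    split_ifs <;> simp [pd_zero]
  simp only [fieldDiv, stokesField, pd_sub, Finset.sum_sub_distrib, h1, Finset.sum_ite_eq',
    Finset.mem_univ, if_true]
  rw [← laplacian_eq_sum_pd, pd_laplacian, sub_self]

/-- Applying `-Δ` to the component along `e` produces `-Δ² ∂κ`, which cancels the divergence of the
stress because `r = Δ² κ`. The rest is a gradient. -/
theorem stokesField_eq (i₀ : Fin n) {κ r : 𝓢(Rn n, ℂ)} (h : Δ (Δ κ) = r) :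
    -vecLaplacian (stokesField i₀ κ) + matrixDiv (diagEntry i₀ r) = grad (Δ (pd i₀ (pd i₀ κ))) := by
  funext k
  have h1 : matrixDiv (diagEntry i₀ r) k = if k = i₀ then pd i₀ r else 0 := by
    rw [matrixDiv, Finset.sum_eq_single i₀]
    · by_cases hk : k = i₀ <;> simp [diagEntry, hk, pd_zero]
    · intro i _ hi; simp [diagEntry, hi, pd_zero]
    · simp
  have h2 : ∀ f g : 𝓢(Rn n, ℂ), Δ (f - g) = Δ f - Δ g := fun f g => by
    simp only [laplacian_eq_sum_pd, pd_sub, Finset.sum_sub_distrib]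
  have h3 : Δ (0 : 𝓢(Rn n, ℂ)) = 0 := by simp [laplacian_eq_sum_pd, pd_zero]
  rw [Pi.add_apply, Pi.neg_apply, h1, vecLaplacian, stokesField, h2, grad, pd_laplacian]
  split_ifs with hk
  · rw [← pd_laplacian, ← pd_laplacian, h]; abel
  · rw [h3]; abel

theorem AnnularSpectrum.stokesField {κ : 𝓢(Rn n, ℂ)} (h : AnnularSpectrum κ) (i₀ i : Fin n) :
    AnnularSpectrum (stokesField i₀ κ i) := by
  refine AnnularSpectrum.sub ?_ (((h.pd _).pd _).pd _)
  split_ifs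
  · exact (h.pd _).laplacian
  · exact annularSpectrum_zero

theorem IsRealFun.stokesField {κ : 𝓢(Rn n, ℂ)} (h : IsRealFun κ) (i₀ i : Fin n) :
    IsRealFun (stokesField i₀ κ i) := by
  refine IsRealFun.sub ?_ (((h.pd _).pd _).pd _)
  split_ifs
  · exact (h.pd _).laplacian
  · exact isRealFun_zero

/-! ### Trace-free divergence -/

/-- `div (Q - (1/n) (tr Q) I)`, which differs from `div Q` by a gradient. -/
def deviatorDiv (Q : Fin n → Fin n → 𝓢(Rn n, ℂ)) : Fin n → 𝓢(Rn n, ℂ) :=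
  fun k => ∑ i, pd i (Q i k - if i = k then (n : ℂ)⁻¹ • ∑ l, Q l l else 0)

/-- The trace only changes the pressure. The trace-free form is preferred because scalar matrices
drop out of it, and because in the plane symmetries can make the means of its entries vanish. -/
theorem deviatorDiv_eq (Q : Fin n → Fin n → 𝓢(Rn n, ℂ)) :
    deviatorDiv Q = matrixDiv Q + grad (-(n : ℂ)⁻¹ • ∑ l, Q l l) := by
  funext k
  have h1 : ∀ i, pd i (if i = k then (n : ℂ)⁻¹ • ∑ l, Q l l else 0) =
      if i = k then pd i ((n : ℂ)⁻¹ • ∑ l, Q l l) else 0 := fun i => by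
    split_ifs <;> simp [pd_zero]
  simp only [deviatorDiv, matrixDiv, pd_sub, Finset.sum_sub_distrib, h1, Finset.sum_ite_eq',
    Finset.mem_univ, if_true, Pi.add_apply, grad]
  rw [neg_smul, pd_neg, sub_eq_add_neg]

theorem deviatorDiv_add (P Q : Fin n → Fin n → 𝓢(Rn n, ℂ)) :
    deviatorDiv (P + Q) = deviatorDiv P + deviatorDiv Q := by
  funext k
  simp only [deviatorDiv, Pi.add_apply, ← Finset.sum_add_distrib, ← pd_add]
  refine Finset.sum_congr rfl fun i _ => ?_
  congr 1
  split_ifs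
  · rw [Finset.sum_add_distrib, smul_add]; abel
  · abel

theorem deviatorDiv_smul (c : ℂ) (Q : Fin n → Fin n → 𝓢(Rn n, ℂ)) :
    deviatorDiv (c • Q) = c • deviatorDiv Q := by
  funext k
  simp only [deviatorDiv, Pi.smul_apply, Finset.smul_sum, ← pd_smul]
  refine Finset.sum_congr rfl fun i _ => ?_
  congr 1
  rw [smul_sub]
  split_ifs
  · simp only [Finset.smul_sum, smul_comm c]
  · simp

/-- The scalar matrix field `g I`. -/
def scalarMatrix (g : 𝓢(Rn n, ℂ)) : Fin n → Fin n → 𝓢(Rn n, ℂ) := fun i k => if i = k then g else 0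

theorem deviatorDiv_scalarMatrix (hn : 0 < n) (g : 𝓢(Rn n, ℂ)) :
    deviatorDiv (scalarMatrix g) = 0 := by
  funext k
  simp only [deviatorDiv, scalarMatrix, if_true]
  refine Finset.sum_eq_zero fun i _ => ?_
  split_ifs
  · rw [Finset.sum_const, Finset.card_univ, Fintype.card_fin, ← Nat.cast_smul_eq_nsmul ℂ, smul_smul,
      inv_mul_cancel₀ (by exact_mod_cast hn.ne'), one_smul, sub_self, pd_zero]
  · rw [sub_self, pd_zero]

theorem IsRealFun.deviatorDiv {Q : Fin n → Fin n → 𝓢(Rn n, ℂ)} (h : ∀ i k, IsRealFun (Q i k))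
    (k : Fin n) : IsRealFun (deviatorDiv Q k) := by
  refine IsRealFun.sum _ fun i _ => IsRealFun.pd _ ((h i k).sub ?_)
  split_ifs
  · have := (IsRealFun.sum Finset.univ fun l _ => h l l).smul (n : ℝ)⁻¹
    push_cast at this
    exact this
  · exact isRealFun_zero

end

section

open SchwartzMap
variable {n : ℕ}

/-! ### Families of functions with frequencies tending to infinity -/

/-- The family `G` tends to zero as `lam → ∞` in the Besov spaces of regularity `s`. -/
def Negligible (φ₀ : 𝓢(Rn n, ℂ)) (s : ℝ) (p : ℝ≥0∞) (G : ℝ → 𝓢(Rn n, ℂ)) : Prop :=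
  ∀ ψ : 𝓢(Rn n, ℂ), SpectralSub φ₀ ψ → Tendsto (fun lam => ∑' j : ℤ,
    ENNReal.ofReal ((2 : ℝ) ^ (s * (j : ℝ))) * eLpNorm (kblock ψ j (G lam)) p volume) atTop (𝓝 0)

section Negligible

variable {φ₀ : 𝓢(Rn n, ℂ)} {s : ℝ} {p : ℝ≥0∞} {F G : ℝ → 𝓢(Rn n, ℂ)}

theorem Negligible.congr' (hF : Negligible φ₀ s p F) (h : ∀ᶠ lam in atTop, F lam = G lam) :
    Negligible φ₀ s p G := fun ψ hψ =>
  (hF ψ hψ).congr' (h.mono fun lam hl => by rw [hl])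

theorem Negligible.add (hp : 1 ≤ p) (hF : Negligible φ₀ s p F) (hG : Negligible φ₀ s p G) :
    Negligible φ₀ s p (fun lam => F lam + G lam) := fun ψ hψ => by
  have h := (hF ψ hψ).add (hG ψ hψ)
  rw [add_zero] at h
  refine tendsto_of_tendsto_of_tendsto_of_le_of_le tendsto_const_nhds h (fun _ => zero_le)
    fun lam => ?_
  dsimp only
  rw [← ENNReal.tsum_add]
  refine ENNReal.tsum_le_tsum fun j => ?_
  rw [← mul_add, kblock_add]
  gcongr
  exact eLpNorm_add_le (kblock ψ j (F lam)).continuous.aestronglyMeasurable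
    (kblock ψ j (G lam)).continuous.aestronglyMeasurable hp

theorem negligible_zero : Negligible φ₀ s p (fun _ => 0) := fun ψ _ => by
  simp [kblock_zero]

theorem Negligible.sum (hp : 1 ≤ p) {ι : Type*} (S : Finset ι) {F : ι → ℝ → 𝓢(Rn n, ℂ)}
    (hF : ∀ a ∈ S, Negligible φ₀ s p (F a)) :
    Negligible φ₀ s p (fun lam => ∑ a ∈ S, F a lam) := by
  classical
  induction S using Finset.induction_on with
  | empty => simpa using negligible_zero
  | insert a S ha ih =>
    simp only [Finset.sum_insert ha]
    exact (hF a (Finset.mem_insert_self _ _)).add hp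
      (ih fun b hb => hF b (Finset.mem_insert_of_mem hb))

theorem Negligible.smul (c : ℂ) (hF : Negligible φ₀ s p F) :
    Negligible φ₀ s p (fun lam => c • F lam) := fun ψ hψ => by
  have h := ENNReal.Tendsto.const_mul (hF ψ hψ) (a := ‖c‖ₑ) (Or.inr (by simp))
  rw [mul_zero] at h
  refine h.congr fun lam => ?_
  rw [← ENNReal.tsum_mul_left]
  refine tsum_congr fun j => ?_
  have h2 : eLpNorm (⇑(c • kblock ψ j (F lam))) p volume =
      ‖c‖ₑ * eLpNorm (kblock ψ j (F lam)) p volume :=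
    eLpNorm_const_smul c (kblock ψ j (F lam)) p volume
  rw [kblock_smul, h2, mul_left_comm]

theorem Negligible.sub (hp : 1 ≤ p) (hF : Negligible φ₀ s p F) (hG : Negligible φ₀ s p G) :
    Negligible φ₀ s p (fun lam => F lam - G lam) := by
  have := hF.add hp (hG.smul (-1))
  simpa [sub_eq_add_neg] using this

theorem eLpNorm_modulate (ζ : Rn n) (f : 𝓢(Rn n, ℂ)) :
    eLpNorm (modulate ζ f) p volume = eLpNorm f p volume :=
  eLpNorm_congr_norm_ae (Eventually.of_forall fun x => norm_modulate ζ f x)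

/-- The spectrum moves away to distance about `lam ‖y‖` while the `Lᵖ` norm stays bounded, so
negative regularity gives decay like `lam ^ s`. -/
theorem negligible_modulate (h : IsLittlewoodPaley φ₀) (hs : s < 0) (hp : 1 ≤ p) {y : Rn n}
    (hy : y ≠ 0) {R : ℝ} {a : 𝓢(Rn n, ℂ)} (ha : BandLimited R a) {c : ℝ → ℂ}
    (hc : ∀ᶠ lam in atTop, ‖c lam‖ ≤ 1) :
    Negligible φ₀ s p (fun lam => c lam • modulate (lam • y) a) := fun ψ hψ => by
  have hy0 : 0 < ‖y‖ := norm_pos_iff.2 hy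
  have hlin : Tendsto (fun lam : ℝ => (lam * ‖y‖ - R) / 4) atTop atTop := by
    refine Tendsto.atTop_div_const (by norm_num) ?_
    exact tendsto_atTop_add_const_right _ _ (tendsto_id.atTop_mul_const hy0)
  have h1 : Tendsto (fun lam : ℝ => ENNReal.ofReal (((lam * ‖y‖ - R) / 4) ^ s) *
      (geomConst s * eLpNorm ψ 1 volume) * eLpNorm a p volume) atTop (𝓝 0) := by
    have h2 := ENNReal.tendsto_ofReal ((tendsto_rpow_neg_atTop (neg_pos.2 hs)).comp hlin)
    rw [ENNReal.ofReal_zero] at h2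
    have h3 := ENNReal.Tendsto.mul_const (b := geomConst s * eLpNorm ψ 1 volume) h2
      (Or.inr (ENNReal.mul_ne_top (geomConst_ne_top hs.ne) (eLpNorm_schwartz_ne_top _ _)))
    have h4 := ENNReal.Tendsto.mul_const (b := eLpNorm a p volume) h3
      (Or.inr (eLpNorm_schwartz_ne_top _ _))
    simpa using h4
  refine tendsto_of_tendsto_of_tendsto_of_le_of_le' tendsto_const_nhds h1
    (Eventually.of_forall fun _ => zero_le) ?_
  filter_upwards [hc, hlin.eventually_gt_atTop 0, eventually_ge_atTop 0] with lam hcl hl hl0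
  have hhp : HighPass (lam * ‖y‖ - R) (c lam • modulate (lam • y) a) := by
    have := ha.highPass_modulate (lam • y)
    rw [norm_smul, Real.norm_of_nonneg hl0] at this
    exact this.smul _
  refine (hhp.tsum_le h hψ hs hp (by linarith)).trans ?_
  gcongr
  have h2 : eLpNorm (⇑(c lam • modulate (lam • y) a)) p volume =
      ‖c lam‖ₑ * eLpNorm (modulate (lam • y) a) p volume :=
    eLpNorm_const_smul (c lam) (modulate (lam • y) a) p volume
  rw [h2, eLpNorm_modulate]
  calc _ ≤ 1 * eLpNorm a p volume := by
        gcongr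
        rw [← ofReal_norm, ENNReal.ofReal_le_one]
        exact hcl
    _ = _ := one_mul _

theorem eventually_norm_div_le (σ : ℝ) (k : ℕ) (hk : k ≠ 0) :
    ∀ᶠ lam : ℝ in atTop, ‖((σ / lam ^ k : ℝ) : ℂ)‖ ≤ 1 := by
  have h : Tendsto (fun lam : ℝ => ‖((σ / lam ^ k : ℝ) : ℂ)‖) atTop (𝓝 0) := by
    have h1 : Tendsto (fun lam : ℝ => σ / lam ^ k) atTop (𝓝 0) :=
      (tendsto_pow_atTop hk).const_div_atTop σ
    have h2 := (Complex.continuous_ofReal.tendsto 0).comp h1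
    have h3 := h2.norm
    simpa using h3
  exact h.eventually (eventually_le_nhds one_pos)

theorem negligible_modulate_combination (h : IsLittlewoodPaley φ₀) (hs : s < 0) (hp : 1 ≤ p)
    {y : Rn n} (hy : y ≠ 0) {R : ℝ} {A B : 𝓢(Rn n, ℂ)} (hA : BandLimited R A)
    (hB : BandLimited R B) (σ : ℝ) :
    Negligible φ₀ s p (fun lam => modulate (lam • y) (A + ((σ / lam : ℝ) : ℂ) • B)) := by
  have h1 := negligible_modulate h hs hp hy hA (c := fun _ => 1) (by simp)
  have h2 := negligible_modulate h hs hp hy hB (c := fun lam => ((σ / lam : ℝ) : ℂ))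
    (by simpa using eventually_norm_div_le σ 1 one_ne_zero)
  refine (h1.add hp h2).congr' (Eventually.of_forall fun lam => ?_)
  rw [one_smul, modulate_add, modulate_smul]

/-- A product of two modulated functions oscillates with the sum of the wave vectors; only pairs
with `y + y' = 0` can leave something at low frequency. -/
theorem negligible_modulate_mul (h : IsLittlewoodPaley φ₀) (hs : s < 0) (hp : 1 ≤ p)
    {y y' : Rn n} (hy : y + y' ≠ 0) {R : ℝ} {A B A' B' : 𝓢(Rn n, ℂ)} (hA : BandLimited R A)
    (hB : BandLimited R B) (hA' : BandLimited R A') (hB' : BandLimited R B') (σ σ' : ℝ) :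
    Negligible φ₀ s p (fun lam => modulate (lam • y) (A + ((σ / lam : ℝ) : ℂ) • B) *
      modulate (lam • y') (A' + ((σ' / lam : ℝ) : ℂ) • B')) := by
  have h1 := negligible_modulate_combination h hs hp hy (hA.mul hA') (hA.mul hB') σ'
  have h2 := negligible_modulate h hs hp hy (hB.mul hA') (c := fun lam => ((σ / lam : ℝ) : ℂ))
    (by simpa using eventually_norm_div_le σ 1 one_ne_zero)
  have h3 := negligible_modulate h hs hp hy (hB.mul hB')
    (c := fun lam => ((σ * σ' / lam ^ 2 : ℝ) : ℂ)) (eventually_norm_div_le _ 2 two_ne_zero)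
  refine ((h1.add hp h2).add hp h3).congr' (Eventually.of_forall fun lam => ?_)
  rw [modulate_mul_modulate, ← smul_add, ← modulate_smul, ← modulate_smul, ← modulate_add,
    ← modulate_add]
  congr 1
  simp only [add_mul, mul_add, smul_mul_assoc, mul_smul_comm]
  have : ((σ * σ' / lam ^ 2 : ℝ) : ℂ) = ((σ / lam : ℝ) : ℂ) * ((σ' / lam : ℝ) : ℂ) := by
    push_cast; ring
  rw [this]
  module

end Negligible

/-- The divergence costs one derivative, so smallness of the stress is needed at regularity `s + 1`.
With `s = n/p - 3` this is `n/p - 2 < 0`. -/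
theorem tendsto_besovNorm_deviatorDiv {φ₀ : 𝓢(Rn n, ℂ)} {s : ℝ} {p q : ℝ≥0∞} (hp : 1 ≤ p)
    (hq : 1 ≤ q) {Q : ℝ → Fin n → Fin n → 𝓢(Rn n, ℂ)}
    (hQ : ∀ i k, Negligible φ₀ (s + 1) p (fun lam => Q lam i k)) :
    Tendsto (fun lam => besovNorm φ₀ s p q (toDist (deviatorDiv (Q lam)))) atTop (𝓝 0) := by
  have h1 : ∀ k i, Negligible φ₀ (s + 1) p
      (fun lam => Q lam i k - if i = k then (n : ℂ)⁻¹ • ∑ l, Q lam l l else 0) := fun k i => by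
    refine (hQ i k).sub hp ?_
    split_ifs
    · exact (Negligible.sum hp _ fun l _ => hQ l l).smul _
    · exact negligible_zero
  have h2 := tendsto_finsetSum (Finset.univ : Finset (Fin n)) fun k _ =>
    tendsto_finsetSum (Finset.univ : Finset (Fin n)) fun i _ =>
      h1 k i (pd i φ₀) ((SpectralSub.refl φ₀).pd i)
  simp only [Finset.sum_const_zero] at h2
  refine tendsto_of_tendsto_of_tendsto_of_le_of_le tendsto_const_nhds h2 (fun _ => zero_le)
    fun lam => ?_
  refine (besovNorm_toDist_le hp hq φ₀ s _).trans (Finset.sum_le_sum fun k _ => ?_)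
  refine (scalarBesov_sum_le hp hq φ₀ s _ _).trans (Finset.sum_le_sum fun i _ => ?_)
  rw [scalarBesov_pd]
  exact lqNorm_le_tsum hq _

/-- For `s = n/p - 3` the two exponents are `n - 2` and `n - 1`: three or more dimensions need no
cancellation, the plane needs means equal to zero. -/
theorem besovNorm_deviatorDiv_lt_top {φ₀ : 𝓢(Rn n, ℂ)} (h : IsLittlewoodPaley φ₀) {s : ℝ}
    {p q : ℝ≥0∞} (hp : 1 ≤ p) (hq : 1 ≤ q) {R : ℝ} {Q : Fin n → Fin n → 𝓢(Rn n, ℂ)}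
    (hR : ∀ i k, BandLimited R (Q i k))
    (hs : 0 < s + 1 + (n - overExponent n p) ∨ 0 < s + 1 + (n - overExponent n p + 1) ∧
      ∀ i k, ∫ x, (Q i k - if i = k then (n : ℂ)⁻¹ • ∑ l, Q l l else 0) x = 0) :
    besovNorm φ₀ s p q (toDist (deviatorDiv Q)) < ∞ := by
  refine (besovNorm_toDist_le hp hq φ₀ s _).trans_lt (ENNReal.sum_lt_top.2 fun k _ => ?_)
  refine (scalarBesov_sum_le hp hq φ₀ s _ _).trans_lt (ENNReal.sum_lt_top.2 fun i _ => ?_)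
  have hb : BandLimited R (Q i k - if i = k then (n : ℂ)⁻¹ • ∑ l, Q l l else 0) := by
    refine (hR i k).sub ?_
    split_ifs
    · exact (BandLimited.sum fun l _ => hR l l).smul _
    · exact bandLimited_zero
  rcases hs with hs | ⟨hs, h0⟩
  · exact hb.scalarBesov_pd_le h hp hq hs i
  · obtain ⟨C, hC, hle⟩ := exists_scalarBesov_pd_le_moment h hp hs R
    exact (hle q hq i _ hb (h0 i k)).trans_lt
      (ENNReal.mul_lt_top hC.lt_top (firstMoment_ne_top _).lt_top)

/-! ### Modulated solenoidal waves -/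

/-- Derivative in the direction `v`. -/
def dirDeriv (v : Rn n) (a : 𝓢(Rn n, ℂ)) : 𝓢(Rn n, ℂ) := ∑ k, (v k : ℂ) • pd k a

theorem fourier_sub_apply (f g : 𝓢(Rn n, ℂ)) (ξ : Rn n) : 𝓕 (f - g) ξ = 𝓕 f ξ - 𝓕 g ξ := by
  have h : f - g = f + (-1 : ℂ) • g := by simp [sub_eq_add_neg]
  rw [h, FourierTransform.fourier_add, FourierTransform.fourier_smul]
  simp [sub_eq_add_neg]

theorem fourier_dirDeriv (v : Rn n) (a : 𝓢(Rn n, ℂ)) (η : Rn n) :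
    𝓕 (dirDeriv v a) η = 2 * Real.pi * Complex.I * (∑ k, (v k : ℂ) * (η k : ℂ)) * 𝓕 a η := by
  simp only [dirDeriv, FourierTransform.fourier_sum, _root_.sum_apply,
    FourierTransform.fourier_smul, _root_.smul_apply, fourier_pd, smul_eq_mul, Finset.mul_sum,
    Finset.sum_mul]
  exact Finset.sum_congr rfl fun k _ => by ring

/-- Data of a wave with amplitude `a`, polarization `ξ`, and direction of oscillation `z`. -/
structure Wave (n : ℕ) where
  a : 𝓢(Rn n, ℂ)
  ξ : Rn n
  z : Rn n

/-- The wave is real, band-limited and transversal. -/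
structure Wave.IsAdmissible (w : Wave n) : Prop where
  real : IsRealFun w.a
  band : ∃ R, BandLimited R w.a
  orth : ∑ i, w.ξ i * w.z i = 0
  ne_zero : w.z ≠ 0

namespace Wave

/-- The corrector making the wave solenoidal. -/
def corrector (w : Wave n) (i : Fin n) : 𝓢(Rn n, ℂ) :=
  (Complex.I / (2 * Real.pi * (‖w.z‖ ^ 2 : ℝ))) •
    ((w.z i : ℂ) • dirDeriv w.ξ w.a - (w.ξ i : ℂ) • dirDeriv w.z w.a)

/-- The part of the wave with frequencies near `σ lam z`. -/
def part (w : Wave n) (σ lam : ℝ) (i : Fin n) : 𝓢(Rn n, ℂ) :=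
  modulate (lam • (σ • w.z)) ((w.ξ i : ℂ) • w.a + ((σ / lam : ℝ) : ℂ) • w.corrector i)

/-- The wave at frequency `lam`. -/
def field (w : Wave n) (lam : ℝ) (i : Fin n) : 𝓢(Rn n, ℂ) := w.part 1 lam i + w.part (-1) lam i

/-- The term of order `lam` vanishes by transversality. At order one, the phase derivative of the
corrector gives `-∂_ξ a` because `σ² = 1`, cancelling the divergence of `a ξ`. At order `lam⁻¹` the
corrector is itself solenoidal, since `∂_z ∂_ξ a = ∂_ξ ∂_z a`. The divergence thus vanishes exactly.
-/
theorem fieldDiv_part (w : Wave n) (hw : w.IsAdmissible) {σ lam : ℝ} (hσ : σ ^ 2 = 1)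
    (hl : lam ≠ 0) : fieldDiv (w.part σ lam) = 0 := by
  apply fourier_ext; intro η
  simp only [fieldDiv, part, corrector, FourierTransform.fourier_sum, _root_.sum_apply,
    fourier_pd, fourier_modulate, FourierTransform.fourier_add, FourierTransform.fourier_smul,
    fourier_sub_apply, FourierTransform.fourier_zero, _root_.zero_apply,
    _root_.add_apply, _root_.smul_apply, smul_eq_mul, fourier_dirDeriv]
  set y : Rn n := η - lam • (σ • w.z) with hy
  have hη : ∀ i, (η i : ℂ) = y i + lam * σ * w.z i := fun i => by
    rw [hy]; simp; ring
  have hz : ((‖w.z‖ ^ 2 : ℝ) : ℂ) = ∑ i, (w.z i : ℂ) * w.z i := by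
    rw [EuclideanSpace.real_norm_sq_eq]; push_cast; simp [pow_two]
  have hz0 : ((‖w.z‖ ^ 2 : ℝ) : ℂ) ≠ 0 := by
    rw [Complex.ofReal_ne_zero]; exact pow_ne_zero _ (norm_ne_zero_iff.2 hw.ne_zero)
  have ho : ∑ i, (w.ξ i : ℂ) * w.z i = 0 := by exact_mod_cast congrArg Complex.ofReal hw.orth
  set X := ∑ k, (w.ξ k : ℂ) * (y k : ℂ) with hX
  set Z := ∑ k, (w.z k : ℂ) * (y k : ℂ) with hZ
  set N := ((‖w.z‖ ^ 2 : ℝ) : ℂ) with hN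
  have h1 : ∀ i, 2 * Real.pi * Complex.I * (η i : ℂ) * ((w.ξ i : ℂ) * 𝓕 w.a y +
      ((σ / lam : ℝ) : ℂ) * (Complex.I / (2 * Real.pi * N) *
      ((w.z i : ℂ) * (2 * Real.pi * Complex.I * X * 𝓕 w.a y) -
       (w.ξ i : ℂ) * (2 * Real.pi * Complex.I * Z * 𝓕 w.a y)))) =
      2 * Real.pi * Complex.I * 𝓕 w.a y * ((w.ξ i : ℂ) * y i + lam * σ * ((w.ξ i : ℂ) * w.z i)
       - σ / lam / N * ((w.z i * y i) * X - (w.ξ i * y i) * Z + lam * σ * ((w.z i * w.z i) * X -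
        (w.ξ i * w.z i) * Z))) := fun i => by
    rw [hη i]
    have hpi : (Real.pi : ℂ) ≠ 0 := by exact_mod_cast Real.pi_ne_zero
    have hl' : (lam : ℂ) ≠ 0 := by exact_mod_cast hl
    push_cast
    field_simp
    ring_nf
    simp only [Complex.I_sq]
    ring
  rw [Finset.sum_congr rfl fun i _ => h1 i, ← Finset.mul_sum]
  simp only [Finset.sum_add_distrib, Finset.sum_sub_distrib, ← Finset.mul_sum, ← Finset.sum_mul]
  rw [ho, ← hz, ← hX, ← hZ]
  have hσ' : (σ : ℂ) ^ 2 = 1 := by exact_mod_cast congrArg Complex.ofReal hσ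
  have hl' : (lam : ℂ) ≠ 0 := by exact_mod_cast hl
  have : X + lam * σ * 0 - σ / lam / N * (Z * X - X * Z + lam * σ * (N * X - 0 * Z)) = 0 := by
    field_simp
    linear_combination (-(N * X * lam)) * hσ'
  rw [this, mul_zero]

theorem fieldDiv_field (w : Wave n) (hw : w.IsAdmissible) {lam : ℝ} (hl : lam ≠ 0) :
    fieldDiv (w.field lam) = 0 := by
  have h : fieldDiv (w.field lam) = fieldDiv (w.part 1 lam) + fieldDiv (w.part (-1) lam) := by
    simp [fieldDiv, field, pd_add, Finset.sum_add_distrib]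
  rw [h, w.fieldDiv_part hw (by norm_num) hl, w.fieldDiv_part hw (by norm_num) hl, add_zero]

theorem isRealFun_dirDeriv (v : Rn n) {a : 𝓢(Rn n, ℂ)} (ha : IsRealFun a) :
    IsRealFun (dirDeriv v a) := IsRealFun.sum _ fun i _ => (ha.pd i).smul _

/-- The corrector is purely imaginary, and it enters the two parts with the opposite signs `σ = ±
1`. The parts are therefore complex conjugates and their sum is real. -/
theorem conj_corrector (w : Wave n) (hw : IsRealFun w.a) (i : Fin n) (x : Rn n) :
    starRingEnd ℂ (w.corrector i x) = -w.corrector i x := by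
  have h1 : ∀ v, starRingEnd ℂ (dirDeriv v w.a x) = dirDeriv v w.a x := fun v =>
    Complex.conj_eq_iff_im.2 (isRealFun_dirDeriv v hw x)
  simp only [corrector, _root_.smul_apply, _root_.sub_apply, smul_eq_mul, map_mul, map_sub, map_div₀,
    Complex.conj_I, Complex.conj_ofReal, h1, map_ofNat]
  ring

theorem isRealFun_field (w : Wave n) (hw : IsRealFun w.a) (lam : ℝ) (i : Fin n) :
    IsRealFun (w.field lam i) := by
  intro x
  have h : w.part (-1) lam i x = starRingEnd ℂ (w.part 1 lam i x) := by
    simp only [part, modulate_apply, _root_.add_apply, _root_.smul_apply, smul_eq_mul, map_mul,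
      map_add, w.conj_corrector hw, Complex.conj_ofReal, Complex.conj_eq_iff_im.2 (hw x),
      ← Complex.exp_conj, Complex.conj_I, map_ofNat, inner_smul_left]
    congr 1
    · congr 1
      simp
    · push_cast; ring
  rw [field, _root_.add_apply, h, Complex.add_conj, Complex.ofReal_im]

end Wave

end

/-! ### Spectra of waves and products of waves. -/

section

open SchwartzMap
variable {n : ℕ}

namespace Wave

theorem exists_band (w : Wave n) (hw : w.IsAdmissible) : ∃ R, ∀ i,
    BandLimited R ((w.ξ i : ℂ) • w.a) ∧ BandLimited R (w.corrector i) := by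
  obtain ⟨R, hR⟩ := hw.band
  refine ⟨R, fun i => ⟨hR.smul _, BandLimited.smul _ (BandLimited.sub (BandLimited.smul _ ?_)
    (BandLimited.smul _ ?_))⟩⟩
  all_goals exact BandLimited.sum fun k _ => (hR.pd k).smul _

theorem annularSpectrum_part (w : Wave n) (hw : w.IsAdmissible) {σ : ℝ} (hσ : |σ| = 1) :
    ∀ᶠ lam in atTop, ∀ i, AnnularSpectrum (w.part σ lam i) := by
  obtain ⟨R, hR⟩ := w.exists_band hw
  have hz : 0 < ‖w.z‖ := norm_pos_iff.2 hw.ne_zero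
  have hlin : Tendsto (fun lam : ℝ => lam * ‖w.z‖ - R) atTop atTop :=
    tendsto_atTop_add_const_right _ _ (tendsto_id.atTop_mul_const hz)
  filter_upwards [hlin.eventually_gt_atTop 0, eventually_ge_atTop 0] with lam h1 h0 i
  have hb : BandLimited R ((w.ξ i : ℂ) • w.a + ((σ / lam : ℝ) : ℂ) • w.corrector i) :=
    (hR i).1.add ((hR i).2.smul _)
  have hnorm : ‖lam • (σ • w.z)‖ = lam * ‖w.z‖ := by
    rw [norm_smul, norm_smul, Real.norm_of_nonneg h0, Real.norm_eq_abs, hσ, one_mul]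
  refine ⟨⟨lam * ‖w.z‖ - R, h1, ?_⟩, ⟨_, hb.modulate _⟩⟩
  have := hb.highPass_modulate (lam • (σ • w.z))
  rwa [hnorm] at this

theorem annularSpectrum_field (w : Wave n) (hw : w.IsAdmissible) :
    ∀ᶠ lam in atTop, ∀ i, AnnularSpectrum (w.field lam i) := by
  filter_upwards [w.annularSpectrum_part hw (σ := 1) (by simp),
    w.annularSpectrum_part hw (σ := -1) (by simp)] with lam h1 h2 i
  exact (h1 i).add (h2 i)

section

variable {φ₀ : 𝓢(Rn n, ℂ)} {s : ℝ} {p : ℝ≥0∞}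

theorem negligible_field (w : Wave n) (hw : w.IsAdmissible) (h : IsLittlewoodPaley φ₀) (hs : s < 0)
    (hp : 1 ≤ p) (i : Fin n) : Negligible φ₀ s p (fun lam => w.field lam i) := by
  obtain ⟨R, hR⟩ := w.exists_band hw
  have key : ∀ σ : ℝ, σ ≠ 0 → Negligible φ₀ s p (fun lam => w.part σ lam i) := fun σ hσ =>
    negligible_modulate_combination h hs hp (smul_ne_zero hσ hw.ne_zero) (hR i).1 (hR i).2 σ
  exact (key 1 (by norm_num)).add hp (key (-1) (by norm_num))

theorem negligible_field_mul (w : Wave n) (hw : w.IsAdmissible) (h : IsLittlewoodPaley φ₀)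
    (hs : s < 0) (hp : 1 ≤ p) (i : Fin n) {R₀ : ℝ} {g : 𝓢(Rn n, ℂ)} (hg : BandLimited R₀ g) :
    Negligible φ₀ s p (fun lam => w.field lam i * g) := by
  obtain ⟨R, hR⟩ := w.exists_band hw
  have key : ∀ σ : ℝ, σ ≠ 0 → Negligible φ₀ s p (fun lam => w.part σ lam i * g) := fun σ hσ => by
    have := negligible_modulate_mul (y := σ • w.z) (y' := 0) h hs hp
      (by simpa using ⟨hσ, hw.ne_zero⟩) ((hR i).1.mono (le_max_left R R₀))
      ((hR i).2.mono (le_max_left R R₀)) (hg.mono (le_max_right R R₀)) bandLimited_zero σ 0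
    refine this.congr' (Eventually.of_forall fun lam => ?_)
    rw [smul_zero, modulate_zero, smul_zero, add_zero, part]
  refine ((key 1 (by norm_num)).add hp (key (-1) (by norm_num))).congr'
    (Eventually.of_forall fun lam => ?_)
  rw [field, add_mul]

theorem negligible_part_mul_part (w w' : Wave n) (hw : w.IsAdmissible) (hw' : w'.IsAdmissible)
    (h : IsLittlewoodPaley φ₀) (hs : s < 0) (hp : 1 ≤ p) (i k : Fin n) {σ σ' : ℝ}
    (hz : σ • w.z + σ' • w'.z ≠ 0) :
    Negligible φ₀ s p (fun lam => w.part σ lam i * w'.part σ' lam k) := by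
  obtain ⟨R, hR⟩ := w.exists_band hw
  obtain ⟨R', hR'⟩ := w'.exists_band hw'
  exact negligible_modulate_mul h hs hp hz ((hR i).1.mono (le_max_left R R'))
    ((hR i).2.mono (le_max_left R R')) ((hR' k).1.mono (le_max_right R R'))
    ((hR' k).2.mono (le_max_right R R')) σ σ'

theorem field_mul_field (w w' : Wave n) (lam : ℝ) (i k : Fin n) :
    w.field lam i * w'.field lam k = (w.part 1 lam i * w'.part 1 lam k +
      w.part (-1) lam i * w'.part (-1) lam k) + (w.part 1 lam i * w'.part (-1) lam k +
      w.part (-1) lam i * w'.part 1 lam k) := by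
  simp only [field, add_mul, mul_add]; abel

theorem negligible_field_mul_field (w w' : Wave n) (hw : w.IsAdmissible) (hw' : w'.IsAdmissible)
    (h : IsLittlewoodPaley φ₀) (hs : s < 0) (hp : 1 ≤ p) (i k : Fin n)
    (hz : w.z ≠ w'.z ∧ w.z ≠ -w'.z) :
    Negligible φ₀ s p (fun lam => w.field lam i * w'.field lam k) := by
  have hm : w.z - w'.z ≠ 0 := sub_ne_zero.2 hz.1
  have hp' : w.z + w'.z ≠ 0 := fun h0 => hz.2 (eq_neg_of_add_eq_zero_left h0)
  have key : ∀ σ σ' : ℝ, σ • w.z + σ' • w'.z ≠ 0 →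
      Negligible φ₀ s p (fun lam => w.part σ lam i * w'.part σ' lam k) := fun σ σ' =>
    negligible_part_mul_part w w' hw hw' h hs hp i k
  refine Negligible.congr' (((key 1 1 ?_).add hp (key (-1) (-1) ?_)).add hp
    ((key 1 (-1) ?_).add hp (key (-1) 1 ?_))) (Eventually.of_forall fun lam =>
      (field_mul_field w w' lam i k).symm)
  · simpa using hp'
  · rw [← smul_add]; exact smul_ne_zero (by norm_num) hp'
  · simpa [sub_eq_add_neg] using hm
  · rw [one_smul, neg_one_smul, neg_add_eq_sub]
    exact fun h0 => hm (by rw [← neg_sub, h0, neg_zero])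

/-- Only products of parts with opposite signs have low frequencies. In their sum the terms with one
amplitude and one corrector cancel, because `σ / lam` changes sign; hence the remaining error is of
order `lam⁻²`. -/
theorem negligible_field_mul_self (w : Wave n) (hw : w.IsAdmissible)
    (h : IsLittlewoodPaley φ₀) (hs : s < 0) (hp : 1 ≤ p) (i k : Fin n) :
    Negligible φ₀ s p (fun lam => w.field lam i * w.field lam k -
      (((2 * w.ξ i * w.ξ k : ℝ) : ℂ) • (w.a * w.a) -
        ((2 / lam ^ 2 : ℝ) : ℂ) • (w.corrector i * w.corrector k))) := by
  have key : ∀ σ : ℝ, σ ≠ 0 →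
      Negligible φ₀ s p (fun lam => w.part σ lam i * w.part σ lam k) := fun σ hσ =>
    negligible_part_mul_part w w hw hw h hs hp i k (by
      rw [← two_smul ℝ (σ • w.z)]
      exact smul_ne_zero two_ne_zero (smul_ne_zero hσ hw.ne_zero))
  refine ((key 1 (by norm_num)).add hp (key (-1) (by norm_num))).congr'
    (Eventually.of_forall fun lam => ?_)
  have hlow : w.part 1 lam i * w.part (-1) lam k + w.part (-1) lam i * w.part 1 lam k =
      ((2 * w.ξ i * w.ξ k : ℝ) : ℂ) • (w.a * w.a) -
        ((2 / lam ^ 2 : ℝ) : ℂ) • (w.corrector i * w.corrector k) := by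
    have h0 : lam • ((1 : ℝ) • w.z) + lam • ((-1 : ℝ) • w.z) = 0 := by simp
    simp only [part, modulate_mul_modulate]
    rw [add_comm (lam • ((-1 : ℝ) • w.z)), h0, modulate_zero, modulate_zero]
    simp only [add_mul, mul_add, smul_mul_assoc, mul_smul_comm, smul_add, smul_smul]
    have h1 : ((1 / lam : ℝ) : ℂ) = (lam : ℂ)⁻¹ := by push_cast; rw [one_div]
    have h2 : ((-1 / lam : ℝ) : ℂ) = -(lam : ℂ)⁻¹ := by push_cast; ring
    have h3 : ((2 / lam ^ 2 : ℝ) : ℂ) = 2 * (lam : ℂ)⁻¹ ^ 2 := by push_cast; ring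
    rw [h1, h2, h3]
    push_cast
    module
  rw [field_mul_field, hlow]
  abel

end

end Wave

/-! ### Superpositions of waves -/

/-- The sum of a finite family of waves. -/
def superpose {ι : Type*} [Fintype ι] (w : ι → Wave n) (lam : ℝ) (i : Fin n) : 𝓢(Rn n, ℂ) :=
  ∑ a, (w a).field lam i

section Superpose

variable {φ₀ : 𝓢(Rn n, ℂ)} {s : ℝ} {p : ℝ≥0∞} {ι κ : Type*} [Fintype ι] [Fintype κ]
  {w : ι → Wave n} {w' : κ → Wave n}

theorem fieldDiv_superpose (hw : ∀ a, (w a).IsAdmissible) {lam : ℝ} (hl : lam ≠ 0) :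
    fieldDiv (superpose w lam) = 0 := by
  have h : fieldDiv (superpose w lam) = ∑ a, fieldDiv ((w a).field lam) := by
    simp only [fieldDiv, superpose, pd_sum]
    rw [Finset.sum_comm]
  rw [h, Finset.sum_eq_zero fun a _ => (w a).fieldDiv_field (hw a) hl]

theorem isRealFun_superpose (hw : ∀ a, (w a).IsAdmissible) (lam : ℝ) (i : Fin n) :
    IsRealFun (superpose w lam i) :=
  IsRealFun.sum _ fun a _ => (w a).isRealFun_field (hw a).real lam i

theorem annularSpectrum_superpose (hw : ∀ a, (w a).IsAdmissible) :
    ∀ᶠ lam in atTop, ∀ i, AnnularSpectrum (superpose w lam i) := by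
  have h := eventually_all.2 fun a => (w a).annularSpectrum_field (hw a)
  filter_upwards [h] with lam hl i
  exact AnnularSpectrum.sum _ fun a _ => hl a i

theorem negligible_superpose (hw : ∀ a, (w a).IsAdmissible) (h : IsLittlewoodPaley φ₀) (hs : s < 0)
    (hp : 1 ≤ p) (i : Fin n) : Negligible φ₀ s p (fun lam => superpose w lam i) :=
  Negligible.sum hp _ fun a _ => (w a).negligible_field (hw a) h hs hp i

theorem negligible_superpose_mul (hw : ∀ a, (w a).IsAdmissible) (h : IsLittlewoodPaley φ₀)
    (hs : s < 0) (hp : 1 ≤ p) (i : Fin n) {R₀ : ℝ} {g : 𝓢(Rn n, ℂ)} (hg : BandLimited R₀ g) :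
    Negligible φ₀ s p (fun lam => superpose w lam i * g) := by
  simp only [superpose, Finset.sum_mul]
  exact Negligible.sum hp _ fun a _ => (w a).negligible_field_mul (hw a) h hs hp i hg

theorem negligible_superpose_mul_superpose (hw : ∀ a, (w a).IsAdmissible)
    (hw' : ∀ a, (w' a).IsAdmissible) (hz : ∀ a b, (w a).z ≠ (w' b).z ∧ (w a).z ≠ -(w' b).z)
    (h : IsLittlewoodPaley φ₀) (hs : s < 0) (hp : 1 ≤ p) (i k : Fin n) :
    Negligible φ₀ s p (fun lam => superpose w lam i * superpose w' lam k) := by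
  simp only [superpose, Finset.sum_mul_sum]
  exact Negligible.sum hp _ fun a _ => Negligible.sum hp _ fun b _ =>
    (w a).negligible_field_mul_field (w' b) (hw a) (hw' b) h hs hp i k (hz a b)

/-- The low frequency part of the Reynolds stress of a superposition of waves. -/
def reynolds (w : ι → Wave n) (i k : Fin n) : 𝓢(Rn n, ℂ) :=
  ∑ a, ((2 * (w a).ξ i * (w a).ξ k : ℝ) : ℂ) • ((w a).a * (w a).a)

/-- The contribution of the correctors to the Reynolds stress. -/
def correctorStress (w : ι → Wave n) (i k : Fin n) : 𝓢(Rn n, ℂ) :=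
  ∑ a, (w a).corrector i * (w a).corrector k

theorem negligible_superpose_mul_self (hw : ∀ a, (w a).IsAdmissible)
    (hz : ∀ a b, a ≠ b → (w a).z ≠ (w b).z ∧ (w a).z ≠ -(w b).z)
    (h : IsLittlewoodPaley φ₀) (hs : s < 0) (hp : 1 ≤ p) (i k : Fin n) :
    Negligible φ₀ s p (fun lam => superpose w lam i * superpose w lam k -
      (reynolds w i k - ((2 / lam ^ 2 : ℝ) : ℂ) • correctorStress w i k)) := by
  classical
  have h1 : Negligible φ₀ s p (fun lam => ∑ a, ∑ b, ((w a).field lam i * (w b).field lam k -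
      if a = b then (((2 * (w a).ξ i * (w a).ξ k : ℝ) : ℂ) • ((w a).a * (w a).a) -
        ((2 / lam ^ 2 : ℝ) : ℂ) • ((w a).corrector i * (w a).corrector k)) else 0)) := by
    refine Negligible.sum hp _ fun a _ => Negligible.sum hp _ fun b _ => ?_
    rcases eq_or_ne a b with rfl | hab
    · simpa using (w a).negligible_field_mul_self (hw a) h hs hp i k
    · simpa [hab] using (w a).negligible_field_mul_field (w b) (hw a) (hw b) h hs hp i k (hz a b hab)
  refine h1.congr' (Eventually.of_forall fun lam => ?_)
  simp only [Finset.sum_sub_distrib, Finset.sum_ite_eq, Finset.mem_univ, if_true, superpose,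
    reynolds, correctorStress, Finset.sum_mul_sum, Finset.smul_sum]

end Superpose

end

/-! ### Stationary pairs from two families of waves. -/

section

open SchwartzMap
variable {n : ℕ}

theorem matrixDiv_add (P Q : Fin n → Fin n → 𝓢(Rn n, ℂ)) :
    matrixDiv (P + Q) = matrixDiv P + matrixDiv Q := by
  funext k
  simp [matrixDiv, pd_add, Finset.sum_add_distrib]

theorem matrixDiv_sub (P Q : Fin n → Fin n → 𝓢(Rn n, ℂ)) :
    matrixDiv (P - Q) = matrixDiv P - matrixDiv Q := by
  funext k
  simp [matrixDiv, pd_sub, Finset.sum_sub_distrib]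

theorem grad_sub (f g : 𝓢(Rn n, ℂ)) : grad (f - g) = grad f - grad g := by
  funext k; simp [grad, pd_sub]

theorem vecLaplacian_add (F G : Fin n → 𝓢(Rn n, ℂ)) :
    vecLaplacian (F + G) = vecLaplacian F + vecLaplacian G := by
  funext k
  simp [vecLaplacian, laplacian_eq_sum_pd, pd_add, Finset.sum_add_distrib]

theorem fieldDiv_add {F G : Fin n → 𝓢(Rn n, ℂ)} (hF : fieldDiv F = 0) (hG : fieldDiv G = 0) :
    fieldDiv (F + G) = 0 := by
  simpa using fieldDiv_combination 1 1 hF hG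

/-- The Stokes equation for `U` turns `-ΔU` into `-div D` modulo a gradient. So the second order
force only feels the difference between `W₁ ⊗ W₁` and `D`, besides the diffusion of `W₂`. -/
theorem isForcedPair_of_stokes {U W₁ W₂ : Fin n → 𝓢(Rn n, ℂ)} {D : Fin n → Fin n → 𝓢(Rn n, ℂ)}
    {π₀ : 𝓢(Rn n, ℂ)} (hU : ∀ i, IsRealFun (U i)) (hW₁ : ∀ i, IsRealFun (W₁ i))
    (hW₂ : ∀ i, IsRealFun (W₂ i)) (hD : ∀ i k, IsRealFun (D i k)) (dU : fieldDiv U = 0)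
    (dW₁ : fieldDiv W₁ = 0) (dW₂ : fieldDiv W₂ = 0) (sU : ∀ i, AnnularSpectrum (U i))
    (sW₁ : ∀ i, AnnularSpectrum (W₁ i)) (sW₂ : ∀ i, AnnularSpectrum (W₂ i))
    (hst : -vecLaplacian U + matrixDiv D = grad π₀) :
    IsForcedPair W₁ (U + W₂) (-vecLaplacian W₁)
      (-vecLaplacian W₂ + deviatorDiv (tensor W₁ W₁ - D))
      (deviatorDiv (tensor W₁ (U + W₂) + tensor (U + W₂) W₁))
      (deviatorDiv (tensor (U + W₂) (U + W₂))) where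
  real_u₁ := hW₁
  real_u₂ := fun i => (hU i).add (hW₂ i)
  real_f₁ := fun i => (hW₁ i).laplacian.neg
  real_f₂ := fun i => (hW₂ i).laplacian.neg.add
    (IsRealFun.deviatorDiv (fun i k => ((hW₁ i).mul (hW₁ k)).sub (hD i k)) i)
  real_f₃ := IsRealFun.deviatorDiv fun i k => ((hW₁ i).mul ((hU k).add (hW₂ k))).add
    (((hU i).add (hW₂ i)).mul (hW₁ k))
  real_f₄ := IsRealFun.deviatorDiv fun i k =>
    ((hU i).add (hW₂ i)).mul ((hU k).add (hW₂ k))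
  div_u₁ := dW₁
  div_u₂ := fieldDiv_add dU dW₂
  spectrum_u₁ := sW₁
  spectrum_u₂ := fun i => (sU i).add (sW₂ i)
  f₁_eq := rfl
  f₂_eq := by
    refine ⟨-(n : ℂ)⁻¹ • ∑ l, (tensor W₁ W₁ - D) l l - π₀, ?_⟩
    rw [deviatorDiv_eq, matrixDiv_sub, grad_sub, ← hst, vecLaplacian_add]
    abel
  f₃_eq := ⟨_, by rw [deviatorDiv_eq, matrixDiv_add]⟩
  f₄_eq := ⟨_, deviatorDiv_eq _⟩

/-- Smallness of a velocity field and of the force needed to sustain it in the linear equation. -/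
def SmallVelocity (φ₀ : 𝓢(Rn n, ℂ)) (p q : ℝ≥0∞) (δ : ℝ) (W : Fin n → 𝓢(Rn n, ℂ)) : Prop :=
  besovNorm φ₀ (overExponent n p - 1) p q (toDist W) ≤ ENNReal.ofReal δ ∧
  besovNorm φ₀ (overExponent n p - 3) p q (toDist (-vecLaplacian W)) ≤ ENNReal.ofReal δ

/-- Two families of waves: the Reynolds stress of the first one drives the Stokes flow `U`, that of
the second one compensates `U ⊗ U`. -/
structure IsWaveSystem {ι κ : Type} [Fintype ι] [Fintype κ] (φ₀ : 𝓢(Rn n, ℂ)) (p q : ℝ≥0∞)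
    (U : Fin n → 𝓢(Rn n, ℂ)) (D : Fin n → Fin n → 𝓢(Rn n, ℂ)) (w₁ : ι → Wave n) (w₂ : κ → Wave n) :
    Prop where
  adm₁ : ∀ a, (w₁ a).IsAdmissible
  adm₂ : ∀ a, (w₂ a).IsAdmissible
  nonres₁ : ∀ a b, a ≠ b → (w₁ a).z ≠ (w₁ b).z ∧ (w₁ a).z ≠ -(w₁ b).z
  nonres₂ : ∀ a b, a ≠ b → (w₂ a).z ≠ (w₂ b).z ∧ (w₂ a).z ≠ -(w₂ b).z
  nonres : ∀ a b, (w₁ a).z ≠ (w₂ b).z ∧ (w₁ a).z ≠ -(w₂ b).z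
  stress₁ : ∃ ρ, reynolds w₁ = D + scalarMatrix ρ
  stress₂ : ∃ ρ, reynolds w₂ + tensor U U = scalarMatrix ρ
  corrector₁ : besovNorm φ₀ (overExponent n p - 3) p q
    (toDist (deviatorDiv (correctorStress w₁))) < ∞
  corrector₂ : besovNorm φ₀ (overExponent n p - 3) p q
    (toDist (deviatorDiv (correctorStress w₂))) < ∞

/-- The scalar matrix exerts no force and the stress `C` has a coefficient tending to zero, so only
negligible terms remain. -/
theorem tendsto_besovNorm_deviatorDiv_of_low (hn : 0 < n) {φ₀ : 𝓢(Rn n, ℂ)} {s : ℝ} {p q : ℝ≥0∞}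
    (hp : 1 ≤ p) (hq : 1 ≤ q) {Q : ℝ → Fin n → Fin n → 𝓢(Rn n, ℂ)}
    {C : Fin n → Fin n → 𝓢(Rn n, ℂ)} (hC : besovNorm φ₀ s p q (toDist (deviatorDiv C)) < ∞)
    (ρ : 𝓢(Rn n, ℂ)) (hQ : ∀ i k, Negligible φ₀ (s + 1) p
      (fun lam => Q lam i k - (scalarMatrix ρ i k - ((2 / lam ^ 2 : ℝ) : ℂ) • C i k))) :
    Tendsto (fun lam => besovNorm φ₀ s p q (toDist (deviatorDiv (Q lam)))) atTop (𝓝 0) := by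
  have h1 := tendsto_besovNorm_deviatorDiv (φ₀ := φ₀) (s := s) hp hq
    (Q := fun lam => Q lam - (scalarMatrix ρ - ((2 / lam ^ 2 : ℝ) : ℂ) • C)) hQ
  have h2 : Tendsto (fun lam : ℝ => ‖(-(2 / lam ^ 2 : ℝ) : ℂ)‖ₑ *
      besovNorm φ₀ s p q (toDist (deviatorDiv C))) atTop (𝓝 0) := by
    have h3 : Tendsto (fun lam : ℝ => ‖(-(2 / lam ^ 2 : ℝ) : ℂ)‖ₑ) atTop (𝓝 0) := by
      have h4 : Tendsto (fun lam : ℝ => 2 / lam ^ 2) atTop (𝓝 0) :=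
        (tendsto_pow_atTop two_ne_zero).const_div_atTop 2
      have hcont : Continuous fun t : ℝ => ‖(-(t : ℝ) : ℂ)‖ₑ := by fun_prop
      have := (hcont.tendsto 0).comp h4
      simpa [Function.comp_def] using this
    have := ENNReal.Tendsto.mul_const h3 (Or.inr hC.ne)
    simpa using this
  have h5 := h1.add h2
  rw [add_zero] at h5
  refine tendsto_of_tendsto_of_tendsto_of_le_of_le tendsto_const_nhds h5 (fun _ => zero_le)
    fun lam => ?_
  have h6 : deviatorDiv (Q lam) =
      deviatorDiv (Q lam - (scalarMatrix ρ - ((2 / lam ^ 2 : ℝ) : ℂ) • C)) +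
      (-(2 / lam ^ 2 : ℝ) : ℂ) • deviatorDiv C := by
    have h7 : Q lam = (Q lam - (scalarMatrix ρ - ((2 / lam ^ 2 : ℝ) : ℂ) • C)) +
        (scalarMatrix ρ + (-(2 / lam ^ 2 : ℝ) : ℂ) • C) := by
      rw [neg_smul]; abel
    conv_lhs => rw [h7]
    rw [deviatorDiv_add, deviatorDiv_add, deviatorDiv_smul, deviatorDiv_scalarMatrix hn, zero_add]
  dsimp only
  conv_lhs => rw [h6]
  rw [toDist_add, toDist_smul]
  refine (besovNorm_add_le hp hq _ _ _ _).trans ?_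
  gcongr
  exact besovNorm_smul_le hq _ _ _ _

/-- All blocks vanish and the Littlewood–Paley series has sum zero. This makes the norm of the
nontrivial Stokes flow positive, which provides `c₀`. -/
theorem eq_zero_of_besovNorm_eq_zero (hn : 0 < n) {φ₀ : 𝓢(Rn n, ℂ)} (h : IsLittlewoodPaley φ₀)
    {s : ℝ} {p q : ℝ≥0∞} (hp : 1 ≤ p) (hq : 1 ≤ q) {U : Fin n → 𝓢(Rn n, ℂ)}
    (h0 : besovNorm φ₀ s p q (toDist U) = 0) : U = 0 := by
  have hblock : ∀ j, lpBlock φ₀ j (toDist U) = 0 := fun j => by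
    have h1 := le_lqNorm hq (fun j : ℤ => ENNReal.ofReal ((2 : ℝ) ^ (s *
      (j : ℝ))) * distLpNorm p (lpBlock φ₀ j (toDist U))) j
    rw [show lqNorm q _ = besovNorm φ₀ s p q (toDist U) from rfl, h0, nonpos_iff_eq_zero, mul_eq_zero] at h1
    rcases h1 with h1 | h1
    · rw [ENNReal.ofReal_eq_zero] at h1
      exact absurd h1 (not_le.2 (by positivity))
    rw [lpBlock_toDist] at h1 ⊢
    have h2 : (fun i => kblock φ₀ j (U i)) = 0 := by
      funext i
      have h3 := le_distLpNorm_toDist p (fun i => kblock φ₀ j (U i)) i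
      rw [h1, nonpos_iff_eq_zero,
        eLpNorm_eq_zero_iff (kblock φ₀ j (U i)).continuous.aestronglyMeasurable
          (zero_lt_one.trans_le hp).ne'] at h3
      have h4 := (kblock φ₀ j (U i)).continuous.ae_eq_iff_eq volume continuous_const |>.1 h3
      ext x; exact congrFun h4 x
    rw [h2, toDist_zero]
  have h5 := hasSum_lpBlock_toDist hn h U
  simp only [hblock] at h5
  have h6 : toDist U = 0 := h5.unique hasSum_zero
  have h7 := distLpNorm_toDist 1 U
  rw [h6, ← toDist_zero] at h7
  have h8 : distLpNorm 1 (toDist (0 : Fin n → 𝓢(Rn n, ℂ))) = 0 := by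
    refine le_antisymm ((distLpNorm_toDist_le le_rfl _).trans (le_of_eq ?_)) zero_le
    refine Finset.sum_eq_zero fun i _ => ?_
    simp
  funext i
  have h9 := le_distLpNorm_toDist 1 U i
  rw [distLpNorm_toDist, ← h7, h8, nonpos_iff_eq_zero,
    eLpNorm_eq_zero_iff (U i).continuous.aestronglyMeasurable one_ne_zero] at h9
  have h10 := (U i).continuous.ae_eq_iff_eq volume continuous_const |>.1 h9
  ext x; exact congrFun h10 x

/-- Take `u₁ = W₁`, `u₂ = U + W₂` with `lam` large. Low frequencies of `W₁ ⊗ W₁ - D` and of `(U +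
W₂) ⊗ (U + W₂)` are scalar matrices up to correctors. Mixed products have only high frequencies: `U`
is band-limited and the two families have no resonances. As `W₁` and `W₂` are small, `u₁ + u₂` is
close to `U`. -/
theorem hasStaticPairs_of_waves (hn : 0 < n) {φ₀ : 𝓢(Rn n, ℂ)} (h : IsLittlewoodPaley φ₀)
    {p q : ℝ≥0∞} (hp : 1 ≤ p) (hq : 1 ≤ q) (hs : overExponent n p < 2) {U : Fin n → 𝓢(Rn n, ℂ)}
    {D : Fin n → Fin n → 𝓢(Rn n, ℂ)} {π₀ : 𝓢(Rn n, ℂ)} (hU : ∀ i, IsRealFun (U i))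
    (dU : fieldDiv U = 0) (sU : ∀ i, AnnularSpectrum (U i)) (hD : ∀ i k, IsRealFun (D i k))
    (hst : -vecLaplacian U + matrixDiv D = grad π₀) (hU0 : U ≠ 0)
    (hw : ∀ δ : ℝ, 0 < δ → ∃ (ι κ : Type) (_ : Fintype ι) (_ : Fintype κ) (w₁ : ι → Wave n)
      (w₂ : κ → Wave n), IsWaveSystem φ₀ p q U D w₁ w₂ ∧
      ∀ᶠ lam in atTop, SmallVelocity φ₀ p q δ (superpose w₁ lam) ∧
        SmallVelocity φ₀ p q δ (superpose w₂ lam)) :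
    HasStaticPairs n p q φ₀ := by
  set N := besovNorm φ₀ (overExponent n p - 1) p q (toDist U) with hN
  have hNtop : N ≠ ∞ := (besovNorm_toDist_lt_top h _ hp hq sU).ne
  have hN0 : N ≠ 0 := by
    exact fun h0 => hU0 (eq_zero_of_besovNorm_eq_zero hn h hp hq h0)
  have hNpos : 0 < N.toReal := ENNReal.toReal_pos hN0 hNtop
  refine ⟨N.toReal / 2, by positivity, N + ENNReal.ofReal (N.toReal / 4),
    ENNReal.add_ne_top.2 ⟨hNtop, ENNReal.ofReal_ne_top⟩, U, sU, fun δ hδ => ?_⟩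
  -- Half of `δ` since `f₂` has two small summands; a quarter of the norm of `U` since two wave
  -- fields are subtracted in the lower bound, which leaves `N / 2`.
  set ε := min (δ / 2) (N.toReal / 4) with hε
  have hε0 : 0 < ε := lt_min (by positivity) (by positivity)
  have hεδ : ε ≤ δ := (min_le_left _ _).trans (by linarith)
  obtain ⟨ι, κ, _, _, w₁, w₂, hsys, hsmall⟩ := hw ε hε0
  have hs' : overExponent n p - 3 + 1 < 0 := by linarith
  have hband : ∃ R, ∀ i, BandLimited R (U i) := by
    choose R hR using fun i => (sU i).exists_bandLimited
    exact ⟨∑ i, |R i|, fun i => (hR i).mono ((le_abs_self _).trans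
      (Finset.single_le_sum (f := fun i => |R i|) (fun _ _ => abs_nonneg _) (Finset.mem_univ i)))⟩
  obtain ⟨R, hR⟩ := hband
  have hself₁ := fun i k => negligible_superpose_mul_self hsys.adm₁ hsys.nonres₁ h hs' hp i k
  have hself₂ := fun i k => negligible_superpose_mul_self hsys.adm₂ hsys.nonres₂ h hs' hp i k
  have hcross := fun i k => negligible_superpose_mul_superpose hsys.adm₁ hsys.adm₂ hsys.nonres
    h hs' hp i k
  have hmul₁ := fun i k => negligible_superpose_mul hsys.adm₁ h hs' hp i (hR k)
  have hmul₂ := fun i k => negligible_superpose_mul hsys.adm₂ h hs' hp i (hR k)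
  obtain ⟨ρ₁, hρ₁⟩ := hsys.stress₁
  obtain ⟨ρ₂, hρ₂⟩ := hsys.stress₂
  have hf₂ : Tendsto (fun lam => besovNorm φ₀ (overExponent n p - 3) p q (toDist
      (deviatorDiv (tensor (superpose w₁ lam) (superpose w₁ lam) - D)))) atTop (𝓝 0) := by
    refine tendsto_besovNorm_deviatorDiv_of_low hn hp hq hsys.corrector₁ ρ₁ fun i k => ?_
    refine (hself₁ i k).congr' (Eventually.of_forall fun lam => ?_)
    rw [hρ₁]
    simp only [Pi.sub_apply, Pi.add_apply, tensor]
    abel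
  have hf₃ : Tendsto (fun lam => besovNorm φ₀ (overExponent n p - 3) p q (toDist
      (deviatorDiv (tensor (superpose w₁ lam) (U + superpose w₂ lam) +
        tensor (U + superpose w₂ lam) (superpose w₁ lam))))) atTop (𝓝 0) := by
    refine tendsto_besovNorm_deviatorDiv hp hq fun i k => ?_
    refine (((hmul₁ i k).add hp (hcross i k)).add hp ((hmul₁ k i).add hp (hcross k i))).congr'
      (Eventually.of_forall fun lam => ?_)
    simp only [Pi.add_apply, tensor, mul_add, add_mul]
    rw [mul_comm (U i), mul_comm (superpose w₂ lam i)]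
  -- Here the second family acts: `ρ₂` collects the low frequencies of `U ⊗ U + W₂ ⊗ W₂`, and the
  -- products of `U` with `W₂` are of high frequency.
  have hf₄ : Tendsto (fun lam => besovNorm φ₀ (overExponent n p - 3) p q (toDist
      (deviatorDiv (tensor (U + superpose w₂ lam) (U + superpose w₂ lam))))) atTop (𝓝 0) := by
    refine tendsto_besovNorm_deviatorDiv_of_low hn hp hq hsys.corrector₂ ρ₂ fun i k => ?_
    refine ((hself₂ i k).add hp ((hmul₂ i k).add hp (hmul₂ k i))).congr'
      (Eventually.of_forall fun lam => ?_)
    rw [← hρ₂]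
    simp only [Pi.add_apply, tensor, mul_add, add_mul]
    rw [mul_comm (U i) (superpose w₂ lam k)]
    abel
  have hε' : (0 : ℝ≥0∞) < ENNReal.ofReal ε := by simpa using hε0
  obtain ⟨lam, hl0, ⟨hsm₁, hsm₂⟩, han₁, han₂, h2, h3, h4⟩ := ((eventually_gt_atTop 0).and
    (hsmall.and ((annularSpectrum_superpose hsys.adm₁).and ((annularSpectrum_superpose
    hsys.adm₂).and (((ENNReal.tendsto_nhds_zero.1 hf₂) _ hε').and
    (((ENNReal.tendsto_nhds_zero.1 hf₃) _ hε').and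
    ((ENNReal.tendsto_nhds_zero.1 hf₄) _ hε'))))))).exists
  have hofδ : ENNReal.ofReal ε ≤ ENNReal.ofReal δ := ENNReal.ofReal_le_ofReal hεδ
  have hof4 : ENNReal.ofReal ε ≤ ENNReal.ofReal (N.toReal / 4) :=
    ENNReal.ofReal_le_ofReal (min_le_right _ _)
  refine ⟨superpose w₁ lam, U + superpose w₂ lam, _, _, _, _, isForcedPair_of_stokes hU
    (isRealFun_superpose hsys.adm₁ lam) (isRealFun_superpose hsys.adm₂ lam) hD dU
    (fieldDiv_superpose hsys.adm₁ hl0.ne') (fieldDiv_superpose hsys.adm₂ hl0.ne') sU han₁ han₂ hst,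
    hsm₁.2.trans hofδ, ?_, h3.trans hofδ, h4.trans hofδ, hsm₁.1.trans hofδ, ?_, ?_, fun _ => ?_⟩
  · rw [toDist_add]
    refine (besovNorm_add_le hp hq _ _ _ _).trans ((add_le_add hsm₂.2 h2).trans ?_)
    rw [← ENNReal.ofReal_add hε0.le hε0.le]
    exact ENNReal.ofReal_le_ofReal (by linarith [min_le_left (δ / 2) (N.toReal / 4)])
  · rw [toDist_add]
    exact (besovNorm_add_le hp hq _ _ _ _).trans (add_le_add le_rfl (hsm₂.1.trans hof4))
  · have hle : N ≤ besovNorm φ₀ (overExponent n p - 1) p q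
        (toDist (superpose w₁ lam + (U + superpose w₂ lam))) +
        (ENNReal.ofReal (N.toReal / 4) + ENNReal.ofReal (N.toReal / 4)) := by
      have heq : toDist U = toDist (superpose w₁ lam + (U + superpose w₂ lam)) +
          (-toDist (superpose w₁ lam) + -toDist (superpose w₂ lam)) := by
        rw [toDist_add, toDist_add]; abel
      calc N = _ := by rw [hN, heq]
        _ ≤ _ := besovNorm_add_le hp hq _ _ _ _
        _ ≤ _ := by
          gcongr
          refine (besovNorm_add_le hp hq _ _ _ _).trans (add_le_add ?_ ?_)
          · exact (besovNorm_neg_le hq _ _ _).trans (hsm₁.1.trans hof4)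
          · exact (besovNorm_neg_le hq _ _ _).trans (hsm₂.1.trans hof4)
    have hN2 : N = ENNReal.ofReal (N.toReal / 2) +
        (ENNReal.ofReal (N.toReal / 4) + ENNReal.ofReal (N.toReal / 4)) := by
      rw [← ENNReal.ofReal_add (by positivity) (by positivity),
        ← ENNReal.ofReal_add (by positivity) (by positivity)]
      conv_lhs => rw [← ENNReal.ofReal_toReal hNtop]
      congr 1; ring
    have hfin : ENNReal.ofReal (N.toReal / 4) + ENNReal.ofReal (N.toReal / 4) ≠ ∞ := by simp
    exact (ENNReal.add_le_add_iff_right hfin).1 ((le_of_eq hN2.symm).trans hle)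
  · rw [add_sub_cancel_left]
    exact hsm₂.1.trans hofδ

end

section

open SchwartzMap
variable {n : ℕ}

/-! ### Smallness of superpositions of waves -/

theorem kblock_laplacian (ψ g : 𝓢(Rn n, ℂ)) (j : ℤ) :
    kblock ψ j (Δ g) = (((2 : ℝ) ^ j : ℂ) * ((2 : ℝ) ^ j : ℂ)) • kblock (Δ ψ) j g := by
  have h : ∀ g, kblock ψ j (Δ g) = ∑ i, kblock ψ j (pd i (pd i g)) := fun g => by
    rw [laplacian_eq_sum_pd, kblock_sum]
  rw [h]
  apply fourier_ext; intro ξ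
  simp only [kblock_pd, fourier_kblock, FourierTransform.fourier_sum, _root_.sum_apply,
    FourierTransform.fourier_smul, _root_.smul_apply, smul_eq_mul, fourier_pd, laplacian_eq_sum_pd,
    Finset.sum_mul, Finset.mul_sum]
  refine Finset.sum_congr rfl fun i _ => ?_
  ring

theorem scalarBesov_laplacian (φ₀ : 𝓢(Rn n, ℂ)) (s : ℝ) (p q : ℝ≥0∞) (g : 𝓢(Rn n, ℂ)) :
    scalarBesov φ₀ s p q (Δ g) = lqNorm q (fun j =>
      ENNReal.ofReal ((2 : ℝ) ^ ((s + 2) * (j : ℝ))) * eLpNorm (kblock (Δ φ₀) j g) p volume) := by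
  rw [scalarBesov]
  congr 1; ext j
  rw [kblock_laplacian]
  have : eLpNorm (⇑((((2 : ℝ) ^ j : ℂ) * ((2 : ℝ) ^ j : ℂ)) • kblock (Δ φ₀) j g)) p volume =
      ‖((2 : ℝ) ^ j : ℂ) * ((2 : ℝ) ^ j : ℂ)‖ₑ * eLpNorm (kblock (Δ φ₀) j g) p volume :=
    eLpNorm_const_smul _ (kblock (Δ φ₀) j g) p volume
  rw [this, ← mul_assoc]
  congr 1
  have h2 : ‖((2 : ℝ) ^ j : ℂ)‖ₑ = ENNReal.ofReal ((2 : ℝ) ^ (j : ℝ)) := by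
    rw [← ofReal_norm, norm_zpow, Complex.norm_real, Real.rpow_intCast]; simp
  have h3 : ENNReal.ofReal ((2 : ℝ) ^ (j : ℝ)) = ENNReal.ofReal ((2 : ℝ) ^ (1 * (j : ℝ))) := by
    rw [one_mul]
  rw [enorm_mul, h2, h3, ofReal_two_rpow_mul, ofReal_two_rpow_mul]
  congr 2; ring

/-- Passing two derivatives to the kernel turns the norm of `ΔW` at regularity `n/p - 3` into a norm
of `W` at `n/p - 1` with kernel `Δ φ₀`. Both requirements thus have the same form. -/
theorem smallVelocity_of_lqNorm_le {φ₀ : 𝓢(Rn n, ℂ)} {p q : ℝ≥0∞} (hp : 1 ≤ p) (hq : 1 ≤ q) {δ : ℝ}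
    {W : Fin n → 𝓢(Rn n, ℂ)} (h : ∀ ψ, ψ = φ₀ ∨ ψ = Δ φ₀ → ∑ i, lqNorm q (fun j =>
      ENNReal.ofReal ((2 : ℝ) ^ ((overExponent n p - 1) * (j : ℝ))) *
        eLpNorm (kblock ψ j (W i)) p volume) ≤ ENNReal.ofReal δ) : SmallVelocity φ₀ p q δ W := by
  refine ⟨(besovNorm_toDist_le hp hq _ _ _).trans (h φ₀ (Or.inl rfl)), ?_⟩
  rw [toDist_neg]
  refine (besovNorm_neg_le hq _ _ _).trans ((besovNorm_toDist_le hp hq _ _ _).trans ?_)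
  refine le_trans (le_of_eq ?_) (h (Δ φ₀) (Or.inr rfl))
  refine Finset.sum_congr rfl fun i _ => ?_
  rw [vecLaplacian, scalarBesov_laplacian]
  congr 1; ext j
  congr 4; ring

/-- Here the regularity `n/p - 1` is itself negative, and high frequency alone makes the waves
small. -/
theorem eventually_smallVelocity {ι : Type*} [Fintype ι] {w : ι → Wave n}
    (hw : ∀ a, (w a).IsAdmissible) {φ₀ : 𝓢(Rn n, ℂ)} (h : IsLittlewoodPaley φ₀) {p q : ℝ≥0∞}
    (hp : 1 ≤ p) (hq : 1 ≤ q) (hs : overExponent n p < 1) {δ : ℝ} (hδ : 0 < δ) :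
    ∀ᶠ lam in atTop, SmallVelocity φ₀ p q δ (superpose w lam) := by
  have key : ∀ ψ, SpectralSub φ₀ ψ → ∀ᶠ lam in atTop, ∑ i, lqNorm q (fun j =>
      ENNReal.ofReal ((2 : ℝ) ^ ((overExponent n p - 1) * (j : ℝ))) *
        eLpNorm (kblock ψ j (superpose w lam i)) p volume) ≤ ENNReal.ofReal δ := fun ψ hψ => by
    have h1 := tendsto_finsetSum (Finset.univ : Finset (Fin n)) fun i _ =>
      negligible_superpose hw h (s := overExponent n p - 1) (by linarith) hp i ψ hψ
    simp only [Finset.sum_const_zero] at h1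
    filter_upwards [(ENNReal.tendsto_nhds_zero.1 h1) (ENNReal.ofReal δ)
      (by simpa using hδ)] with lam hl
    exact (Finset.sum_le_sum fun i _ => lqNorm_le_tsum hq _).trans hl
  filter_upwards [key φ₀ (.refl _), key (Δ φ₀) (SpectralSub.refl _).laplacian] with lam h1 h2
  refine smallVelocity_of_lqNorm_le hp hq ?_
  rintro ψ (rfl | rfl)
  · exact h1
  · exact h2

/-- A sum of functions with lacunary spectra: at most one of them is seen by each block. -/
theorem lqNorm_kblock_lacunary_le {φ₀ ψ : 𝓢(Rn n, ℂ)} (h : IsLittlewoodPaley φ₀)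
    (hψ : SpectralSub φ₀ ψ) {p q : ℝ≥0∞} (hp : 1 ≤ p) (hq : 1 ≤ q) {K : ℕ} (hK : 0 < K)
    {F : Fin K → 𝓢(Rn n, ℂ)} {X : ℝ} (hX : 0 < X)
    (hlow : ∀ k : Fin K, HighPass (X * 64 ^ (k : ℕ) / 2) (F k))
    (hhigh : ∀ k : Fin K, BandLimited (2 * (X * 64 ^ (k : ℕ))) (F k)) {A : ℝ≥0∞}
    (hA : ∀ k, eLpNorm (F k) p volume ≤ A) :
    lqNorm q (fun j => eLpNorm (kblock ψ j (∑ k, F k)) p volume) ≤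
      eLpNorm ψ 1 volume * A * ((9 * K : ℕ) : ℝ≥0∞) ^ (q⁻¹).toReal := by
  -- The function with index `k` is seen only by blocks whose scale lies within a factor `4` of `X *
  -- 64 ^ k`.
  have hact : ∀ (j : ℤ) (k : Fin K), kblock ψ j (F k) ≠ 0 →
      X * 64 ^ (k : ℕ) / 4 ≤ (2 : ℝ) ^ j ∧ (2 : ℝ) ^ j ≤ 4 * (X * 64 ^ (k : ℕ)) := by
    intro j k hne
    constructor
    · by_contra hlt
      refine hne (kblock_eq_zero_of_highPass h hψ (hlow k) ?_)
      rw [zpow_add_one₀ two_ne_zero]; linarith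
    · by_contra hlt
      refine hne (kblock_eq_zero_of_bandLimited h hψ (hhigh k) ?_)
      rw [zpow_sub_one₀ two_ne_zero]; linarith
  set l := Int.log 2 X with hl
  have hl1 : ((2 : ℕ) : ℝ) ^ l ≤ X := Int.zpow_log_le_self (by norm_num) hX
  have hl2 : X < ((2 : ℕ) : ℝ) ^ (l + 1) := Int.lt_zpow_succ_log_self (by norm_num) X
  push_cast at hl1 hl2
  -- As `64 = 2 ^ 6`, the active blocks lie in an interval of `6 K + 3 ≤ 9 K` integers.
  refine (lqNorm_le_of_support (M := eLpNorm ψ 1 volume * A) hq (Finset.Icc (l - 2) (l + 6 * K))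
    (fun j => ?_) (fun j hj => ?_)).trans ?_
  · rw [kblock_sum]
    by_cases hex : ∃ k, kblock ψ j (F k) ≠ 0
    · obtain ⟨k, hk⟩ := hex
      rw [Finset.sum_eq_single k]
      · exact (eLpNorm_kblock_le hp ψ j _).trans (by gcongr; exact hA k)
      · intro k' _ hkk'
        by_contra hk'
        -- Consecutive frequencies differ by the factor `64`, more than the factor `16` spanned by
        -- the two tolerances of `4`, so no block sees two functions.
        have key : ∀ a b : Fin K, kblock ψ j (F a) ≠ 0 → kblock ψ j (F b) ≠ 0 → ¬a < b := by
          intro a b ha hb hab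
          have h1 := (hact j a ha).2
          have h2 := (hact j b hb).1
          have h3 : (64 : ℝ) ^ ((a : ℕ) + 1) ≤ 64 ^ (b : ℕ) :=
            pow_le_pow_right₀ (by norm_num) (by exact_mod_cast hab)
          rw [pow_succ] at h3
          have h4 : (0 : ℝ) < 64 ^ (a : ℕ) := by positivity
          nlinarith [mul_le_mul_of_nonneg_left h3 hX.le, mul_pos hX h4]
        rcases lt_trichotomy k k' with hlt | heq | hlt
        · exact key k k' hk hk' hlt
        · exact hkk' heq.symm
        · exact key k' k hk' hk hlt
      · simp
    · push Not at hex
      rw [Finset.sum_eq_zero fun k _ => hex k]; simp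
  · rw [kblock_sum]
    have hz : ∀ k, kblock ψ j (F k) = 0 := by
      intro k
      by_contra hne
      apply hj
      obtain ⟨h1, h2⟩ := hact j k hne
      rw [Finset.mem_Icc]
      constructor
      · have h3 : (2 : ℝ) ^ (l - 2) ≤ 2 ^ j := by
          rw [zpow_sub₀ two_ne_zero]
          have h4 : (1 : ℝ) ≤ 64 ^ (k : ℕ) := one_le_pow₀ (by norm_num)
          norm_num
          nlinarith
        exact (zpow_le_zpow_iff_right₀ (by norm_num)).1 h3
      · have h3 : (2 : ℝ) ^ j < 2 ^ (l + 6 * K + 1) := by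
          have h4 : (64 : ℝ) ^ ((k : ℕ) + 1) ≤ 64 ^ K :=
            pow_le_pow_right₀ (by norm_num) k.2
          have h5 : (2 : ℝ) ^ (l + 6 * K + 1) = 2 ^ (l + 1) * 64 ^ K := by
            rw [show l + 6 * (K : ℤ) + 1 = (l + 1) + (6 : ℕ) * (K : ℕ) by push_cast; ring,
              zpow_add₀ two_ne_zero, zpow_mul, zpow_natCast, zpow_natCast]
            norm_num
          rw [h5]
          rw [pow_succ] at h4
          have h6 : (0 : ℝ) < 64 ^ (k : ℕ) := by positivity
          calc (2 : ℝ) ^ j ≤ 4 * (X * 64 ^ (k : ℕ)) := h2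
            _ < X * (64 ^ (k : ℕ) * 64) := by nlinarith [mul_pos hX h6]
            _ ≤ X * 64 ^ K := by gcongr
            _ ≤ 2 ^ (l + 1) * 64 ^ K := by gcongr
        have := (zpow_lt_zpow_iff_right₀ (by norm_num : (1 : ℝ) < 2)).1 h3
        linarith
    rw [Finset.sum_eq_zero fun k _ => hz k]; simp
  · gcongr
    rw [Int.card_Icc]
    omega

namespace Wave

/-- The wave with amplitude multiplied by `c` and frequency by `m`. -/
def rescale (w : Wave n) (c m : ℝ) : Wave n := ⟨(c : ℂ) • w.a, w.ξ, m • w.z⟩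

theorem IsAdmissible.rescale {w : Wave n} (hw : w.IsAdmissible) (c : ℝ) {m : ℝ} (hm : m ≠ 0) :
    (w.rescale c m).IsAdmissible where
  real := hw.real.smul c
  band := hw.band.imp fun _ h => h.smul _
  orth := by
    have : ∑ i, w.ξ i * (m * w.z i) = m * ∑ i, w.ξ i * w.z i := by
      rw [Finset.mul_sum]; exact Finset.sum_congr rfl fun i _ => by ring
    simpa [Wave.rescale, hw.orth] using this
  ne_zero := smul_ne_zero hm hw.ne_zero

theorem dirDeriv_smul_left (m : ℝ) (v : Rn n) (a : 𝓢(Rn n, ℂ)) :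
    dirDeriv (m • v) a = (m : ℂ) • dirDeriv v a := by
  simp only [dirDeriv, Finset.smul_sum, smul_smul, PiLp.smul_apply, smul_eq_mul,
    Complex.ofReal_mul]

theorem dirDeriv_smul_right (c : ℂ) (v : Rn n) (a : 𝓢(Rn n, ℂ)) :
    dirDeriv v (c • a) = c • dirDeriv v a := by
  simp only [dirDeriv, Finset.smul_sum, pd_smul, smul_comm c]

theorem corrector_rescale (w : Wave n) (c : ℝ) {m : ℝ} (hm : m ≠ 0) (i : Fin n) :
    (w.rescale c m).corrector i = ((c / m : ℝ) : ℂ) • w.corrector i := by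
  simp only [corrector, rescale, dirDeriv_smul_left, dirDeriv_smul_right, norm_smul, PiLp.smul_apply,
    smul_eq_mul]
  simp only [smul_sub, smul_smul]
  have hm' : (m : ℂ) ≠ 0 := by exact_mod_cast hm
  have h1 : (((‖m‖ * ‖w.z‖) ^ 2 : ℝ) : ℂ) = (m : ℂ) ^ 2 * ((‖w.z‖ ^ 2 : ℝ) : ℂ) := by
    rw [mul_pow, Real.norm_eq_abs, sq_abs]; push_cast; ring
  rw [h1]
  by_cases hz : ((‖w.z‖ ^ 2 : ℝ) : ℂ) = 0
  · simp [hz]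
  congr 2
  · push_cast
    field_simp
  · push_cast
    field_simp

/-- Multiplying the frequency by `m ≥ 1` only weakens the corrector, so `B` and the threshold for
`lam` do not depend on `m` or `c`. One choice of `lam` then serves all copies of a wave. -/
theorem exists_field_bounds (w : Wave n) (hw : w.IsAdmissible) {p : ℝ≥0∞} (hp : 1 ≤ p) :
    ∃ B : ℝ≥0∞, B ≠ ∞ ∧ ∀ᶠ lam in atTop, ∀ (m : ℝ), 1 ≤ m → ∀ (c : ℝ) (i : Fin n),
      HighPass (lam * ‖w.z‖ * m / 2) ((w.rescale c m).field lam i) ∧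
      BandLimited (2 * (lam * ‖w.z‖ * m)) ((w.rescale c m).field lam i) ∧
      eLpNorm ((w.rescale c m).field lam i) p volume ≤ ENNReal.ofReal |c| * B := by
  obtain ⟨R, hR⟩ := w.exists_band hw
  have hz : 0 < ‖w.z‖ := norm_pos_iff.2 hw.ne_zero
  refine ⟨∑ i, 2 * (eLpNorm ((w.ξ i : ℂ) • w.a) p volume + eLpNorm (w.corrector i) p volume),
    ?_, ?_⟩
  · refine ENNReal.sum_ne_top.2 fun i _ => ENNReal.mul_ne_top (by simp) (ENNReal.add_ne_top.2 ⟨?_, ?_⟩)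
    · exact eLpNorm_schwartz_ne_top ((w.ξ i : ℂ) • w.a) p
    · exact eLpNorm_schwartz_ne_top _ _
  have hlin : Tendsto (fun lam : ℝ => lam * ‖w.z‖) atTop atTop := tendsto_id.atTop_mul_const hz
  filter_upwards [hlin.eventually_ge_atTop (2 * R), eventually_ge_atTop 1] with lam h1 h0 m hm c i
  have hm0 : m ≠ 0 := by positivity
  have hX : 2 * R ≤ lam * ‖w.z‖ * m := h1.trans (le_mul_of_one_le_right (by positivity) hm)
  have hX0 : 0 < lam * ‖w.z‖ * m := by positivity
  have hpart : ∀ σ : ℝ, (w.rescale c m).part σ lam i = modulate (lam • (σ • (m • w.z)))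
      ((c : ℂ) • ((w.ξ i : ℂ) • w.a + ((σ / (lam * m) : ℝ) : ℂ) • w.corrector i)) := fun σ => by
    rw [part, corrector_rescale w c hm0]
    have hl : (lam : ℂ) ≠ 0 := by exact_mod_cast (by positivity : lam ≠ 0)
    have hm' : (m : ℂ) ≠ 0 := by exact_mod_cast hm0
    simp only [rescale]
    congr 1
    rw [smul_add, smul_smul, smul_smul, smul_smul, smul_smul, mul_comm (c : ℂ)]
    congr 2
    push_cast
    field_simp
  have key : ∀ σ : ℝ, |σ| = 1 → HighPass (lam * ‖w.z‖ * m / 2) ((w.rescale c m).part σ lam i) ∧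
      BandLimited (2 * (lam * ‖w.z‖ * m)) ((w.rescale c m).part σ lam i) ∧
      eLpNorm ((w.rescale c m).part σ lam i) p volume ≤ ENNReal.ofReal |c| *
        (eLpNorm ((w.ξ i : ℂ) • w.a) p volume + eLpNorm (w.corrector i) p volume) := by
    intro σ hσ
    rw [hpart]
    have hb : BandLimited R ((c : ℂ) • ((w.ξ i : ℂ) • w.a +
      ((σ / (lam * m) : ℝ) : ℂ) • w.corrector i)) := ((hR i).1.add ((hR i).2.smul _)).smul _
    have hnorm : ‖lam • (σ • (m • w.z))‖ = lam * ‖w.z‖ * m := by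
      rw [norm_smul, norm_smul, norm_smul, Real.norm_of_nonneg (by positivity : 0 ≤ lam),
        Real.norm_eq_abs, hσ, Real.norm_of_nonneg (by positivity : 0 ≤ m)]
      ring
    refine ⟨?_, ?_, ?_⟩
    · have := hb.highPass_modulate (lam • (σ • (m • w.z)))
      rw [hnorm] at this
      exact this.mono (by linarith)
    · have := hb.modulate (lam • (σ • (m • w.z)))
      rw [hnorm] at this
      exact this.mono (by linarith)
    · rw [eLpNorm_modulate]
      have h2 : ∀ (d : ℝ) (f : 𝓢(Rn n, ℂ)), eLpNorm (⇑((d : ℂ) • f)) p volume =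
          ENNReal.ofReal |d| * eLpNorm f p volume := fun d f => by
        have := eLpNorm_const_smul (d : ℂ) f p volume
        rw [← ofReal_norm, Complex.norm_real] at this
        exact this
      rw [h2]
      gcongr
      refine (eLpNorm_add_le ((w.ξ i : ℂ) • w.a).continuous.aestronglyMeasurable
        (((σ / (lam * m) : ℝ) : ℂ) • w.corrector i).continuous.aestronglyMeasurable hp).trans ?_
      gcongr
      rw [h2]
      calc _ ≤ 1 * eLpNorm (w.corrector i) p volume := by
            gcongr
            rw [ENNReal.ofReal_le_one, abs_div, hσ, abs_of_pos (by positivity)]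
            rw [div_le_one (by positivity)]
            nlinarith
        _ = _ := one_mul _
  obtain ⟨a1, a2, a3⟩ := key 1 (by simp)
  obtain ⟨b1, b2, b3⟩ := key (-1) (by simp)
  refine ⟨a1.add b1, a2.add b2, ?_⟩
  refine (eLpNorm_add_le ((w.rescale c m).part 1 lam i).continuous.aestronglyMeasurable
    ((w.rescale c m).part (-1) lam i).continuous.aestronglyMeasurable hp).trans ?_
  refine (add_le_add a3 b3).trans ?_
  rw [← two_mul, mul_left_comm]
  gcongr
  exact Finset.single_le_sum (f := fun i => 2 * (eLpNorm ((w.ξ i : ℂ) • w.a) p volume +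
    eLpNorm (w.corrector i) p volume)) (fun _ _ => zero_le) (Finset.mem_univ i)

end Wave

end

section

open SchwartzMap
variable {n : ℕ}

/-! ### Lacunary copies of waves -/

/-- Each wave is replaced by `K` copies with amplitude divided by `√K` and lacunary frequencies;
waves with different labels `τ` get frequencies of different sizes. -/
def dup {ι : Type*} (K : ℕ) (τ : ι → ℕ) (v : ι → Wave n) : ι × Fin K → Wave n :=
  fun x => (v x.1).rescale (√K)⁻¹ (64 ^ ((x.2 : ℕ) + K * τ x.1))

section Dup

variable {ι κ : Type*} {K : ℕ} {τ : ι → ℕ} {v : ι → Wave n} {τ' : κ → ℕ} {v' : κ → Wave n}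

theorem dup_isAdmissible (hv : ∀ a, (v a).IsAdmissible) (x : ι × Fin K) :
    (dup K τ v x).IsAdmissible := (hv x.1).rescale _ (by positivity)

/-- All wave vectors have lengths in `[1, 2]`, so different powers of `64` give different lengths;
for equal powers the scaling factor cancels. -/
theorem lacunary_ne {z z' : Rn n} (hz : 1 ≤ ‖z‖ ∧ ‖z‖ ≤ 2) (hz' : 1 ≤ ‖z'‖ ∧ ‖z'‖ ≤ 2) {e e' : ℕ}
    (h : e = e' → z ≠ z' ∧ z ≠ -z') :
    (64 : ℝ) ^ e • z ≠ (64 : ℝ) ^ e' • z' ∧ (64 : ℝ) ^ e • z ≠ -((64 : ℝ) ^ e' • z') := by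
  have key : ∀ (z z' : Rn n), (1 ≤ ‖z‖ ∧ ‖z‖ ≤ 2) → (1 ≤ ‖z'‖ ∧ ‖z'‖ ≤ 2) → ∀ e e' : ℕ, e < e' →
      ‖(64 : ℝ) ^ e • z‖ ≠ ‖(64 : ℝ) ^ e' • z'‖ := by
    intro z z' hz hz' e e' hlt heq
    rw [norm_smul, norm_smul, Real.norm_of_nonneg (by positivity),
      Real.norm_of_nonneg (by positivity)] at heq
    have h1 : (64 : ℝ) ^ (e + 1) ≤ 64 ^ e' := pow_le_pow_right₀ (by norm_num) hlt
    rw [pow_succ] at h1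
    have h2 : (0 : ℝ) < 64 ^ e := by positivity
    nlinarith [mul_le_mul h1 hz'.1 zero_le_one (by positivity)]
  rcases lt_trichotomy e e' with hlt | rfl | hlt
  · have := key z z' hz hz' e e' hlt
    exact ⟨fun h => this (by rw [h]), fun h => this (by rw [h, norm_neg])⟩
  · obtain ⟨h1, h2⟩ := h rfl
    have h0 : (64 : ℝ) ^ e ≠ 0 := by positivity
    refine ⟨fun h3 => h1 (smul_right_injective _ h0 h3), fun h3 => h2 ?_⟩
    rw [← smul_neg] at h3
    exact smul_right_injective _ h0 h3
  · have := key z' z hz' hz e' e hlt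
    exact ⟨fun h => this (by rw [h]), fun h => this (by rw [h, norm_neg])⟩

theorem dup_exponent_eq {k k' : Fin K} {t t' : ℕ} (h : (k : ℕ) + K * t = k' + K * t') :
    k = k' ∧ t = t' := by
  have h1 := congrArg (· % K) h
  have h2 := congrArg (· / K) h
  have hK : 0 < K := k.pos
  simp only [Nat.add_mul_mod_self_left, Nat.mod_eq_of_lt k.2, Nat.mod_eq_of_lt k'.2] at h1
  simp only [Nat.add_mul_div_left _ _ hK, Nat.div_eq_of_lt k.2, Nat.div_eq_of_lt k'.2,
    zero_add] at h2
  exact ⟨Fin.ext h1, h2⟩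

theorem dup_nonres (hz : ∀ a, 1 ≤ ‖(v a).z‖ ∧ ‖(v a).z‖ ≤ 2)
    (h : ∀ a b, a ≠ b → τ a = τ b → (v a).z ≠ (v b).z ∧ (v a).z ≠ -(v b).z)
    (x y : ι × Fin K) (hxy : x ≠ y) :
    (dup K τ v x).z ≠ (dup K τ v y).z ∧ (dup K τ v x).z ≠ -(dup K τ v y).z := by
  refine lacunary_ne (hz x.1) (hz y.1) fun he => ?_
  obtain ⟨h1, h2⟩ := dup_exponent_eq he
  exact h _ _ (fun h3 => hxy (Prod.ext h3 h1)) h2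

theorem dup_nonres_dup (hz : ∀ a, 1 ≤ ‖(v a).z‖ ∧ ‖(v a).z‖ ≤ 2)
    (hz' : ∀ a, 1 ≤ ‖(v' a).z‖ ∧ ‖(v' a).z‖ ≤ 2) (h : ∀ a b, τ a ≠ τ' b)
    (x : ι × Fin K) (y : κ × Fin K) :
    (dup K τ v x).z ≠ (dup K τ' v' y).z ∧ (dup K τ v x).z ≠ -(dup K τ' v' y).z := by
  refine lacunary_ne (hz x.1) (hz' y.1) fun he => ?_
  exact absurd (dup_exponent_eq he).2 (h _ _)

variable [Fintype ι] [Fintype κ]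

/-- The Reynolds stress is quadratic in the amplitude: `K` copies of amplitude `K ^ (-1/2)` add up
to the original stress. -/
theorem reynolds_dup (hK : 0 < K) : reynolds (dup K τ v) = reynolds v := by
  funext i k
  simp only [reynolds, Fintype.sum_prod_type, dup, Wave.rescale, smul_mul_assoc, mul_smul_comm,
    Finset.sum_const, Finset.card_univ, Fintype.card_fin]
  refine Finset.sum_congr rfl fun a _ => ?_
  rw [← Nat.cast_smul_eq_nsmul ℂ, smul_smul, smul_smul, smul_smul]
  congr 1
  have hK' : (0 : ℝ) < K := by exact_mod_cast hK
  have h1 : (((√K)⁻¹ : ℝ) : ℂ) * (((√K)⁻¹ : ℝ) : ℂ) = ((K : ℝ) : ℂ)⁻¹ := by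
    rw [← Complex.ofReal_mul, ← mul_inv, Real.mul_self_sqrt hK'.le, Complex.ofReal_inv]
  have h2 : ((K : ℝ) : ℂ) ≠ 0 := by exact_mod_cast hK'.ne'
  have h3 : (K : ℂ) = ((K : ℝ) : ℂ) := by push_cast; rfl
  calc _ = (K : ℂ) * ((2 * (v a).ξ i * (v a).ξ k : ℝ) : ℂ) *
      ((((√K)⁻¹ : ℝ) : ℂ) * (((√K)⁻¹ : ℝ) : ℂ)) := by ring
    _ = _ := by rw [h1, h3]; field_simp

/-- The weights with which the correctors of the copies enter. -/
def dupWeight (K t : ℕ) : ℝ := ∑ k : Fin K, ((√K)⁻¹ / 64 ^ ((k : ℕ) + K * t)) ^ 2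

/-- The weight of a wave depends on its label only, so a symmetry that permutes waves with equal
labels survives the duplication. -/
theorem correctorStress_dup (i k : Fin n) : correctorStress (dup K τ v) i k =
    ∑ a, (dupWeight K (τ a) : ℂ) • ((v a).corrector i * (v a).corrector k) := by
  simp only [correctorStress, Fintype.sum_prod_type, dup]
  refine Finset.sum_congr rfl fun a _ => ?_
  rw [dupWeight, Complex.ofReal_sum, Finset.sum_smul]
  refine Finset.sum_congr rfl fun l _ => ?_
  rw [Wave.corrector_rescale _ _ (by positivity), Wave.corrector_rescale _ _ (by positivity),
    smul_mul_assoc, mul_smul_comm, smul_smul]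
  push_cast
  rw [pow_two]

theorem tendsto_lacunary_gain {θ : ℝ} (hθ : θ < 1 / 2) :
    Tendsto (fun K : ℕ => ENNReal.ofReal |(√K)⁻¹| * ((9 * K : ℕ) : ℝ≥0∞) ^ θ) atTop (𝓝 0) := by
  have h1 : Tendsto (fun K : ℕ => (9 : ℝ) ^ θ * (K : ℝ) ^ (-(1 / 2 - θ))) atTop (𝓝 0) := by
    have := ((tendsto_rpow_neg_atTop (sub_pos.2 hθ)).comp
      tendsto_natCast_atTop_atTop).const_mul ((9 : ℝ) ^ θ)
    simpa using this
  have h2 := ENNReal.tendsto_ofReal h1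
  rw [ENNReal.ofReal_zero] at h2
  refine h2.congr' ?_
  filter_upwards [eventually_gt_atTop 0] with K hK
  have hK' : (0 : ℝ) < K := by exact_mod_cast hK
  have h3 : ((9 * K : ℕ) : ℝ≥0∞) = ENNReal.ofReal (9 * K) := by
    rw [← ENNReal.ofReal_natCast]; push_cast; rfl
  rw [h3, ENNReal.ofReal_rpow_of_pos (by positivity), ← ENNReal.ofReal_mul (abs_nonneg _)]
  congr 1
  rw [abs_of_nonneg (by positivity), Real.mul_rpow (by norm_num) hK'.le, Real.sqrt_eq_rpow,
    ← Real.rpow_neg hK'.le, mul_left_comm, ← Real.rpow_add hK']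
  congr 2; ring

/-- At regularity zero frequency gives no gain. Each block sees at most one copy of a given wave, of
size `K ^ (-1/2)`, and at most `9 K` blocks are active; the norm is of order `K ^ (1/q - 1/2)`,
which tends to zero for `q > 2`. -/
theorem eventually_smallVelocity_dup (hv : ∀ a, (v a).IsAdmissible) {φ₀ : 𝓢(Rn n, ℂ)}
    (h : IsLittlewoodPaley φ₀) {p q : ℝ≥0∞} (hp : 1 ≤ p) (hq : 1 ≤ q)
    (hs : overExponent n p = 1) (hq2 : 2 < q) {δ : ℝ} (hδ : 0 < δ) (τ : ι → ℕ) :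
    ∀ᶠ K in atTop, ∀ᶠ lam in atTop, SmallVelocity φ₀ p q δ (superpose (dup K τ v) lam) := by
  choose B hB hbd using fun a => (v a).exists_field_bounds (hv a) hp
  have hθ : (q⁻¹).toReal < 1 / 2 := by
    have h1 : q⁻¹ < 2⁻¹ := ENNReal.inv_lt_inv.2 hq2
    have h2 := (ENNReal.toReal_lt_toReal (ne_top_of_lt h1) (by simp)).2 h1
    simpa using h2
  set C : ℝ≥0∞ := (eLpNorm φ₀ 1 volume + eLpNorm (Δ φ₀ : 𝓢(Rn n, ℂ)) 1 volume) * (n * ∑ a, B a) with hC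
  have hCtop : C ≠ ∞ := ENNReal.mul_ne_top (ENNReal.add_ne_top.2 ⟨eLpNorm_schwartz_ne_top _ _,
    eLpNorm_schwartz_ne_top _ _⟩) (ENNReal.mul_ne_top (by simp) (ENNReal.sum_ne_top.2 fun a _ => hB a))
  have hg := ENNReal.Tendsto.const_mul (a := C) (tendsto_lacunary_gain hθ)
    (Or.inr hCtop)
  rw [mul_zero] at hg
  filter_upwards [(ENNReal.tendsto_nhds_zero.1 hg) (ENNReal.ofReal δ) (by simpa using hδ),
    eventually_gt_atTop 0] with K hKδ hK
  filter_upwards [eventually_all.2 hbd, eventually_gt_atTop 0] with lam hl hl0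
  refine smallVelocity_of_lqNorm_le hp hq fun ψ hψ => le_trans ?_ hKδ
  have hsub : SpectralSub φ₀ ψ := by
    rcases hψ with rfl | rfl
    · exact .refl _
    · exact (SpectralSub.refl _).laplacian
  have hψC : eLpNorm ψ 1 volume ≤ eLpNorm φ₀ 1 volume + eLpNorm (Δ φ₀ : 𝓢(Rn n, ℂ)) 1 volume := by
    rcases hψ with rfl | rfl
    · exact le_self_add
    · exact le_add_self
  have hone : ∀ (i : Fin n) (a : ι), lqNorm q (fun j => eLpNorm (kblock ψ j
      (∑ k : Fin K, (dup K τ v (a, k)).field lam i)) p volume) ≤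
      eLpNorm ψ 1 volume * (ENNReal.ofReal |(√K)⁻¹| * B a) *
        ((9 * K : ℕ) : ℝ≥0∞) ^ (q⁻¹).toReal := fun i a => by
    have hz : 0 < ‖(v a).z‖ := norm_pos_iff.2 (hv a).ne_zero
    have hm : ∀ k : Fin K, (1 : ℝ) ≤ 64 ^ ((k : ℕ) + K * τ a) := fun k =>
      one_le_pow₀ (by norm_num)
    have hX : ∀ k : Fin K, lam * ‖(v a).z‖ * 64 ^ (K * τ a) * 64 ^ (k : ℕ) =
        lam * ‖(v a).z‖ * 64 ^ ((k : ℕ) + K * τ a) := fun k => by rw [pow_add]; ring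
    refine lqNorm_kblock_lacunary_le h hsub hp hq hK
      (X := lam * ‖(v a).z‖ * 64 ^ (K * τ a)) (by positivity) (fun k => ?_) (fun k => ?_)
      fun k => ?_
    · rw [hX]; exact (hl a _ (hm k) _ i).1
    · rw [hX]; exact (hl a _ (hm k) _ i).2.1
    · exact (hl a _ (hm k) _ i).2.2
  calc _ ≤ ∑ i : Fin n, ∑ a, eLpNorm ψ 1 volume * (ENNReal.ofReal |(√K)⁻¹| * B a) *
        ((9 * K : ℕ) : ℝ≥0∞) ^ (q⁻¹).toReal := by
        refine Finset.sum_le_sum fun i _ => ?_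
        refine le_trans (lqNorm_mono fun j => ?_) ((lqNorm_sum_le hq Finset.univ fun a j =>
          eLpNorm (kblock ψ j (∑ k : Fin K, (dup K τ v (a, k)).field lam i)) p volume).trans
          (Finset.sum_le_sum fun a _ => hone i a))
        rw [hs, sub_self, zero_mul, Real.rpow_zero, ENNReal.ofReal_one, one_mul, superpose,
          Fintype.sum_prod_type, kblock_sum]
        have hcoe : (⇑(∑ a, kblock ψ j (∑ k : Fin K, (dup K τ v (a, k)).field lam i)) :
            Rn n → ℂ) = ∑ a, ⇑(kblock ψ j (∑ k : Fin K, (dup K τ v (a, k)).field lam i)) := by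
          ext x; rw [_root_.sum_apply, Finset.sum_apply]
        rw [hcoe]
        exact eLpNorm_sum_le (fun a _ => (kblock ψ j _).continuous.aestronglyMeasurable) hp
    _ = eLpNorm ψ 1 volume * (n * ∑ a, B a) * (ENNReal.ofReal |(√K)⁻¹| *
        ((9 * K : ℕ) : ℝ≥0∞) ^ (q⁻¹).toReal) := by
        rw [Finset.sum_const, Finset.card_univ, Fintype.card_fin, nsmul_eq_mul, Finset.mul_sum,
          Finset.mul_sum, Finset.mul_sum, Finset.sum_mul]
        exact Finset.sum_congr rfl fun a _ => by ring
    _ ≤ _ := by rw [hC]; exact mul_le_mul' (mul_le_mul' hψC le_rfl) le_rfl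

end Dup

end

section

open SchwartzMap
variable {n : ℕ}

/-! ### Profiles -/

theorem isRealFun_of_radial {g : 𝓢(Rn n, ℂ)} (hg : ∀ ξ, 𝓕 g ξ = (radialCutoff ξ : ℂ)) :
    IsRealFun g := isRealFun_of_fourier fun ξ => by
  rw [hg, hg, Complex.conj_ofReal, radialCutoff, radialCutoff, norm_neg]

theorem bandLimited_of_radial {g : 𝓢(Rn n, ℂ)} (hg : ∀ ξ, 𝓕 g ξ = (radialCutoff ξ : ℂ)) :
    BandLimited 2 g := fun ξ hξ => by
  rw [hg, radialCutoff_eq_zero hξ.le, Complex.ofReal_zero]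

theorem isoComp_of_radial {g : 𝓢(Rn n, ℂ)} (hg : ∀ ξ, 𝓕 g ξ = (radialCutoff ξ : ℂ))
    (A : Rn n ≃ₗᵢ[ℝ] Rn n) : isoComp A g = g := by
  apply fourier_ext; intro ξ
  rw [fourier_isoComp, hg, hg, radialCutoff, radialCutoff, A.norm_map]

/-- The cutoff is real and even, so the convolution at the origin is the integral of its square. -/
theorem fourier_mul_self_zero_ne_zero {g : 𝓢(Rn n, ℂ)} (hg : ∀ ξ, 𝓕 g ξ = (radialCutoff ξ : ℂ)) :
    𝓕 (g * g) 0 ≠ 0 := by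
  have h1 : ∀ η : Rn n, 𝓕 g η * 𝓕 g (0 - η) = ((radialCutoff η ^ 2 : ℝ) : ℂ) := fun η => by
    rw [hg, hg, zero_sub, pow_two, Complex.ofReal_mul]
    congr 2
    rw [radialCutoff, radialCutoff, norm_neg]
  rw [fourier_mul]
  simp only [h1]
  rw [integral_complex_ofReal, Complex.ofReal_ne_zero]
  refine ne_of_gt ?_
  have hcont : Continuous fun η : Rn n => radialCutoff η ^ 2 :=
    (contDiff_radialCutoff.continuous).pow 2
  refine hcont.integral_pos_of_hasCompactSupport_nonneg_nonzero
    (HasCompactSupport.intro (isCompact_closedBall (0 : Rn n) 2) fun x hx => ?_)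
    (fun x => sq_nonneg _) (x := 0) ?_
  · rw [Metric.mem_closedBall, dist_zero_right, not_le] at hx
    rw [radialCutoff_eq_zero hx.le]; simp
  · rw [radialCutoff_eq_one (by simp)]; simp

/-- The product of `g` with `sin (8 π x_i) sin (8 π x_j)`. -/
def checkerboard (i j : Fin n) (g : 𝓢(Rn n, ℂ)) : 𝓢(Rn n, ℂ) :=
  let ζ : Rn n := EuclideanSpace.single i 4 - EuclideanSpace.single j 4
  let ζ' : Rn n := EuclideanSpace.single i 4 + EuclideanSpace.single j 4
  (4⁻¹ : ℂ) • ((modulate ζ g + modulate (-ζ) g) - (modulate ζ' g + modulate (-ζ') g))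

theorem checkerboard_mul (i j : Fin n) (f g : 𝓢(Rn n, ℂ)) :
    checkerboard i j g * f = checkerboard i j (g * f) := by
  simp only [checkerboard, smul_mul_assoc, sub_mul, add_mul, modulate_mul]

theorem isRealFun_checkerboard (i j : Fin n) {g : 𝓢(Rn n, ℂ)} (hg : IsRealFun g) :
    IsRealFun (checkerboard i j g) := isRealFun_of_fourier fun ξ => by
  have h1 : ∀ ζ : Rn n, 𝓕 g (-ξ - ζ) = starRingEnd ℂ (𝓕 g (ξ + ζ)) := fun ζ => by
    rw [← fourier_neg_of_isRealFun hg, neg_add]; rfl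
  have h2 : ∀ ζ : Rn n, 𝓕 g (-ξ + ζ) = starRingEnd ℂ (𝓕 g (ξ - ζ)) := fun ζ => by
    rw [← sub_neg_eq_add, h1, sub_eq_add_neg]
  simp only [checkerboard, FourierTransform.fourier_smul, _root_.smul_apply, fourier_sub_apply,
    FourierTransform.fourier_add, _root_.add_apply, fourier_modulate, map_mul, map_sub, map_add,
    smul_eq_mul, sub_neg_eq_add, map_inv₀, map_ofNat]
  rw [h1, h1, h2, h2]
  ring

theorem isoComp_add (A : Rn n ≃ₗᵢ[ℝ] Rn n) (f g : 𝓢(Rn n, ℂ)) :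
    isoComp A (f + g) = isoComp A f + isoComp A g := rfl
theorem isoComp_sub (A : Rn n ≃ₗᵢ[ℝ] Rn n) (f g : 𝓢(Rn n, ℂ)) :
    isoComp A (f - g) = isoComp A f - isoComp A g := rfl
theorem isoComp_mul (A : Rn n ≃ₗᵢ[ℝ] Rn n) (f g : 𝓢(Rn n, ℂ)) :
    isoComp A (f * g) = isoComp A f * isoComp A g := by ext x; simp
theorem isoComp_smul (A : Rn n ≃ₗᵢ[ℝ] Rn n) (c : ℂ) (f : 𝓢(Rn n, ℂ)) :
    isoComp A (c • f) = c • isoComp A f := rfl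
theorem isoComp_neg (A : Rn n ≃ₗᵢ[ℝ] Rn n) (f : 𝓢(Rn n, ℂ)) :
    isoComp A (-f) = -isoComp A f := rfl

theorem isoComp_modulate (A : Rn n ≃ₗᵢ[ℝ] Rn n) (ζ : Rn n) (g : 𝓢(Rn n, ℂ)) :
    isoComp A (modulate (A ζ) g) = modulate ζ (isoComp A g) := by
  ext x; simp [modulate_apply]

/-- The rotation exchanges the wave vectors of the two cosines, up to sign; the checkerboard is
their difference and changes sign. -/
theorem isoComp_checkerboard (i j : Fin n) {A : Rn n ≃ₗᵢ[ℝ] Rn n}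
    (hi : A (EuclideanSpace.single i 4) = EuclideanSpace.single j 4)
    (hj : A (EuclideanSpace.single j 4) = -EuclideanSpace.single i 4) (g : 𝓢(Rn n, ℂ)) :
    isoComp A (checkerboard i j g) = -checkerboard i j (isoComp A g) := by
  simp only [checkerboard]
  set ζ : Rn n := EuclideanSpace.single i 4 - EuclideanSpace.single j 4 with hζ
  set ζ' : Rn n := EuclideanSpace.single i 4 + EuclideanSpace.single j 4 with hζ'
  have h1 : A ζ = ζ' := by rw [hζ, hζ', map_sub, hi, hj]; abel
  have h2 : A ζ' = -ζ := by rw [hζ, hζ', map_add, hi, hj]; abel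
  have e1 : isoComp A (modulate ζ' g) = modulate ζ (isoComp A g) := by
    rw [← h1, isoComp_modulate]
  have e2 : isoComp A (modulate (-ζ') g) = modulate (-ζ) (isoComp A g) := by
    rw [← h1, ← map_neg, isoComp_modulate]
  have e3 : isoComp A (modulate (-ζ) g) = modulate ζ' (isoComp A g) := by
    rw [← h2, isoComp_modulate]
  have e4 : isoComp A (modulate ζ g) = modulate (-ζ') (isoComp A g) := by
    rw [← isoComp_modulate, map_neg, h2, neg_neg]
  rw [isoComp_smul, isoComp_sub, isoComp_add, isoComp_add, e1, e2, e3, e4, ← smul_neg]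
  congr 1; abel

theorem single_sub_single (i j : Fin n) (a b : ℝ) :
    (EuclideanSpace.single i a - EuclideanSpace.single j b : Rn n) =
      EuclideanSpace.single i a + EuclideanSpace.single j (-b) := by
  ext k; simp only [PiLp.add_apply, PiLp.sub_apply, PiLp.single_apply]
  split_ifs <;> ring

theorem norm_single_add_single_sq {i j : Fin n} (h : i ≠ j) (a b : ℝ) :
    ‖(EuclideanSpace.single i a + EuclideanSpace.single j b : Rn n)‖ ^ 2 = a ^ 2 + b ^ 2 := by
  rw [← real_inner_self_eq_norm_sq, inner_add_left, inner_add_right, inner_add_right]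
  simp only [EuclideanSpace.inner_single_left, PiLp.single_apply, h, h.symm, if_true, if_false]
  simp
  ring

theorem checkerboard_spectrum {i j : Fin n} (hij : i ≠ j) {g : 𝓢(Rn n, ℂ)} {R : ℝ}
    (hg : BandLimited R g) :
    HighPass (√32 - R) (checkerboard i j g) ∧ BandLimited (√32 + R) (checkerboard i j g) := by
  have hn1 : ‖(EuclideanSpace.single i 4 - EuclideanSpace.single j 4 : Rn n)‖ = √32 := by
    have := norm_single_add_single_sq hij 4 (-4)
    rw [← Real.sqrt_sq (norm_nonneg (EuclideanSpace.single i 4 - EuclideanSpace.single j 4 : Rn n)),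
      single_sub_single, this]
    norm_num
  have hn2 : ‖(EuclideanSpace.single i 4 + EuclideanSpace.single j 4 : Rn n)‖ = √32 := by
    rw [← Real.sqrt_sq (norm_nonneg (EuclideanSpace.single i 4 + EuclideanSpace.single j 4 : Rn n)),
      norm_single_add_single_sq hij 4 4]
    norm_num
  have hhp := fun ζ => hg.highPass_modulate ζ
  have hbl := fun ζ => hg.modulate ζ
  constructor
  · refine HighPass.smul _ (HighPass.sub (HighPass.add ?_ ?_) (HighPass.add ?_ ?_))
    · rw [← hn1]; exact hhp _
    · rw [← hn1, ← norm_neg]; exact hhp _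
    · rw [← hn2]; exact hhp _
    · rw [← hn2, ← norm_neg]; exact hhp _
  · refine BandLimited.smul _ (BandLimited.sub (BandLimited.add ?_ ?_) (BandLimited.add ?_ ?_))
    · rw [← hn1]; exact hbl _
    · rw [← hn1, ← norm_neg]; exact hbl _
    · rw [← hn2]; exact hbl _
    · rw [← hn2, ← norm_neg]; exact hbl _

theorem fourier_checkerboard_apply {i j : Fin n} (hij : i ≠ j) {G : 𝓢(Rn n, ℂ)}
    (hG : BandLimited 4 G) :
    𝓕 (checkerboard i j G) (EuclideanSpace.single i 4 - EuclideanSpace.single j 4) =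
      4⁻¹ * 𝓕 G 0 := by
  -- At this frequency three of the four translates are evaluated at points of length at least `8`,
  -- outside the band of radius `4`; the fourth is evaluated at the origin.
  have hz : ∀ a b : ℝ, 16 < a ^ 2 + b ^ 2 → 𝓕 G (EuclideanSpace.single i a +
      EuclideanSpace.single j b) = 0 := fun a b hab => hG _ (by
    have := norm_single_add_single_sq hij a b
    nlinarith [norm_nonneg (EuclideanSpace.single i a + EuclideanSpace.single j b : Rn n)])
  have h1 := hz 8 (-8) (by norm_num)
  have h2 := hz 0 (-8) (by norm_num)
  have h3 := hz 8 0 (by norm_num)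
  have e1 : (EuclideanSpace.single i 4 - EuclideanSpace.single j 4 : Rn n) -
      -(EuclideanSpace.single i 4 - EuclideanSpace.single j 4) =
      EuclideanSpace.single i 8 + EuclideanSpace.single j (-8) := by
    ext k; simp only [PiLp.add_apply, PiLp.sub_apply, PiLp.neg_apply, PiLp.single_apply]
    split_ifs <;> norm_num
  have e2 : (EuclideanSpace.single i 4 - EuclideanSpace.single j 4 : Rn n) -
      (EuclideanSpace.single i 4 + EuclideanSpace.single j 4) =
      EuclideanSpace.single i 0 + EuclideanSpace.single j (-8) := by
    ext k; simp only [PiLp.add_apply, PiLp.sub_apply, PiLp.single_apply]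
    split_ifs <;> norm_num
  have e3 : (EuclideanSpace.single i 4 - EuclideanSpace.single j 4 : Rn n) -
      -(EuclideanSpace.single i 4 + EuclideanSpace.single j 4) =
      EuclideanSpace.single i 8 + EuclideanSpace.single j 0 := by
    ext k; simp only [PiLp.add_apply, PiLp.sub_apply, PiLp.neg_apply, PiLp.single_apply]
    split_ifs <;> norm_num
  simp only [checkerboard, FourierTransform.fourier_smul, _root_.smul_apply, fourier_sub_apply,
    FourierTransform.fourier_add, _root_.add_apply, fourier_modulate, sub_self, smul_eq_mul,
    e1, e2, e3, h1, h2, h3]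
  ring

theorem fourier_stokesField (i₀ : Fin n) (κ : 𝓢(Rn n, ℂ)) (ξ : Rn n) :
    𝓕 (stokesField i₀ κ i₀) ξ =
      2 * Real.pi * Complex.I * (ξ i₀ : ℝ) * (4 * Real.pi ^ 2 * ((ξ i₀) ^ 2 - ‖ξ‖ ^ 2 : ℝ)) *
        𝓕 κ ξ := by
  rw [stokesField, if_pos rfl, fourier_sub_apply, fourier_laplacian, fourier_pd, fourier_pd,
    fourier_pd, fourier_pd]
  push_cast
  linear_combination (-(8 * (Real.pi : ℂ) ^ 3 * Complex.I * (ξ i₀ : ℂ) ^ 3 * 𝓕 κ ξ)) *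
    Complex.I_sq

/-- At the test frequency the Stokes symbol contains `ξᵢ² - ‖ξ‖² = 16 - 32`, which does not vanish.
-/
theorem stokesField_ne_zero {i j : Fin n} (hij : i ≠ j) {κ : 𝓢(Rn n, ℂ)}
    (hκ : 𝓕 κ (EuclideanSpace.single i 4 - EuclideanSpace.single j 4) ≠ 0) :
    stokesField i κ ≠ 0 := fun h0 => by
  have h1 := fourier_stokesField i κ (EuclideanSpace.single i 4 - EuclideanSpace.single j 4)
  have h2 := norm_single_add_single_sq hij 4 (-4)
  rw [← single_sub_single] at h2
  rw [h0, Pi.zero_apply, FourierTransform.fourier_zero, _root_.zero_apply, h2] at h1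
  have h3 : (EuclideanSpace.single i 4 - EuclideanSpace.single j 4 : Rn n) i = 4 := by
    simp [hij]
  rw [h3] at h1
  have hpi : (Real.pi : ℂ) ≠ 0 := by exact_mod_cast Real.pi_ne_zero
  refine absurd h1.symm (mul_ne_zero (mul_ne_zero ?_ ?_) hκ)
  · refine mul_ne_zero (mul_ne_zero (mul_ne_zero two_ne_zero hpi) Complex.I_ne_zero) ?_
    norm_num
  · refine mul_ne_zero (mul_ne_zero (by norm_num) (pow_ne_zero _ hpi)) ?_
    norm_num

/-- Two amplitudes whose product drives a nontrivial Stokes flow with bounded spectrum. -/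
theorem exists_profiles {i j : Fin n} (hij : i ≠ j) : ∃ α β κ : 𝓢(Rn n, ℂ),
    IsRealFun α ∧ IsRealFun β ∧ IsRealFun κ ∧ (∃ R, BandLimited R α) ∧ (∃ R, BandLimited R β) ∧
    AnnularSpectrum κ ∧ Δ (Δ κ) = α * β ∧ stokesField i κ ≠ 0 ∧
    ∀ A : Rn n ≃ₗᵢ[ℝ] Rn n, A (EuclideanSpace.single i 4) = EuclideanSpace.single j 4 →
      A (EuclideanSpace.single j 4) = -EuclideanSpace.single i 4 →
      isoComp A α = α ∧ isoComp A β = -β ∧ isoComp A κ = -κ := by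
  obtain ⟨g, hg⟩ := exists_radial_bandLimited n
  have hgr := isRealFun_of_radial hg
  have hgb := bandLimited_of_radial hg
  have hG : BandLimited 4 (g * g) := (hgb.mul hgb).mono (by norm_num)
  have hr : g * checkerboard i j g = checkerboard i j (g * g) := by
    rw [mul_comm, checkerboard_mul]
  have hsp := checkerboard_spectrum hij hG
  -- The product `α β` is a checkerboard modulation of `g²`, with spectrum in balls of radius `4`
  -- around points of length `√32`. It stays away from the origin, and the Stokes equation can be
  -- solved by division.
  have h32 : 4 < √32 := by
    rw [Real.lt_sqrt (by norm_num)]; norm_num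
  have hann : AnnularSpectrum (g * checkerboard i j g) := by
    rw [hr]; exact ⟨⟨_, by linarith, hsp.1⟩, _, hsp.2⟩
  obtain ⟨κ, hκ⟩ := hann.exists_isBilaplacianInverse
  refine ⟨g, checkerboard i j g, κ, hgr, isRealFun_checkerboard i j hgr,
    hκ.isRealFun (hgr.mul (isRealFun_checkerboard i j hgr)), ⟨2, hgb⟩,
    ⟨_, (checkerboard_spectrum hij hgb).2⟩, hκ.annularSpectrum hann,
    hκ.laplacian_laplacian hann.fourier_zero_eq, stokesField_ne_zero hij ?_, fun A hi hj => ?_⟩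
  · rw [hκ, hr, fourier_checkerboard_apply hij hG]
    refine mul_ne_zero ?_ (mul_ne_zero (by norm_num) (fourier_mul_self_zero_ne_zero hg))
    have h2 := norm_single_add_single_sq hij 4 (-4)
    rw [← single_sub_single] at h2
    rw [h2, Complex.ofReal_ne_zero]
    have := Real.pi_pos
    positivity
  · have hb : isoComp A (checkerboard i j g) = -checkerboard i j g := by
      rw [isoComp_checkerboard i j hi hj, isoComp_of_radial hg]
    refine ⟨isoComp_of_radial hg A, hb, ?_⟩
    have := hκ.isoComp_eq A (c := -1) (by
      rw [isoComp_mul, hb, isoComp_of_radial hg, mul_neg, neg_one_smul])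
    rwa [neg_one_smul] at this

end

section

open SchwartzMap
variable {n : ℕ}

/-! ### The two families of waves -/

/-- Waves in the coordinate directions whose Reynolds stress is `α β e ⊗ e` up to a scalar matrix,
`e` being the coordinate vector with number `i₀`. -/
def drivingWave (σ : Equiv.Perm (Fin n)) (i₀ : Fin n) (α β : 𝓢(Rn n, ℂ)) (k : Fin n) : Wave n :=
  ⟨(((√8)⁻¹ : ℝ) : ℂ) • (if k = i₀ then α + β else α - β), EuclideanSpace.single k 1,
    EuclideanSpace.single (σ k) 1⟩

/-- Waves whose Reynolds stress is a scalar matrix minus `U ⊗ U`. -/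
def compensatingWave (U : Fin n → 𝓢(Rn n, ℂ)) :
    {x : Fin n × Fin n // x.1 ≠ x.2} × Fin 3 → Wave n
  | (x, 0) => ⟨((√n / 2 : ℝ) : ℂ) • U x.1.2, EuclideanSpace.single x.1.1 1,
      EuclideanSpace.single x.1.2 1⟩
  | (x, 1) => ⟨((4⁻¹ : ℝ) : ℂ) • (U x.1.1 + U x.1.2),
      EuclideanSpace.single x.1.1 1 + EuclideanSpace.single x.1.2 (-1),
      EuclideanSpace.single x.1.1 1 + EuclideanSpace.single x.1.2 1⟩
  | (x, 2) => ⟨((4⁻¹ : ℝ) : ℂ) • (U x.1.1 - U x.1.2),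
      EuclideanSpace.single x.1.1 1 + EuclideanSpace.single x.1.2 1,
      EuclideanSpace.single x.1.1 1 + EuclideanSpace.single x.1.2 (-1)⟩

/-- Labels of the compensating waves; waves with parallel wave vectors have different labels. -/
def compensatingLabel (n : ℕ) : {x : Fin n × Fin n // x.1 ≠ x.2} × Fin 3 → ℕ
  | (x, 0) => 1 + (x.1.1 + x.1.2 : ℕ)
  | (x, 1) => 2 * n + 1 + (x.1.1 * n + x.1.2 : ℕ)
  | (x, 2) => 2 * n + 1 + (x.1.1 * n + x.1.2 : ℕ)

theorem drivingWave_isAdmissible {σ : Equiv.Perm (Fin n)} (hσ : ∀ k, σ k ≠ k) (i₀ : Fin n)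
    {α β : 𝓢(Rn n, ℂ)} (hα : IsRealFun α) (hβ : IsRealFun β) {R : ℝ} (bα : BandLimited R α)
    (bβ : BandLimited R β) (k : Fin n) : (drivingWave σ i₀ α β k).IsAdmissible where
  real := by
    refine IsRealFun.smul _ ?_
    split_ifs
    exacts [hα.add hβ, hα.sub hβ]
  band := by
    refine ⟨R, BandLimited.smul _ ?_⟩
    split_ifs
    exacts [bα.add bβ, bα.sub bβ]
  orth := by
    refine Finset.sum_eq_zero fun i _ => ?_
    simp only [drivingWave, PiLp.single_apply]
    rcases eq_or_ne k i with rfl | h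
    · rw [if_neg (hσ k).symm, mul_zero]
    · rw [if_neg h.symm, zero_mul]
  ne_zero := by simp [drivingWave]

theorem norm_single_one (k : Fin n) : 1 ≤ ‖(EuclideanSpace.single k 1 : Rn n)‖ ∧
    ‖(EuclideanSpace.single k 1 : Rn n)‖ ≤ 2 := by
  rw [PiLp.norm_single]; norm_num

theorem norm_pair {i j : Fin n} (h : i ≠ j) {b : ℝ} (hb : b ^ 2 = 1) :
    1 ≤ ‖(EuclideanSpace.single i 1 + EuclideanSpace.single j b : Rn n)‖ ∧
    ‖(EuclideanSpace.single i 1 + EuclideanSpace.single j b : Rn n)‖ ≤ 2 := by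
  have := norm_single_add_single_sq h 1 b
  rw [hb] at this
  constructor <;> nlinarith [norm_nonneg (EuclideanSpace.single i 1 + EuclideanSpace.single j b : Rn n)]

theorem compensatingWave_isAdmissible {U : Fin n → 𝓢(Rn n, ℂ)} (hU : ∀ i, IsRealFun (U i)) {R : ℝ}
    (bU : ∀ i, BandLimited R (U i)) : ∀ x, (compensatingWave U x).IsAdmissible
  | (x, 0) => {
      real := (hU _).smul _
      band := ⟨R, (bU _).smul _⟩
      orth := by
        refine Finset.sum_eq_zero fun i _ => ?_
        simp only [compensatingWave, PiLp.single_apply]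
        rcases eq_or_ne i x.1.1 with rfl | h
        · rw [if_neg x.2, mul_zero]
        · rw [if_neg h, zero_mul]
      ne_zero := by simp [compensatingWave] }
  | (x, 1) => {
      real := ((hU _).add (hU _)).smul _
      band := ⟨R, ((bU _).add (bU _)).smul _⟩
      orth := by
        have hx := x.2
        simp [compensatingWave, PiLp.single_apply, mul_add, Finset.sum_add_distrib, hx,
          hx.symm]
      ne_zero := norm_pos_iff.1 (zero_lt_one.trans_le (norm_pair x.2 (by norm_num)).1) }
  | (x, 2) => {
      real := ((hU _).sub (hU _)).smul _
      band := ⟨R, ((bU _).sub (bU _)).smul _⟩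
      orth := by
        have hx := x.2
        simp [compensatingWave, PiLp.single_apply, mul_add, Finset.sum_add_distrib, hx,
          hx.symm]
      ne_zero := norm_pos_iff.1 (zero_lt_one.trans_le (norm_pair x.2 (by norm_num)).1) }

theorem norm_compensatingWave (U : Fin n → 𝓢(Rn n, ℂ)) :
    ∀ x, 1 ≤ ‖(compensatingWave U x).z‖ ∧ ‖(compensatingWave U x).z‖ ≤ 2
  | (x, 0) => norm_single_one _
  | (x, 1) => norm_pair x.2 (by norm_num)
  | (x, 2) => norm_pair x.2 (by norm_num)

theorem single_nonparallel {i j : Fin n} (h : i ≠ j) :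
    (EuclideanSpace.single i 1 : Rn n) ≠ EuclideanSpace.single j 1 ∧
    (EuclideanSpace.single i 1 : Rn n) ≠ -EuclideanSpace.single j 1 := by
  constructor <;> intro h0
  all_goals
    have := congrArg (fun v : Rn n => v i) h0
    simp [h] at this

theorem pair_nonparallel {i j : Fin n} (h : i ≠ j) :
    (EuclideanSpace.single i 1 + EuclideanSpace.single j 1 : Rn n) ≠
      EuclideanSpace.single i 1 + EuclideanSpace.single j (-1) ∧
    (EuclideanSpace.single i 1 + EuclideanSpace.single j 1 : Rn n) ≠
      -(EuclideanSpace.single i 1 + EuclideanSpace.single j (-1)) := by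
  constructor <;> intro h0
  · have := congrArg (fun v : Rn n => v j) h0
    simp [h.symm] at this
    norm_num at this
  · have := congrArg (fun v : Rn n => v i) h0
    simp [h] at this
    norm_num at this

theorem pair_eq_of_code_eq {x y : {x : Fin n × Fin n // x.1 ≠ x.2}}
    (h : (x.1.1 * n + x.1.2 : ℕ) = y.1.1 * n + y.1.2) : x = y := by
  have hn : 0 < n := x.1.1.pos
  have h1 := congrArg (· % n) h
  have h2 := congrArg (· / n) h
  simp only [Nat.mul_add_mod_of_lt x.1.2.2, Nat.mul_add_mod_of_lt y.1.2.2] at h1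
  simp only [mul_comm _ n, Nat.mul_add_div hn, Nat.div_eq_of_lt x.1.2.2,
    Nat.div_eq_of_lt y.1.2.2, add_zero] at h2
  exact Subtype.ext (Prod.ext (Fin.ext h2) (Fin.ext h1))

/-- Equal labels of the first type together with equal wave vectors determine the pair. The other
two types share an injective code, but their wave vectors `e ± e'` are not parallel. The labels are
chosen to be compatible with the rotation of the plane, which reverses pairs of the first type and
exchanges the other two types. -/
theorem compensatingWave_nonres (U : Fin n → 𝓢(Rn n, ℂ)) : ∀ x y, x ≠ y →
    compensatingLabel n x = compensatingLabel n y →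
    (compensatingWave U x).z ≠ (compensatingWave U y).z ∧
      (compensatingWave U x).z ≠ -(compensatingWave U y).z
  | (x, 0), (y, 0), hxy, ht => by
      refine single_nonparallel fun h => hxy ?_
      simp only [compensatingLabel, h] at ht
      congr 1
      exact Subtype.ext (Prod.ext (Fin.ext (by omega)) h)
  | (x, 1), (y, 1), hxy, ht => absurd (by
      simp only [compensatingLabel] at ht; rw [pair_eq_of_code_eq (x := x) (y := y) (by omega)]) hxy
  | (x, 2), (y, 2), hxy, ht => absurd (by
      simp only [compensatingLabel] at ht; rw [pair_eq_of_code_eq (x := x) (y := y) (by omega)]) hxy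
  | (x, 1), (y, 2), hxy, ht => by
      simp only [compensatingLabel] at ht
      obtain rfl := pair_eq_of_code_eq (x := x) (y := y) (by omega)
      exact pair_nonparallel x.2
  | (x, 2), (y, 1), hxy, ht => by
      simp only [compensatingLabel] at ht
      obtain rfl := pair_eq_of_code_eq (x := x) (y := y) (by omega)
      have h := pair_nonparallel x.2
      exact ⟨h.1.symm, fun h0 => h.2 (by
        change _ = -(compensatingWave U (x, 2)).z
        rw [h0, neg_neg]; rfl)⟩
  | (x, 0), (y, 1), _, ht => by
      have := x.1.1.2; have := x.1.2.2
      simp only [compensatingLabel] at ht; omega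
  | (x, 0), (y, 2), _, ht => by
      have := x.1.1.2; have := x.1.2.2
      simp only [compensatingLabel] at ht; omega
  | (x, 1), (y, 0), _, ht => by
      have := y.1.1.2; have := y.1.2.2
      simp only [compensatingLabel] at ht; omega
  | (x, 2), (y, 0), _, ht => by
      have := y.1.1.2; have := y.1.2.2
      simp only [compensatingLabel] at ht; omega

/-- With amplitude `8 ^ (-1/2)` the coefficients on the diagonal are `(α ± β)² / 4`, and `(α + β)² -
(α - β)² = 4 α β` singles out the entry `i₀`. -/
theorem reynolds_drivingWave (σ : Equiv.Perm (Fin n)) (i₀ : Fin n) (α β : 𝓢(Rn n, ℂ)) :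
    reynolds (drivingWave σ i₀ α β) =
      diagEntry i₀ (α * β) + scalarMatrix ((4⁻¹ : ℂ) • ((α - β) * (α - β))) := by
  have h8 : (((√8)⁻¹ : ℝ) : ℂ) * (((√8)⁻¹ : ℝ) : ℂ) = 8⁻¹ := by
    rw [← Complex.ofReal_mul, ← mul_inv, Real.mul_self_sqrt (by norm_num)]; push_cast; rfl
  push_cast at h8
  funext i k
  ext x
  simp only [reynolds, _root_.sum_apply, Pi.add_apply, _root_.add_apply]
  rw [Finset.sum_eq_single i]
  · simp only [drivingWave, PiLp.single_apply, if_true, _root_.smul_apply, mul_apply, smul_eq_mul]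
    by_cases hik : i = k
    · subst hik
      by_cases hi : i = i₀
      · simp [diagEntry, scalarMatrix, hi]
        linear_combination (2 * (α x + β x) ^ 2) * h8
      · simp [diagEntry, scalarMatrix, hi]
        linear_combination (2 * (α x - β x) ^ 2) * h8
    · have : ¬ (i = i₀ ∧ k = i₀) := fun h => hik (h.1.trans h.2.symm)
      simp [diagEntry, scalarMatrix, Ne.symm hik, hik, this]
  · intro j _ hj
    simp [drivingWave, PiLp.single_apply, Ne.symm hj]
  · simp

theorem sum_offDiag {M : Type*} [AddCommGroup M] (f : Fin n × Fin n → M) :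
    ∑ x : {x : Fin n × Fin n // x.1 ≠ x.2}, f x.1 = ∑ i, ∑ j, f (i, j) - ∑ i, f (i, i) := by
  rw [← Fintype.sum_prod_type', eq_sub_iff_add_eq]
  have h1 := Fintype.sum_subtype_add_sum_subtype (fun x : Fin n × Fin n => x.1 ≠ x.2) f
  rw [← h1]
  congr 1
  refine Finset.sum_bij (fun i _ => ⟨(i, i), by simp⟩) (by simp) (fun a _ b _ h => ?_) ?_ (by simp)
  · simpa using h
  · rintro ⟨⟨a, b⟩, h⟩ -
    simp only [ne_eq, not_not] at h
    exact ⟨a, Finset.mem_univ _, by simp [h]⟩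

/-- The waves along `e ∓ e'` produce the off-diagonal entries through `(u - v)² - (u + v)² = -4 u
v`. The coefficient `n / 2` of the axis waves is the one for which the diagonal, including `u k ^
2`, no longer depends on `k`. -/
theorem compensating_identity (u : Fin n → ℂ) (k l : Fin n) :
    ∑ x : {x : Fin n × Fin n // x.1 ≠ x.2},
      ((if k = x.1.1 then 1 else 0) * (if l = x.1.1 then 1 else 0) * (n / 2 * u x.1.2 ^ 2) +
      ((if k = x.1.1 then 1 else 0) + (if k = x.1.2 then (-1) else 0)) *
        ((if l = x.1.1 then 1 else 0) + (if l = x.1.2 then (-1) else 0)) *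
        (8⁻¹ * (u x.1.1 + u x.1.2) ^ 2) +
      ((if k = x.1.1 then 1 else 0) + (if k = x.1.2 then 1 else 0)) *
        ((if l = x.1.1 then 1 else 0) + (if l = x.1.2 then 1 else 0)) *
        (8⁻¹ * (u x.1.1 - u x.1.2) ^ 2)) + u k * u l =
    if k = l then ((n + 1) / 2) * ∑ i, u i ^ 2 else 0 := by
  rw [sum_offDiag (fun x : Fin n × Fin n =>
      ((if k = x.1 then 1 else 0) * (if l = x.1 then 1 else 0) * (n / 2 * u x.2 ^ 2) +
      ((if k = x.1 then 1 else 0) + (if k = x.2 then (-1) else 0)) *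
        ((if l = x.1 then 1 else 0) + (if l = x.2 then (-1) else 0)) *
        (8⁻¹ * (u x.1 + u x.2) ^ 2) +
      ((if k = x.1 then 1 else 0) + (if k = x.2 then 1 else 0)) *
        ((if l = x.1 then 1 else 0) + (if l = x.2 then 1 else 0)) *
        (8⁻¹ * (u x.1 - u x.2) ^ 2)))]
  set d : Fin n → Fin n → ℂ := fun a b => if a = b then 1 else 0 with hd
  have hd1 : ∀ a b, (if a = b then (1 : ℂ) else 0) = d a b := fun a b => rfl
  have hd2 : ∀ a b, (if a = b then (-1 : ℂ) else 0) = -d a b := fun a b => by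
    simp only [hd]; split_ifs <;> simp
  have hsum : ∀ (a : Fin n) (f : Fin n → ℂ), ∑ i, d a i * f i = f a := fun a f => by
    simp [hd, ite_mul]
  have hdiag : ∀ i, (d k i * d l i * (n / 2 * u i ^ 2) +
      (d k i + -d k i) * (d l i + -d l i) * (8⁻¹ * (u i + u i) ^ 2) +
      (d k i + d k i) * (d l i + d l i) * (8⁻¹ * (u i - u i) ^ 2)) =
      d k i * (d l i * (n / 2 * u i ^ 2)) := fun i => by ring
  have hoff : ∀ i j, (d k i * d l i * (n / 2 * u j ^ 2) +
      (d k i + -d k j) * (d l i + -d l j) * (8⁻¹ * (u i + u j) ^ 2) +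
      (d k i + d k j) * (d l i + d l j) * (8⁻¹ * (u i - u j) ^ 2)) =
      d k i * (d l i * ((n / 2 + 4⁻¹) * u j ^ 2 + 4⁻¹ * u i ^ 2)) +
      d k j * (d l j * (4⁻¹ * u i ^ 2 + 4⁻¹ * u j ^ 2))
      - 2⁻¹ * ((d k i * u i) * (d l j * u j)) - 2⁻¹ * ((d l i * u i) * (d k j * u j)) :=
    fun i j => by ring
  simp only [hd1, hd2, hdiag, hoff]
  simp only [Finset.sum_add_distrib, Finset.sum_sub_distrib, ← Finset.mul_sum, hsum,
    Finset.sum_const, Finset.card_univ, Fintype.card_fin, nsmul_eq_mul]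
  rw [← Finset.sum_mul, hsum, ← Finset.sum_mul, hsum]
  have hlk : d l k = if k = l then 1 else 0 := by simp [hd, eq_comm]
  rw [hlk]
  split_ifs with h
  · subst h; ring
  · ring

theorem reynolds_compensatingWave (U : Fin n → 𝓢(Rn n, ℂ)) :
    reynolds (compensatingWave U) + tensor U U =
      scalarMatrix ((((n : ℂ) + 1) / 2) • ∑ i, U i * U i) := by
  funext k l
  ext x
  have h := compensating_identity (fun i => U i x) k l
  have hr : (scalarMatrix ((((n : ℂ) + 1) / 2) • ∑ i, U i * U i) k l) x =
      if k = l then (((n : ℂ) + 1) / 2) * ∑ i, U i x ^ 2 else 0 := by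
    simp only [scalarMatrix]
    split_ifs
    · rw [_root_.smul_apply, _root_.sum_apply, smul_eq_mul]
      simp only [mul_apply, pow_two]
    · rfl
  rw [hr, ← h]
  simp only [Pi.add_apply, _root_.add_apply, tensor, mul_apply, reynolds, Fintype.sum_prod_type,
    _root_.sum_apply, Fin.sum_univ_three]
  congr 1
  refine Finset.sum_congr rfl fun y _ => ?_
  simp only [compensatingWave, _root_.smul_apply, mul_apply, _root_.add_apply, _root_.sub_apply,
    smul_eq_mul, PiLp.add_apply, PiLp.single_apply]
  have hc : ∀ (P : Prop) [Decidable P] (a b : ℝ), ((if P then a else b : ℝ) : ℂ) =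
      if P then (a : ℂ) else b := fun P _ a b => by split_ifs <;> rfl
  push_cast [hc]
  have hn' : ((√n : ℝ) : ℂ) * ((√n : ℝ) : ℂ) = n := by
    rw [← Complex.ofReal_mul, Real.mul_self_sqrt (by positivity)]; simp
  linear_combination (2⁻¹ * (if k = y.1.1 then 1 else 0) * (if l = y.1.1 then 1 else 0) *
    U y.1.2 x ^ 2) * hn'

end

section

open SchwartzMap
variable {n : ℕ}

/-! ### The plane -/

/-- The rotation of the plane by a right angle. -/
def quarterTurn : Rn 2 ≃ₗᵢ[ℝ] Rn 2 where
  toFun x := !₂[-x 1, x 0]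
  invFun x := !₂[x 1, -x 0]
  map_add' x y := by ext i; fin_cases i <;> simp; ring
  map_smul' c x := by ext i; fin_cases i <;> simp
  left_inv x := by ext i; fin_cases i <;> simp
  right_inv x := by ext i; fin_cases i <;> simp
  norm_map' x := by
    rw [← sq_eq_sq₀ (norm_nonneg _) (norm_nonneg _), EuclideanSpace.norm_sq_eq,
      EuclideanSpace.norm_sq_eq]
    simp [Fin.sum_univ_two, add_comm]

@[simp] theorem quarterTurn_zero (x : Rn 2) : quarterTurn x 0 = -x 1 := rfl
@[simp] theorem quarterTurn_one (x : Rn 2) : quarterTurn x 1 = x 0 := rfl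

theorem quarterTurn_single_zero (c : ℝ) :
    quarterTurn (EuclideanSpace.single 0 c) = EuclideanSpace.single 1 c := by
  ext i; fin_cases i <;> simp

theorem quarterTurn_single_one (c : ℝ) :
    quarterTurn (EuclideanSpace.single 1 c) = -EuclideanSpace.single 0 c := by
  ext i; fin_cases i <;> simp

theorem isoComp_pd_zero (f : 𝓢(Rn 2, ℂ)) :
    isoComp quarterTurn (pd 0 f) = -pd 1 (isoComp quarterTurn f) := by
  rw [← neg_one_smul ℂ]
  apply fourier_ext; intro ξ
  rw [FourierTransform.fourier_smul, _root_.smul_apply, fourier_isoComp, fourier_pd, fourier_pd,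
    fourier_isoComp, quarterTurn_zero, smul_eq_mul]
  push_cast; ring

theorem isoComp_pd_one (f : 𝓢(Rn 2, ℂ)) :
    isoComp quarterTurn (pd 1 f) = pd 0 (isoComp quarterTurn f) := by
  apply fourier_ext; intro ξ
  rw [fourier_isoComp, fourier_pd, fourier_pd, fourier_isoComp, quarterTurn_one]

theorem integralCLM_isoComp (A : Rn n ≃ₗᵢ[ℝ] Rn n) (f : 𝓢(Rn n, ℂ)) :
    integralCLM ℂ volume (isoComp A f) = integralCLM ℂ volume f := by
  rw [integralCLM_apply, integralCLM_apply]
  exact A.measurePreserving.integral_comp A.toHomeomorph.measurableEmbedding f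

theorem integral_deviator_eq_zero {Q : Fin 2 → Fin 2 → 𝓢(Rn 2, ℂ)}
    (h0 : integralCLM ℂ volume (Q 0 0) = integralCLM ℂ volume (Q 1 1))
    (h1 : integralCLM ℂ volume (Q 0 1) = 0) (h2 : integralCLM ℂ volume (Q 1 0) = 0) (i k : Fin 2) :
    ∫ x, (Q i k - if i = k then ((2 : ℕ) : ℂ)⁻¹ • ∑ l, Q l l else 0) x = 0 := by
  rw [← integralCLM_apply (𝕜 := ℂ), map_sub, Fin.sum_univ_two]
  have h3 : integralCLM ℂ volume (((2 : ℕ) : ℂ)⁻¹ • (Q 0 0 + Q 1 1)) =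
      integralCLM ℂ volume (Q 1 1) := by
    rw [map_smul, map_add, h0, smul_eq_mul]; push_cast; ring
  fin_cases i <;> fin_cases k
  · exact sub_eq_zero.2 (h0.trans h3.symm)
  · exact (congrArg₂ (· - ·) h1 (map_zero _)).trans (sub_zero 0)
  · exact (congrArg₂ (· - ·) h2 (map_zero _)).trans (sub_zero 0)
  · exact sub_eq_zero.2 h3.symm

/-- The hypothesis holds if polarization and wave vector are orthogonal and of equal length. In the
plane the corrector is then `± (i / 2π)` times the rotated gradient of the amplitude, whatever the
direction of the wave. -/
theorem corrector_plane (w : Wave 2)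
    (hw : (w.z 0 * w.ξ 1 - w.ξ 0 * w.z 1) ^ 2 = (‖w.z‖ ^ 2) ^ 2) (h0 : w.z ≠ 0) :
    w.corrector 0 * w.corrector 0 = (-(4 * (Real.pi : ℂ) ^ 2)⁻¹) • (pd 1 w.a * pd 1 w.a) ∧
    w.corrector 0 * w.corrector 1 = ((4 * (Real.pi : ℂ) ^ 2)⁻¹) • (pd 0 w.a * pd 1 w.a) ∧
    w.corrector 1 * w.corrector 1 = (-(4 * (Real.pi : ℂ) ^ 2)⁻¹) • (pd 0 w.a * pd 0 w.a) := by
  set c : ℂ := Complex.I / (2 * Real.pi * (‖w.z‖ ^ 2 : ℝ)) with hc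
  set d : ℂ := ((w.z 0 * w.ξ 1 - w.ξ 0 * w.z 1 : ℝ) : ℂ) with hd
  have hpi : (Real.pi : ℂ) ≠ 0 := by exact_mod_cast Real.pi_ne_zero
  have hz : ((‖w.z‖ ^ 2 : ℝ) : ℂ) ≠ 0 := by
    rw [Complex.ofReal_ne_zero]; exact pow_ne_zero _ (norm_ne_zero_iff.2 h0)
  have hcd : (c * d) ^ 2 = -(4 * (Real.pi : ℂ) ^ 2)⁻¹ := by
    have hd2 : d ^ 2 = ((‖w.z‖ ^ 2 : ℝ) : ℂ) ^ 2 := by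
      rw [hd]; exact_mod_cast hw
    rw [mul_pow, hd2, hc, div_pow, Complex.I_sq]
    field_simp
    norm_num
  have e0 : w.corrector 0 = (c * d) • pd 1 w.a := by
    ext x
    simp only [Wave.corrector, dirDeriv, Fin.sum_univ_two, _root_.smul_apply, _root_.add_apply,
      _root_.sub_apply, smul_eq_mul, hd, ← hc]
    push_cast; ring
  have e1 : w.corrector 1 = (-(c * d)) • pd 0 w.a := by
    ext x
    simp only [Wave.corrector, dirDeriv, Fin.sum_univ_two, _root_.smul_apply, _root_.add_apply,
      _root_.sub_apply, smul_eq_mul, hd, ← hc]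
    push_cast; ring
  rw [e0, e1]
  simp only [smul_mul_assoc, mul_smul_comm, smul_smul]
  refine ⟨?_, ?_, ?_⟩
  · rw [← hcd, pow_two]
  · rw [mul_comm (pd 1 w.a)]
    congr 1
    linear_combination -hcd
  · rw [← hcd]; congr 1; ring

/-- The rotation permutes the amplitudes, up to signs to which quadratic expressions are blind, and
preserves the weights. It exchanges the two diagonal means and reverses the off-diagonal one, so the
mean of the total stress is a scalar matrix. -/
theorem correctorStress_dup_mean {ι : Type*} [Fintype ι] {K : ℕ} {τ : ι → ℕ} {v : ι → Wave 2}
    (hv : ∀ a, ((v a).z 0 * (v a).ξ 1 - (v a).ξ 0 * (v a).z 1) ^ 2 = (‖(v a).z‖ ^ 2) ^ 2)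
    (h0 : ∀ a, (v a).z ≠ 0) (π : Equiv.Perm ι) (hτ : ∀ a, τ (π a) = τ a)
    (hπ : ∀ a, isoComp quarterTurn (v a).a = (v (π a)).a ∨
      isoComp quarterTurn (v a).a = -(v (π a)).a) (i k : Fin 2) :
    ∫ x, (correctorStress (dup K τ v) i k - if i = k then ((2 : ℕ) : ℂ)⁻¹ •
      ∑ l, correctorStress (dup K τ v) l l else 0) x = 0 := by
  set M : ι → Fin 2 → Fin 2 → ℂ := fun a i k =>
    integralCLM ℂ volume (pd i (v a).a * pd k (v a).a) with hM
  have hM' : ∀ a, M (π a) 0 0 = M a 1 1 ∧ M (π a) 1 1 = M a 0 0 ∧ M (π a) 0 1 = -M a 0 1 := by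
    intro a
    have h : ∀ i k, pd i (v (π a)).a * pd k (v (π a)).a =
        pd i (isoComp quarterTurn (v a).a) * pd k (isoComp quarterTurn (v a).a) := fun i k => by
      rcases hπ a with h | h <;> rw [h]
      rw [pd_neg, pd_neg, neg_mul_neg]
    have e0 := isoComp_pd_one (v a).a
    have e1 := (neg_eq_iff_eq_neg.2 (isoComp_pd_zero (v a).a)).symm
    simp only [hM, h, ← e0, e1]
    refine ⟨?_, ?_, ?_⟩
    · rw [← isoComp_mul, integralCLM_isoComp]
    · rw [neg_mul_neg, ← isoComp_mul, integralCLM_isoComp]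
    · rw [mul_neg, ← isoComp_mul, map_neg, integralCLM_isoComp, mul_comm]
  have hI : ∀ i k, integralCLM ℂ volume (correctorStress (dup K τ v) i k) =
      ∑ a, (dupWeight K (τ a) : ℂ) *
        integralCLM ℂ volume ((v a).corrector i * (v a).corrector k) := fun i k => by
    rw [correctorStress_dup, map_sum]
    exact Finset.sum_congr rfl fun a _ => by rw [map_smul, smul_eq_mul]
  have hc := fun a => corrector_plane (v a) (hv a) (h0 a)
  have h01 : integralCLM ℂ volume (correctorStress (dup K τ v) 0 1) = 0 := by
    have e : ∀ a, integralCLM ℂ volume ((v a).corrector 0 * (v a).corrector 1) =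
      (4 * (Real.pi : ℂ) ^ 2)⁻¹ * M a 0 1 := fun a => by
      rw [(hc a).2.1, map_smul, smul_eq_mul]
    rw [hI]
    simp only [e]
    have h1 := Equiv.sum_comp π fun a => (dupWeight K (τ a) : ℂ) * ((4 * (Real.pi : ℂ) ^ 2)⁻¹ * M a 0 1)
    simp only [hτ, (hM' _).2.2, mul_neg, Finset.sum_neg_distrib] at h1
    exact self_eq_neg.1 h1.symm
  refine integral_deviator_eq_zero ?_ h01 ?_ i k
  · have e0 : ∀ a, integralCLM ℂ volume ((v a).corrector 0 * (v a).corrector 0) =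
      -(4 * (Real.pi : ℂ) ^ 2)⁻¹ * M a 1 1 := fun a => by
      rw [(hc a).1, map_smul, smul_eq_mul]
    have e1 : ∀ a, integralCLM ℂ volume ((v a).corrector 1 * (v a).corrector 1) =
      -(4 * (Real.pi : ℂ) ^ 2)⁻¹ * M a 0 0 := fun a => by
      rw [(hc a).2.2, map_smul, smul_eq_mul]
    rw [hI, hI]
    simp only [e0, e1]
    have h1 := Equiv.sum_comp π fun a => (dupWeight K (τ a) : ℂ) * (-(4 * (Real.pi : ℂ) ^ 2)⁻¹ * M a 0 0)
    simp only [hτ, (hM' _).1] at h1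
    exact h1
  · rw [← h01]
    congr 1
    simp only [correctorStress, mul_comm]

theorem exists_bandLimited_correctorStress {ι : Type*} [Fintype ι] {w : ι → Wave n}
    (hw : ∀ a, (w a).IsAdmissible) : ∃ R, ∀ i k, BandLimited R (correctorStress w i k) := by
  choose R hR using fun a => (w a).exists_band (hw a)
  refine ⟨∑ a, |R a + R a|, fun i k => BandLimited.sum fun a _ =>
    BandLimited.mono (((hR a i).2).mul ((hR a k).2)) ((le_abs_self _).trans
      (Finset.single_le_sum (f := fun a => |R a + R a|) (fun _ _ => abs_nonneg _)
        (Finset.mem_univ a)))⟩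

theorem stokesField_plane {κ : 𝓢(Rn 2, ℂ)} (h : isoComp quarterTurn κ = -κ) :
    isoComp quarterTurn (stokesField 0 κ 0) = -stokesField 0 κ 1 ∧
    isoComp quarterTurn (stokesField 0 κ 1) = stokesField 0 κ 0 := by
  have e0 : stokesField 0 κ 0 = pd 0 (pd 1 (pd 1 κ)) := by
    rw [stokesField, if_pos rfl, ← pd_laplacian, laplacian_eq_sum_pd, Fin.sum_univ_two, pd_add]
    abel
  have e1 : stokesField 0 κ 1 = -pd 1 (pd 0 (pd 0 κ)) := by
    rw [stokesField, if_neg (by decide), zero_sub]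
  rw [e0, e1]
  simp only [isoComp_neg, isoComp_pd_zero, isoComp_pd_one, h, pd_neg, neg_neg]
  exact ⟨trivial, trivial⟩

end

/-! ### Vanishing means in the plane, and the case of waves. -/

section

open SchwartzMap
variable {n : ℕ}

/-- The rotation fixes `α` and reverses `β`, so it exchanges the amplitudes `α + β` and `α - β` of
the two waves. -/
theorem drivingWave_mean {σ : Equiv.Perm (Fin 2)} (hσ : ∀ k, σ k ≠ k) {α β : 𝓢(Rn 2, ℂ)}
    (hα : isoComp quarterTurn α = α) (hβ : isoComp quarterTurn β = -β) {K : ℕ} (i k : Fin 2) :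
    ∫ x, (correctorStress (dup K (fun _ => 0) (drivingWave σ 0 α β)) i k -
      if i = k then ((2 : ℕ) : ℂ)⁻¹ •
        ∑ l, correctorStress (dup K (fun _ => 0) (drivingWave σ 0 α β)) l l else 0) x = 0 := by
  have h0 : σ 0 = 1 := Fin.eq_one_of_ne_zero _ (hσ 0)
  have h1 : σ 1 = 0 := by
    have := hσ 1
    omega
  refine correctorStress_dup_mean (fun a => ?_) (fun a => by simp [drivingWave]) (Equiv.swap 0 1)
    (fun _ => rfl) (fun a => Or.inl ?_) i k
  · fin_cases a <;> simp [drivingWave, h0, h1]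
  · fin_cases a
    · simp only [drivingWave, isoComp_smul]
      simp [isoComp_add, hα, hβ, sub_eq_add_neg]
    · simp only [drivingWave, isoComp_smul]
      simp [isoComp_sub, hα, hβ]

/-- The symmetry of the labels which corresponds to a rotation by a right angle. -/
def turnLabel : {x : Fin 2 × Fin 2 // x.1 ≠ x.2} × Fin 3 → {x : Fin 2 × Fin 2 // x.1 ≠ x.2} × Fin 3
  | (x, 0) => (⟨(x.1.2, x.1.1), x.2.symm⟩, 0)
  | (x, 1) => (x, 2)
  | (x, 2) => (x, 1)

theorem turnLabel_involutive : Function.Involutive turnLabel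
  | (_, 0) => rfl
  | (_, 1) => rfl
  | (_, 2) => rfl

theorem compensatingLabel_turnLabel :
    ∀ x, compensatingLabel 2 (turnLabel x) = compensatingLabel 2 x
  | (x, 0) => by simp only [turnLabel, compensatingLabel]; omega
  | (_, 1) => rfl
  | (_, 2) => rfl

theorem pair_plane {x : Fin 2 × Fin 2} (h : x.1 ≠ x.2) : x = (0, 1) ∨ x = (1, 0) := by
  decide +revert

theorem compensatingWave_plane (U : Fin 2 → 𝓢(Rn 2, ℂ)) : ∀ x,
    ((compensatingWave U x).z 0 * (compensatingWave U x).ξ 1 -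
      (compensatingWave U x).ξ 0 * (compensatingWave U x).z 1) ^ 2 =
      (‖(compensatingWave U x).z‖ ^ 2) ^ 2
  | (⟨x, hx⟩, 0) => by
      rcases pair_plane hx with rfl | rfl <;> simp [compensatingWave]
  | (⟨x, hx⟩, 1) => by
      simp only [compensatingWave, norm_single_add_single_sq hx]
      rcases pair_plane hx with rfl | rfl <;> simp <;> norm_num
  | (⟨x, hx⟩, 2) => by
      simp only [compensatingWave, norm_single_add_single_sq hx]
      rcases pair_plane hx with rfl | rfl <;> simp <;> norm_num

/-- The rotation exchanges the components of `U` up to sign, hence also their sum and difference;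
pairs of the first type are reversed. -/
theorem compensatingWave_turn {U : Fin 2 → 𝓢(Rn 2, ℂ)} (h0 : isoComp quarterTurn (U 0) = -U 1)
    (h1 : isoComp quarterTurn (U 1) = U 0) : ∀ x,
    isoComp quarterTurn (compensatingWave U x).a = (compensatingWave U (turnLabel x)).a ∨
      isoComp quarterTurn (compensatingWave U x).a = -(compensatingWave U (turnLabel x)).a
  | (⟨x, hx⟩, 0) => by
      simp only [compensatingWave, turnLabel, isoComp_smul]
      rcases pair_plane hx with rfl | rfl
      · left; simp only [h1]
      · right; simp only [h0, smul_neg]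
  | (⟨x, hx⟩, 1) => by
      simp only [compensatingWave, turnLabel, isoComp_smul, isoComp_add]
      rcases pair_plane hx with rfl | rfl
      · left; simp only [h0, h1]; congr 1; abel
      · right; simp only [h0, h1]; rw [← smul_neg]; congr 1; abel
  | (⟨x, hx⟩, 2) => by
      simp only [compensatingWave, turnLabel, isoComp_smul, isoComp_sub]
      rcases pair_plane hx with rfl | rfl
      · right; simp only [h0, h1]; rw [← smul_neg]; congr 1; abel
      · left; simp only [h0, h1]; congr 1; abel

theorem compensatingWave_mean {U : Fin 2 → 𝓢(Rn 2, ℂ)} (h0 : isoComp quarterTurn (U 0) = -U 1)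
    (h1 : isoComp quarterTurn (U 1) = U 0) {K : ℕ} (i k : Fin 2) :
    ∫ x, (correctorStress (dup K (compensatingLabel 2) (compensatingWave U)) i k -
      if i = k then ((2 : ℕ) : ℂ)⁻¹ •
        ∑ l, correctorStress (dup K (compensatingLabel 2) (compensatingWave U)) l l else 0) x = 0 :=
  correctorStress_dup_mean (compensatingWave_plane U)
    (fun x => norm_pos_iff.1 (zero_lt_one.trans_le (norm_compensatingWave U x).1))
    turnLabel_involutive.toPerm compensatingLabel_turnLabel (compensatingWave_turn h0 h1) i k

/-- Near zero frequency the series has exponent `n - 2`, positive for `n ≥ 3`. In the plane the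
vanishing mean raises it to `n - 1 = 1`. -/
theorem besovNorm_correctorStress_lt_top (hn : 2 ≤ n) {φ₀ : 𝓢(Rn n, ℂ)} (h : IsLittlewoodPaley φ₀)
    {p q : ℝ≥0∞} (hp : 1 ≤ p) (hq : 1 ≤ q) {ι : Type*} [Fintype ι] {w : ι → Wave n}
    (hw : ∀ a, (w a).IsAdmissible) (hmean : n = 2 → ∀ i k, ∫ x, (correctorStress w i k -
      if i = k then (n : ℂ)⁻¹ • ∑ l, correctorStress w l l else 0) x = 0) :
    besovNorm φ₀ (overExponent n p - 3) p q (toDist (deviatorDiv (correctorStress w))) < ∞ := by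
  obtain ⟨R, hR⟩ := exists_bandLimited_correctorStress hw
  refine besovNorm_deviatorDiv_lt_top h hp hq hR ?_
  have hn' : (2 : ℝ) ≤ n := by exact_mod_cast hn
  rcases eq_or_lt_of_le hn with h2 | h3
  · exact Or.inr ⟨by linarith, hmean h2.symm⟩
  · have : (3 : ℝ) ≤ n := by exact_mod_cast h3
    exact Or.inl (by linarith)

theorem exists_perm_ne (hn : 2 ≤ n) : ∃ σ : Equiv.Perm (Fin n), ∀ k, σ k ≠ k := by
  obtain ⟨m, rfl⟩ := Nat.exists_eq_add_of_le' hn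
  refine ⟨finRotate (m + 2), fun k h => ?_⟩
  rw [finRotate_apply] at h
  simp at h

/-- One construction covers both cases. For `n/p < 1` a single copy of each wave (`K = 1`) suffices;
for `n/p = 1` the number `K` is taken large depending on `δ`, which is why the wave system may vary
with `δ` while `U` does not. -/
theorem hasStaticPairs_of_overExponent_le_one (hn : 2 ≤ n) {φ₀ : 𝓢(Rn n, ℂ)}
    (h : IsLittlewoodPaley φ₀) {p q : ℝ≥0∞} (hp : 1 ≤ p) (hq : 1 ≤ q)
    (hs : overExponent n p < 1 ∨ overExponent n p = 1 ∧ 2 < q) : HasStaticPairs n p q φ₀ := by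
  have hij : (⟨0, by omega⟩ : Fin n) ≠ ⟨1, by omega⟩ := by simp
  obtain ⟨α, β, κ, hα, hβ, hκ, ⟨Rα, bα⟩, ⟨Rβ, bβ⟩, sκ, hΔ, hne, hrot⟩ := exists_profiles hij
  obtain ⟨σ, hσ⟩ := exists_perm_ne hn
  set i₀ : Fin n := ⟨0, by omega⟩ with hi₀
  set U := stokesField i₀ κ with hU
  have sU : ∀ i, AnnularSpectrum (U i) := sκ.stokesField i₀
  have rU : ∀ i, IsRealFun (U i) := hκ.stokesField i₀
  obtain ⟨RU, bU⟩ : ∃ R, ∀ i, BandLimited R (U i) := by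
    choose R hR using fun i => (sU i).exists_bandLimited
    exact ⟨∑ i, |R i|, fun i => (hR i).mono ((le_abs_self _).trans
      (Finset.single_le_sum (f := fun i => |R i|) (fun _ _ => abs_nonneg _) (Finset.mem_univ i)))⟩
  have adm₁ := drivingWave_isAdmissible hσ i₀ hα hβ (bα.mono (le_max_left Rα Rβ))
    (bβ.mono (le_max_right Rα Rβ))
  have adm₂ := compensatingWave_isAdmissible rU bU
  have hn0 : 0 < n := by omega
  refine hasStaticPairs_of_waves hn0 h hp hq (by rcases hs with hs | ⟨hs, -⟩ <;> linarith) rU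
    (fieldDiv_stokesField i₀ κ) sU (D := diagEntry i₀ (α * β)) (fun i k => ?_)
    (stokesField_eq i₀ hΔ) hne fun δ hδ => ?_
  · rw [diagEntry]
    split_ifs
    exacts [hα.mul hβ, isRealFun_zero]
  have hsys : ∀ K : ℕ, 0 < K → IsWaveSystem φ₀ p q U (diagEntry i₀ (α * β))
      (dup K (fun _ => 0) (drivingWave σ i₀ α β))
      (dup K (compensatingLabel n) (compensatingWave U)) := fun K hK =>
    { adm₁ := dup_isAdmissible adm₁
      adm₂ := dup_isAdmissible adm₂
      nonres₁ := dup_nonres (fun a => norm_single_one _) fun a b hab _ =>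
        single_nonparallel (σ.injective.ne hab)
      nonres₂ := dup_nonres (norm_compensatingWave U) (compensatingWave_nonres U)
      nonres := dup_nonres_dup (fun a => norm_single_one _) (norm_compensatingWave U) fun a b => by
        obtain ⟨x, t⟩ := b
        fin_cases t <;> simp only [compensatingLabel] <;> omega
      stress₁ := ⟨_, (reynolds_dup hK).trans (reynolds_drivingWave σ i₀ α β)⟩
      stress₂ := ⟨_, by rw [reynolds_dup hK, reynolds_compensatingWave U]⟩
      corrector₁ := besovNorm_correctorStress_lt_top hn h hp hq (dup_isAdmissible adm₁) fun h2 => by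
        subst h2
        obtain ⟨h1, h2, -⟩ := hrot quarterTurn (quarterTurn_single_zero 4)
          (quarterTurn_single_one 4)
        exact drivingWave_mean hσ h1 h2
      corrector₂ := besovNorm_correctorStress_lt_top hn h hp hq (dup_isAdmissible adm₂) fun h2 => by
        subst h2
        obtain ⟨-, -, h3⟩ := hrot quarterTurn (quarterTurn_single_zero 4) (quarterTurn_single_one 4)
        exact compensatingWave_mean (stokesField_plane h3).1 (stokesField_plane h3).2 }
  rcases hs with hs | ⟨hs, hq2⟩
  · exact ⟨_, _, _, _, _, _, hsys 1 one_pos,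
      (eventually_smallVelocity (dup_isAdmissible adm₁) h hp hq hs hδ).and
      (eventually_smallVelocity (dup_isAdmissible adm₂) h hp hq hs hδ)⟩
  · obtain ⟨K, hK, h1, h2⟩ := ((eventually_gt_atTop 0).and
      ((eventually_smallVelocity_dup adm₁ h hp hq hs hq2 hδ (fun _ => 0)).and
      (eventually_smallVelocity_dup adm₂ h hp hq hs hq2 hδ (compensatingLabel n)))).exists
    exact ⟨_, _, _, _, _, _, hsys K hK, h1.and h2⟩

end

section

open SchwartzMap
variable {n : ℕ}

/-! ### Dilations -/

theorem dil_add (m : ℤ) (f g : 𝓢(Rn n, ℂ)) : dil m (f + g) = dil m f + dil m g := rfl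
theorem dil_sub (m : ℤ) (f g : 𝓢(Rn n, ℂ)) : dil m (f - g) = dil m f - dil m g := rfl
theorem dil_smul (m : ℤ) (c : ℂ) (f : 𝓢(Rn n, ℂ)) : dil m (c • f) = c • dil m f := rfl
theorem dil_neg (m : ℤ) (f : 𝓢(Rn n, ℂ)) : dil m (-f) = -dil m f := rfl
theorem dil_sum {ι : Type*} (m : ℤ) (s : Finset ι) (f : ι → 𝓢(Rn n, ℂ)) :
    dil m (∑ a ∈ s, f a) = ∑ a ∈ s, dil m (f a) := by
  ext x; simp [_root_.sum_apply]
theorem dil_mul (m : ℤ) (f g : 𝓢(Rn n, ℂ)) : dil m (f * g) = dil m f * dil m g := by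
  ext x; simp
theorem isoComp_dil (A : Rn n ≃ₗᵢ[ℝ] Rn n) (m : ℤ) (f : 𝓢(Rn n, ℂ)) :
    isoComp A (dil m f) = dil m (isoComp A f) := by
  ext x; simp

theorem IsRealFun.dil {f : 𝓢(Rn n, ℂ)} (hf : IsRealFun f) (m : ℤ) : IsRealFun (dil m f) :=
  fun _ => hf _

theorem pd_dil (i : Fin n) (m : ℤ) (f : 𝓢(Rn n, ℂ)) :
    pd i (dil m f) = (2 : ℂ) ^ m • dil m (pd i f) := by
  apply fourier_ext; intro ξ
  have h2 : ((2 : ℂ) ^ m) * (2 : ℂ) ^ (-m) = 1 := by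
    rw [zpow_neg, mul_inv_cancel₀ (zpow_ne_zero _ two_ne_zero)]
  rw [FourierTransform.fourier_smul, _root_.smul_apply, fourier_pd, fourier_dil, fourier_dil,
    fourier_pd, PiLp.smul_apply, smul_eq_mul, smul_eq_mul]
  push_cast
  linear_combination (-(2 * Real.pi * Complex.I * (ξ i : ℂ) * (((2 : ℂ) ^ m)⁻¹ ^ n) *
    𝓕 f ((2 : ℝ) ^ (-m) • ξ))) * h2

theorem laplacian_dil (m : ℤ) (f : 𝓢(Rn n, ℂ)) :
    Δ (dil m f) = ((2 : ℂ) ^ m) ^ 2 • dil m (Δ f) := by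
  simp only [laplacian_eq_sum_pd, pd_dil, pd_smul, dil_sum, Finset.smul_sum, smul_smul, pow_two]

theorem norm_two_zpow_smul (m : ℤ) (ξ : Rn n) : ‖(2 : ℝ) ^ m • ξ‖ = (2 : ℝ) ^ m * ‖ξ‖ := by
  rw [norm_smul, Real.norm_of_nonneg (by positivity)]

theorem BandLimited.dil {R : ℝ} {f : 𝓢(Rn n, ℂ)} (hf : BandLimited R f) (m : ℤ) :
    BandLimited ((2 : ℝ) ^ m * R) (dil m f) := fun ξ hξ => by
  rw [fourier_dil, hf, mul_zero]
  rw [norm_two_zpow_smul, zpow_neg, lt_inv_mul_iff₀ (by positivity)]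
  exact hξ

theorem HighPass.dil {R : ℝ} {f : 𝓢(Rn n, ℂ)} (hf : HighPass R f) (m : ℤ) :
    HighPass ((2 : ℝ) ^ m * R) (dil m f) := fun ξ hξ => by
  rw [fourier_dil, hf, mul_zero]
  rw [norm_two_zpow_smul, zpow_neg, inv_mul_lt_iff₀ (by positivity)]
  exact hξ

theorem AnnularSpectrum.dil {f : 𝓢(Rn n, ℂ)} (hf : AnnularSpectrum f) (m : ℤ) :
    AnnularSpectrum (dil m f) := by
  obtain ⟨⟨r, hr, h1⟩, R, h2⟩ := hf
  exact ⟨⟨_, by positivity, h1.dil m⟩, _, h2.dil m⟩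

theorem enorm_two_zpow (m : ℤ) : ‖(2 : ℂ) ^ m‖ₑ = ENNReal.ofReal ((2 : ℝ) ^ (m : ℝ)) := by
  rw [← ofReal_norm, norm_zpow, Complex.norm_two, Real.rpow_intCast]

theorem kblock_dil (ψ : 𝓢(Rn n, ℂ)) (j m : ℤ) (f : 𝓢(Rn n, ℂ)) :
    kblock ψ (j + m) (dil m f) = dil m (kblock ψ j f) := (dil_kblock ψ j m f).symm

theorem scalarBesov_dil (φ₀ : 𝓢(Rn n, ℂ)) (s : ℝ) (p : ℝ≥0∞) (m : ℤ) (f : 𝓢(Rn n, ℂ)) :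
    scalarBesov φ₀ s p 1 (dil m f) =
      ENNReal.ofReal ((2 : ℝ) ^ ((s - overExponent n p) * (m : ℝ))) * scalarBesov φ₀ s p 1 f := by
  rw [scalarBesov, scalarBesov, lqNorm_one, lqNorm_one, ← ENNReal.tsum_mul_left,
    ← (Equiv.addRight m).tsum_eq]
  congr 1; ext j
  rw [Equiv.coe_addRight, kblock_dil, eLpNorm_dil, ← mul_assoc, ← mul_assoc, ofReal_two_rpow_mul,
    ofReal_two_rpow_mul]
  congr 3
  push_cast; ring

theorem firstMoment_mul_le (f g : 𝓢(Rn n, ℂ)) :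
    firstMoment (f * g) ≤ firstMoment f * eLpNorm g ∞ volume := by
  rw [firstMoment, firstMoment, ← lintegral_mul_const' _ _ (eLpNorm_schwartz_ne_top g ∞)]
  refine lintegral_mono_ae ?_
  have h := ae_le_eLpNormEssSup (f := g) (μ := volume)
  filter_upwards [h] with y hy
  rw [mul_apply, enorm_mul, ← mul_assoc, eLpNorm_exponent_top]
  gcongr

/-- The scaling of velocity fields which leaves the Navier-Stokes equations invariant. -/
def velocityScale (m : ℤ) (f : 𝓢(Rn n, ℂ)) : 𝓢(Rn n, ℂ) := (2 : ℂ) ^ m • dil m f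

/-- The scaling of stresses which leaves the Navier-Stokes equations invariant. -/
def stressScale (m : ℤ) (f : 𝓢(Rn n, ℂ)) : 𝓢(Rn n, ℂ) := ((2 : ℂ) ^ m) ^ 2 • dil m f

theorem velocityScale_zero (f : 𝓢(Rn n, ℂ)) : velocityScale 0 f = f := by
  rw [velocityScale, dil_zero, zpow_zero, one_smul]

theorem velocityScale_mul (m m' : ℤ) (f g : 𝓢(Rn n, ℂ)) :
    velocityScale m f * velocityScale (m + m') g = stressScale m (f * velocityScale m' g) := by
  simp only [velocityScale, stressScale, ← dil_dil, smul_mul_assoc, mul_smul_comm, dil_mul, dil_smul,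
    smul_smul]
  congr 1
  rw [zpow_add₀ two_ne_zero]; ring

theorem BandLimited.velocityScale {R : ℝ} {f : 𝓢(Rn n, ℂ)} (hf : BandLimited R f) (m : ℤ) :
    BandLimited ((2 : ℝ) ^ m * R) (velocityScale m f) := (hf.dil m).smul _

theorem HighPass.velocityScale {R : ℝ} {f : 𝓢(Rn n, ℂ)} (hf : HighPass R f) (m : ℤ) :
    HighPass ((2 : ℝ) ^ m * R) (velocityScale m f) := (hf.dil m).smul _

theorem AnnularSpectrum.velocityScale {f : 𝓢(Rn n, ℂ)} (hf : AnnularSpectrum f) (m : ℤ) :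
    AnnularSpectrum (velocityScale m f) := (hf.dil m).smul _

theorem IsRealFun.velocityScale {f : 𝓢(Rn n, ℂ)} (hf : IsRealFun f) (m : ℤ) :
    IsRealFun (velocityScale m f) := by
  have := (hf.dil m).smul ((2 : ℝ) ^ m)
  push_cast at this
  exact this

theorem isoComp_velocityScale (A : Rn n ≃ₗᵢ[ℝ] Rn n) (m : ℤ) (f : 𝓢(Rn n, ℂ)) :
    isoComp A (velocityScale m f) = velocityScale m (isoComp A f) := by
  rw [velocityScale, velocityScale, isoComp_smul, isoComp_dil]

theorem velocityScale_neg (m : ℤ) (f : 𝓢(Rn n, ℂ)) :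
    velocityScale m (-f) = -velocityScale m f := by
  rw [velocityScale, velocityScale, dil_neg, smul_neg]

theorem eLpNorm_velocityScale (m : ℤ) (f : 𝓢(Rn n, ℂ)) :
    eLpNorm (velocityScale m f) ∞ volume =
      ENNReal.ofReal ((2 : ℝ) ^ (m : ℝ)) * eLpNorm f ∞ volume := by
  have h : (⇑(velocityScale m f) : Rn n → ℂ) = (2 : ℂ) ^ m • ⇑(dil m f) := rfl
  rw [h, eLpNorm_const_smul, enorm_two_zpow, eLpNorm_dil]
  simp [overExponent]

/-- The velocity norm is critical: the amplitude factor `2 ^ m` cancels the factor `2 ^ (-m)` which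
the dilation produces at regularity `n/p - 1`. -/
theorem scalarBesov_velocityScale (φ₀ : 𝓢(Rn n, ℂ)) (p : ℝ≥0∞) (m : ℤ) (f : 𝓢(Rn n, ℂ)) :
    scalarBesov φ₀ (overExponent n p - 1) p 1 (velocityScale m f) =
      scalarBesov φ₀ (overExponent n p - 1) p 1 f := by
  rw [velocityScale, scalarBesov_smul le_rfl, scalarBesov_dil, enorm_two_zpow, ← mul_assoc,
    ofReal_two_rpow_mul, sub_sub_cancel_left, neg_one_mul, add_neg_cancel, Real.rpow_zero,
    ENNReal.ofReal_one, one_mul]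

theorem scalarBesov_forceScale (φ₀ : 𝓢(Rn n, ℂ)) (p : ℝ≥0∞) (m : ℤ) (f : 𝓢(Rn n, ℂ)) :
    scalarBesov φ₀ (overExponent n p - 3) p 1 (((2 : ℂ) ^ m) ^ 3 • dil m f) =
      scalarBesov φ₀ (overExponent n p - 3) p 1 f := by
  rw [scalarBesov_smul le_rfl, scalarBesov_dil, enorm_pow, enorm_two_zpow, ← mul_assoc,
    pow_succ, pow_two, ofReal_two_rpow_mul, ofReal_two_rpow_mul, ofReal_two_rpow_mul]
  have : (m : ℝ) + m + m + (overExponent n p - 3 - overExponent n p) * m = 0 := by ring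
  rw [this, Real.rpow_zero, ENNReal.ofReal_one, one_mul]

theorem scalarBesov_laplacian_velocityScale (φ₀ : 𝓢(Rn n, ℂ)) (p : ℝ≥0∞) (m : ℤ)
    (f : 𝓢(Rn n, ℂ)) :
    scalarBesov φ₀ (overExponent n p - 3) p 1 (Δ (velocityScale m f)) =
      scalarBesov φ₀ (overExponent n p - 3) p 1 (Δ f) := by
  rw [← scalarBesov_forceScale φ₀ p m (Δ f)]
  congr 1
  have h : Δ (velocityScale m f) = (2 : ℂ) ^ m • Δ (dil m f) := by
    simp only [velocityScale, laplacian_eq_sum_pd, pd_smul, Finset.smul_sum]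
  rw [h, laplacian_dil, smul_smul]
  congr 1; ring

/-! ### The size of the force exerted by a stress -/

/-- The trace-free part of a matrix field. -/
def deviator (Q : Fin n → Fin n → 𝓢(Rn n, ℂ)) (i k : Fin n) : 𝓢(Rn n, ℂ) :=
  Q i k - if i = k then (n : ℂ)⁻¹ • ∑ l, Q l l else 0

theorem deviator_add (P Q : Fin n → Fin n → 𝓢(Rn n, ℂ)) :
    deviator (P + Q) = deviator P + deviator Q := by
  funext i k
  simp only [deviator, Pi.add_apply]
  split_ifs
  · rw [Finset.sum_add_distrib, smul_add]; abel
  · abel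

theorem deviator_smul (c : ℂ) (Q : Fin n → Fin n → 𝓢(Rn n, ℂ)) :
    deviator (c • Q) = c • deviator Q := by
  funext i k
  simp only [deviator, Pi.smul_apply]
  rw [smul_sub]
  split_ifs
  · simp only [Finset.smul_sum, smul_comm c]
  · simp

/-- An upper bound for the critical norm of the trace-free divergence of a stress. -/
def stressNorm (φ₀ : 𝓢(Rn n, ℂ)) (p : ℝ≥0∞) (Q : Fin n → Fin n → 𝓢(Rn n, ℂ)) : ℝ≥0∞ :=
  ∑ k, ∑ i, scalarBesov φ₀ (overExponent n p - 3) p 1 (pd i (deviator Q i k))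

section StressNorm

variable {φ₀ : 𝓢(Rn n, ℂ)} {p : ℝ≥0∞}

theorem besovNorm_deviatorDiv_le (hp : 1 ≤ p) (Q : Fin n → Fin n → 𝓢(Rn n, ℂ)) :
    besovNorm φ₀ (overExponent n p - 3) p 1 (toDist (deviatorDiv Q)) ≤ stressNorm φ₀ p Q :=
  (besovNorm_toDist_le hp le_rfl φ₀ _ _).trans
    (Finset.sum_le_sum fun _ _ => scalarBesov_sum_le hp le_rfl φ₀ _ _ _)

theorem stressNorm_add_le (hp : 1 ≤ p) (P Q : Fin n → Fin n → 𝓢(Rn n, ℂ)) :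
    stressNorm φ₀ p (P + Q) ≤ stressNorm φ₀ p P + stressNorm φ₀ p Q := by
  simp only [stressNorm, ← Finset.sum_add_distrib]
  refine Finset.sum_le_sum fun k _ => Finset.sum_le_sum fun i _ => ?_
  rw [deviator_add, Pi.add_apply, Pi.add_apply, pd_add]
  exact scalarBesov_add_le hp le_rfl _ _ _ _

theorem stressNorm_smul (c : ℂ) (Q : Fin n → Fin n → 𝓢(Rn n, ℂ)) :
    stressNorm φ₀ p (c • Q) = ‖c‖ₑ * stressNorm φ₀ p Q := by
  simp only [stressNorm, Finset.mul_sum]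
  refine Finset.sum_congr rfl fun k _ => Finset.sum_congr rfl fun i _ => ?_
  rw [deviator_smul, Pi.smul_apply, Pi.smul_apply, pd_smul, scalarBesov_smul le_rfl]

theorem stressNorm_zero : stressNorm φ₀ p 0 = 0 := by
  have := stressNorm_smul (φ₀ := φ₀) (p := p) 0 0
  simpa using this

theorem stressNorm_sum_le (hp : 1 ≤ p) {ι : Type*} (s : Finset ι)
    (Q : ι → Fin n → Fin n → 𝓢(Rn n, ℂ)) :
    stressNorm φ₀ p (∑ a ∈ s, Q a) ≤ ∑ a ∈ s, stressNorm φ₀ p (Q a) := by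
  classical
  induction s using Finset.induction_on with
  | empty => simp [stressNorm_zero]
  | insert m s hm ih =>
    rw [Finset.sum_insert hm, Finset.sum_insert hm]
    exact (stressNorm_add_le hp _ _).trans (add_le_add le_rfl ih)

/-- A derivative turns the stress factor `2 ^ (2 m)` into the critical force factor `2 ^ (3 m)`, so
the force has the same norm at all scales. -/
theorem stressNorm_stressScale (m : ℤ) (Q : Fin n → Fin n → 𝓢(Rn n, ℂ)) :
    stressNorm φ₀ p (fun i k => stressScale m (Q i k)) = stressNorm φ₀ p Q := by
  refine Finset.sum_congr rfl fun k _ => Finset.sum_congr rfl fun i _ => ?_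
  have h : deviator (fun i k => stressScale m (Q i k)) i k =
      stressScale m (deviator Q i k) := by
    simp only [deviator, stressScale, dil_sub, smul_sub]
    split_ifs
    · rw [dil_smul, dil_sum, ← Finset.smul_sum, smul_comm]
    · ext x; simp
  rw [h, stressScale, pd_smul, pd_dil, smul_smul,
    ← scalarBesov_forceScale φ₀ p m (pd i (deviator Q i k))]
  rw [← pow_succ]

theorem firstMoment_deviator_le (Q : Fin n → Fin n → 𝓢(Rn n, ℂ)) (i k : Fin n) :
    firstMoment (deviator Q i k) ≤ 2 * ∑ i, ∑ k, firstMoment (Q i k) := by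
  have hle : ∀ y (i k : Fin n), ‖Q i k y‖ₑ ≤ ∑ i, ∑ k, ‖Q i k y‖ₑ := fun y i k =>
    (Finset.single_le_sum (f := fun k => ‖Q i k y‖ₑ) (fun _ _ => zero_le)
      (Finset.mem_univ k)).trans (Finset.single_le_sum (f := fun i => ∑ k, ‖Q i k y‖ₑ)
        (fun _ _ => zero_le) (Finset.mem_univ i))
  have hpt : ∀ y, ‖deviator Q i k y‖ₑ ≤ 2 * ∑ i, ∑ k, ‖Q i k y‖ₑ := fun y => by
    have hn : 0 < n := i.pos
    rw [deviator, _root_.sub_apply, two_mul]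
    refine (enorm_sub_le).trans (add_le_add (hle y i k) ?_)
    split_ifs
    · rw [_root_.smul_apply, _root_.sum_apply, smul_eq_mul, enorm_mul]
      have h1 : ‖((n : ℂ))⁻¹‖ₑ ≤ 1 := by
        rw [← ofReal_norm, ENNReal.ofReal_le_one, norm_inv, Complex.norm_natCast]
        exact inv_le_one_of_one_le₀ (by exact_mod_cast hn)
      calc _ ≤ 1 * ∑ l, ‖Q l l y‖ₑ := mul_le_mul' h1 (enorm_sum_le _ _)
        _ = ∑ l, ‖Q l l y‖ₑ := one_mul _
        _ ≤ _ := Finset.sum_le_sum fun l _ => Finset.single_le_sum (f := fun k => ‖Q l k y‖ₑ)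
          (fun _ _ => zero_le) (Finset.mem_univ l)
    · simp
  calc _ ≤ ∫⁻ y, 2 * ∑ i, ∑ k, ‖y‖ₑ * ‖Q i k y‖ₑ := by
        refine lintegral_mono fun y => ?_
        simp only [← Finset.mul_sum]
        rw [mul_left_comm]
        exact mul_le_mul' le_rfl (hpt y)
    _ = _ := by
        have hm : ∀ i k, Measurable fun y => ‖y‖ₑ * ‖Q i k y‖ₑ := fun i k =>
          (measurable_enorm).mul (Q i k).continuous.measurable.enorm
        rw [lintegral_const_mul' _ _ ENNReal.ofNat_ne_top, lintegral_finsetSum]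
        · simp only [firstMoment]
          congr 1
          refine Finset.sum_congr rfl fun i _ => ?_
          rw [lintegral_finsetSum]
          exact fun k _ => hm i k
        · exact fun i _ => Finset.measurable_sum _ fun k _ => hm i k

/-- The mean of a matrix field is a multiple of the identity. -/
def HasScalarMean (Q : Fin n → Fin n → 𝓢(Rn n, ℂ)) : Prop := ∀ i k, ∫ x, deviator Q i k x = 0

/-- For means equal to zero the low frequency series has exponent `n - 1 > 0`, for every `p`; the
stress is then measured by its first moments. -/
theorem exists_stressNorm_le (hn : 2 ≤ n) (h : IsLittlewoodPaley φ₀) (hp : 1 ≤ p) (R : ℝ) :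
    ∃ C : ℝ≥0∞, C ≠ ∞ ∧ ∀ Q : Fin n → Fin n → 𝓢(Rn n, ℂ), (∀ i k, BandLimited R (Q i k)) →
      HasScalarMean Q → stressNorm φ₀ p Q ≤ C * ∑ i, ∑ k, firstMoment (Q i k) := by
  have hn' : (2 : ℝ) ≤ n := by exact_mod_cast hn
  obtain ⟨C, hC, hle⟩ := exists_scalarBesov_pd_le_moment h (s := overExponent n p - 3) hp
    (by linarith) R
  refine ⟨n * (n * (C * 2)), by finiteness, fun Q hQ hmean => ?_⟩
  have hb : ∀ i k, BandLimited R (deviator Q i k) := fun i k => by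
    refine (hQ i k).sub ?_
    split_ifs
    · exact (BandLimited.sum fun l _ => hQ l l).smul _
    · exact bandLimited_zero
  calc stressNorm φ₀ p Q ≤ ∑ k : Fin n, ∑ i : Fin n, C * (2 * ∑ i, ∑ k, firstMoment (Q i k)) :=
        Finset.sum_le_sum fun k _ => Finset.sum_le_sum fun i _ =>
          (hle 1 le_rfl i _ (hb i k) (hmean i k)).trans
            (mul_le_mul' le_rfl (firstMoment_deviator_le Q i k))
    _ = _ := by
        simp only [Finset.sum_const, Finset.card_univ, Fintype.card_fin, nsmul_eq_mul]
        ring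

theorem stressNorm_ne_top (hn : 2 ≤ n) (h : IsLittlewoodPaley φ₀) (hp : 1 ≤ p) {R : ℝ}
    {Q : Fin n → Fin n → 𝓢(Rn n, ℂ)} (hQ : ∀ i k, BandLimited R (Q i k)) (hmean : HasScalarMean Q) :
    stressNorm φ₀ p Q ≠ ∞ := by
  obtain ⟨C, hC, hle⟩ := exists_stressNorm_le hn h hp R
  refine ((hle Q hQ hmean).trans_lt (ENNReal.mul_lt_top hC.lt_top ?_)).ne
  exact ENNReal.sum_lt_top.2 fun i _ => ENNReal.sum_lt_top.2 fun k _ =>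
    (firstMoment_ne_top _).lt_top

/-- The scaling of a velocity field. -/
def scaleField (m : ℤ) (F : Fin n → 𝓢(Rn n, ℂ)) : Fin n → 𝓢(Rn n, ℂ) :=
  fun i => velocityScale m (F i)

/-- By scale invariance the faster field `F` may be placed at scale zero. The slower one then has
frequencies in a smaller ball and amplitude `2 ^ m'` in the supremum norm, and this is the decay of
the interaction. Only the mean of the normalized product has to be controlled. -/
theorem exists_stressNorm_tensor_le (hn : 2 ≤ n) (h : IsLittlewoodPaley φ₀) (hp : 1 ≤ p) {R : ℝ}
    {F H : Fin n → 𝓢(Rn n, ℂ)} (hF : ∀ i, BandLimited R (F i)) (hH : ∀ i, BandLimited R (H i)) :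
    ∃ C : ℝ≥0∞, C ≠ ∞ ∧ ∀ m' : ℤ, m' ≤ 0 →
      (HasScalarMean (tensor F (scaleField m' H)) → ∀ m, stressNorm φ₀ p
        (tensor (scaleField m F) (scaleField (m + m') H)) ≤ C * ENNReal.ofReal (2 ^ (m' : ℝ))) ∧
      (HasScalarMean (tensor (scaleField m' H) F) → ∀ m, stressNorm φ₀ p
        (tensor (scaleField (m + m') H) (scaleField m F)) ≤ C * ENNReal.ofReal (2 ^ (m' : ℝ))) := by
  obtain ⟨C, hC, hle⟩ := exists_stressNorm_le hn h hp (|R| + |R|)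
  set A := ∑ i, ∑ k, firstMoment (F i) * eLpNorm (H k) ∞ volume with hA
  have hAtop : A ≠ ∞ := ENNReal.sum_ne_top.2 fun i _ => ENNReal.sum_ne_top.2 fun k _ =>
    ENNReal.mul_ne_top (firstMoment_ne_top _) (eLpNorm_schwartz_ne_top _ _)
  refine ⟨C * A, ENNReal.mul_ne_top hC hAtop, fun m' hm' => ?_⟩
  have hb : ∀ i k, BandLimited (|R| + |R|) (F i * velocityScale m' (H k)) := fun i k => by
    refine ((hF i).mono (le_abs_self R)).mul (((hH k).mono (le_abs_self R)).velocityScale m' |>.mono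
      (mul_le_of_le_one_left (abs_nonneg _) (zpow_le_one_of_nonpos₀ one_le_two hm')))
  have hmom : ∀ i k, firstMoment (F i * velocityScale m' (H k)) ≤
      firstMoment (F i) * eLpNorm (H k) ∞ volume * ENNReal.ofReal (2 ^ (m' : ℝ)) := fun i k => by
    refine (firstMoment_mul_le _ _).trans (le_of_eq ?_)
    rw [eLpNorm_velocityScale]; ring
  constructor
  · intro hmean m
    have heq : tensor (scaleField m F) (scaleField (m + m') H) =
        fun i k => stressScale m (tensor F (scaleField m' H) i k) := by
      funext i k
      exact velocityScale_mul m m' (F i) (H k)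
    rw [heq, stressNorm_stressScale]
    refine (hle _ (fun i k => hb i k) hmean).trans ?_
    rw [mul_assoc, hA, Finset.sum_mul]
    refine mul_le_mul' le_rfl (Finset.sum_le_sum fun i _ => ?_)
    rw [Finset.sum_mul]
    exact Finset.sum_le_sum fun k _ => hmom i k
  · intro hmean m
    have heq : tensor (scaleField (m + m') H) (scaleField m F) =
        fun i k => stressScale m (tensor (scaleField m' H) F i k) := by
      funext i k
      simp only [tensor, scaleField]
      rw [mul_comm, velocityScale_mul m m' (F k) (H i), mul_comm]
    rw [heq, stressNorm_stressScale]
    refine (hle _ (fun i k => ?_) hmean).trans ?_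
    · simp only [tensor, scaleField]; rw [mul_comm]; exact hb k i
    rw [mul_assoc, hA, Finset.sum_mul, Finset.sum_comm]
    refine mul_le_mul' le_rfl (Finset.sum_le_sum fun i _ => ?_)
    rw [Finset.sum_mul]
    refine Finset.sum_le_sum fun k _ => ?_
    simp only [tensor, scaleField]
    rw [mul_comm (velocityScale m' (H k))]
    exact hmom i k

end StressNorm

end

section

open SchwartzMap
variable {n : ℕ}

/-! ### Profiles in the plane -/

/-- The reflection of the first coordinate. -/
def reflection : Rn 2 ≃ₗᵢ[ℝ] Rn 2 where
  toFun x := !₂[-x 0, x 1]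
  invFun x := !₂[-x 0, x 1]
  map_add' x y := by ext i; fin_cases i <;> simp; ring
  map_smul' c x := by ext i; fin_cases i <;> simp
  left_inv x := by ext i; fin_cases i <;> simp
  right_inv x := by ext i; fin_cases i <;> simp
  norm_map' x := by
    rw [← sq_eq_sq₀ (norm_nonneg _) (norm_nonneg _), EuclideanSpace.norm_sq_eq,
      EuclideanSpace.norm_sq_eq]
    simp [Fin.sum_univ_two]

@[simp] theorem reflection_zero (x : Rn 2) : reflection x 0 = -x 0 := rfl
@[simp] theorem reflection_one (x : Rn 2) : reflection x 1 = x 1 := rfl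

theorem isoComp_reflection_pd_zero (f : 𝓢(Rn 2, ℂ)) :
    isoComp reflection (pd 0 f) = -pd 0 (isoComp reflection f) := by
  rw [← neg_one_smul ℂ]
  apply fourier_ext; intro ξ
  rw [FourierTransform.fourier_smul, _root_.smul_apply, fourier_isoComp, fourier_pd, fourier_pd,
    fourier_isoComp, reflection_zero, smul_eq_mul]
  push_cast; ring

theorem isoComp_reflection_pd_one (f : 𝓢(Rn 2, ℂ)) :
    isoComp reflection (pd 1 f) = pd 1 (isoComp reflection f) := by
  apply fourier_ext; intro ξ
  rw [fourier_isoComp, fourier_pd, fourier_pd, fourier_isoComp, reflection_one]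

theorem isoComp_neg_pd (i : Fin n) (f : 𝓢(Rn n, ℂ)) :
    isoComp (LinearIsometryEquiv.neg ℝ) (pd i f) = -pd i (isoComp (LinearIsometryEquiv.neg ℝ) f) := by
  rw [← neg_one_smul ℂ]
  apply fourier_ext; intro ξ
  rw [FourierTransform.fourier_smul, _root_.smul_apply, fourier_isoComp, fourier_pd, fourier_pd,
    fourier_isoComp, smul_eq_mul]
  simp

/-- In the plane the stress factor equals the Jacobian of the dilation. Hence rescaled stresses have
equal transforms at the origin, and their differences can drive flows without low frequencies. -/
theorem fourier_stressScale (m : ℤ) (f : 𝓢(Rn 2, ℂ)) (ξ : Rn 2) :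
    𝓕 (stressScale m f) ξ = 𝓕 f ((2 : ℝ) ^ (-m) • ξ) := by
  rw [stressScale, FourierTransform.fourier_smul, _root_.smul_apply, fourier_dil, smul_eq_mul,
    ← mul_assoc]
  push_cast
  rw [← mul_pow, mul_inv_cancel₀ (zpow_ne_zero _ two_ne_zero), one_pow, one_mul]

/-- A real function with frequencies near `± 4 e`, where `e` is the second coordinate vector. -/
def ripple (g : 𝓢(Rn 2, ℂ)) : 𝓢(Rn 2, ℂ) :=
  modulate (EuclideanSpace.single 1 4) g + modulate (-EuclideanSpace.single 1 4) g

/-- An even solenoidal field with frequencies near `± 4 e`. -/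
def rippleField (g : 𝓢(Rn 2, ℂ)) : Fin 2 → 𝓢(Rn 2, ℂ) :=
  ![pd 1 (pd 1 (ripple g)), -pd 0 (pd 1 (ripple g))]

theorem fieldDiv_rippleField (g : 𝓢(Rn 2, ℂ)) : fieldDiv (rippleField g) = 0 := by
  rw [fieldDiv, Fin.sum_univ_two]
  simp only [rippleField, Matrix.cons_val_zero, Matrix.cons_val_one, pd_neg]
  rw [pd_comm 0 1, add_neg_cancel]

section Ripple

variable {g : 𝓢(Rn 2, ℂ)}

/-- The Fourier transform of a ripple. -/
def rippleSymbol (ξ : Rn 2) : ℝ :=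
  radialCutoff (ξ - EuclideanSpace.single 1 4) + radialCutoff (ξ + EuclideanSpace.single 1 4)

theorem fourier_ripple (hg : ∀ ξ, 𝓕 g ξ = (radialCutoff ξ : ℂ)) (ξ : Rn 2) :
    𝓕 (ripple g) ξ = (rippleSymbol ξ : ℂ) := by
  rw [ripple, FourierTransform.fourier_add, _root_.add_apply, fourier_modulate, fourier_modulate,
    hg, hg, sub_neg_eq_add, rippleSymbol, Complex.ofReal_add]

theorem rippleSymbol_neg (ξ : Rn 2) : rippleSymbol (-ξ) = rippleSymbol ξ := by
  have h : ∀ ζ : Rn 2, radialCutoff (-ζ) = radialCutoff ζ := fun ζ => by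
    rw [radialCutoff, radialCutoff, norm_neg]
  rw [rippleSymbol, rippleSymbol, add_comm, ← h (-ξ + _), ← h (-ξ - _)]
  congr 2 <;> abel

theorem rippleSymbol_reflection (ξ : Rn 2) : rippleSymbol (reflection ξ) = rippleSymbol ξ := by
  have h : ∀ ζ : Rn 2, radialCutoff (reflection ζ) = radialCutoff ζ := fun ζ => by
    rw [radialCutoff, radialCutoff, LinearIsometryEquiv.norm_map]
  have h1 : reflection (EuclideanSpace.single 1 4) = EuclideanSpace.single 1 4 := by
    ext i; fin_cases i <;> simp
  rw [rippleSymbol, rippleSymbol, ← h (ξ - _), ← h (ξ + _), map_sub, map_add, h1]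

theorem sq_le_sq_of_rippleSymbol_ne_zero {ξ : Rn 2} (h : rippleSymbol ξ ≠ 0) :
    ξ 0 ^ 2 ≤ ξ 1 ^ 2 := by
  have key : ∀ c : ℝ, c ^ 2 = 16 →
      radialCutoff (ξ + EuclideanSpace.single 1 c) ≠ 0 → ξ 0 ^ 2 ≤ ξ 1 ^ 2 := fun c hc h => by
    have h1 : ‖ξ + EuclideanSpace.single 1 c‖ < 2 := by
      by_contra h2
      exact h (radialCutoff_eq_zero (not_lt.1 h2))
    have h2 : ‖ξ + EuclideanSpace.single 1 c‖ ^ 2 = ξ 0 ^ 2 + (ξ 1 + c) ^ 2 := by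
      rw [EuclideanSpace.norm_sq_eq, Fin.sum_univ_two]; simp
    have h3 : ξ 0 ^ 2 + (ξ 1 + c) ^ 2 < 4 := by
      rw [← h2]; nlinarith [norm_nonneg (ξ + EuclideanSpace.single 1 c)]
    -- By `(2 ξ₁ + c)² ≥ 0` one has `ξ₁² + (ξ₁ + c)² ≥ c² / 2 = 8`, which exceeds `4`.
    nlinarith [sq_nonneg (2 * ξ 1 + c)]
  by_cases h1 : radialCutoff (ξ + EuclideanSpace.single 1 4) = 0
  · refine key (-4) (by norm_num) fun h2 => h ?_
    have h3 : ξ - EuclideanSpace.single 1 4 = ξ + EuclideanSpace.single 1 (-4) := by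
      ext i; fin_cases i <;> simp [sub_eq_add_neg]
    rw [rippleSymbol, h1, h3, h2, add_zero]
  · exact key 4 (by norm_num) h1

theorem fourier_rippleField_zero (hg : ∀ ξ, 𝓕 g ξ = (radialCutoff ξ : ℂ)) (ξ : Rn 2) :
    𝓕 (rippleField g 0) ξ = ((-(4 * Real.pi ^ 2 * ξ 1 ^ 2 * rippleSymbol ξ) : ℝ) : ℂ) := by
  change 𝓕 (pd 1 (pd 1 (ripple g))) ξ = _
  rw [fourier_pd, fourier_pd, fourier_ripple hg]
  push_cast
  linear_combination (4 * (Real.pi : ℂ) ^ 2 * (ξ 1 : ℂ) ^ 2 * rippleSymbol ξ) * Complex.I_sq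

theorem fourier_rippleField_one (hg : ∀ ξ, 𝓕 g ξ = (radialCutoff ξ : ℂ)) (ξ : Rn 2) :
    𝓕 (rippleField g 1) ξ = ((4 * Real.pi ^ 2 * ξ 0 * ξ 1 * rippleSymbol ξ : ℝ) : ℂ) := by
  change 𝓕 (-pd 0 (pd 1 (ripple g))) ξ = _
  rw [← neg_one_smul ℂ, FourierTransform.fourier_smul, _root_.smul_apply, fourier_pd, fourier_pd,
    fourier_ripple hg, smul_eq_mul]
  push_cast
  linear_combination (-(4 * (Real.pi : ℂ) ^ 2 * (ξ 0 : ℂ) * (ξ 1 : ℂ) * rippleSymbol ξ)) *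
    Complex.I_sq

theorem isRealFun_rippleField (hg : ∀ ξ, 𝓕 g ξ = (radialCutoff ξ : ℂ)) (i : Fin 2) :
    IsRealFun (rippleField g i) := by
  have h : IsRealFun (ripple g) := isRealFun_of_fourier fun ξ => by
    rw [fourier_ripple hg, fourier_ripple hg, rippleSymbol_neg, Complex.conj_ofReal]
  fin_cases i
  · exact (h.pd 1).pd 1
  · exact ((h.pd 1).pd 0).neg

theorem isoComp_neg_rippleField (hg : ∀ ξ, 𝓕 g ξ = (radialCutoff ξ : ℂ)) (i : Fin 2) :
    isoComp (LinearIsometryEquiv.neg ℝ) (rippleField g i) = rippleField g i := by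
  have h : isoComp (LinearIsometryEquiv.neg ℝ) (ripple g) = ripple g := by
    apply fourier_ext; intro ξ
    rw [fourier_isoComp, fourier_ripple hg, fourier_ripple hg, LinearIsometryEquiv.coe_neg,
      rippleSymbol_neg]
  fin_cases i
  · simp [rippleField, isoComp_neg_pd, h, pd_neg]
  · simp [rippleField, isoComp_neg_pd, isoComp_neg, h, pd_neg]

theorem isoComp_reflection_rippleField (hg : ∀ ξ, 𝓕 g ξ = (radialCutoff ξ : ℂ)) :
    isoComp reflection (rippleField g 0) = rippleField g 0 ∧
    isoComp reflection (rippleField g 1) = -rippleField g 1 := by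
  have h : isoComp reflection (ripple g) = ripple g := by
    apply fourier_ext; intro ξ
    rw [fourier_isoComp, fourier_ripple hg, fourier_ripple hg, rippleSymbol_reflection]
  simp [rippleField, isoComp_neg, isoComp_reflection_pd_zero, isoComp_reflection_pd_one, h]

theorem spectrum_rippleField (hg : ∀ ξ, 𝓕 g ξ = (radialCutoff ξ : ℂ)) (i : Fin 2) :
    HighPass 2 (rippleField g i) ∧ BandLimited 6 (rippleField g i) := by
  have hn : ‖(EuclideanSpace.single 1 4 : Rn 2)‖ = 4 := by
    rw [PiLp.norm_single]; norm_num
  have hb := bandLimited_of_radial hg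
  have h1 := hb.highPass_modulate (EuclideanSpace.single 1 4)
  have h2 := hb.highPass_modulate (-EuclideanSpace.single 1 4)
  have h3 := hb.modulate (EuclideanSpace.single 1 4)
  have h4 := hb.modulate (-EuclideanSpace.single 1 4)
  rw [norm_neg, hn] at h2 h4
  rw [hn] at h1 h3
  have h5 : HighPass 2 (ripple g) := (h1.add h2).mono (by norm_num)
  have h6 : BandLimited 6 (ripple g) := (h3.add h4).mono (by norm_num)
  fin_cases i
  · exact ⟨(h5.pd 1).pd 1, (h6.pd 1).pd 1⟩
  · change HighPass 2 (-pd 0 (pd 1 (ripple g))) ∧ BandLimited 6 (-pd 0 (pd 1 (ripple g)))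
    rw [← neg_one_smul ℂ]
    exact ⟨((h5.pd 1).pd 0).smul _, ((h6.pd 1).pd 0).smul _⟩

/-- By Parseval's formula the difference of energies is the integral of `16 π⁴ ξ₁² (ξ₁² - ξ₀²)`
against the squared symbol; the symbol lives where `|ξ₀| ≤ |ξ₁|`. This anisotropy of the mean stress
is what drives the cascade. -/
theorem exists_mean_rippleField (hg : ∀ ξ, 𝓕 g ξ = (radialCutoff ξ : ℂ)) : ∃ μ : ℝ, 0 < μ ∧
    integralCLM ℂ volume (rippleField g 0 * rippleField g 0) -
      integralCLM ℂ volume (rippleField g 1 * rippleField g 1) = μ := by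
  have h1 : integralCLM ℂ volume (rippleField g 0 * rippleField g 0) -
      integralCLM ℂ volume (rippleField g 1 * rippleField g 1) =
      ∫ x, (rippleField g 0 + rippleField g 1) x * (rippleField g 0 - rippleField g 1) x := by
    rw [← map_sub, integralCLM_apply]
    congr 1; ext x
    simp only [_root_.sub_apply, _root_.add_apply, mul_apply]; ring
  have h2 : ∀ ξ : Rn 2, 𝓕 (rippleField g 0 + rippleField g 1) (-ξ) *
      𝓕 (rippleField g 0 - rippleField g 1) ξ = ((16 * Real.pi ^ 4 * ξ 1 ^ 2 *
        (ξ 1 ^ 2 - ξ 0 ^ 2) * rippleSymbol ξ ^ 2 : ℝ) : ℂ) := fun ξ => by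
    rw [FourierTransform.fourier_add, _root_.add_apply, fourier_sub_apply,
      fourier_rippleField_zero hg, fourier_rippleField_one hg, fourier_rippleField_zero hg,
      fourier_rippleField_one hg, rippleSymbol_neg]
    simp only [PiLp.neg_apply]
    push_cast; ring
  refine ⟨∫ ξ : Rn 2, 16 * Real.pi ^ 4 * ξ 1 ^ 2 * (ξ 1 ^ 2 - ξ 0 ^ 2) * rippleSymbol ξ ^ 2, ?_, ?_⟩
  · have hc : Continuous (rippleSymbol) := by
      have := contDiff_radialCutoff (n := 2) |>.continuous
      unfold rippleSymbol
      fun_prop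
    refine Continuous.integral_pos_of_hasCompactSupport_nonneg_nonzero (by fun_prop)
      (HasCompactSupport.intro (isCompact_closedBall (0 : Rn 2) 6) fun ξ hξ => ?_)
      (fun ξ => ?_) (x := EuclideanSpace.single 1 4) ?_
    · rw [Metric.mem_closedBall, dist_zero_right, not_le] at hξ
      have := (spectrum_rippleField hg 0).2 ξ hξ
      rw [fourier_rippleField_zero hg, Complex.ofReal_eq_zero, neg_eq_zero] at this
      have h3 : ξ 1 ^ 2 * rippleSymbol ξ = 0 := by
        have hpi : 4 * Real.pi ^ 2 ≠ 0 := by positivity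
        refine (mul_eq_zero.1 ?_).resolve_left hpi
        rw [← this]; ring
      calc _ = 16 * Real.pi ^ 4 * (ξ 1 ^ 2 - ξ 0 ^ 2) * rippleSymbol ξ *
            (ξ 1 ^ 2 * rippleSymbol ξ) := by ring
        _ = 0 := by rw [h3, mul_zero]
    · by_cases h : rippleSymbol ξ = 0
      · simp [h]
      · have := sub_nonneg.2 (sq_le_sq_of_rippleSymbol_ne_zero h)
        positivity
    · have h3 : rippleSymbol (EuclideanSpace.single 1 4) = 1 := by
        rw [rippleSymbol, sub_self, radialCutoff_eq_one (by simp), radialCutoff_eq_zero, add_zero]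
        rw [← two_smul ℝ, norm_smul, PiLp.norm_single]; norm_num
      simp [h3]
  · rw [h1, integral_mul_eq_fourier]
    simp only [h2]
    exact integral_complex_ofReal

end Ripple

/-! ### The Stokes flow in the plane -/

/-- The contribution of one scale to a stress. -/
def stressStep (G : 𝓢(Rn 2, ℂ)) : 𝓢(Rn 2, ℂ) := G - stressScale (-8) G

section Step

variable {g : 𝓢(Rn 2, ℂ)} {μ : ℝ}

theorem fourier_stressStep (hg : ∀ ξ, 𝓕 g ξ = (radialCutoff ξ : ℂ)) (ξ : Rn 2) :
    𝓕 (stressStep ((μ : ℂ) • g)) ξ =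
      ((μ * (radialCutoff ξ - radialCutoff ((2 : ℝ) ^ (8 : ℤ) • ξ)) : ℝ) : ℂ) := by
  rw [stressStep, fourier_sub_apply, fourier_stressScale, FourierTransform.fourier_smul,
    _root_.smul_apply, _root_.smul_apply, hg, hg, neg_neg, smul_eq_mul, smul_eq_mul]
  push_cast; ring

/-- Both cutoffs equal one near the origin, so their difference vanishes there; the inner radius is
where the faster of the two starts to decrease at the earliest. -/
theorem spectrum_stressStep (hg : ∀ ξ, 𝓕 g ξ = (radialCutoff ξ : ℂ)) :
    HighPass ((2 : ℝ) ^ (-8 : ℤ)) (stressStep ((μ : ℂ) • g)) ∧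
      BandLimited 2 (stressStep ((μ : ℂ) • g)) := by
  constructor
  · intro ξ hξ
    have h1 : ‖(2 : ℝ) ^ (8 : ℤ) • ξ‖ ≤ 1 := by
      rw [norm_two_zpow_smul]
      norm_num at hξ ⊢
      linarith
    have h2 : ‖ξ‖ ≤ 1 := by
      norm_num at hξ
      linarith
    rw [fourier_stressStep hg, radialCutoff_eq_one h1, radialCutoff_eq_one h2]
    simp
  · intro ξ hξ
    have h1 : 2 ≤ ‖(2 : ℝ) ^ (8 : ℤ) • ξ‖ := by
      rw [norm_two_zpow_smul]
      norm_num
      linarith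
    rw [fourier_stressStep hg, radialCutoff_eq_zero h1, radialCutoff_eq_zero hξ.le]
    simp

theorem isoComp_stressStep (hg : ∀ ξ, 𝓕 g ξ = (radialCutoff ξ : ℂ)) (A : Rn 2 ≃ₗᵢ[ℝ] Rn 2) :
    isoComp A (stressStep ((μ : ℂ) • g)) = stressStep ((μ : ℂ) • g) := by
  apply fourier_ext; intro ξ
  rw [fourier_isoComp, fourier_stressStep hg, fourier_stressStep hg, ← map_smul, radialCutoff,
    radialCutoff, radialCutoff, radialCutoff, A.norm_map, A.norm_map]

theorem fourier_stressStep_ne_zero (hg : ∀ ξ, 𝓕 g ξ = (radialCutoff ξ : ℂ)) (hμ : μ ≠ 0) {ξ : Rn 2}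
    (h1 : 1 / 16 ≤ ‖ξ‖) (h2 : ‖ξ‖ ≤ 1) : 𝓕 (stressStep ((μ : ℂ) • g)) ξ ≠ 0 := by
  have h3 : 2 ≤ ‖(2 : ℝ) ^ (8 : ℤ) • ξ‖ := by
    rw [norm_two_zpow_smul]
    norm_num
    linarith
  rw [fourier_stressStep hg, radialCutoff_eq_one h2, radialCutoff_eq_zero h3, sub_zero, mul_one,
    Complex.ofReal_ne_zero]
  exact hμ

theorem isRealFun_stressStep (hg : ∀ ξ, 𝓕 g ξ = (radialCutoff ξ : ℂ)) :
    IsRealFun (stressStep ((μ : ℂ) • g)) := isRealFun_of_fourier fun ξ => by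
  rw [fourier_stressStep hg, fourier_stressStep hg, Complex.conj_ofReal, smul_neg, radialCutoff,
    radialCutoff, radialCutoff, radialCutoff, norm_neg, norm_neg]

end Step

/-- Profiles of a small fast flow `W` and of a Stokes flow with stream function `κ`. -/
structure PlaneProfiles (W : Fin 2 → 𝓢(Rn 2, ℂ)) (G κ : 𝓢(Rn 2, ℂ)) : Prop where
  real_W : ∀ i, IsRealFun (W i)
  real_G : IsRealFun G
  real_κ : IsRealFun κ
  div_W : fieldDiv W = 0
  spectrum_W : ∀ i, HighPass 2 (W i) ∧ BandLimited 6 (W i)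
  spectrum_G : BandLimited 2 G
  spectrum_κ : HighPass ((2 : ℝ) ^ (-8 : ℤ)) κ ∧ BandLimited 2 κ
  even_W : ∀ i, isoComp (LinearIsometryEquiv.neg ℝ) (W i) = W i
  reflection_W : isoComp reflection (W 0) = W 0 ∧ isoComp reflection (W 1) = -W 1
  radial_κ : ∀ A, isoComp A κ = κ
  mean_W : integralCLM ℂ volume (W 0 * W 0) - integralCLM ℂ volume (W 1 * W 1) =
    integralCLM ℂ volume G
  laplacian_κ : Δ (Δ κ) = stressStep G
  ne_zero_κ : ∀ ξ, 1 / 16 ≤ ‖ξ‖ → ‖ξ‖ ≤ 1 → 𝓕 κ ξ ≠ 0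

theorem exists_planeProfiles : ∃ W G κ, PlaneProfiles W G κ := by
  obtain ⟨g, hg⟩ := exists_radial_bandLimited 2
  obtain ⟨μ, hμ, hmean⟩ := exists_mean_rippleField hg
  have hs := spectrum_stressStep (μ := μ) hg
  have hann : AnnularSpectrum (stressStep ((μ : ℂ) • g)) :=
    ⟨⟨_, by positivity, hs.1⟩, _, hs.2⟩
  obtain ⟨κ, hκ⟩ := hann.exists_isBilaplacianInverse
  refine ⟨rippleField g, (μ : ℂ) • g, κ, isRealFun_rippleField hg, (isRealFun_of_radial hg).smul _,
    hκ.isRealFun (isRealFun_stressStep hg), fieldDiv_rippleField g, spectrum_rippleField hg,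
    (bandLimited_of_radial hg).smul _, ⟨fun ξ hξ => ?_, fun ξ hξ => ?_⟩,
    isoComp_neg_rippleField hg, isoComp_reflection_rippleField hg, fun A => ?_, ?_,
    hκ.laplacian_laplacian hann.fourier_zero_eq, fun ξ h1 h2 => ?_⟩
  · rw [hκ, hs.1 ξ hξ, mul_zero]
  · rw [hκ, hs.2 ξ hξ, mul_zero]
  · have := hκ.isoComp_eq A (c := 1) (by rw [one_smul, isoComp_stressStep hg])
    rwa [one_smul] at this
  -- The mean of `g` is its transform at the origin, so `G = μ g` has exactly the mean `μ` of the
  -- anisotropy of `W ⊗ W`.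
  · have h0 : integralCLM ℂ volume g = 1 := by
      have h1 := hg 0
      rw [fourier_coe, Real.fourier_eq', radialCutoff_eq_one (by simp)] at h1
      simpa [integralCLM_apply] using h1
    rw [hmean, map_smul, h0, smul_eq_mul, mul_one]
  · rw [hκ]
    refine mul_ne_zero ?_ (fourier_stressStep_ne_zero hg hμ.ne' h1 h2)
    rw [Complex.ofReal_ne_zero]
    have : 0 < ‖ξ‖ := by linarith
    have := Real.pi_pos
    positivity

end

section

open SchwartzMap
variable {n : ℕ}

/-! ### Symmetries of fields in the plane -/

/-- The rotation of a velocity field by a right angle. -/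
def turnField (F : Fin 2 → 𝓢(Rn 2, ℂ)) : Fin 2 → 𝓢(Rn 2, ℂ) :=
  ![isoComp quarterTurn (F 1), -isoComp quarterTurn (F 0)]

theorem fieldDiv_turnField {F : Fin 2 → 𝓢(Rn 2, ℂ)} (h : fieldDiv F = 0) :
    fieldDiv (turnField F) = 0 := by
  rw [fieldDiv, Fin.sum_univ_two] at h ⊢
  simp only [turnField, Matrix.cons_val_zero, Matrix.cons_val_one, pd_neg]
  have := congrArg (isoComp quarterTurn) h
  rw [isoComp_add, isoComp_pd_zero, isoComp_pd_one] at this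
  rw [← sub_eq_add_neg, ← neg_add_eq_sub, this]
  ext x; simp

theorem isoComp_isoComp (A B : Rn n ≃ₗᵢ[ℝ] Rn n) (f : 𝓢(Rn n, ℂ)) :
    isoComp A (isoComp B f) = isoComp (A.trans B) f := by
  ext x; simp

theorem HighPass.isoComp {R : ℝ} {f : 𝓢(Rn n, ℂ)} (hf : HighPass R f) (A : Rn n ≃ₗᵢ[ℝ] Rn n) :
    HighPass R (isoComp A f) := fun ξ hξ => by
  rw [fourier_isoComp, hf _ (by rwa [LinearIsometryEquiv.norm_map])]

theorem BandLimited.isoComp {R : ℝ} {f : 𝓢(Rn n, ℂ)} (hf : BandLimited R f) (A : Rn n ≃ₗᵢ[ℝ] Rn n) :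
    BandLimited R (isoComp A f) := fun ξ hξ => by
  rw [fourier_isoComp, hf _ (by rwa [LinearIsometryEquiv.norm_map])]

theorem integralCLM_eq_zero_of_odd {A : Rn n ≃ₗᵢ[ℝ] Rn n} {f : 𝓢(Rn n, ℂ)}
    (h : isoComp A f = -f) : integralCLM ℂ volume f = 0 := by
  have h1 := integralCLM_isoComp A f
  rw [h, map_neg] at h1
  exact self_eq_neg.1 h1.symm

/-- Even components times odd components. -/
theorem hasScalarMean_of_odd {P Q : Fin 2 → 𝓢(Rn 2, ℂ)}
    (h : ∀ i k, isoComp (LinearIsometryEquiv.neg ℝ) (P i * Q k) = -(P i * Q k)) :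
    HasScalarMean (tensor P Q) :=
  have h0 : ∀ i k, integralCLM ℂ volume (tensor P Q i k) = 0 := fun i k =>
    integralCLM_eq_zero_of_odd (h i k)
  integral_deviator_eq_zero ((h0 0 0).trans (h0 1 1).symm) (h0 0 1) (h0 1 0)

/-- The symmetries of the Stokes flow driven by a radial stress. -/
structure IsVortexSymmetric (V : Fin 2 → 𝓢(Rn 2, ℂ)) : Prop where
  turn_zero : isoComp quarterTurn (V 0) = V 1
  turn_one : isoComp quarterTurn (V 1) = -V 0
  reflection_zero : isoComp reflection (V 0) = -V 0
  reflection_one : isoComp reflection (V 1) = V 1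
  odd : ∀ i, isoComp (LinearIsometryEquiv.neg ℝ) (V i) = -V i

theorem IsVortexSymmetric.scaleField {V : Fin 2 → 𝓢(Rn 2, ℂ)} (h : IsVortexSymmetric V) (m : ℤ) :
    IsVortexSymmetric (scaleField m V) where
  turn_zero := by simp only [_root_.scaleField, isoComp_velocityScale, h.turn_zero]
  turn_one := by simp only [_root_.scaleField, isoComp_velocityScale, h.turn_one, velocityScale_neg]
  reflection_zero := by
    simp only [_root_.scaleField, isoComp_velocityScale, h.reflection_zero, velocityScale_neg]
  reflection_one := by simp only [_root_.scaleField, isoComp_velocityScale, h.reflection_one]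
  odd i := by simp only [_root_.scaleField, isoComp_velocityScale, h.odd, velocityScale_neg]

/-- The rotation exchanges the diagonal entries and the reflection reverses the off-diagonal ones.
-/
theorem IsVortexSymmetric.hasScalarMean {V V' : Fin 2 → 𝓢(Rn 2, ℂ)} (h : IsVortexSymmetric V)
    (h' : IsVortexSymmetric V') : HasScalarMean (tensor V V') := by
  refine integral_deviator_eq_zero ?_ (integralCLM_eq_zero_of_odd (A := reflection) ?_)
    (integralCLM_eq_zero_of_odd (A := reflection) ?_)
  · rw [← integralCLM_isoComp quarterTurn]
    simp only [tensor, isoComp_mul, h.turn_zero, h'.turn_zero]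
  · simp only [tensor, isoComp_mul, h.reflection_zero, h'.reflection_one, neg_mul]
  · simp only [tensor, isoComp_mul, h.reflection_one, h'.reflection_zero, mul_neg]

theorem isVortexSymmetric_stokesField {κ : 𝓢(Rn 2, ℂ)} (h : ∀ A, isoComp A κ = κ) :
    IsVortexSymmetric (stokesField 0 κ) := by
  have e0 : stokesField 0 κ 0 = pd 0 (pd 1 (pd 1 κ)) := by
    rw [stokesField, if_pos rfl, ← pd_laplacian, laplacian_eq_sum_pd, Fin.sum_univ_two, pd_add]
    abel
  have e1 : stokesField 0 κ 1 = -pd 1 (pd 0 (pd 0 κ)) := by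
    rw [stokesField, if_neg (by decide), zero_sub]
  constructor
  · simp only [e0, e1, isoComp_pd_zero, isoComp_pd_one, h]
  · simp only [e0, e1, isoComp_neg, isoComp_pd_zero, isoComp_pd_one, h, pd_neg, neg_neg]
  · simp only [e0, isoComp_reflection_pd_zero, isoComp_reflection_pd_one, h]
  · simp only [e1, isoComp_neg, isoComp_reflection_pd_zero, isoComp_reflection_pd_one, h, pd_neg,
      neg_neg]
  · intro i
    fin_cases i
    · change isoComp _ (stokesField 0 κ 0) = -stokesField 0 κ 0
      simp only [e0, isoComp_neg_pd, h, pd_neg, neg_neg]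
    · change isoComp _ (stokesField 0 κ 1) = -stokesField 0 κ 1
      simp only [e1, isoComp_neg, isoComp_neg_pd, h, pd_neg, neg_neg]

section Stress

variable {W : Fin 2 → 𝓢(Rn 2, ℂ)} {G κ : 𝓢(Rn 2, ℂ)}

theorem PlaneProfiles.spectrum_turnField (h : PlaneProfiles W G κ) (i : Fin 2) :
    HighPass 2 (turnField W i) ∧ BandLimited 6 (turnField W i) := by
  fin_cases i
  · exact ⟨(h.spectrum_W 1).1.isoComp _, (h.spectrum_W 1).2.isoComp _⟩
  · change HighPass 2 (-isoComp quarterTurn (W 0)) ∧ BandLimited 6 (-isoComp quarterTurn (W 0))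
    rw [← neg_one_smul ℂ]
    exact ⟨((h.spectrum_W 0).1.isoComp _).smul _, ((h.spectrum_W 0).2.isoComp _).smul _⟩

theorem PlaneProfiles.even_turnField (h : PlaneProfiles W G κ) (i : Fin 2) :
    isoComp (LinearIsometryEquiv.neg ℝ) (turnField W i) = turnField W i := by
  have hc : ∀ i, isoComp (LinearIsometryEquiv.neg ℝ) (isoComp quarterTurn (W i)) =
      isoComp quarterTurn (W i) := fun i => by
    nth_rw 2 [← h.even_W i]
    rw [isoComp_isoComp, isoComp_isoComp]
    ext x; simp
  fin_cases i
  · exact hc 1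
  · change isoComp _ (-isoComp quarterTurn (W 0)) = -isoComp quarterTurn (W 0)
    rw [isoComp_neg, hc]

theorem PlaneProfiles.integral_mul (h : PlaneProfiles W G κ) :
    integralCLM ℂ volume (W 0 * W 1) = 0 :=
  integralCLM_eq_zero_of_odd (A := reflection) (by
    rw [isoComp_mul, h.reflection_W.1, h.reflection_W.2, mul_neg])

/-- The mean of `G` equals the difference of the diagonal means of `W ⊗ W`; the off-diagonal mean
vanishes by reflection. -/
theorem PlaneProfiles.hasScalarMean_sub (h : PlaneProfiles W G κ) :
    HasScalarMean (tensor W W - diagEntry 0 G) := by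
  refine integral_deviator_eq_zero ?_ ?_ ?_
  · change integralCLM ℂ volume (W 0 * W 0 - G) = integralCLM ℂ volume (W 1 * W 1 - 0)
    rw [map_sub, map_sub, map_zero, ← h.mean_W]; ring
  · change integralCLM ℂ volume (W 0 * W 1 - 0) = 0
    rw [sub_zero, h.integral_mul]
  · change integralCLM ℂ volume (W 1 * W 0 - 0) = 0
    rw [sub_zero, mul_comm, h.integral_mul]

/-- The turned field has the opposite anisotropy. It can supply `-G` at the other end of the
cascade, which no real multiple of `W ⊗ W` coming from a velocity could do. -/
theorem PlaneProfiles.hasScalarMean_add (h : PlaneProfiles W G κ) :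
    HasScalarMean (tensor (turnField W) (turnField W) + diagEntry 0 G) := by
  have h0 : integralCLM ℂ volume (isoComp quarterTurn (W 1) * isoComp quarterTurn (W 0)) = 0 := by
    rw [← isoComp_mul, integralCLM_isoComp, mul_comm, h.integral_mul]
  refine integral_deviator_eq_zero ?_ ?_ ?_
  · change integralCLM ℂ volume (isoComp quarterTurn (W 1) * isoComp quarterTurn (W 1) + G) =
      integralCLM ℂ volume (-isoComp quarterTurn (W 0) * -isoComp quarterTurn (W 0) + 0)
    rw [neg_mul_neg, ← isoComp_mul, ← isoComp_mul, map_add, map_add, integralCLM_isoComp,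
      integralCLM_isoComp, map_zero, ← h.mean_W]; ring
  · change integralCLM ℂ volume (isoComp quarterTurn (W 1) * -isoComp quarterTurn (W 0) + 0) = 0
    rw [add_zero, mul_neg, map_neg, h0, neg_zero]
  · change integralCLM ℂ volume (-isoComp quarterTurn (W 0) * isoComp quarterTurn (W 1) + 0) = 0
    rw [add_zero, neg_mul, map_neg, mul_comm, h0, neg_zero]

/-- Fields with disjoint spectra. -/
theorem hasScalarMean_of_spectra {F H : Fin 2 → 𝓢(Rn 2, ℂ)} {R S : ℝ}
    (hF : ∀ i, BandLimited R (F i)) (hH : ∀ i, HighPass S (H i)) (h : R < S) :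
    HasScalarMean (tensor F H) ∧ HasScalarMean (tensor H F) := by
  have h0 : ∀ i k, integralCLM ℂ volume (F i * H k) = 0 := fun i k => by
    rw [integralCLM_apply, ← integral_mul_eq_zero_of_spectra (hF i) (hH k) h]
    exact integral_congr_ae (Eventually.of_forall fun x => mul_apply _ _ x)
  have h1 : ∀ i k, integralCLM ℂ volume (H i * F k) = 0 := fun i k => by rw [mul_comm, h0]
  exact ⟨integral_deviator_eq_zero ((h0 0 0).trans (h0 1 1).symm) (h0 0 1) (h0 1 0),
    integral_deviator_eq_zero ((h1 0 0).trans (h1 1 1).symm) (h1 0 1) (h1 1 0)⟩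

end Stress

end

section

open SchwartzMap
variable {n : ℕ}

/-! ### A cascade of Stokes flows -/

theorem laplacian_const_smul (c : ℂ) (f : 𝓢(Rn n, ℂ)) : Δ (c • f) = c • Δ f := by
  simp only [laplacian_eq_sum_pd, pd_smul, Finset.smul_sum]

theorem laplacian_sum {ι : Type*} (s : Finset ι) (f : ι → 𝓢(Rn n, ℂ)) :
    Δ (∑ a ∈ s, f a) = ∑ a ∈ s, Δ (f a) := by
  simp only [laplacian_eq_sum_pd, pd_sum]
  exact Finset.sum_comm

theorem stokesField_smul (i₀ : Fin n) (c : ℂ) (κ : 𝓢(Rn n, ℂ)) :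
    stokesField i₀ (c • κ) = c • stokesField i₀ κ := by
  funext i
  simp only [stokesField, pd_smul, laplacian_const_smul, Pi.smul_apply, smul_sub]
  split_ifs
  · rfl
  · rw [smul_zero]

theorem stokesField_sum {ι : Type*} (i₀ : Fin n) (s : Finset ι) (κ : ι → 𝓢(Rn n, ℂ)) :
    stokesField i₀ (∑ a ∈ s, κ a) = ∑ a ∈ s, stokesField i₀ (κ a) := by
  funext i
  simp only [stokesField, pd_sum, laplacian_sum, Finset.sum_apply, Finset.sum_sub_distrib]
  split_ifs
  · rfl
  · rw [Finset.sum_const_zero]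

theorem stokesField_dil (i₀ : Fin n) (m : ℤ) (κ : 𝓢(Rn n, ℂ)) :
    stokesField i₀ (((2 : ℂ) ^ m)⁻¹ ^ 2 • dil m κ) = scaleField m (stokesField i₀ κ) := by
  have h2 : (2 : ℂ) ^ m ≠ 0 := zpow_ne_zero _ two_ne_zero
  rw [stokesField_smul]
  funext i
  simp only [Pi.smul_apply, scaleField, velocityScale, stokesField, pd_dil, laplacian_dil, pd_smul,
    laplacian_const_smul, smul_sub, dil_sub, smul_smul]
  congr 1
  · split_ifs
    · rw [smul_smul]; congr 1; field_simp
    · ext x; simp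
  · congr 1; field_simp

/-- Rescaled copies of `F` at `L` separated scales. -/
def cascade (L : ℕ) (F : Fin n → 𝓢(Rn n, ℂ)) : Fin n → 𝓢(Rn n, ℂ) :=
  ∑ k ∈ Finset.range L, scaleField (-8 * (k : ℤ)) F

theorem stokesField_cascade (i₀ : Fin n) (L : ℕ) (κ : 𝓢(Rn n, ℂ)) :
    stokesField i₀ (∑ k ∈ Finset.range L, ((2 : ℂ) ^ (-8 * (k : ℤ)))⁻¹ ^ 2 • dil (-8 * (k : ℤ)) κ) =
      cascade L (stokesField i₀ κ) := by
  rw [stokesField_sum, cascade]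
  exact Finset.sum_congr rfl fun k _ => stokesField_dil _ _ _

theorem stressScale_sub (m : ℤ) (f g : 𝓢(Rn n, ℂ)) :
    stressScale m (f - g) = stressScale m f - stressScale m g := by
  simp only [stressScale, dil_sub, smul_sub]

theorem stressScale_stressScale (m m' : ℤ) (f : 𝓢(Rn n, ℂ)) :
    stressScale m (stressScale m' f) = stressScale (m + m') f := by
  simp only [stressScale, dil_smul, dil_dil, smul_smul]
  congr 1
  rw [zpow_add₀ two_ne_zero]; ring

theorem stressScale_zero (f : 𝓢(Rn n, ℂ)) : stressScale 0 f = f := by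
  rw [stressScale, dil_zero, zpow_zero, one_pow, one_smul]

/-- The stresses of the single scales telescope. The stress needed to drive `L` scales is
concentrated at the two ends, so its size does not grow with `L`. -/
theorem laplacian_laplacian_cascade (L : ℕ) {κ G : 𝓢(Rn 2, ℂ)} (h : Δ (Δ κ) = stressStep G) :
    Δ (Δ (∑ k ∈ Finset.range L, ((2 : ℂ) ^ (-8 * (k : ℤ)))⁻¹ ^ 2 • dil (-8 * (k : ℤ)) κ)) =
      G - stressScale (-8 * (L : ℤ)) G := by
  have hk : ∀ k : ℕ, Δ (Δ (((2 : ℂ) ^ (-8 * (k : ℤ)))⁻¹ ^ 2 • dil (-8 * (k : ℤ)) κ)) =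
      stressScale (-8 * (k : ℤ)) G - stressScale (-8 * ((k + 1 : ℕ) : ℤ)) G := fun k => by
    have h2 : (2 : ℂ) ^ (-8 * (k : ℤ)) ≠ 0 := zpow_ne_zero _ two_ne_zero
    rw [laplacian_const_smul, laplacian_dil, laplacian_const_smul, laplacian_const_smul, laplacian_dil, h,
      show -8 * ((k + 1 : ℕ) : ℤ) = -8 * (k : ℤ) + -8 by push_cast; ring,
      ← stressScale_stressScale, ← stressScale_sub, ← stressStep, stressScale, smul_smul, smul_smul]
    congr 1; field_simp
  rw [laplacian_sum, laplacian_sum, Finset.sum_congr rfl fun k _ => hk k,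
    Finset.sum_range_sub' fun k => stressScale (-8 * (k : ℤ)) G, Nat.cast_zero, mul_zero,
    stressScale_zero]

theorem scaleField_zero (F : Fin n → 𝓢(Rn n, ℂ)) : scaleField 0 F = F :=
  funext fun i => velocityScale_zero (F i)

theorem fieldDiv_scaleField {F : Fin n → 𝓢(Rn n, ℂ)} (h : fieldDiv F = 0) (m : ℤ) :
    fieldDiv (scaleField m F) = 0 := by
  have : fieldDiv (scaleField m F) = ((2 : ℂ) ^ m) ^ 2 • dil m (fieldDiv F) := by
    simp only [fieldDiv, scaleField, velocityScale, pd_smul, pd_dil, smul_smul, dil_sum,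
      Finset.smul_sum, pow_two]
  rw [this, h]
  ext x; simp

end

/-! ### Forces exerted by the driving field and the cascade. -/

section

open SchwartzMap
variable {n : ℕ}

theorem tensor_add_left (F F' H : Fin n → 𝓢(Rn n, ℂ)) :
    tensor (F + F') H = tensor F H + tensor F' H := by
  funext i k; exact add_mul _ _ _

theorem tensor_add_right (F H H' : Fin n → 𝓢(Rn n, ℂ)) :
    tensor F (H + H') = tensor F H + tensor F H' := by
  funext i k; exact mul_add _ _ _

theorem tensor_sum_left {ι : Type*} (s : Finset ι) (F : ι → Fin n → 𝓢(Rn n, ℂ))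
    (H : Fin n → 𝓢(Rn n, ℂ)) : tensor (∑ a ∈ s, F a) H = ∑ a ∈ s, tensor (F a) H := by
  funext i k
  simp only [tensor, Finset.sum_apply, Finset.sum_mul]

theorem tensor_sum_right {ι : Type*} (s : Finset ι) (F : Fin n → 𝓢(Rn n, ℂ))
    (H : ι → Fin n → 𝓢(Rn n, ℂ)) : tensor F (∑ a ∈ s, H a) = ∑ a ∈ s, tensor F (H a) := by
  funext i k
  simp only [tensor, Finset.sum_apply, Finset.mul_sum]

theorem tensor_smul_smul (a b : ℂ) (F H : Fin n → 𝓢(Rn n, ℂ)) :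
    tensor (a • F) (b • H) = (a * b) • tensor F H := by
  funext i k
  simp only [tensor, Pi.smul_apply, smul_mul_smul_comm]

theorem tensor_scaleField (m : ℤ) (F H : Fin n → 𝓢(Rn n, ℂ)) :
    tensor (scaleField m F) (scaleField m H) = fun i k => stressScale m (tensor F H i k) := by
  funext i k
  have := velocityScale_mul m 0 (F i) (H k)
  rwa [add_zero, velocityScale_zero] at this

theorem stressScale_add (m : ℤ) (f g : 𝓢(Rn n, ℂ)) :
    stressScale m (f + g) = stressScale m f + stressScale m g := by
  simp only [stressScale, dil_add, smul_add]

theorem ofReal_two_rpow_le_one {m : ℤ} (hm : m ≤ 0) : ENNReal.ofReal ((2 : ℝ) ^ (m : ℝ)) ≤ 1 := by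
  rw [ENNReal.ofReal_le_one]
  exact Real.rpow_le_one_of_one_le_of_nonpos one_le_two (by exact_mod_cast hm)

section Stress

variable {W : Fin 2 → 𝓢(Rn 2, ℂ)} {G κ φ₀ : 𝓢(Rn 2, ℂ)} {p : ℝ≥0∞}

/-- The driving velocity, at two extreme scales. -/
def drivingField (W : Fin 2 → 𝓢(Rn 2, ℂ)) (L : ℕ) : Fin 2 → 𝓢(Rn 2, ℂ) :=
  W + scaleField (-8 * (L : ℤ)) (turnField W)

theorem tensor_drivingField (W : Fin 2 → 𝓢(Rn 2, ℂ)) (G : 𝓢(Rn 2, ℂ)) (L : ℕ) :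
    tensor (drivingField W L) (drivingField W L) -
      diagEntry 0 (G - stressScale (-8 * (L : ℤ)) G) =
    (tensor W W - diagEntry 0 G) +
      (fun i k => stressScale (-8 * (L : ℤ))
        ((tensor (turnField W) (turnField W) + diagEntry 0 G) i k)) +
      (tensor W (scaleField (-8 * (L : ℤ)) (turnField W)) +
        tensor (scaleField (-8 * (L : ℤ)) (turnField W)) W) := by
  rw [drivingField, tensor_add_left, tensor_add_right, tensor_add_right, tensor_scaleField]
  funext i k
  simp only [Pi.add_apply, Pi.sub_apply, stressScale_add, diagEntry]
  split_ifs
  · abel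
  · have : stressScale (-8 * (L : ℤ)) (0 : 𝓢(Rn 2, ℂ)) = 0 := by ext x; simp [stressScale]
    rw [this]; abel

/-- Each end is matched by its own Reynolds stress up to a scalar mean, and the second end is
brought to scale zero by scale invariance. The mixed products have mean zero because of disjoint
spectra, for which `L > 0` separates the ends: `2 ^ (-8) * 6 < 2`. -/
theorem PlaneProfiles.exists_stressNorm_reynolds_le (h : PlaneProfiles W G κ)
    (hφ : IsLittlewoodPaley φ₀) (hp : 1 ≤ p) : ∃ C : ℝ≥0∞, C ≠ ∞ ∧ ∀ L : ℕ, 0 < L → stressNorm φ₀ p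
    (tensor (drivingField W L) (drivingField W L) -
      diagEntry 0 (G - stressScale (-8 * (L : ℤ)) G)) ≤ C := by
  have hb := fun i => (h.spectrum_W i).2
  have hb' := fun i => (h.spectrum_turnField i).2
  have hG : ∀ i k, BandLimited (6 + 6) (diagEntry 0 G i k) := fun i k => by
    rw [diagEntry]
    split_ifs
    exacts [h.spectrum_G.mono (by norm_num), bandLimited_zero]
  have h1 := stressNorm_ne_top (p := p) le_rfl hφ hp (R := 6 + 6)
    (fun i k => ((hb i).mul (hb k)).sub (hG i k)) h.hasScalarMean_sub
  have h2 := stressNorm_ne_top (p := p) le_rfl hφ hp (R := 6 + 6)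
    (fun i k => ((hb' i).mul (hb' k)).add (hG i k)) h.hasScalarMean_add
  obtain ⟨C, hC, hle⟩ := exists_stressNorm_tensor_le le_rfl hφ hp hb hb'
  refine ⟨stressNorm φ₀ p (tensor W W - diagEntry 0 G) +
    stressNorm φ₀ p (tensor (turnField W) (turnField W) + diagEntry 0 G) + (C + C), by
      exact ENNReal.add_ne_top.2 ⟨ENNReal.add_ne_top.2 ⟨h1, h2⟩, ENNReal.add_ne_top.2 ⟨hC, hC⟩⟩,
    fun L hL => ?_⟩
  rw [tensor_drivingField]
  have hm : -8 * (L : ℤ) ≤ 0 := by omega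
  have hmean := hasScalarMean_of_spectra (F := scaleField (-8 * (L : ℤ)) (turnField W)) (H := W)
    (fun i => (hb' i).velocityScale _) (fun i => (h.spectrum_W i).1) (by
      have : (2 : ℝ) ^ (-8 * (L : ℤ)) ≤ 2 ^ (-8 : ℤ) :=
        zpow_le_zpow_right₀ one_le_two (by omega)
      calc _ ≤ (2 : ℝ) ^ (-8 : ℤ) * 6 := by gcongr
        _ < 2 := by norm_num)
  refine (stressNorm_add_le hp _ _).trans (add_le_add ((stressNorm_add_le hp _ _).trans
    (add_le_add le_rfl (stressNorm_stressScale _ _).le)) ((stressNorm_add_le hp _ _).trans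
      (add_le_add ?_ ?_)))
  · have := (hle _ hm).1 hmean.2 0
    rw [scaleField_zero, zero_add] at this
    exact this.trans (mul_le_of_le_one_right' (ofReal_two_rpow_le_one hm))
  · have := (hle _ hm).2 hmean.1 0
    rw [scaleField_zero, zero_add] at this
    exact this.trans (mul_le_of_le_one_right' (ofReal_two_rpow_le_one hm))

theorem PlaneProfiles.isVortexSymmetric (h : PlaneProfiles W G κ) :
    IsVortexSymmetric (stokesField 0 κ) := isVortexSymmetric_stokesField h.radial_κ

theorem PlaneProfiles.bandLimited_stokesField (h : PlaneProfiles W G κ) (i : Fin 2) :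
    BandLimited 2 (stokesField 0 κ i) := by
  refine BandLimited.sub ?_ (((h.spectrum_κ.2.pd _).pd _).pd _)
  split_ifs
  · exact fun ξ hξ => by rw [fourier_laplacian, (h.spectrum_κ.2.pd _) ξ hξ, mul_zero]
  · exact bandLimited_zero

theorem PlaneProfiles.highPass_stokesField (h : PlaneProfiles W G κ) (i : Fin 2) :
    HighPass ((2 : ℝ) ^ (-8 : ℤ)) (stokesField 0 κ i) := by
  refine HighPass.sub ?_ (((h.spectrum_κ.1.pd _).pd _).pd _)
  split_ifs
  · exact fun ξ hξ => by rw [fourier_laplacian, (h.spectrum_κ.1.pd _) ξ hξ, mul_zero]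
  · exact fun ξ _ => by simp [FourierTransform.fourier_zero]

theorem hasScalarMean_even_odd {P Q : Fin 2 → 𝓢(Rn 2, ℂ)}
    (hP : ∀ i, isoComp (LinearIsometryEquiv.neg ℝ) (P i) = P i)
    (hQ : ∀ i, isoComp (LinearIsometryEquiv.neg ℝ) (Q i) = -Q i) :
    HasScalarMean (tensor P Q) ∧ HasScalarMean (tensor Q P) :=
  ⟨hasScalarMean_of_odd fun i k => by rw [isoComp_mul, hP, hQ, mul_neg],
    hasScalarMean_of_odd fun i k => by rw [isoComp_mul, hP, hQ, neg_mul]⟩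

/-- The driving field is even and the Stokes flow odd, so mixed products have mean zero. Each of the
`L` scales then contributes a bounded force. -/
theorem PlaneProfiles.exists_stressNorm_cross_le (h : PlaneProfiles W G κ)
    (hφ : IsLittlewoodPaley φ₀) (hp : 1 ≤ p) : ∃ C : ℝ≥0∞, C ≠ ∞ ∧ ∀ L : ℕ, stressNorm φ₀ p
    (tensor (drivingField W L) (cascade L (stokesField 0 κ)) +
      tensor (cascade L (stokesField 0 κ)) (drivingField W L)) ≤ L * C := by
  set V := stokesField 0 κ with hV
  have hb : ∀ i, BandLimited 6 (V i) := fun i => (h.bandLimited_stokesField i).mono (by norm_num)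
  have hs := h.isVortexSymmetric
  obtain ⟨C, hC, hle⟩ := exists_stressNorm_tensor_le le_rfl hφ hp (fun i => (h.spectrum_W i).2) hb
  obtain ⟨C', hC', hle'⟩ := exists_stressNorm_tensor_le le_rfl hφ hp hb
    (fun i => (h.spectrum_turnField i).2)
  refine ⟨(C + C') + (C + C'), by finiteness, fun L => ?_⟩
  have key : ∀ k < L,
      (stressNorm φ₀ p (tensor W (scaleField (-8 * (k : ℤ)) V)) ≤ C ∧
      stressNorm φ₀ p (tensor (scaleField (-8 * (k : ℤ)) V) W) ≤ C) ∧
      stressNorm φ₀ p (tensor (scaleField (-8 * (L : ℤ)) (turnField W))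
        (scaleField (-8 * (k : ℤ)) V)) ≤ C' ∧
      stressNorm φ₀ p (tensor (scaleField (-8 * (k : ℤ)) V)
        (scaleField (-8 * (L : ℤ)) (turnField W))) ≤ C' := fun k hk => by
    constructor
    · have hm : -8 * (k : ℤ) ≤ 0 := by omega
      have hmean := hasScalarMean_even_odd h.even_W (hs.scaleField (-8 * (k : ℤ))).odd
      have h1 := (hle _ hm).1 hmean.1 0
      have h2 := (hle _ hm).2 hmean.2 0
      rw [scaleField_zero, zero_add] at h1 h2
      exact ⟨h1.trans (mul_le_of_le_one_right' (ofReal_two_rpow_le_one hm)),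
        h2.trans (mul_le_of_le_one_right' (ofReal_two_rpow_le_one hm))⟩
    · have hm : -8 * (L : ℤ) - -8 * (k : ℤ) ≤ 0 := by omega
      have hmean := hasScalarMean_even_odd (P := scaleField (-8 * (L : ℤ) - -8 * (k : ℤ)) (turnField W))
        (fun i => by rw [scaleField, isoComp_velocityScale, h.even_turnField]) hs.odd
      have h1 := (hle' _ hm).1 hmean.2 (-8 * (k : ℤ))
      have h2 := (hle' _ hm).2 hmean.1 (-8 * (k : ℤ))
      rw [add_sub_cancel] at h1 h2
      exact ⟨h2.trans (mul_le_of_le_one_right' (ofReal_two_rpow_le_one hm)),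
        h1.trans (mul_le_of_le_one_right' (ofReal_two_rpow_le_one hm))⟩
  have hsum : tensor (drivingField W L) (cascade L V) + tensor (cascade L V) (drivingField W L) =
      ∑ k ∈ Finset.range L, ((tensor W (scaleField (-8 * (k : ℤ)) V) +
        tensor (scaleField (-8 * (L : ℤ)) (turnField W)) (scaleField (-8 * (k : ℤ)) V)) +
        (tensor (scaleField (-8 * (k : ℤ)) V) W + tensor (scaleField (-8 * (k : ℤ)) V)
          (scaleField (-8 * (L : ℤ)) (turnField W)))) := by
    rw [cascade, tensor_sum_left, tensor_sum_right, ← Finset.sum_add_distrib]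
    refine Finset.sum_congr rfl fun k _ => ?_
    rw [drivingField, tensor_add_left, tensor_add_right]
  rw [hsum]
  calc _ ≤ ∑ k ∈ Finset.range L, ((C + C') + (C + C')) := by
        refine (stressNorm_sum_le hp _ _).trans (Finset.sum_le_sum fun k hk => ?_)
        obtain ⟨⟨h1, h2⟩, h3, h4⟩ := key k (Finset.mem_range.1 hk)
        exact (stressNorm_add_le hp _ _).trans (add_le_add
          ((stressNorm_add_le hp _ _).trans (add_le_add h1 h3))
          ((stressNorm_add_le hp _ _).trans (add_le_add h2 h4)))
    _ = _ := by rw [Finset.sum_const, Finset.card_range, nsmul_eq_mul]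

/-- Two scales at distance `d` interact with strength `2 ^ (-8 d)`. Each row of the double sum is a
convergent geometric series, so the total grows like `L` and not like `L²`. -/
theorem PlaneProfiles.exists_stressNorm_cascade_le (h : PlaneProfiles W G κ)
    (hφ : IsLittlewoodPaley φ₀) (hp : 1 ≤ p) : ∃ C : ℝ≥0∞, C ≠ ∞ ∧ ∀ L : ℕ, stressNorm φ₀ p
    (tensor (cascade L (stokesField 0 κ)) (cascade L (stokesField 0 κ))) ≤ L * C := by
  set V := stokesField 0 κ with hV
  have hb := h.bandLimited_stokesField
  have hs := h.isVortexSymmetric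
  obtain ⟨C, hC, hle⟩ := exists_stressNorm_tensor_le le_rfl hφ hp hb hb
  refine ⟨(C + C) * geomConst 8, ENNReal.mul_ne_top (by finiteness)
    (geomConst_ne_top (by norm_num)), fun L => ?_⟩
  set b : ℕ → ℕ → ℝ≥0∞ := fun k l => stressNorm φ₀ p
    (tensor (scaleField (-8 * (k : ℤ)) V) (scaleField (-8 * (l : ℤ)) V)) with hbdef
  set g : ℕ → ℝ≥0∞ := fun d => ENNReal.ofReal ((2 : ℝ) ^ (-|8| * (d : ℝ))) with hg
  have key : ∀ k d : ℕ, b k (k + d) ≤ C * g d ∧ b (k + d) k ≤ C * g d := fun k d => by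
    have hm : -8 * (d : ℤ) ≤ 0 := by omega
    have h1 := (hle _ hm).1 (hs.hasScalarMean (hs.scaleField _)) (-8 * (k : ℤ))
    have h2 := (hle _ hm).2 ((hs.scaleField _).hasScalarMean hs) (-8 * (k : ℤ))
    have e1 : -8 * (k : ℤ) + -8 * (d : ℤ) = -8 * ((k + d : ℕ) : ℤ) := by push_cast; ring
    have e2 : (((-8 * (d : ℤ) : ℤ)) : ℝ) = -|8| * (d : ℝ) := by push_cast; rw [abs_of_pos]; norm_num
    rw [e1, e2] at h1 h2
    exact ⟨h1, h2⟩
  -- The diagonal may occur in both halves; this only costs a factor in the constant.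
  have hsplit : ∀ k l : ℕ, b k l ≤ (if k ≤ l then C * g (l - k) else 0) +
      (if l ≤ k then C * g (k - l) else 0) := fun k l => by
    rcases le_total k l with hkl | hkl
    · rw [if_pos hkl]
      refine le_add_right ?_
      have := (key k (l - k)).1
      rwa [Nat.add_sub_cancel' hkl] at this
    · rw [if_pos hkl]
      refine le_add_left ?_
      have := (key l (k - l)).2
      rwa [Nat.add_sub_cancel' hkl] at this
  have hgeom : ∀ k : ℕ, ∑ l ∈ Finset.range L, (if k ≤ l then C * g (l - k) else 0) ≤
      C * geomConst 8 := fun k => by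
    rw [← Finset.sum_filter, geomConst, ← ENNReal.tsum_mul_left,
      ← Finset.sum_image (f := fun d => C * g d) (g := fun l => l - k) (by
        intro x hx y hy hxy
        simp only [Finset.coe_filter, Set.mem_ofPred_eq] at hx hy
        change x - k = y - k at hxy
        omega)]
    exact ENNReal.sum_le_tsum _
  have hsum : tensor (cascade L V) (cascade L V) = ∑ k ∈ Finset.range L, ∑ l ∈ Finset.range L,
      tensor (scaleField (-8 * (k : ℤ)) V) (scaleField (-8 * (l : ℤ)) V) := by
    simp only [cascade, tensor_sum_left, tensor_sum_right]
    rw [Finset.sum_comm]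
  rw [hsum]
  calc _ ≤ ∑ k ∈ Finset.range L, ∑ l ∈ Finset.range L, b k l :=
        (stressNorm_sum_le hp _ _).trans (Finset.sum_le_sum fun k _ => stressNorm_sum_le hp _ _)
    _ ≤ ∑ k ∈ Finset.range L, ∑ l ∈ Finset.range L, ((if k ≤ l then C * g (l - k) else 0) +
          (if l ≤ k then C * g (k - l) else 0)) :=
        Finset.sum_le_sum fun k _ => Finset.sum_le_sum fun l _ => hsplit k l
    _ = ∑ k ∈ Finset.range L, ∑ l ∈ Finset.range L, (if k ≤ l then C * g (l - k) else 0) +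
          ∑ l ∈ Finset.range L, ∑ k ∈ Finset.range L, (if l ≤ k then C * g (k - l) else 0) := by
        simp only [Finset.sum_add_distrib]
        congr 1
        exact Finset.sum_comm
    _ ≤ ∑ k ∈ Finset.range L, C * geomConst 8 + ∑ k ∈ Finset.range L, C * geomConst 8 :=
        add_le_add (Finset.sum_le_sum fun k _ => hgeom k) (Finset.sum_le_sum fun k _ => hgeom k)
    _ = _ := by
        simp only [Finset.sum_const, Finset.card_range, nsmul_eq_mul]
        ring

end Stress

end

/-! ### A lower bound for the cascade. -/

section

open SchwartzMap
variable {n : ℕ}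

theorem kblock_velocityScale (ψ : 𝓢(Rn n, ℂ)) (j m : ℤ) (f : 𝓢(Rn n, ℂ)) :
    kblock ψ (j + m) (velocityScale m f) = velocityScale m (kblock ψ j f) := by
  rw [velocityScale, velocityScale, kblock_smul, kblock_dil]

theorem block_velocityScale (φ₀ : 𝓢(Rn n, ℂ)) (p : ℝ≥0∞) (j m : ℤ) (f : 𝓢(Rn n, ℂ)) :
    ENNReal.ofReal (2 ^ ((overExponent n p - 1) * ((j + m : ℤ) : ℝ))) *
      eLpNorm (kblock φ₀ (j + m) (velocityScale m f)) p volume =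
    ENNReal.ofReal (2 ^ ((overExponent n p - 1) * (j : ℝ))) *
      eLpNorm (kblock φ₀ j f) p volume := by
  rw [kblock_velocityScale]
  have h : (⇑(velocityScale m (kblock φ₀ j f)) : Rn n → ℂ) =
    (2 : ℂ) ^ m • ⇑(dil m (kblock φ₀ j f)) := rfl
  rw [h, eLpNorm_const_smul, enorm_two_zpow, eLpNorm_dil, ← mul_assoc, ← mul_assoc,
    ofReal_two_rpow_mul, ofReal_two_rpow_mul]
  congr 3
  push_cast
  ring

section LowerBound

variable {W : Fin 2 → 𝓢(Rn 2, ℂ)} {G κ φ₀ : 𝓢(Rn 2, ℂ)} {p : ℝ≥0∞}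

/-- On the diagonal direction some point `c ζ` lies in the support of `𝓕 φ₀`, so its length is
between `1/2` and `2`. Division by `8`, which is the index `-3`, brings it to lengths between `1/16`
and `1/4`, where `𝓕 κ` does not vanish; the Stokes symbol there contains `-(c / 8)²`. -/
theorem PlaneProfiles.kblock_stokesField_ne_zero (h : PlaneProfiles W G κ)
    (hφ : IsLittlewoodPaley φ₀) : kblock φ₀ (-3) (stokesField 0 κ 0) ≠ 0 := fun h0 => by
  set ζ : Rn 2 := EuclideanSpace.single 0 1 + EuclideanSpace.single 1 1 with hζ
  have hζ0 : ζ 0 = 1 := by simp [hζ]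
  have hζ1 : ζ 1 = 1 := by simp [hζ]
  have hζn : ζ ≠ 0 := fun h => by rw [h] at hζ0; simp at hζ0
  obtain ⟨j, hj⟩ : ∃ j : ℤ, 𝓕 φ₀ ((2 : ℝ) ^ (-j) • ζ) ≠ 0 := by
    by_contra! hc
    have := hφ.hasSum_one ζ hζn
    simp only [hc] at this
    exact zero_ne_one (hasSum_zero.unique this)
  set c : ℝ := (2 : ℝ) ^ (-j) with hc
  have hcpos : 0 < c := by positivity
  obtain ⟨hl, hu⟩ := hφ.support_subset _ hj
  set ξ : Rn 2 := ((2 : ℝ) ^ (-3 : ℤ)) • c • ζ with hξ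
  have h1 := congrArg (fun f : 𝓢(Rn 2, ℂ) => 𝓕 f ξ) h0
  simp only [fourier_kblock, FourierTransform.fourier_zero, _root_.zero_apply] at h1
  have e1 : (2 : ℝ) ^ (-(-3) : ℤ) • ξ = c • ζ := by
    rw [hξ, smul_smul, ← zpow_add₀ two_ne_zero]; simp
  have hn : ‖ξ‖ = ‖c • ζ‖ / 8 := by
    rw [hξ, norm_two_zpow_smul]; norm_num; ring
  rw [e1, fourier_stokesField] at h1
  have hκ := h.ne_zero_κ ξ (by rw [hn]; linarith) (by rw [hn]; linarith)
  have hξ0 : ξ 0 = c / 8 := by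
    rw [hξ]; simp only [PiLp.smul_apply, hζ0, smul_eq_mul]; norm_num; ring
  have hξ1 : ξ 1 = c / 8 := by
    rw [hξ]; simp only [PiLp.smul_apply, hζ1, smul_eq_mul]; norm_num; ring
  have hns : (ξ 0) ^ 2 - ‖ξ‖ ^ 2 = -(c / 8) ^ 2 := by
    rw [EuclideanSpace.norm_sq_eq, Fin.sum_univ_two, hξ0, hξ1, Real.norm_eq_abs, sq_abs]; ring
  rw [hns, hξ0] at h1
  have hpi : (Real.pi : ℂ) ≠ 0 := by exact_mod_cast Real.pi_ne_zero
  have hc0 : ((c / 8 : ℝ) : ℂ) ≠ 0 := by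
    rw [Complex.ofReal_ne_zero]; positivity
  refine absurd h1 (mul_ne_zero hj (mul_ne_zero (mul_ne_zero ?_ ?_) hκ))
  · exact mul_ne_zero (mul_ne_zero (mul_ne_zero two_ne_zero hpi) Complex.I_ne_zero) hc0
  · refine mul_ne_zero (mul_ne_zero (by norm_num) (pow_ne_zero _ hpi)) ?_
    push_cast
    push_cast at hc0
    exact neg_ne_zero.2 (pow_ne_zero _ hc0)

/-- The block covers scales from `2 ^ (-4 - 8 k)` to `2 ^ (-2 - 8 k)`, while the term `l` lives
between `2 ^ (-8 - 8 l)` and `2 ^ (1 - 8 l)`; these ranges are disjoint for `l ≠ k`. -/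
theorem PlaneProfiles.kblock_cascade (h : PlaneProfiles W G κ) (hφ : IsLittlewoodPaley φ₀)
    {L k : ℕ} (hk : k < L) : kblock φ₀ (-3 + -8 * (k : ℤ)) (cascade L (stokesField 0 κ) 0) =
      kblock φ₀ (-3 + -8 * (k : ℤ)) (velocityScale (-8 * (k : ℤ)) (stokesField 0 κ 0)) := by
  have h2 : ∀ a b : ℤ, a < b → (2 : ℝ) ^ a < 2 ^ b := fun a b hab =>
    zpow_lt_zpow_right₀ one_lt_two hab
  rw [cascade, Finset.sum_apply, kblock_sum, Finset.sum_eq_single k]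
  · rfl
  · intro l _ hl
    rcases lt_or_gt_of_ne hl with hlk | hlk
    · refine kblock_eq_zero_of_highPass hφ (SpectralSub.refl φ₀)
        ((h.highPass_stokesField 0).velocityScale (-8 * (l : ℤ))) ?_
      rw [← zpow_add₀ two_ne_zero]
      exact h2 _ _ (by omega)
    · refine kblock_eq_zero_of_bandLimited hφ (SpectralSub.refl φ₀)
        ((h.bandLimited_stokesField 0).velocityScale (-8 * (l : ℤ))) ?_
      rw [← zpow_add_one₀ two_ne_zero]
      exact h2 _ _ (by omega)
  · intro hkL
    exact absurd (Finset.mem_range.2 hk) hkL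

/-- Each scale contributes the same amount in a block of its own, by scale invariance. The `ℓ¹` norm
adds these contributions; this is where `q = 1` enters. -/
theorem PlaneProfiles.exists_le_scalarBesov_cascade (h : PlaneProfiles W G κ)
    (hφ : IsLittlewoodPaley φ₀) (hp : 1 ≤ p) : ∃ c : ℝ≥0∞, c ≠ 0 ∧ c ≠ ∞ ∧ ∀ L : ℕ,
      L * c ≤ scalarBesov φ₀ (overExponent 2 p - 1) p 1 (cascade L (stokesField 0 κ) 0) := by
  refine ⟨ENNReal.ofReal (2 ^ ((overExponent 2 p - 1) * ((-3 : ℤ) : ℝ))) *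
    eLpNorm (kblock φ₀ (-3) (stokesField 0 κ 0)) p volume, mul_ne_zero ?_ ?_,
    ENNReal.mul_ne_top ENNReal.ofReal_ne_top (eLpNorm_schwartz_ne_top _ _), fun L => ?_⟩
  · rw [Ne, ENNReal.ofReal_eq_zero, not_le]
    positivity
  · intro h0
    rw [eLpNorm_eq_zero_iff (SchwartzMap.continuous _).aestronglyMeasurable
      (zero_lt_one.trans_le hp).ne'] at h0
    refine h.kblock_stokesField_ne_zero hφ ?_
    have := (Continuous.ae_eq_iff_eq volume (SchwartzMap.continuous _) continuous_const).1 h0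
    ext x
    exact congrFun this x
  · rw [scalarBesov, lqNorm_one]
    have hinj : Function.Injective fun k : ℕ => (-3 + -8 * (k : ℤ)) := fun a b hab => by
      simp only at hab; omega
    refine le_trans (le_of_eq ?_) (ENNReal.sum_le_tsum ((Finset.range L).image
      fun k : ℕ => (-3 + -8 * (k : ℤ))))
    rw [Finset.sum_image hinj.injOn, Finset.sum_congr rfl fun k hk => by
      rw [h.kblock_cascade hφ (Finset.mem_range.1 hk), block_velocityScale], Finset.sum_const,
      Finset.card_range, nsmul_eq_mul]

end LowerBound

end

/-! ### Stationary pairs in the plane for small integrability exponents. -/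

section

open SchwartzMap
variable {n : ℕ}

theorem vecLaplacian_smul (c : ℂ) (F : Fin n → 𝓢(Rn n, ℂ)) :
    vecLaplacian (c • F) = c • vecLaplacian F :=
  funext fun i => laplacian_const_smul c (F i)

theorem besovNorm_cascade_le {φ₀ : 𝓢(Rn n, ℂ)} {p : ℝ≥0∞} (hp : 1 ≤ p) (L : ℕ)
    (F : Fin n → 𝓢(Rn n, ℂ)) : besovNorm φ₀ (overExponent n p - 1) p 1 (toDist (cascade L F)) ≤
      L * ∑ i, scalarBesov φ₀ (overExponent n p - 1) p 1 (F i) := by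
  rw [cascade, toDist_sum]
  calc _ ≤ ∑ k ∈ Finset.range L, ∑ i, scalarBesov φ₀ (overExponent n p - 1) p 1 (F i) := by
        refine (besovNorm_sum_le hp le_rfl _ _ _ _).trans (Finset.sum_le_sum fun k _ => ?_)
        refine (besovNorm_toDist_le hp le_rfl _ _ _).trans (Finset.sum_le_sum fun i _ => ?_)
        exact (scalarBesov_velocityScale _ _ _ _).le
    _ = _ := by rw [Finset.sum_const, Finset.card_range, nsmul_eq_mul]

section Assembly

variable {W : Fin 2 → 𝓢(Rn 2, ℂ)} {G κ φ₀ : 𝓢(Rn 2, ℂ)} {p : ℝ≥0∞}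

theorem PlaneProfiles.annularSpectrum_W (h : PlaneProfiles W G κ) (i : Fin 2) :
    AnnularSpectrum (W i) := ⟨⟨_, two_pos, (h.spectrum_W i).1⟩, _, (h.spectrum_W i).2⟩

theorem PlaneProfiles.annularSpectrum_turnField (h : PlaneProfiles W G κ) (i : Fin 2) :
    AnnularSpectrum (turnField W i) :=
  ⟨⟨_, two_pos, (h.spectrum_turnField i).1⟩, _, (h.spectrum_turnField i).2⟩

theorem PlaneProfiles.annularSpectrum_κ (h : PlaneProfiles W G κ) : AnnularSpectrum κ :=
  ⟨⟨_, by positivity, h.spectrum_κ.1⟩, _, h.spectrum_κ.2⟩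

theorem PlaneProfiles.real_turnField (h : PlaneProfiles W G κ) (i : Fin 2) :
    IsRealFun (turnField W i) := by
  fin_cases i
  · exact fun x => h.real_W 1 _
  · exact IsRealFun.neg fun x => h.real_W 0 _

theorem PlaneProfiles.exists_besovNorm_drivingField_le (h : PlaneProfiles W G κ)
    (hφ : IsLittlewoodPaley φ₀) (hp : 1 ≤ p) : ∃ C : ℝ≥0∞, C ≠ ∞ ∧ ∀ L : ℕ,
      besovNorm φ₀ (overExponent 2 p - 1) p 1 (toDist (drivingField W L)) ≤ C ∧
      besovNorm φ₀ (overExponent 2 p - 3) p 1 (toDist (vecLaplacian (drivingField W L))) ≤ C := by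
  have hfin : ∀ s, ∑ i, (scalarBesov φ₀ s p 1 (W i) + scalarBesov φ₀ s p 1 (turnField W i)) ≠ ∞ :=
    fun s => ENNReal.sum_ne_top.2 fun i _ => ENNReal.add_ne_top.2
      ⟨((h.annularSpectrum_W i).scalarBesov_lt_top hφ s le_rfl).ne,
        ((h.annularSpectrum_turnField i).scalarBesov_lt_top hφ s le_rfl).ne⟩
  have hfin' : ∀ s, ∑ i, (scalarBesov φ₀ s p 1 (Δ (W i)) +
      scalarBesov φ₀ s p 1 (Δ (turnField W i))) ≠ ∞ :=
    fun s => ENNReal.sum_ne_top.2 fun i _ => ENNReal.add_ne_top.2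
      ⟨((h.annularSpectrum_W i).laplacian.scalarBesov_lt_top hφ s le_rfl).ne,
        ((h.annularSpectrum_turnField i).laplacian.scalarBesov_lt_top hφ s le_rfl).ne⟩
  refine ⟨_, ENNReal.add_ne_top.2 ⟨hfin (overExponent 2 p - 1), hfin' (overExponent 2 p - 3)⟩,
    fun L => ⟨le_add_right ?_, le_add_left ?_⟩⟩
  · refine (besovNorm_toDist_le hp le_rfl _ _ _).trans (Finset.sum_le_sum fun i _ => ?_)
    refine (scalarBesov_add_le hp le_rfl _ _ _ _).trans (add_le_add le_rfl ?_)
    exact (scalarBesov_velocityScale _ _ _ _).le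
  · refine (besovNorm_toDist_le hp le_rfl _ _ _).trans (Finset.sum_le_sum fun i _ => ?_)
    rw [drivingField, vecLaplacian_add]
    refine (scalarBesov_add_le hp le_rfl _ _ _ _).trans (add_le_add le_rfl ?_)
    exact (scalarBesov_laplacian_velocityScale _ _ _ _).le

/-- The cascade of Stokes flows, driven by the Reynolds stress at its two ends. -/
theorem PlaneProfiles.isForcedPair (h : PlaneProfiles W G κ) (a : ℝ) (L : ℕ) :
    IsForcedPair ((a : ℂ) • drivingField W L) ((a : ℂ) ^ 2 • cascade L (stokesField 0 κ))
      (-((a : ℂ) • vecLaplacian (drivingField W L)))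
      ((a : ℂ) ^ 2 • deviatorDiv (tensor (drivingField W L) (drivingField W L) -
        diagEntry 0 (G - stressScale (-8 * (L : ℤ)) G)))
      ((a : ℂ) ^ 3 • deviatorDiv (tensor (drivingField W L) (cascade L (stokesField 0 κ)) +
        tensor (cascade L (stokesField 0 κ)) (drivingField W L)))
      ((a : ℂ) ^ 4 • deviatorDiv (tensor (cascade L (stokesField 0 κ))
        (cascade L (stokesField 0 κ)))) := by
  set V := cascade L (stokesField 0 κ) with hV
  set D := drivingField W L with hD
  set r := G - stressScale (-8 * (L : ℤ)) G with hr
  set K := (a : ℂ) ^ 2 • ∑ k ∈ Finset.range L,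
    ((2 : ℂ) ^ (-8 * (k : ℤ)))⁻¹ ^ 2 • dil (-8 * (k : ℤ)) κ with hK
  have hKV : stokesField 0 K = (a : ℂ) ^ 2 • V := by
    rw [hK, stokesField_smul, stokesField_cascade]
  have hsq : ((a ^ 2 : ℝ) : ℂ) = (a : ℂ) ^ 2 := by push_cast; rfl
  have sK : AnnularSpectrum K :=
    (AnnularSpectrum.sum _ fun k _ => (h.annularSpectrum_κ.dil _).smul _).smul _
  have rK : IsRealFun K := by
    rw [hK, ← hsq]
    refine (IsRealFun.sum _ fun k _ => ?_).smul _
    have := (h.real_κ.dil (-8 * (k : ℤ))).smul (((2 : ℝ) ^ (-8 * (k : ℤ)))⁻¹ ^ 2)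
    push_cast at this
    exact this
  have rS : IsRealFun (stressScale (-8 * (L : ℤ)) G) := by
    have := (h.real_G.dil (-8 * (L : ℤ))).smul (((2 : ℝ) ^ (-8 * (L : ℤ))) ^ 2)
    push_cast at this
    exact this
  have rD : ∀ i, IsRealFun (((a : ℂ) • D) i) := fun i =>
    ((h.real_W i).add ((h.real_turnField i).velocityScale _)).smul a
  have sD : ∀ i, AnnularSpectrum (((a : ℂ) • D) i) := fun i =>
    ((h.annularSpectrum_W i).add ((h.annularSpectrum_turnField i).velocityScale _)).smul _
  have dD : fieldDiv ((a : ℂ) • D) = 0 := by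
    have h1 := fieldDiv_combination (a : ℂ) 0 (fieldDiv_add h.div_W
      (fieldDiv_scaleField (fieldDiv_turnField h.div_W) (-8 * (L : ℤ)))) h.div_W
    rwa [zero_smul, add_zero] at h1
  have d0 : fieldDiv (0 : Fin 2 → 𝓢(Rn 2, ℂ)) = 0 := by simp [fieldDiv, pd_zero]
  -- No compensating family is needed: the self-interaction of the cascade is small because of its
  -- amplitude.
  have key := isForcedPair_of_stokes (U := stokesField 0 K) (W₁ := (a : ℂ) • D) (W₂ := 0)
    (D := diagEntry 0 ((a : ℂ) ^ 2 • r)) (rK.stokesField 0) rD (fun _ => isRealFun_zero)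
    (fun i k => by
      rw [diagEntry]
      split_ifs
      · rw [← hsq]; exact (h.real_G.sub rS).smul _
      · exact isRealFun_zero) (fieldDiv_stokesField 0 K) dD d0 (sK.stokesField 0) sD
    (fun _ => annularSpectrum_zero) (stokesField_eq 0 (by
      rw [hK, laplacian_const_smul, laplacian_const_smul, laplacian_laplacian_cascade L h.laplacian_κ]))
  have v0 : -vecLaplacian (0 : Fin 2 → 𝓢(Rn 2, ℂ)) = 0 := by
    funext i; simp [vecLaplacian, laplacian_eq_sum_pd, pd_zero]
  have hdiag : diagEntry (0 : Fin 2) ((a : ℂ) ^ 2 • r) = (a : ℂ) ^ 2 • diagEntry 0 r := by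
    funext i k
    simp only [diagEntry, Pi.smul_apply]
    split_ifs
    exacts [rfl, (smul_zero _).symm]
  rw [add_zero, hKV, v0, zero_add, vecLaplacian_smul, tensor_smul_smul, tensor_smul_smul,
    tensor_smul_smul, tensor_smul_smul, hdiag, ← pow_two, ← smul_sub, ← pow_succ', ← pow_succ,
    ← smul_add, ← pow_add, deviatorDiv_smul, deviatorDiv_smul, deviatorDiv_smul] at key
  exact key

theorem hasStaticPairs_plane (hφ : IsLittlewoodPaley φ₀) (hp : 1 ≤ p) (hp2 : p ≤ 2) :
    HasStaticPairs 2 p 1 φ₀ := by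
  obtain ⟨W, G, κ, h⟩ := exists_planeProfiles
  obtain ⟨C₁, hC₁, h₁⟩ := h.exists_besovNorm_drivingField_le hφ hp
  obtain ⟨C₂, hC₂, h₂⟩ := h.exists_stressNorm_reynolds_le hφ hp
  obtain ⟨C₃, hC₃, h₃⟩ := h.exists_stressNorm_cross_le hφ hp
  obtain ⟨C₄, hC₄, h₄⟩ := h.exists_stressNorm_cascade_le hφ hp
  obtain ⟨c, hc0, hctop, hc⟩ := h.exists_le_scalarBesov_cascade hφ hp
  have hcpos : 0 < c.toReal := ENNReal.toReal_pos hc0 hctop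
  set V := stokesField 0 κ with hV
  have sV := h.annularSpectrum_κ.stokesField 0
  refine ⟨c.toReal / 2, by positivity, ∑ i, scalarBesov φ₀ (overExponent 2 p - 1) p 1 (V i),
    ENNReal.sum_ne_top.2 fun i _ => ((sV i).scalarBesov_lt_top hφ _ le_rfl).ne, 0,
    fun _ => annularSpectrum_zero, fun δ hδ => ?_⟩
  set C := C₁ + C₂ + C₃ + C₄ with hC
  have hCtop : C ≠ ∞ := by finiteness
  set ε := ENNReal.ofReal (min δ (c.toReal / 2)) with hε
  have hε0 : ε ≠ 0 := by
    rw [hε, Ne, ENNReal.ofReal_eq_zero, not_le]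
    exact lt_min hδ (by positivity)
  have hεδ : ε ≤ ENNReal.ofReal δ := ENNReal.ofReal_le_ofReal (min_le_left _ _)
  -- With `a = 1 / N` and `L = N²`, every force is at most `a C ≤ ε`; the powers `a³ L` and `a⁴ L`
  -- reduce to `a` and `a²`.
  obtain ⟨N, hN⟩ := ENNReal.exists_nat_gt (ENNReal.div_ne_top hCtop hε0)
  have hN0 : N ≠ 0 := by
    rintro rfl
    simp at hN
  have hNε : (N : ℝ≥0∞) ≠ 0 := by exact_mod_cast hN0
  have hNtop : (N : ℝ≥0∞) ≠ ∞ := ENNReal.natCast_ne_top N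
  set A : ℝ≥0∞ := (N : ℝ≥0∞)⁻¹ with hA
  have hA1 : A ≤ 1 := by
    rw [hA, ENNReal.inv_le_one]
    exact_mod_cast Nat.one_le_iff_ne_zero.2 hN0
  have hAC : A * C ≤ ε := by
    rw [hA, mul_comm, ← div_eq_mul_inv]
    refine ENNReal.div_le_of_le_mul ?_
    rw [mul_comm]
    exact (ENNReal.div_le_iff_le_mul (Or.inl hε0) (Or.inl ENNReal.ofReal_ne_top)).1 hN.le
  have hAN : A ^ 2 * ((N ^ 2 : ℕ) : ℝ≥0∞) = 1 := by
    rw [Nat.cast_pow, ← mul_pow, hA, ENNReal.inv_mul_cancel hNε hNtop, one_pow]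
  have ha : ‖(((N : ℝ)⁻¹ : ℝ) : ℂ)‖ₑ = A := by
    rw [Complex.ofReal_inv, enorm_inv (by exact_mod_cast hN0), Complex.ofReal_natCast, hA, ← ofReal_norm,
      Complex.norm_natCast, ENNReal.ofReal_natCast]
  set a : ℝ := (N : ℝ)⁻¹ with haN
  have hpow : ∀ k, ‖(a : ℂ) ^ k‖ₑ = A ^ k := fun k => by rw [enorm_pow, ha]
  have hdev : ∀ (k : ℕ) Q, besovNorm φ₀ (overExponent 2 p - 3) p 1
      (toDist ((a : ℂ) ^ k • deviatorDiv Q)) ≤ A ^ k * stressNorm φ₀ p Q := fun k Q => by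
    rw [toDist_smul, ← hpow]
    exact (besovNorm_smul_le le_rfl _ _ _ _).trans
      (mul_le_mul' le_rfl (besovNorm_deviatorDiv_le hp Q))
  have hone : ∀ k : ℕ, 1 ≤ k → A ^ k ≤ A := fun k hk =>
    pow_le_of_le_one zero_le hA1 (by omega)
  have hu₁ : besovNorm φ₀ (overExponent 2 p - 1) p 1
      (toDist ((a : ℂ) • drivingField W (N ^ 2))) ≤ ε := by
    rw [toDist_smul]
    refine (besovNorm_smul_le le_rfl _ _ _ _).trans (le_trans ?_ hAC)
    rw [ha]
    exact mul_le_mul' le_rfl ((h₁ _).1.trans (by rw [hC, add_assoc, add_assoc]; exact le_self_add))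
  refine ⟨_, _, _, _, _, _, h.isForcedPair a (N ^ 2), ?_, ?_, ?_, ?_, hu₁.trans hεδ, ?_, ?_, ?_⟩
  · rw [toDist_neg]
    refine (besovNorm_neg_le le_rfl _ _ _).trans ?_
    rw [toDist_smul]
    refine (besovNorm_smul_le le_rfl _ _ _ _).trans (le_trans ?_ (hAC.trans hεδ))
    rw [ha]
    exact mul_le_mul' le_rfl ((h₁ _).2.trans (by rw [hC, add_assoc, add_assoc]; exact le_self_add))
  · refine (hdev 2 _).trans (le_trans ?_ (hAC.trans hεδ))
    refine mul_le_mul' (hone 2 (by norm_num)) ((h₂ _ (by positivity)).trans ?_)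
    rw [hC, add_assoc, add_assoc]
    exact le_add_left le_self_add
  · refine (hdev 3 _).trans (le_trans ?_ (hAC.trans hεδ))
    calc _ ≤ A ^ 3 * (((N ^ 2 : ℕ) : ℝ≥0∞) * C₃) := mul_le_mul' le_rfl (h₃ _)
      _ = A * (A ^ 2 * ((N ^ 2 : ℕ) : ℝ≥0∞)) * C₃ := by ring
      _ = A * C₃ := by rw [hAN, mul_one]
      _ ≤ A * C := mul_le_mul' le_rfl (by rw [hC, add_assoc]; exact le_add_left le_self_add)
  · refine (hdev 4 _).trans (le_trans ?_ (hAC.trans hεδ))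
    calc _ ≤ A ^ 4 * (((N ^ 2 : ℕ) : ℝ≥0∞) * C₄) := mul_le_mul' le_rfl (h₄ _)
      _ = A ^ 2 * (A ^ 2 * ((N ^ 2 : ℕ) : ℝ≥0∞)) * C₄ := by ring
      _ = A ^ 2 * C₄ := by rw [hAN, mul_one]
      _ ≤ A * C := mul_le_mul' (hone 2 (by norm_num)) (by rw [hC]; exact le_add_self)
  · rw [toDist_smul]
    refine (besovNorm_smul_le le_rfl _ _ _ _).trans ?_
    rw [hpow]
    calc _ ≤ A ^ 2 * (((N ^ 2 : ℕ) : ℝ≥0∞) * _) :=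
          mul_le_mul' le_rfl (besovNorm_cascade_le hp _ _)
      _ = _ := by rw [← mul_assoc, hAN, one_mul]
  · set u₁ := (a : ℂ) • drivingField W (N ^ 2) with hu₁'
    set u₂ := (a : ℂ) ^ 2 • cascade (N ^ 2) V with hu₂'
    have hlow : c ≤ besovNorm φ₀ (overExponent 2 p - 1) p 1 (toDist u₂) := by
      refine le_trans ?_ (scalarBesov_le_besovNorm φ₀ _ u₂ 0)
      rw [hu₂', Pi.smul_apply, scalarBesov_smul le_rfl, hpow]
      calc c = A ^ 2 * (((N ^ 2 : ℕ) : ℝ≥0∞) * c) := by rw [← mul_assoc, hAN, one_mul]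
        _ ≤ _ := mul_le_mul' le_rfl (hc _)
    have htri : besovNorm φ₀ (overExponent 2 p - 1) p 1 (toDist u₂) ≤
        besovNorm φ₀ (overExponent 2 p - 1) p 1 (toDist (u₁ + u₂)) + ε := by
      have e : toDist u₂ = toDist (u₁ + u₂) + -toDist u₁ := by
        rw [toDist_add]; abel
      rw [e]
      exact (besovNorm_add_le hp le_rfl _ _ _ _).trans
        (add_le_add le_rfl ((besovNorm_neg_le le_rfl _ _ _).trans hu₁))
    have hsplit : c = ENNReal.ofReal (c.toReal / 2) + ENNReal.ofReal (c.toReal / 2) := by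
      rw [← ENNReal.ofReal_add (by positivity) (by positivity), add_halves,
        ENNReal.ofReal_toReal hctop]
    have hfin := hlow.trans (htri.trans (add_le_add le_rfl
      (ENNReal.ofReal_le_ofReal (min_le_right δ (c.toReal / 2)))))
    nth_rw 1 [hsplit] at hfin
    exact (ENNReal.add_le_add_iff_right ENNReal.ofReal_ne_top).1 hfin
  · rintro (h3 | h2)
    · omega
    · exact absurd hp2 (not_le.2 h2)

end Assembly

end

/-! ### Stationary pairs for all admissible indices, and proof of the theorem. -/

theorem hasStaticPairs {n : ℕ} {p q : ℝ≥0∞} (h : AdmissibleIndices n p q) {φ₀ : 𝓢(Rn n, ℂ)}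
    (hφ₀ : IsLittlewoodPaley φ₀) : HasStaticPairs n p q φ₀ := by
  have hlt : ∀ m : ℕ, 2 ≤ m → (m : ℝ≥0∞) < p → overExponent m p < 1 := fun m hm hp => by
    have hm0 : (0 : ℝ) < m := by exact_mod_cast (by omega : 0 < m)
    have h1 : (p⁻¹).toReal < ((m : ℝ≥0∞)⁻¹).toReal :=
      ENNReal.toReal_strict_mono (ENNReal.inv_ne_top.2 (by exact_mod_cast (by omega : m ≠ 0)))
        (ENNReal.inv_lt_inv.2 hp)
    rw [ENNReal.toReal_inv (m : ℝ≥0∞), ENNReal.toReal_natCast] at h1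
    rw [overExponent]
    calc (m : ℝ) * (p⁻¹).toReal < m * (m : ℝ)⁻¹ := mul_lt_mul_of_pos_left h1 hm0
      _ = 1 := mul_inv_cancel₀ hm0.ne'
  rcases h with ⟨hn, hp, hq⟩ | ⟨hn, rfl, hq⟩ | ⟨rfl, hp, rfl⟩
  · have h1 : (1 : ℝ≥0∞) ≤ n := by exact_mod_cast (by omega : 1 ≤ n)
    exact hasStaticPairs_of_overExponent_le_one (by omega) hφ₀ (h1.trans hp.le) hq
      (Or.inl (hlt n (by omega) hp))
  · have hn0 : (n : ℝ) ≠ 0 := by exact_mod_cast (by omega : n ≠ 0)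
    refine hasStaticPairs_of_overExponent_le_one (by omega) hφ₀
      (by exact_mod_cast (by omega : 1 ≤ n)) (one_le_two.trans hq.le) (Or.inr ⟨?_, hq⟩)
    rw [overExponent, ENNReal.toReal_inv, ENNReal.toReal_natCast, mul_inv_cancel₀ hn0]
  · rcases le_or_gt p 2 with hp2 | hp2
    · exact hasStaticPairs_plane hφ₀ hp hp2
    · exact hasStaticPairs_of_overExponent_le_one le_rfl hφ₀ hp le_rfl
        (Or.inl (hlt 2 le_rfl (by exact_mod_cast hp2)))

theorem theorem1p2 (n : ℕ) (p q : ℝ≥0∞) (h : AdmissibleIndices n p q)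
    (φ₀ : 𝓢(Rn n, ℂ)) (hφ₀ : IsLittlewoodPaley φ₀) :
    ∃ ε₀ : ℝ, 0 < ε₀ ∧ ∃ c₀ : ℝ, 0 < c₀ ∧ ∀ ε : ℝ, 0 < ε → ε ≤ ε₀ →
      ∃ f u : ℝ → VecDistribution n,
        -- the force
        (∀ t, 0 < t → IsRealDistribution (f t)) ∧
        MemTildeC φ₀ (Set.Ioi 0) (overExponent n p - 3) p q f ∧
        cheminLernerNorm φ₀ (Set.Ioi 0) (overExponent n p - 3) p q f ≤ ENNReal.ofReal ε ∧
        Tendsto (fun t => besovNorm φ₀ (overExponent n p - 3) p q (f t)) atTop (𝓝 0) ∧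
        -- the global solution with zero initial data
        IsNSSolution 0 f u ∧
        ContinuousInBesov φ₀ (Set.Ici 0) (overExponent n p - 1) p q u ∧
        (⨆ t ∈ Set.Ici (0 : ℝ), besovNorm φ₀ (overExponent n p - 1) p q (u t)) < ∞ ∧
        (∀ T : ℝ, 0 < T → MemTildeC φ₀ (Set.Icc 0 T) (overExponent n p - 1) p q u) ∧
        ((3 ≤ n ∨ 2 < p) → MemTildeC φ₀ (Set.Ici 0) (overExponent n p - 1) p q u) ∧
        -- oscillation
        ENNReal.ofReal c₀ ≤
          limsup (fun t => besovNorm φ₀ (overExponent n p - 1) p q (u t)) atTop ∧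
        liminf (fun t => besovNorm φ₀ (overExponent n p - 1) p q (u t)) atTop = 0 ∧
        -- no strong limit
        (¬ ∃ w : VecDistribution n, MemBesov φ₀ (overExponent n p - 1) p q w ∧
          Tendsto (fun t => besovNorm φ₀ (overExponent n p - 1) p q (u t - w)) atTop (𝓝 0)) ∧
        -- no uniform a priori bound
        (∀ C : ℝ, 0 < C → C * ε < c₀ → ∃ t, 0 ≤ t ∧
          ENNReal.ofReal C * cheminLernerNorm φ₀ (Set.Ioi 0) (overExponent n p - 3) p q f <
            besovNorm φ₀ (overExponent n p - 1) p q (u t)) := by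
  have hp := h.one_le_p
  have hq := h.one_le_q
  have hn := h.pos
  obtain ⟨c₀, hc₀, C₀, hC₀, V, hV, hstat⟩ := hasStaticPairs h hφ₀
  refine ⟨1, one_pos, c₀, hc₀, fun ε hε _ => ?_⟩
  -- The force consists of six glued terms: four powers of `θ` and two from the time derivative.
  -- Each of them receives the share `ε / 6`, distributed over the windows as a convergent series.
  obtain ⟨δ, hδ, hδs⟩ := ENNReal.exists_pos_sum_of_countable
    (ε := ENNReal.ofReal (ε / 6)) (by simpa using hε) ℕ
  choose u₁ u₂ f₁ f₂ f₃ f₄ hF hf₁ hf₂ hf₃ hf₄ hu₁ hu₂ hlow hstrong using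
    fun m => hstat (δ m) (by exact_mod_cast hδ m)
  simp only [ENNReal.ofReal_coe_nnreal] at hf₁ hf₂ hf₃ hf₄ hu₁ hstrong
  have hfin₁ : ∀ (s : ℝ) m, besovNorm φ₀ s p q (toDist (u₁ m)) < ∞ := fun s m =>
    besovNorm_toDist_lt_top hφ₀ s hp hq (hF m).spectrum_u₁
  have hfin₂ : ∀ (s : ℝ) m, besovNorm φ₀ s p q (toDist (u₂ m)) < ∞ := fun s m =>
    besovNorm_toDist_lt_top hφ₀ s hp hq (hF m).spectrum_u₂
  -- The speed of the bump in window `m` is chosen after the stationary pair, whose velocity is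
  -- finite but not small at regularity `n/p - 3`.
  choose B hB0 hB using fun m => exists_small_pos
    (ENNReal.add_lt_top.2 ⟨hfin₁ (overExponent n p - 3) m, hfin₂ (overExponent n p - 3) m⟩).ne
    (δ := δ m) (by exact_mod_cast hδ m)
  simp only [ENNReal.ofReal_coe_nnreal] at hB
  obtain ⟨T, θ, θ', hT, hθ, hθ', hd, hcont, hθ1, hθB, hmid⟩ := exists_windows B hB0
  have hθc : ∀ m, Continuous (θ m) := fun m =>
    continuous_iff_continuousAt.2 fun t => (hd m t).continuousAt
  have hθθ : LivesIn T (fun m t => 2 * θ m t * θ' m t) := fun m t h => by simp [hθ m t h]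
  have hθ2 := hθ.pow two_ne_zero
  have hθ3 := hθ.pow three_ne_zero
  have hθ4 := hθ.pow four_ne_zero
  have hpow : ∀ (k m : ℕ) t, ‖((θ m t ^ k : ℝ) : ℂ)‖ₑ ≤ 1 := fun k m t => by
    rw [← ofReal_norm, Complex.norm_real, norm_pow, ENNReal.ofReal_le_one]
    exact pow_le_one₀ (norm_nonneg _) (hθ1 m t)
  have hone : ∀ (m : ℕ) t, ‖(θ m t : ℂ)‖ₑ ≤ 1 := fun m t => by simpa using hpow 1 m t
  have hder₁ : ∀ (m : ℕ) t, ‖(θ' m t : ℂ)‖ₑ ≤ ENNReal.ofReal (2 * B m) := fun m t => by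
    rw [← ofReal_norm, Complex.norm_real]
    exact ENNReal.ofReal_le_ofReal ((hθB m t).trans (by linarith [hB0 m]))
  have hder₂ : ∀ (m : ℕ) t, ‖((2 * θ m t * θ' m t : ℝ) : ℂ)‖ₑ ≤ ENNReal.ofReal (2 * B m) :=
    fun m t => by
    rw [← ofReal_norm, Complex.norm_real]
    refine ENNReal.ofReal_le_ofReal ?_
    rw [Real.norm_eq_abs, abs_mul, abs_mul, abs_two]
    have := mul_le_mul (hθ1 m t) (hθB m t) (abs_nonneg _) zero_le_one
    linarith
  have hB₁ : ∀ m, ENNReal.ofReal (2 * B m) *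
      besovNorm φ₀ (overExponent n p - 3) p q (toDist (u₁ m)) ≤ δ m := fun m =>
    le_trans (by gcongr; exact le_self_add) (hB m)
  have hB₂ : ∀ m, ENNReal.ofReal (2 * B m) *
      besovNorm φ₀ (overExponent n p - 3) p q (toDist (u₂ m)) ≤ δ m := fun m =>
    le_trans (by gcongr; exact le_add_self) (hB m)
  have hone' : ∀ (x : ℕ → ℝ≥0∞), (∀ m, x m ≤ δ m) → ∀ m, 1 * x m ≤ δ m := fun x hx m => by
    rw [one_mul]; exact hx m
  have hsum : ∀ x : ℕ → ℝ≥0∞, (∀ m, x m ≤ δ m) → ∑' m, x m ≤ ENNReal.ofReal (ε / 6) :=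
    fun x hx => (ENNReal.tsum_le_tsum hx).trans hδs.le
  have hδ0 : Tendsto (fun m => (δ m : ℝ≥0∞)) atTop (𝓝 0) :=
    ENNReal.tendsto_atTop_zero_of_tsum_ne_top (hδs.trans ENNReal.ofReal_lt_top).ne
  set f : ℝ → VecDistribution n := fun t => toDist (glue θ f₁ t + glue (fun m t => θ m t ^ 2) f₂ t +
    glue (fun m t => θ m t ^ 3) f₃ t + glue (fun m t => θ m t ^ 4) f₄ t +
    (glue θ' u₁ t + glue (fun m t => 2 * θ m t * θ' m t) u₂ t)) with hf
  set u : ℝ → VecDistribution n := fun t =>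
    toDist (glue θ u₁ t + glue (fun m t => θ m t ^ 2) u₂ t) with hu
  have hf' : f = fun t => toDist (glue θ f₁ t) + toDist (glue (fun m t => θ m t ^ 2) f₂ t) +
      toDist (glue (fun m t => θ m t ^ 3) f₃ t) + toDist (glue (fun m t => θ m t ^ 4) f₄ t) +
      (toDist (glue θ' u₁ t) + toDist (glue (fun m t => 2 * θ m t * θ' m t) u₂ t)) := by
    simp only [hf, toDist_add]
  have hu' : u = fun t =>
      toDist (glue θ u₁ t) + toDist (glue (fun m t => θ m t ^ 2) u₂ t) := by
    simp only [hu, toDist_add]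
  have hδtop : ∀ (x : ℝ≥0∞) m, x ≤ δ m → x < ∞ := fun x m hx => hx.trans_lt ENNReal.coe_lt_top
  have hnorm : cheminLernerNorm φ₀ (Set.Ioi 0) (overExponent n p - 3) p q f ≤
      ENNReal.ofReal ε := by
    have key : ∀ (c : ℕ → ℝ → ℝ) (M : ℕ → ℝ≥0∞) (A : ℕ → Fin n → 𝓢(Rn n, ℂ)), LivesIn T c →
        (∀ m t, ‖(c m t : ℂ)‖ₑ ≤ M m) →
        (∀ m, M m * besovNorm φ₀ (overExponent n p - 3) p q (toDist (A m)) ≤ δ m) →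
        cheminLernerNorm φ₀ (Set.Ioi 0) (overExponent n p - 3) p q
          (fun t => toDist (glue c A t)) ≤ ENNReal.ofReal (ε / 6) := fun c M A hc hM hA =>
      (cheminLernerNorm_glue_le hq hT hc measurableSet_Ioi (fun t ht => le_of_lt ht)
        (fun m t _ => hM m t)).trans (hsum _ hA)
    have hsix : ENNReal.ofReal ε = ENNReal.ofReal (ε / 6) + ENNReal.ofReal (ε / 6) +
        ENNReal.ofReal (ε / 6) + ENNReal.ofReal (ε / 6) +
        (ENNReal.ofReal (ε / 6) + ENNReal.ofReal (ε / 6)) := by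
      have h6 : 0 ≤ ε / 6 := by positivity
      rw [← ENNReal.ofReal_add h6 h6, ← ENNReal.ofReal_add (by positivity) h6,
        ← ENNReal.ofReal_add (by positivity) h6, ← ENNReal.ofReal_add (by positivity) (by positivity)]
      congr 1; ring
    rw [hsix, hf']
    refine (cheminLernerNorm_add_le hp hq _ _).trans (add_le_add ?_ ?_)
    · refine (cheminLernerNorm_add_le hp hq _ _).trans (add_le_add ?_ ?_)
      · refine (cheminLernerNorm_add_le hp hq _ _).trans (add_le_add ?_ ?_)
        · exact (cheminLernerNorm_add_le hp hq _ _).trans (add_le_add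
            (key _ _ _ hθ hone (hone' _ hf₁)) (key _ _ _ hθ2 (hpow 2) (hone' _ hf₂)))
        · exact key _ _ _ hθ3 (hpow 3) (hone' _ hf₃)
      · exact key _ _ _ hθ4 (hpow 4) (hone' _ hf₄)
    · exact (cheminLernerNorm_add_le hp hq _ _).trans (add_le_add
        (key _ _ _ hθ' hder₁ hB₁) (key _ _ _ hθθ hder₂ hB₂))
  have hfcont : ContinuousInBesov φ₀ (Set.Ioi 0) (overExponent n p - 3) p q f := by
    rw [hf']
    have key : ∀ (c : ℕ → ℝ → ℝ) (A : ℕ → Fin n → 𝓢(Rn n, ℂ)), LivesIn T c →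
        (∀ m, Continuous (c m)) →
        (∀ m, besovNorm φ₀ (overExponent n p - 3) p q (toDist (A m)) < ∞) →
        ContinuousInBesov φ₀ (Set.Ioi 0) (overExponent n p - 3) p q
          (fun t => toDist (glue c A t)) := fun c A hc hcc hA =>
      continuousInBesov_glue hn hφ₀ hp hq hT hc hcc hA _
    refine ContinuousInBesov.add hp hq (ContinuousInBesov.add hp hq (ContinuousInBesov.add hp hq
      (ContinuousInBesov.add hp hq ?_ ?_) ?_) ?_) (ContinuousInBesov.add hp hq ?_ ?_)
    · exact key _ _ hθ hθc fun m => hδtop _ m (hf₁ m)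
    · exact key _ _ hθ2 (fun m => (hθc m).pow 2) fun m => hδtop _ m (hf₂ m)
    · exact key _ _ hθ3 (fun m => (hθc m).pow 3) fun m => hδtop _ m (hf₃ m)
    · exact key _ _ hθ4 (fun m => (hθc m).pow 4) fun m => hδtop _ m (hf₄ m)
    · exact key _ _ hθ' hcont (hfin₁ _)
    · exact key _ _ hθθ (fun m => (continuous_const.mul (hθc m)).mul (hcont m)) (hfin₂ _)
  have hucont : ∀ I, ContinuousInBesov φ₀ I (overExponent n p - 1) p q u := fun I => by
    rw [hu']
    exact ContinuousInBesov.add hp hq (continuousInBesov_glue hn hφ₀ hp hq hT hθ hθc (hfin₁ _) I)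
      (continuousInBesov_glue hn hφ₀ hp hq hT hθ2 (fun m => (hθc m).pow 2) (hfin₂ _) I)
  have hutop : ∀ m t, T m ≤ t → θ m t = 1 → u t = toDist (u₁ m + u₂ m) := fun m t _ ht => by
    have hwin : T m < t ∧ t < T (m + 1) := by
      by_contra hcon
      rw [hθ m t hcon] at ht
      exact zero_ne_one ht
    have hiso : ∀ m', m' ≠ m → θ m' t = 0 := fun m' hne => hθ m' t fun hm' => by
      have h1 := hT.strictMono.lt_iff_lt.1 (hwin.1.trans hm'.2)
      have h2 := hT.strictMono.lt_iff_lt.1 (hm'.1.trans hwin.2)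
      omega
    simp only [hu]
    rw [glue_eq_single u₁ hiso, glue_eq_single u₂ (m := m) fun m' hm' => by simp [hiso m' hm']]
    simp [ht]
  have huzero : ∀ m, u (T m) = 0 := fun m => by
    have hz : ∀ m', θ m' (T m) = 0 := fun m' => hθ m' _ fun hm' => by
      have h1 := hT.strictMono.lt_iff_lt.1 hm'.1
      have h2 := hT.strictMono.lt_iff_lt.1 hm'.2
      omega
    simp only [hu]
    rw [glue_eq_single (m := 0) u₁ fun m' _ => hz m', glue_eq_single (m := 0) u₂ fun m' _ => by
      simp [hz m']]
    simp [hz, toDist_zero]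
  have hfreq : ∃ᶠ t in atTop, ENNReal.ofReal c₀ ≤
      besovNorm φ₀ (overExponent n p - 1) p q (u t) := by
    rw [frequently_atTop]
    intro a
    obtain ⟨m, hm⟩ := exists_nat_ge a
    obtain ⟨t, ht, ht1⟩ := hmid m
    refine ⟨t, hm.trans ((hT.natCast_le m).trans ht), ?_⟩
    rw [hutop m t ht ht1]
    exact hlow m
  have hfreq0 : ∃ᶠ t in atTop, u t = 0 := by
    rw [frequently_atTop]
    intro a
    obtain ⟨m, hm⟩ := exists_nat_ge a
    exact ⟨T m, hm.trans (hT.natCast_le m), huzero m⟩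
  refine ⟨f, u, fun t ht => ?_, ⟨hfcont, hnorm.trans_lt ENNReal.ofReal_lt_top⟩, hnorm, ?_,
    isNSSolution_glue hT hθ hθ' hd hcont hF, hucont _, ?_, fun S hS => ⟨hucont _, ?_⟩,
    fun hnp => ⟨hucont _, ?_⟩, ?_, ?_, ?_, fun C hC hCε => ?_⟩
  · refine isRealDistribution_toDist fun i => ?_
    obtain ⟨m, hm⟩ := exists_glue_eq_single_of_nonneg (n := n) hT ht.le
    rw [hm _ _ hθ, hm _ _ hθ2, hm _ _ hθ3, hm _ _ hθ4, hm _ _ hθ', hm _ _ hθθ]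
    have hFm := hF m
    exact ((((((hFm.real_f₁ i).smul _).add ((hFm.real_f₂ i).smul _)).add
      ((hFm.real_f₃ i).smul _)).add ((hFm.real_f₄ i).smul _)).add
      (((hFm.real_u₁ i).smul _).add ((hFm.real_u₂ i).smul _)))
  · have key : ∀ (c : ℕ → ℝ → ℝ) (M : ℕ → ℝ≥0∞) (A : ℕ → Fin n → 𝓢(Rn n, ℂ)), LivesIn T c →
        (∀ m t, ‖(c m t : ℂ)‖ₑ ≤ M m) →
        (∀ m, M m * besovNorm φ₀ (overExponent n p - 3) p q (toDist (A m)) ≤ δ m) →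
        Tendsto (fun t => besovNorm φ₀ (overExponent n p - 3) p q (toDist (glue c A t))) atTop
          (𝓝 0) := fun c M A hc hM hA => tendsto_besovNorm_glue hq hT hc hM hδ0 hA
    have hlim := ((((key _ _ _ hθ hone (hone' _ hf₁)).add
      (key _ _ _ hθ2 (hpow 2) (hone' _ hf₂))).add (key _ _ _ hθ3 (hpow 3) (hone' _ hf₃))).add
      (key _ _ _ hθ4 (hpow 4) (hone' _ hf₄))).add ((key _ _ _ hθ' hder₁ hB₁).add
      (key _ _ _ hθθ hder₂ hB₂))
    simp only [add_zero] at hlim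
    refine tendsto_of_tendsto_of_tendsto_of_le_of_le tendsto_const_nhds hlim
      (fun _ => zero_le) fun t => ?_
    rw [hf']
    refine (besovNorm_add_le hp hq _ _ _ _).trans (add_le_add ?_ (besovNorm_add_le hp hq _ _ _ _))
    refine (besovNorm_add_le hp hq _ _ _ _).trans (add_le_add ?_ le_rfl)
    refine (besovNorm_add_le hp hq _ _ _ _).trans (add_le_add ?_ le_rfl)
    exact besovNorm_add_le hp hq _ _ _ _
  · refine lt_of_le_of_lt (iSup₂_le (a := ENNReal.ofReal (ε / 6) + C₀) fun t ht => ?_)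
      (ENNReal.add_lt_top.2 ⟨ENNReal.ofReal_lt_top, hC₀.lt_top⟩)
    have ht0 : T 0 ≤ t := by rw [hT.zero]; exact ht
    rw [hu']
    refine (besovNorm_add_le hp hq _ _ _ _).trans (add_le_add ?_ ?_)
    · refine besovNorm_glue_le hq hT hθ hone (fun m _ => (hone' _ hu₁ m).trans ?_) ht0
      exact (ENNReal.le_tsum m).trans hδs.le
    · refine besovNorm_glue_le hq hT hθ2 (hpow 2) (fun m _ => ?_) ht0
      rw [one_mul]; exact hu₂ m
  · rw [hu']
    refine (cheminLernerNorm_add_le hp hq _ _).trans_lt (ENNReal.add_lt_top.2 ⟨?_, ?_⟩)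
    · exact (cheminLernerNorm_glue_le hq hT hθ measurableSet_Icc (fun t ht => ht.1)
        (fun m t _ => hone m t)).trans_lt ((hsum _ (hone' _ hu₁)).trans_lt ENNReal.ofReal_lt_top)
    · obtain ⟨N, hN⟩ := exists_nat_gt S
      -- On a bounded interval only the windows with `m < N` open, so a finite sum bounds `u₂`,
      -- which is not summable over all windows.
      refine (cheminLernerNorm_glue_le (M := fun m => if m < N then 1 else 0) hq hT hθ2
        measurableSet_Icc (fun t ht => ht.1) (fun m t ht => ?_)).trans_lt ?_
      · split_ifs with hm
        · exact hpow 2 m t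
        · have : θ m t = 0 := hθ m t fun hm' => by
            have h1 := hT.natCast_le m
            have h2 : (N : ℝ) ≤ m := by exact_mod_cast not_lt.1 hm
            linarith [hm'.1, ht.2]
          simp [this]
      · rw [tsum_eq_sum (s := Finset.range N) fun m hm => by
          rw [if_neg (by simpa using hm), zero_mul]]
        exact ENNReal.sum_lt_top.2 fun m hm => by
          rw [if_pos (by simpa using hm), one_mul]; exact hfin₂ _ m
  -- The fields `u₂ m` are not summable, but `u₂ m - V` is; the common field `V` is handled by its
  -- own norm.
  · have hsplit : u = fun t => toDist (glue θ u₁ t) +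
        (toDist (glue (fun m t => θ m t ^ 2) (fun m => u₂ m - V) t) +
        toDist (glue (fun m t => θ m t ^ 2) (fun _ => V) t)) := by
      rw [hu']
      funext t
      congr 1
      rw [← toDist_add]
      congr 1
      obtain ⟨N, hN⟩ := exists_nat_gt t
      rw [glue_eq_sum hT hθ2 _ hN, glue_eq_sum hT hθ2 _ hN, glue_eq_sum hT hθ2 _ hN,
        ← Finset.sum_add_distrib]
      exact Finset.sum_congr rfl fun m _ => by rw [← smul_add, sub_add_cancel]
    rw [hsplit]
    have hI0 : ∀ t ∈ Set.Ici (0 : ℝ), 0 ≤ t := fun t ht => ht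
    refine (cheminLernerNorm_add_le hp hq _ _).trans_lt (ENNReal.add_lt_top.2 ⟨?_, ?_⟩)
    · exact (cheminLernerNorm_glue_le hq hT hθ measurableSet_Ici hI0
        (fun m t _ => hone m t)).trans_lt ((hsum _ (hone' _ hu₁)).trans_lt ENNReal.ofReal_lt_top)
    refine (cheminLernerNorm_add_le hp hq _ _).trans_lt (ENNReal.add_lt_top.2 ⟨?_, ?_⟩)
    · exact (cheminLernerNorm_glue_le hq hT hθ2 measurableSet_Ici hI0
        (fun m t _ => hpow 2 m t)).trans_lt
        ((hsum _ (hone' _ fun m => hstrong m hnp)).trans_lt ENNReal.ofReal_lt_top)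
    · exact (cheminLernerNorm_glue_const_le hT hθ2 measurableSet_Ici hI0
        (fun m t _ => hpow 2 m t) V).trans_lt (besovNorm_toDist_lt_top hφ₀ _ hp hq hV)
  · exact le_limsup_of_frequently_le hfreq
  · refine le_antisymm (liminf_le_of_frequently_le (hfreq0.mono fun t ht => ?_)) zero_le
    rw [ht, besovNorm_zero hq]
  · rintro ⟨w, hwB, hw⟩
    have hc : ENNReal.ofReal c₀ ≠ 0 := by simpa using hc₀
    -- As `u` vanishes at arbitrarily late times, a strong limit would have norm zero; this
    -- contradicts the times at which the norm of `u` is at least `c₀`.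
    have hw0 : besovNorm φ₀ (overExponent n p - 1) p q w = 0 := by
      by_contra hne
      have h1 := (ENNReal.tendsto_nhds_zero.1 hw) _ (ENNReal.half_pos hne)
      obtain ⟨t, ht, ht0⟩ := (hfreq0.and_eventually h1).exists
      rw [ht, zero_sub] at ht0
      have h2 := besovNorm_neg_le (p := p) hq φ₀ (overExponent n p - 1) (-w)
      rw [neg_neg] at h2
      have h3 := h2.trans ht0
      exact absurd h3 (not_le.2 (ENNReal.half_lt_self hne hwB.1.ne))
    have h1 := (ENNReal.tendsto_nhds_zero.1 hw) _ (ENNReal.half_pos hc)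
    obtain ⟨t, ht, ht0⟩ := (hfreq.and_eventually h1).exists
    have h2 : besovNorm φ₀ (overExponent n p - 1) p q (u t) ≤ ENNReal.ofReal c₀ / 2 := by
      calc _ = besovNorm φ₀ (overExponent n p - 1) p q (u t - w + w) := by rw [sub_add_cancel]
        _ ≤ _ := besovNorm_add_le hp hq _ _ _ _
        _ ≤ _ := by rw [hw0, add_zero]; exact ht0
    exact absurd (ht.trans h2) (not_le.2 (ENNReal.half_lt_self hc ENNReal.ofReal_ne_top))
  · obtain ⟨t, ht, ht1⟩ := hmid 0
    refine ⟨t, hT.zero.symm.trans_le ht, ?_⟩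
    rw [hutop 0 t ht ht1]
    calc _ ≤ ENNReal.ofReal C * ENNReal.ofReal ε := by gcongr
      _ = ENNReal.ofReal (C * ε) := (ENNReal.ofReal_mul hC.le).symm
      _ < ENNReal.ofReal c₀ := (ENNReal.ofReal_lt_ofReal_iff hc₀).2 hCε
      _ ≤ _ := hlow 0

end
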